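/- **Alexander's Theorem for Virtual Braids.** A virtual link diagram is a generic (here: polygonal) immersion of finitely many oriented circles in $\mathbb{R}^2$, each of whose double points is marked either as a classical crossing (with over/under information) or as a virtual crossing. Two diagrams are equivalent if they are related by a finite sequence of planar isotopies, the Reidemeister moves R1, R2, R3, and the virtual moves: V1, V2, V3 (the versions of R1, R2, R3 in which all crossings are virtual) and V4 (an arc that crosses two other arcs virtually is moved across a classical crossing of these two arcs). A virtual knot or link is an equivalence class of diagrams. For $n\ge 0$ let $\mathcal{VB}_n$ be the virtual braid group, with generators $\sigma_1,\dots,\sigma_{n-1},\nu_1,\dots,\nu_{n-1}$ and relations $$\sigma_i\sigma_k=\sigma_k\sigma_i,\quad \nu_i\nu_k=\nu_k\nu_i,\quad \sigma_i\nu_k=\nu_k\sigma_i\qquad(|i-k|>1),$$ $$\sigma_i\sigma_{i+1}\sigma_i=\sigma_{i+1}\sigma_i\sigma_{i+1},\quad \nu_i\nu_{i+1}\nu_i=\nu_{i+1}\nu_i\nu_{i+1},\quad \sigma_i\nu_{i+1}\nu_i=\nu_{i+1}\nu_i\sigma_{i+1},\quad \nu_i^2=1.$$ A word in $\sigma_i^{\pm1},\nu_i$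 is drawn as a braid diagram on $n$ strings, $\sigma_i^{\pm1}$ being a classical and $\nu_i$ a virtual crossing of the $i$-th and $(i+1)$-st strings. The closure of $\beta\in\mathcal{VB}_n$ is the virtual link represented by the diagram obtained from a braid diagram of $\beta$ by joining the end point of each string position to the initial point of the same position around a braid axis. Then for every virtual knot or link $K$ there are $n$ and $\beta\in\mathcal{VB}_n$ such that $K$ is the closure of $\beta$. -/

import Mathlib

/-! ## Virtual link diagrams

The plane is `ℂ`. Link diagrams are polygonal: a closed generic polygonal curve with finitely many
components, whose double points are marked as classical (over/under) or virtual. -/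

/-- The determinant `det (z, w)` of two plane vectors; it is positive iff `w` points to the left
of `z`. -/
def planeDet (z w : ℂ) : ℝ := z.re * w.im - z.im * w.re

/-- The edge starting at the vertex `i`, for a polygonal curve with successor permutation `next`
and vertex positions `pos`. -/
def polyEdge {ι : Type} (next : Equiv.Perm ι) (pos : ι → ℂ) (i : ι) : Set ℂ :=
  segment ℝ (pos i) (pos (next i))

/-- Two distinct, non-adjacent edges (named by their starting vertices) cross. -/
def polyCrosses {ι : Type} (next : Equiv.Perm ι) (pos : ι → ℂ) (i j : ι) : Prop :=
  i ≠ j ∧ next i ≠ j ∧ next j ≠ i ∧ (polyEdge next pos i ∩ polyEdge next pos j).Nonempty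

/-- An oriented virtual link diagram with vertex set `ι`. The cycles of `next` are the components;
the vertex `i` also names the oriented edge from `pos i` to `pos (next i)`.

The fields from `next_ne` to `no_triple` say that the curve is a generic immersion: every component
has at least three vertices, a vertex lies on no edges but
the two that it bounds (so vertices are distinct, there are no cusps, edges do not overlap, and
non-adjacent edges which meet do so transversally, at interior points of both), and no point lies
on three edges.

`isOver i j` means that the edges `i` and `j` cross at a classical crossing where `i` is the upper
strand. The crossings where neither strand is upper are the virtual ones. -/
structure VDiagram (ι : Type) where
  finite : Finite ι
  next : Equiv.Perm ι
  pos : ι → ℂ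
  isOver : ι → ι → Prop
  next_ne : ∀ i, next i ≠ i
  next_next_ne : ∀ i, next (next i) ≠ i
  vertex_generic : ∀ i k, pos k ∈ polyEdge next pos i → k = i ∨ k = next i
  no_triple : ∀ i j k, i ≠ j → j ≠ k → i ≠ k → ∀ z, z ∈ polyEdge next pos i →
    z ∈ polyEdge next pos j → z ∉ polyEdge next pos k
  over_crosses : ∀ i j, isOver i j → polyCrosses next pos i j
  over_asymm : ∀ i j, isOver i j → ¬ isOver j i

namespace VDiagram

variable {ι κ : Type}

/-- The edge starting at the vertex `i`. -/
def edge (D : VDiagram ι) (i : ι) : Set ℂ := polyEdge D.next D.pos i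

/-- The direction vector of the edge starting at the vertex `i`. -/
def dir (D : VDiagram ι) (i : ι) : ℂ := D.pos (D.next i) - D.pos i

/-- The edges `i` and `j` cross (classically or virtually). -/
def Crosses (D : VDiagram ι) (i j : ι) : Prop := polyCrosses D.next D.pos i j

/-- The edges `i` and `j` cross at a classical crossing. -/
def Classical (D : VDiagram ι) (i j : ι) : Prop := D.isOver i j ∨ D.isOver j i

/-- The edges `i` and `j` cross at a virtual crossing. -/
def Virtual (D : VDiagram ι) (i j : ι) : Prop := D.Crosses i j ∧ ¬ D.isOver i j ∧ ¬ D.isOver j i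

/-- The underlying point set of the diagram. -/
def trace (D : VDiagram ι) : Set ℂ := ⋃ i, D.edge i

/-- `D'` arises from `D` by replacing the edge `a`, from `A` to `B`, by two edges `A C` and `C B`
through one new vertex `C` (named `none`), everything away from the edge `a` being unchanged.
In `D'` the edge `A C` is named `some a` and the edge `C B` is named `none`. -/
structure IsInsertion (D : VDiagram ι) (D' : VDiagram (Option ι)) (a : ι) : Prop where
  next_start : D'.next (some a) = none
  next_new : D'.next none = some (D.next a)
  next_old : ∀ x, x ≠ a → D'.next (some x) = some (D.next x)
  pos_old : ∀ x, D'.pos (some x) = D.pos x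
  over_old : ∀ x y, x ≠ a → y ≠ a → (D'.isOver (some x) (some y) ↔ D.isOver x y)

/-- In the situation of `IsInsertion`, every crossing of `D'` that is classical comes from the
same classical crossing of `D`, where both new edges are regarded as parts of the strand `a`. -/
def InheritsCrossings (D : VDiagram ι) (D' : VDiagram (Option ι)) (a : ι) : Prop :=
  ∀ x y, D'.isOver x y ↔ D'.Crosses x y ∧ D.isOver (x.getD a) (y.getD a)

/-- The triangle `A C B` swept when the edge `a` of `D` is replaced as in `IsInsertion`. -/
def sweptTriangle (D : VDiagram ι) (D' : VDiagram (Option ι)) (a : ι) : Set ℂ :=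
  convexHull ℝ {D.pos a, D'.pos none, D.pos (D.next a)}

/-- The edge `x` meets the swept triangle at most in the end points of the edge `a`. -/
def AvoidsTriangle (D : VDiagram ι) (D' : VDiagram (Option ι)) (a x : ι) : Prop :=
  D.edge x ∩ D.sweptTriangle D' a ⊆ {D.pos a, D.pos (D.next a)}

/-- The crossings among three pairwise crossing strands are as in one of the moves
R3 (three classical crossings, the strands being stacked), V3 (three virtual crossings) or
V4 (a strand crossing two others virtually, which cross each other classically). -/
def AdmissibleTriple (D : VDiagram ι) (a e f : ι) : Prop :=
  ∃ x y z : ι, ({x, y, z} : Set ι) = {a, e, f} ∧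
    ((D.isOver x y ∧ D.isOver x z ∧ D.isOver y z) ∨
     (D.Virtual x y ∧ D.Virtual x z ∧ D.Virtual y z) ∨
     (D.Virtual x y ∧ D.Virtual x z ∧ D.Classical y z))

/-- The elementary moves between virtual link diagrams. -/
inductive Move : ∀ {ι κ : Type}, VDiagram ι → VDiagram κ → Prop
  /-- The names of the vertices do not matter. -/
  | relabel {ι κ : Type} (D : VDiagram ι) (D' : VDiagram κ) (e : ι ≃ κ)
      (hnext : ∀ i, D'.next (e i) = e (D.next i))
      (hpos : ∀ i, D'.pos (e i) = D.pos i)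
      (hover : ∀ i j, D'.isOver (e i) (e j) ↔ D.isOver i j) : Move D D'
  /-- Planar isotopy: the vertices move continuously in such a way that the diagram is generic
  at all times (so that crossings neither appear nor disappear), with fixed crossing types. -/
  | isotopy {ι : Type} (F : unitInterval → VDiagram ι)
      (hpos : Continuous fun t => (F t).pos)
      (hnext : ∀ t, (F t).next = (F 0).next)
      (hover : ∀ t i j, (F t).isOver i j ↔ (F 0).isOver i j) : Move (F 0) (F 1)
  /-- Subdivision of an edge by a new vertex. -/
  | subdivide {ι : Type} (D : VDiagram ι) (D' : VDiagram (Option ι)) (a : ι)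
      (hins : D.IsInsertion D' a)
      (hmem : D'.pos none ∈ openSegment ℝ (D.pos a) (D.pos (D.next a)))
      (hinh : D.InheritsCrossings D' a) : Move D D'
  /-- R1 and V1: the edge `a` is pulled across the end of an adjacent edge `b`, so that a small
  loop with one crossing, of arbitrary type, is created. -/
  | curl {ι : Type} (D : VDiagram ι) (D' : VDiagram (Option ι)) (a b : ι)
      (hins : D.IsInsertion D' a)
      (hadj : D.next b = a ∨ D.next a = b)
      (hcross : D'.Crosses (some b) none ∨ D'.Crosses (some b) (some a))
      (hrest : ∀ x, x ≠ a → x ≠ b → D.AvoidsTriangle D' a x) : Move D D'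
  /-- R2 and V2: the edge `a` is pulled across an edge `e`, so that two crossings are created,
  which are both virtual, or both classical with the same strand on top. -/
  | bigon {ι : Type} (D : VDiagram ι) (D' : VDiagram (Option ι)) (a e : ι)
      (hins : D.IsInsertion D' a)
      (hcross₁ : D'.Crosses (some e) (some a))
      (hcross₂ : D'.Crosses (some e) none)
      (hover : D'.isOver (some e) (some a) ↔ D'.isOver (some e) none)
      (hunder : D'.isOver (some a) (some e) ↔ D'.isOver none (some e))
      (hrest : ∀ x, x ≠ a → x ≠ e → D.AvoidsTriangle D' a x) : Move D D'
  /-- R3, V3 and V4: the edge `a`, which crosses the edges `e` and `f`, is pulled across the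
  crossing of `e` and `f`. -/
  | triangle {ι : Type} (D : VDiagram ι) (D' : VDiagram (Option ι)) (a e f : ι)
      (hins : D.IsInsertion D' a)
      (hae : D.Crosses a e) (haf : D.Crosses a f) (hef : D.Crosses e f)
      (hmem : (D.edge e ∩ D.edge f ∩ D.sweptTriangle D' a).Nonempty)
      (hadm : D.AdmissibleTriple a e f)
      (hinh : D.InheritsCrossings D' a)
      (hrest : ∀ x, x ≠ a → x ≠ e → x ≠ f → D.AvoidsTriangle D' a x) : Move D D'

/-- Equivalence of virtual link diagrams: a finite sequence of moves and inverse moves. -/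
def equivalence : Setoid (Σ ι : Type, VDiagram ι) :=
  Relation.EqvGen.setoid fun X Y => Move X.2 Y.2

end VDiagram

/-- An (oriented) virtual knot or link: an equivalence class of virtual link diagrams. -/
def VirtualLink : Type 1 := Quotient VDiagram.equivalence

/-- The virtual link represented by a diagram. -/
def VDiagram.link {ι : Type} (D : VDiagram ι) : VirtualLink :=
  Quotient.mk VDiagram.equivalence ⟨ι, D⟩

/-! ## Virtual braids -/

/-- The generators `σ_1, …, σ_{n-1}`, `ν_1, …, ν_{n-1}`, with indices shifted to start at `0`. -/
inductive VBGen (n : ℕ) : Type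
  | sigma (i : Fin (n - 1)) : VBGen n
  | nu (i : Fin (n - 1)) : VBGen n

/-- The free-group letter of `σ_i`. -/
def VBGen.s {n : ℕ} (i : Fin (n - 1)) : FreeGroup (VBGen n) := FreeGroup.of (VBGen.sigma i)

/-- The free-group letter of `ν_i`. -/
def VBGen.v {n : ℕ} (i : Fin (n - 1)) : FreeGroup (VBGen n) := FreeGroup.of (VBGen.nu i)

open VBGen in
/-- `VBRel n u w` says that `u = w` is a defining relation of the virtual braid group. -/
inductive VBRel (n : ℕ) : FreeGroup (VBGen n) → FreeGroup (VBGen n) → Prop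
  | sigma_comm (i k : Fin (n - 1)) (h : i.val + 1 < k.val ∨ k.val + 1 < i.val) :
      VBRel n (s i * s k) (s k * s i)
  | sigma_braid (i k : Fin (n - 1)) (h : k.val = i.val + 1) :
      VBRel n (s i * s k * s i) (s k * s i * s k)
  | nu_sq (i : Fin (n - 1)) : VBRel n (v i ^ 2) 1
  | nu_comm (i k : Fin (n - 1)) (h : i.val + 1 < k.val ∨ k.val + 1 < i.val) :
      VBRel n (v i * v k) (v k * v i)
  | nu_braid (i k : Fin (n - 1)) (h : k.val = i.val + 1) :
      VBRel n (v i * v k * v i) (v k * v i * v k)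
  | mixed_comm (i k : Fin (n - 1)) (h : i.val + 1 < k.val ∨ k.val + 1 < i.val) :
      VBRel n (s i * v k) (v k * s i)
  | mixed_braid (i k : Fin (n - 1)) (h : k.val = i.val + 1) :
      VBRel n (s i * v k * v i) (v k * v i * s k)

/-- The virtual braid group on `n` strings. -/
abbrev VirtualBraidGroup (n : ℕ) : Type :=
  PresentedGroup {r : FreeGroup (VBGen n) | ∃ u w, VBRel n u w ∧ r = u * w⁻¹}

/-- The elementary braid diagrams `σ_i`, `σ_i⁻¹`, `ν_i` on `n` strings. -/
inductive BraidLetter (n : ℕ) : Type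
  | sigma (i : Fin (n - 1)) : BraidLetter n
  | sigmaInv (i : Fin (n - 1)) : BraidLetter n
  | nu (i : Fin (n - 1)) : BraidLetter n

namespace BraidLetter

/-- The position of the crossing of an elementary braid diagram. -/
def index {n : ℕ} : BraidLetter n → Fin (n - 1)
  | sigma i => i
  | sigmaInv i => i
  | nu i => i

/-- The group element of an elementary braid diagram. -/
def toGroup {n : ℕ} : BraidLetter n → VirtualBraidGroup n
  | sigma i => PresentedGroup.of (VBGen.sigma i)
  | sigmaInv i => (PresentedGroup.of (VBGen.sigma i))⁻¹
  | nu i => PresentedGroup.of (VBGen.nu i)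

end BraidLetter

/-! ## Closures of virtual braids -/

namespace VDiagram

variable {ι : Type}

/-- The crossing of the edges `a` and `b` of a closed braid diagram, where `a` goes from left to
right of `b`, has the type of the given letter. In `σ_i` the strand going from the
`i`-th to the `(i+1)`-st position is the upper one. -/
def HasType (D : VDiagram ι) (a b : ι) {n : ℕ} : BraidLetter n → Prop
  | .sigma _ => D.isOver a b
  | .sigmaInv _ => D.isOver b a
  | .nu _ => D.Virtual a b

/-- `D` is the closure, around the braid axis at the origin, of the braid diagram on `n` strings
which is the composite of the elementary braid diagrams of the word `w`.

All strands run counterclockwise around the axis, and the ray of negative reals, along which the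
initial points and the end points of the `n` strings are identified, meets `D` in `n` points, none
of them a crossing. From this ray on, the crossings `c 0, c 1, …`, at the points `x 0, x 1, …`,
occur at increasing angles. The strings are numbered from left to right, that is, from
the axis outwards: the crossing at `x k` lies between the `i`-th and the `(i+1)`-st
string (counted from `0`) if `i` strands pass between it and the axis. -/
structure IsClosedBraid (D : VDiagram ι) (n : ℕ) (w : List (BraidLetter n)) : Prop where
  counterclockwise : ∀ i, 0 < planeDet (D.pos i) (D.pos (D.next i))
  strings : (D.trace ∩ {z : ℂ | z.re < 0 ∧ z.im = 0}).ncard = n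
  reading : ∃ (c : Fin w.length → ι × ι) (x : Fin w.length → ℂ),
    (∀ k, D.Crosses (c k).1 (c k).2 ∧ 0 < planeDet (D.dir (c k).1) (D.dir (c k).2)) ∧
    (∀ a b, D.Crosses a b → 0 < planeDet (D.dir a) (D.dir b) → ∃ k, c k = (a, b)) ∧
    (∀ k, x k ∈ D.edge (c k).1 ∩ D.edge (c k).2) ∧
    (∀ k, x k ∈ Complex.slitPlane) ∧
    StrictMono (fun k => (x k).arg) ∧
    (∀ k, (D.trace ∩ openSegment ℝ 0 (x k)).ncard = ((w.get k).index : ℕ)) ∧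
    (∀ k, D.HasType (c k).1 (c k).2 (w.get k))

end VDiagram

/-- The virtual link `K` is the closure of the virtual braid `β`: it is represented by the closure
of a braid diagram which represents `β`. -/
def IsBraidClosure {n : ℕ} (β : VirtualBraidGroup n) (K : VirtualLink) : Prop :=
  ∃ w : List (BraidLetter n), (w.map BraidLetter.toGroup).prod = β ∧
    ∃ (ι : Type) (D : VDiagram ι), D.IsClosedBraid n w ∧ D.link = K

open Set Filter Topology

/-! ## Plane geometry -/

section Plane

/-! The braid axis is the origin, and an edge from `A` to `B` runs counterclockwise around it iff
`planeDet A B > 0`. Once all edges do so, the diagram is a closed braid up to a small translation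
that puts the crossings on different rays, so everything rests on making clockwise edges
counterclockwise. What sets virtual diagrams apart is the detour move: an arc without classical
crossings can be rerouted at will. Hence classical crossings only have to be turned in place. At
each of them a clockwise strand is rotated, within a small disc, to a counterclockwise direction by
a planar isotopy (`VDiagram.exists_fewer_bad`). The clockwise edges that remain have no classical
crossings, and each is thrown across the axis and replaced by two counterclockwise edges
(`VDiagram.exists_fewer_negative`). Both processes end by induction on a count.

The main work is to derive the detour move `VDiagram.link_ins_of_virtual` from the elementary moves.
A vertex is inserted on the edge and moved along a segment to its target. A configuration is called
`Nice` if all diagrams near it with the same combinatorial data represent one link. A path of nice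
configurations, generic at a dense set of times, does not change the link, because the link is then
locally constant on a connected interval (`link_eq_of_nice_path`). Generic configurations are nice,
as genericity is open. If the path is in general position, then at any time at most one degeneracy
occurs, of one of three kinds: the moving vertex lies on an edge, a moving edge passes through a
vertex, or a moving edge passes through a crossing. Near such a configuration the non-generic
positions form a wall `f = 0` with connected sides, so niceness follows from one pair of diagrams of
the same link on the two sides (`nice_of_wall`).

For a vertex on an edge, deletion of the vertex leaves a diagram from which both sides arise by
inserting it again, and each insertion is an isotopy, a bigon move or a curl move
(`VDiagram.link_ins_of_convex`, `VertexWall.nice`). For an edge through a crossing, the sides differ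
by a triangle move, of type V3 or V4 as the edge has only virtual crossings (`TripleWall.nice`).
Subdivisions make the edges involved so short that the swept triangles meet nothing else. General
position is obtained by perturbing the neighbours and the target of the moving vertex
(`VDiagram.link_eq_of_local_move`).

To read off the braid word, crossings are sorted by argument. The number of strands on a ray does
not depend on the ray (`VDiagram.ncard_rayEdges_eq`), and this bounds the position of each crossing.
-/

theorem planeDet_self (z : ℂ) : planeDet z z = 0 := by
  simp [planeDet]; ring

theorem planeDet_swap (z w : ℂ) : planeDet z w = - planeDet w z := by
  simp [planeDet]; ring

theorem planeDet_add_left (a b w : ℂ) : planeDet (a + b) w = planeDet a w + planeDet b w := by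
  simp [planeDet]; ring

theorem planeDet_add_right (w a b : ℂ) : planeDet w (a + b) = planeDet w a + planeDet w b := by
  simp [planeDet]; ring

theorem planeDet_sub_left (a b w : ℂ) : planeDet (a - b) w = planeDet a w - planeDet b w := by
  simp [planeDet]; ring

theorem planeDet_sub_right (w a b : ℂ) : planeDet w (a - b) = planeDet w a - planeDet w b := by
  simp [planeDet]; ring

theorem planeDet_mul_left (s : ℝ) (a w : ℂ) : planeDet (s * a) w = s * planeDet a w := by
  simp [planeDet]; ring

theorem planeDet_mul_right (s : ℝ) (a w : ℂ) : planeDet a (s * w) = s * planeDet a w := by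
  simp [planeDet]; ring

theorem planeDet_neg_left (a w : ℂ) : planeDet (-a) w = - planeDet a w := by
  simp [planeDet]; ring

theorem planeDet_neg_right (a w : ℂ) : planeDet a (-w) = - planeDet a w := by
  simp [planeDet]; ring

theorem planeDet_zero_left (w : ℂ) : planeDet 0 w = 0 := by simp [planeDet]

theorem planeDet_zero_right (w : ℂ) : planeDet w 0 = 0 := by simp [planeDet]

theorem planeDet_I_mul (u : ℂ) : planeDet u (Complex.I * u) = u.re ^ 2 + u.im ^ 2 := by
  simp [planeDet]; ring

/-- Multiplication by `I` is the quarter turn to the left. The vector `I * u` is the normal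
direction in which points are pushed off a line of direction `u` throughout. -/
theorem planeDet_I_mul_pos {u : ℂ} (hu : u ≠ 0) : 0 < planeDet u (Complex.I * u) := by
  rw [planeDet_I_mul]
  have : u.re ≠ 0 ∨ u.im ≠ 0 := by
    by_contra! h
    exact hu (Complex.ext h.1 h.2)
  rcases this with h | h <;> positivity

@[fun_prop]
theorem Continuous.planeDet {X : Type*} [TopologicalSpace X] {f g : X → ℂ} (hf : Continuous f)
    (hg : Continuous g) : Continuous fun x => planeDet (f x) (g x) := by
  unfold _root_.planeDet
  fun_prop

/-- The factor is the projection coefficient `⟨u, v⟩ / ‖u‖ ^ 2`. -/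
theorem exists_real_mul_of_planeDet_eq_zero {u v : ℂ} (hu : u ≠ 0) (h : planeDet u v = 0) :
    ∃ t : ℝ, v = t * u := by
  have hn : u.re ^ 2 + u.im ^ 2 ≠ 0 := by
    have := planeDet_I_mul_pos hu
    rw [planeDet_I_mul] at this
    exact this.ne'
  refine ⟨(u.re * v.re + u.im * v.im) / (u.re ^ 2 + u.im ^ 2), ?_⟩
  simp only [planeDet] at h
  apply Complex.ext
  · simp only [Complex.mul_re, Complex.ofReal_re, Complex.ofReal_im]
    field_simp
    linear_combination (-u.im) * h
  · simp only [Complex.mul_im, Complex.ofReal_re, Complex.ofReal_im]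
    field_simp
    linear_combination u.re * h

theorem mem_segment_iff_real {a b z : ℂ} :
    z ∈ segment ℝ a b ↔ ∃ s : ℝ, 0 ≤ s ∧ s ≤ 1 ∧ z = a + s * (b - a) := by
  rw [segment_eq_image']
  constructor
  · rintro ⟨s, ⟨h0, h1⟩, rfl⟩
    exact ⟨s, h0, h1, by simp⟩
  · rintro ⟨s, h0, h1, rfl⟩
    exact ⟨s, ⟨h0, h1⟩, by simp⟩

theorem mem_openSegment_iff_real {a b z : ℂ} :
    z ∈ openSegment ℝ a b ↔ ∃ s : ℝ, 0 < s ∧ s < 1 ∧ z = a + s * (b - a) := by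
  rw [openSegment_eq_image']
  constructor
  · rintro ⟨s, ⟨h0, h1⟩, rfl⟩
    exact ⟨s, h0, h1, by simp⟩
  · rintro ⟨s, h0, h1, rfl⟩
    exact ⟨s, ⟨h0, h1⟩, by simp⟩

theorem planeDet_eq_zero_of_mem_segment {a b z : ℂ} (hz : z ∈ segment ℝ a b) :
    planeDet (b - a) (z - a) = 0 := by
  obtain ⟨s, -, -, rfl⟩ := mem_segment_iff_real.1 hz
  rw [add_sub_cancel_left, planeDet_mul_right, planeDet_self, mul_zero]

/-- A collinear point whose projection is between the end points lies on the segment. -/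
theorem mem_segment_of_collinear {a b z : ℂ} (h : planeDet (b - a) (z - a) = 0)
    (h0 : 0 ≤ (b - a).re * (z - a).re + (b - a).im * (z - a).im)
    (h1 : 0 ≤ (a - b).re * (z - b).re + (a - b).im * (z - b).im) (hab : b - a ≠ 0) :
    z ∈ segment ℝ a b := by
  obtain ⟨t, ht⟩ := exists_real_mul_of_planeDet_eq_zero hab h
  have hz : z = a + t * (b - a) := by rw [← ht]; ring
  have hn := planeDet_I_mul_pos hab
  rw [planeDet_I_mul] at hn
  refine mem_segment_iff_real.2 ⟨t, ?_, ?_, hz⟩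
  · rw [ht] at h0
    simp only [Complex.mul_re, Complex.mul_im, Complex.ofReal_re, Complex.ofReal_im] at h0
    by_contra! hneg
    nlinarith
  · have : z - b = ((t - 1 : ℝ) : ℂ) * (b - a) := by rw [hz]; push_cast; ring
    rw [this] at h1
    simp only [Complex.mul_re, Complex.mul_im, Complex.ofReal_re, Complex.ofReal_im,
      Complex.sub_re, Complex.sub_im] at h1 hn
    by_contra! hneg
    nlinarith

/-- If two segments have a common point and parallel directions, then an end point of one of them
lies on the other. -/
theorem endpoint_mem_of_parallel {a b c d z : ℂ} (hab : a ≠ b)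
    (hd : planeDet (b - a) (d - c) = 0) (h1 : z ∈ segment ℝ a b) (h2 : z ∈ segment ℝ c d) :
    c ∈ segment ℝ a b ∨ d ∈ segment ℝ a b ∨ a ∈ segment ℝ c d := by
  have hu : b - a ≠ 0 := sub_ne_zero.2 hab.symm
  obtain ⟨m, hm⟩ := exists_real_mul_of_planeDet_eq_zero hu hd
  obtain ⟨s, hs0, hs1, hs⟩ := mem_segment_iff_real.1 h1
  obtain ⟨t, ht0, ht1, ht⟩ := mem_segment_iff_real.1 h2
  have hc : c = a + ((s - t * m : ℝ) : ℂ) * (b - a) := by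
    have : c = z - t * (d - c) := by rw [ht]; ring
    rw [this, hm, hs]; push_cast; ring
  have hdd : d = a + ((s + (1 - t) * m : ℝ) : ℂ) * (b - a) := by
    have : d = c + (d - c) := by ring
    rw [this, hm]; nth_rw 1 [hc]; push_cast; ring
  -- In the coordinate on the line with `a` at `0` and `b` at `1`, the point `z` is at `s`, `c` at
  -- `s - t * m` and `d` at `s + (1 - t) * m`. If neither `c` nor `d` is in the unit interval, they
  -- lie on different sides of it, since `z` is between them; then the segment `c d` covers it and
  -- contains `a`.
  by_cases hα : 0 ≤ s - t * m ∧ s - t * m ≤ 1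
  · exact Or.inl (mem_segment_iff_real.2 ⟨_, hα.1, hα.2, hc⟩)
  by_cases hβ : 0 ≤ s + (1 - t) * m ∧ s + (1 - t) * m ≤ 1
  · exact Or.inr (Or.inl (mem_segment_iff_real.2 ⟨_, hβ.1, hβ.2, hdd⟩))
  refine Or.inr (Or.inr ?_)
  have hm0 : m ≠ 0 := by
    rintro rfl
    apply hα; constructor <;> linarith
  refine mem_segment_iff_real.2 ⟨t - s / m, ?_, ?_, ?_⟩
  · rcases lt_or_gt_of_ne hm0 with h | h
    · have : s / m ≤ 0 := div_nonpos_of_nonneg_of_nonpos hs0 h.le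
      linarith
    · by_contra! hneg
      apply hα
      have : t * m < s := by rw [← lt_div_iff₀ h]; linarith
      constructor
      · linarith
      · nlinarith
  · rcases lt_or_gt_of_ne hm0 with h | h
    · by_contra! hneg
      apply hβ
      have h' : s / m < -(1 - t) := by linarith
      rw [div_lt_iff_of_neg h] at h'
      constructor
      · nlinarith
      · nlinarith
    · have : 0 ≤ s / m := div_nonneg hs0 h.le
      linarith
  · rw [hm]; nth_rw 1 [hc]
    have : (m : ℂ) ≠ 0 := by exact_mod_cast hm0
    push_cast
    field_simp
    ring

/-- The sign condition for a transversal crossing of the segments `a b` and `c d`. -/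
def SignCross (a b c d : ℂ) : Prop :=
  planeDet (b - a) (c - a) * planeDet (b - a) (d - a) < 0 ∧
    planeDet (d - c) (a - c) * planeDet (d - c) (b - c) < 0

/-- The signed distance from the line `c d` is affine along `a b` with end values proportional to
`γ` and `δ` of opposite signs, so it vanishes at the interior parameter `γ / (γ - δ)`; likewise `α /
(α - β)` on `c d`. Cramer's rule identifies the two points. -/
theorem SignCross.exists_mem {a b c d : ℂ} (h : SignCross a b c d) :
    (openSegment ℝ a b ∩ openSegment ℝ c d).Nonempty := by
  obtain ⟨h1, h2⟩ := h
  set α := planeDet (b - a) (c - a) with hα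
  set β := planeDet (b - a) (d - a) with hβ
  set γ := planeDet (d - c) (a - c) with hγ
  set δ := planeDet (d - c) (b - c) with hδ
  have e1 : α - β = - planeDet (b - a) (d - c) := by simp only [hα, hβ, planeDet]; simp; ring
  have e2 : γ - δ = planeDet (b - a) (d - c) := by simp only [hγ, hδ, planeDet]; simp; ring
  have hD : planeDet (b - a) (d - c) ≠ 0 := by
    intro h0
    have : α = β := by linarith
    rw [this] at h1
    nlinarith [mul_self_nonneg β]
  have hs : 0 < γ / (γ - δ) ∧ γ / (γ - δ) < 1 := by
    rcases mul_neg_iff.1 h2 with ⟨hp, hn⟩ | ⟨hp, hn⟩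
    · exact ⟨div_pos hp (by linarith), by rw [div_lt_one (by linarith)]; linarith⟩
    · exact ⟨div_pos_of_neg_of_neg hp (by linarith), by
        rw [div_lt_one_of_neg (by linarith)]; linarith⟩
  have ht : 0 < α / (α - β) ∧ α / (α - β) < 1 := by
    rcases mul_neg_iff.1 h1 with ⟨hp, hn⟩ | ⟨hp, hn⟩
    · exact ⟨div_pos hp (by linarith), by rw [div_lt_one (by linarith)]; linarith⟩
    · exact ⟨div_pos_of_neg_of_neg hp (by linarith), by
        rw [div_lt_one_of_neg (by linarith)]; linarith⟩
  refine ⟨a + (γ / (γ - δ) : ℝ) * (b - a), mem_openSegment_iff_real.2 ⟨_, hs.1, hs.2, rfl⟩,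
    mem_openSegment_iff_real.2 ⟨_, ht.1, ht.2, ?_⟩⟩
  rw [e1, e2, hγ, hα]
  have key : a + (planeDet (d - c) (a - c) / planeDet (b - a) (d - c) : ℝ) * (b - a) =
      c + (planeDet (b - a) (c - a) / -planeDet (b - a) (d - c) : ℝ) * (d - c) := by
    set D := planeDet (b - a) (d - c) with hDdef
    apply Complex.ext
    · simp only [Complex.add_re, Complex.mul_re, Complex.ofReal_re, Complex.ofReal_im]
      field_simp
      rw [hDdef]; simp only [planeDet, Complex.sub_re, Complex.sub_im]; ring
    · simp only [Complex.add_im, Complex.mul_im, Complex.ofReal_re, Complex.ofReal_im]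
      field_simp
      rw [hDdef]; simp only [planeDet, Complex.sub_re, Complex.sub_im]; ring
  exact key

theorem SignCross.nonempty {a b c d : ℂ} (h : SignCross a b c d) :
    (segment ℝ a b ∩ segment ℝ c d).Nonempty := by
  obtain ⟨z, h1, h2⟩ := h.exists_mem
  exact ⟨z, openSegment_subset_segment _ _ _ h1, openSegment_subset_segment _ _ _ h2⟩

/-- Parallel segments with a common point overlap, and then an end point of one lies on the other.
-/
theorem planeDet_ne_zero_of_meet {a b c d : ℂ} (ha : a ∉ segment ℝ c d)
    (hc : c ∉ segment ℝ a b) (hd : d ∉ segment ℝ a b)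
    (h : (segment ℝ a b ∩ segment ℝ c d).Nonempty) : planeDet (b - a) (d - c) ≠ 0 := by
  obtain ⟨z, h1, h2⟩ := h
  intro h0
  by_cases hab : a = b
  · subst hab
    rw [segment_same] at h1
    rw [mem_singleton_iff] at h1
    exact ha (h1 ▸ h2)
  · rcases endpoint_mem_of_parallel hab h0 h1 h2 with h | h | h
    exacts [hc h, hd h, ha h]

/-- Two segments which meet, none of whose end points lies on the other, cross transversally. -/
theorem signCross_of_meet {a b c d : ℂ} (ha : a ∉ segment ℝ c d) (hb : b ∉ segment ℝ c d)
    (hc : c ∉ segment ℝ a b) (hd : d ∉ segment ℝ a b)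
    (h : (segment ℝ a b ∩ segment ℝ c d).Nonempty) : SignCross a b c d := by
  have hD := planeDet_ne_zero_of_meet ha hc hd h
  obtain ⟨z, h1, h2⟩ := h
  obtain ⟨s, hs0, hs1, hs⟩ := mem_segment_iff_real.1 h1
  obtain ⟨t, ht0, ht1, ht⟩ := mem_segment_iff_real.1 h2
  have hs0' : 0 < s := lt_of_le_of_ne hs0 fun h => ha (by
    have : z = a := by rw [hs, ← h]; simp
    exact this ▸ h2)
  have hs1' : s < 1 := lt_of_le_of_ne hs1 fun h => hb (by
    have : z = b := by rw [hs, h]; simp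
    exact this ▸ h2)
  have ht0' : 0 < t := lt_of_le_of_ne ht0 fun h => hc (by
    have : z = c := by rw [ht, ← h]; simp
    exact this ▸ h1)
  have ht1' : t < 1 := lt_of_le_of_ne ht1 fun h => hd (by
    have : z = d := by rw [ht, h]; simp
    exact this ▸ h1)
  set D := planeDet (b - a) (d - c) with hDdef
  -- This equates the two expressions for the common point. It makes the four determinants equal to
  -- `-t`, `1 - t`, `s` and `-(1 - s)` times `D`, where `0 < s, t < 1`.
  have hca : c - a = s * (b - a) - t * (d - c) := by
    have : a + s * (b - a) = c + t * (d - c) := by rw [← hs, ← ht]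
    linear_combination -this
  have hD2 : 0 < D ^ 2 := by positivity
  have e1 : planeDet (b - a) (c - a) = - t * D := by
    rw [hca, planeDet_sub_right, planeDet_mul_right, planeDet_mul_right, planeDet_self]; ring
  have e2 : planeDet (b - a) (d - a) = (1 - t) * D := by
    have : d - a = (c - a) + (d - c) := by ring
    rw [this, planeDet_add_right, e1]; ring
  have e3 : planeDet (d - c) (a - c) = s * D := by
    have : a - c = -(c - a) := by ring
    rw [this, hca, planeDet_neg_right, planeDet_sub_right, planeDet_mul_right, planeDet_mul_right,
      planeDet_self, planeDet_swap (d - c) (b - a)]; ring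
  have e4 : planeDet (d - c) (b - c) = - (1 - s) * D := by
    have : b - c = (a - c) + (b - a) := by ring
    rw [this, planeDet_add_right, e3, planeDet_swap (d - c) (b - a)]; ring
  constructor
  · rw [e1, e2]
    have : 0 < t * (1 - t) * D ^ 2 := by
      have : 0 < 1 - t := by linarith
      positivity
    linarith
  · rw [e3, e4]
    have : 0 < s * (1 - s) * D ^ 2 := by
      have : 0 < 1 - s := by linarith
      positivity
    linarith

/-- Two segments with a common end point `b` and a further common point overlap. -/
theorem overlap_of_shared_endpoint {a b c z : ℂ} (h1 : z ∈ segment ℝ a b)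
    (h2 : z ∈ segment ℝ b c) (hz : z ≠ b) : a ∈ segment ℝ b c ∨ c ∈ segment ℝ a b := by
  rw [segment_symm] at h1
  obtain ⟨s, hs0, hs1, hs⟩ := mem_segment_iff_real.1 h1
  obtain ⟨t, ht0, ht1, ht⟩ := mem_segment_iff_real.1 h2
  have hs0' : 0 < s := lt_of_le_of_ne hs0 fun h => hz (by rw [hs, ← h]; simp)
  have ht0' : 0 < t := lt_of_le_of_ne ht0 fun h => hz (by rw [ht, ← h]; simp)
  have hst : (s : ℂ) * (a - b) = t * (c - b) := by
    have : b + s * (a - b) = b + t * (c - b) := by rw [← hs, ← ht]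
    exact add_left_cancel this
  have hs' : (s : ℂ) ≠ 0 := by exact_mod_cast hs0'.ne'
  have ht' : (t : ℂ) ≠ 0 := by exact_mod_cast ht0'.ne'
  -- Both segments lie on one ray from `b`, with `s * (a - b) = t * (c - b)`. The larger parameter
  -- belongs to the shorter segment, whose far end therefore lies on the other.
  rcases le_total t s with h | h
  · left
    refine mem_segment_iff_real.2 ⟨t / s, by positivity, by rw [div_le_one hs0']; exact h, ?_⟩
    push_cast
    field_simp
    linear_combination hst
  · right
    rw [segment_symm]
    refine mem_segment_iff_real.2 ⟨s / t, by positivity, by rw [div_le_one ht0']; exact h, ?_⟩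
    push_cast
    field_simp
    linear_combination -hst

/-- If the segment `a b` starts on the segment `c d` and contains a further point of it, then they
overlap. -/
theorem overlap_of_start_mem {a b c d z : ℂ} (ha : a ∈ segment ℝ c d) (h1 : z ∈ segment ℝ a b)
    (h2 : z ∈ segment ℝ c d) (hz : z ≠ a) :
    b ∈ segment ℝ c d ∨ c ∈ segment ℝ a b ∨ d ∈ segment ℝ a b := by
  by_cases hca : c = a
  · subst hca
    exact Or.inr (Or.inl (left_mem_segment _ _ _))
  -- split the segment `c d` at `a`
  have hsplit : z ∈ segment ℝ c a ∨ z ∈ segment ℝ a d := by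
    obtain ⟨s, hs0, hs1, hs⟩ := mem_segment_iff_real.1 ha
    obtain ⟨t, ht0, ht1, ht⟩ := mem_segment_iff_real.1 h2
    rcases le_total t s with h | h
    · left
      rcases eq_or_lt_of_le hs0 with h0 | h0
      · have : a = c := by rw [hs, ← h0]; simp
        exact absurd this.symm hca
      refine mem_segment_iff_real.2 ⟨t / s, by positivity, by rw [div_le_one h0]; exact h, ?_⟩
      have hs' : (s : ℂ) ≠ 0 := by exact_mod_cast h0.ne'
      rw [hs, ht]; push_cast; field_simp; ring
    · right
      rcases eq_or_lt_of_le hs1 with h0 | h0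
      · have : t = s := by linarith
        have : z = a := by rw [hs, ht, this]
        exact absurd this hz
      refine mem_segment_iff_real.2 ⟨(t - s) / (1 - s),
        div_nonneg (by linarith) (by linarith), by rw [div_le_one (by linarith)]; linarith, ?_⟩
      have hs' : ((1 : ℂ) - s) ≠ 0 := by
        have : (1 - s : ℝ) ≠ 0 := by linarith
        exact_mod_cast this
      rw [hs, ht]; push_cast; field_simp; ring
  have hsub1 : segment ℝ c a ⊆ segment ℝ c d :=
    (convex_segment c d).segment_subset (left_mem_segment _ _ _) ha
  have hsub2 : segment ℝ a d ⊆ segment ℝ c d :=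
    (convex_segment c d).segment_subset ha (right_mem_segment _ _ _)
  rcases hsplit with h | h
  · rcases overlap_of_shared_endpoint h h1 hz with h' | h'
    · exact Or.inr (Or.inl h')
    · exact Or.inl (hsub1 h')
  · rw [segment_symm] at h
    rcases overlap_of_shared_endpoint h h1 hz with h' | h'
    · exact Or.inr (Or.inr h')
    · rw [segment_symm] at h'; exact Or.inl (hsub2 h')

/-- Finitely many lines do not cover a nonempty open set. -/
theorem exists_mem_open_off_lines {α : Type*} {T : Set α} (hT : T.Finite) (b u : α → ℂ)
    (hu : ∀ i ∈ T, u i ≠ 0) {U : Set ℂ} (hU : IsOpen U) (hne : U.Nonempty) :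
    ∃ z ∈ U, ∀ i ∈ T, planeDet (u i) (z - b i) ≠ 0 := by
  induction T, hT using Set.Finite.induction_on generalizing U with
  | empty => obtain ⟨z, hz⟩ := hne; exact ⟨z, hz, by simp⟩
  | @insert i T _ _ ih =>
    have hui : u i ≠ 0 := hu i (mem_insert _ _)
    have hopen : IsOpen (U ∩ {z | planeDet (u i) (z - b i) ≠ 0}) := by
      refine hU.inter (isOpen_ne_fun (by fun_prop) continuous_const)
    have hne' : (U ∩ {z | planeDet (u i) (z - b i) ≠ 0}).Nonempty := by
      obtain ⟨z, hz⟩ := hne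
      -- A point on the new line is pushed off it along the normal `I * u i`, by so little that it
      -- stays in `U`.
      by_cases h0 : planeDet (u i) (z - b i) = 0
      · have hc : Continuous fun ε : ℝ => z + ε * (Complex.I * u i) := by fun_prop
        have hev : ∀ᶠ ε : ℝ in 𝓝 0, z + ε * (Complex.I * u i) ∈ U :=
          hc.continuousAt.eventually_mem (by simpa using hU.mem_nhds hz)
        have hev' : ∀ᶠ ε : ℝ in 𝓝[>] 0, z + ε * (Complex.I * u i) ∈ U :=
          hev.filter_mono nhdsWithin_le_nhds
        obtain ⟨ε, hε, hpos⟩ := (hev'.and self_mem_nhdsWithin).exists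
        refine ⟨_, hε, ?_⟩
        have : z + ε * (Complex.I * u i) - b i = (z - b i) + ε * (Complex.I * u i) := by ring
        rw [Set.mem_ofPred_eq]
        rw [this, planeDet_add_right, h0, planeDet_mul_right, zero_add]
        exact (mul_pos hpos (planeDet_I_mul_pos hui)).ne'
      · exact ⟨z, hz, h0⟩
    obtain ⟨z, hz, h⟩ := ih (fun j hj => hu j (mem_insert_of_mem _ hj)) hopen hne'
    refine ⟨z, hz.1, ?_⟩
    intro j hj
    rcases mem_insert_iff.1 hj with rfl | hj
    · exact hz.2
    · exact h j hj

end Plane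

/-! ## Generic positions and isotopies -/

section Generic

variable {ι κ : Type}

/-- The vertex positions `p` define a generic polygonal curve. -/
def Gen (next : Equiv.Perm ι) (p : ι → ℂ) : Prop :=
  (∀ i k, p k ∈ polyEdge next p i → k = i ∨ k = next i) ∧
    ∀ i j k, i ≠ j → j ≠ k → i ≠ k → ∀ z, z ∈ polyEdge next p i →
      z ∈ polyEdge next p j → z ∉ polyEdge next p k

theorem VDiagram.gen (D : VDiagram ι) : Gen D.next D.pos := ⟨D.vertex_generic, D.no_triple⟩

theorem VDiagram.eq_of_data {D D' : VDiagram ι} (hn : D.next = D'.next) (hp : D.pos = D'.pos)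
    (ho : D.isOver = D'.isOver) : D = D' := by
  cases D; cases D'; simp only at hn hp ho; subst hn hp ho; rfl

/-- The diagram `D` with its vertices moved to generic positions `p`. -/
def VDiagram.withPos (D : VDiagram ι) (p : ι → ℂ) (hg : Gen D.next p)
    (hc : ∀ i j, D.isOver i j → polyCrosses D.next p i j) : VDiagram ι :=
  { D with
    pos := p
    vertex_generic := hg.1
    no_triple := hg.2
    over_crosses := hc }

theorem VDiagram.Move.link_eq {D : VDiagram ι} {D' : VDiagram κ} (h : VDiagram.Move D D') :
    D.link = D'.link :=
  Quotient.sound (Relation.EqvGen.rel _ _ h)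

/-- Projection along a compact factor is a closed map. Incidences with an edge quantify over a
parameter in the unit interval, so they are closed conditions on the vertex positions. -/
theorem isClosed_exists_compact {K X : Type*} [TopologicalSpace K] [CompactSpace K]
    [TopologicalSpace X] {P : K × X → Prop} (hP : IsClosed {y | P y}) :
    IsClosed {x | ∃ k, P (k, x)} := by
  have := isClosedMap_snd_of_compactSpace (X := K) (Y := X) _ hP
  convert this using 1
  ext x
  simp [Set.mem_image]

theorem mem_polyEdge_iff {next : Equiv.Perm ι} {p : ι → ℂ} {i : ι} {z : ℂ} :
    z ∈ polyEdge next p i ↔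
      ∃ s : unitInterval, z = p i + ((s : ℝ) : ℂ) * (p (next i) - p i) := by
  rw [polyEdge, mem_segment_iff_real]
  constructor
  · rintro ⟨s, h0, h1, h⟩; exact ⟨⟨s, h0, h1⟩, h⟩
  · rintro ⟨⟨s, h0, h1⟩, h⟩; exact ⟨s, h0, h1, h⟩

theorem isClosed_vertex_mem (next : Equiv.Perm ι) (i k : ι) :
    IsClosed {p : ι → ℂ | p k ∈ polyEdge next p i} := by
  simp only [mem_polyEdge_iff]
  refine isClosed_exists_compact (P := fun y : unitInterval × (ι → ℂ) =>
    y.2 k = y.2 i + ((y.1 : ℝ) : ℂ) * (y.2 (next i) - y.2 i)) (isClosed_eq ?_ ?_) <;> fun_prop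

theorem isClosed_meet (next : Equiv.Perm ι) (i j : ι) :
    IsClosed {p : ι → ℂ | (polyEdge next p i ∩ polyEdge next p j).Nonempty} := by
  have h := isClosed_exists_compact (P := fun y : (unitInterval × unitInterval) × (ι → ℂ) =>
    y.2 i + ((y.1.1 : ℝ) : ℂ) * (y.2 (next i) - y.2 i) =
      y.2 j + ((y.1.2 : ℝ) : ℂ) * (y.2 (next j) - y.2 j)) (isClosed_eq (by fun_prop) (by fun_prop))
  convert h using 1
  ext p
  simp only [Set.mem_ofPred_eq, Set.Nonempty, Set.mem_inter_iff, mem_polyEdge_iff]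
  constructor
  · rintro ⟨z, ⟨s, hs⟩, t, ht⟩; exact ⟨(s, t), by rw [← hs, ← ht]⟩
  · rintro ⟨⟨s, t⟩, h⟩; exact ⟨_, ⟨s, rfl⟩, t, h⟩

theorem isClosed_triple (next : Equiv.Perm ι) (i j k : ι) :
    IsClosed {p : ι → ℂ | ∃ z, z ∈ polyEdge next p i ∧ z ∈ polyEdge next p j ∧
      z ∈ polyEdge next p k} := by
  have h := isClosed_exists_compact
    (P := fun y : (unitInterval × unitInterval × unitInterval) × (ι → ℂ) =>
    y.2 i + ((y.1.1 : ℝ) : ℂ) * (y.2 (next i) - y.2 i) =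
      y.2 j + ((y.1.2.1 : ℝ) : ℂ) * (y.2 (next j) - y.2 j) ∧
    y.2 i + ((y.1.1 : ℝ) : ℂ) * (y.2 (next i) - y.2 i) =
      y.2 k + ((y.1.2.2 : ℝ) : ℂ) * (y.2 (next k) - y.2 k))
    ((isClosed_eq (by fun_prop) (by fun_prop)).inter (isClosed_eq (by fun_prop) (by fun_prop)))
  convert h using 1
  ext p
  simp only [Set.mem_ofPred_eq, mem_polyEdge_iff]
  constructor
  · rintro ⟨z, ⟨s, hs⟩, ⟨t, ht⟩, u, hu⟩; exact ⟨(s, t, u), by rw [← hs, ← ht], by rw [← hs, ← hu]⟩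
  · rintro ⟨⟨s, t, u⟩, h, h'⟩; exact ⟨_, ⟨s, rfl⟩, ⟨t, h⟩, u, h'⟩

theorem eventually_vertex_notMem {next : Equiv.Perm ι} {p₀ : ι → ℂ} {i k : ι}
    (h : p₀ k ∉ polyEdge next p₀ i) : ∀ᶠ p in 𝓝 p₀, p k ∉ polyEdge next p i :=
  (isClosed_vertex_mem next i k).isOpen_compl.mem_nhds h

theorem eventually_not_meet {next : Equiv.Perm ι} {p₀ : ι → ℂ} {i j : ι}
    (h : ¬ (polyEdge next p₀ i ∩ polyEdge next p₀ j).Nonempty) :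
    ∀ᶠ p in 𝓝 p₀, ¬ (polyEdge next p i ∩ polyEdge next p j).Nonempty :=
  (isClosed_meet next i j).isOpen_compl.mem_nhds h

theorem eventually_not_triple {next : Equiv.Perm ι} {p₀ : ι → ℂ} {i j k : ι}
    (h : ¬ ∃ z, z ∈ polyEdge next p₀ i ∧ z ∈ polyEdge next p₀ j ∧ z ∈ polyEdge next p₀ k) :
    ∀ᶠ p in 𝓝 p₀, ¬ ∃ z, z ∈ polyEdge next p i ∧ z ∈ polyEdge next p j ∧ z ∈ polyEdge next p k :=
  (isClosed_triple next i j k).isOpen_compl.mem_nhds h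

/-- Strict polynomial inequalities are open. This complements the closedness of meeting: transversal
crossings persist, and absent ones do not appear. -/
theorem eventually_signCross {next : Equiv.Perm ι} {p₀ : ι → ℂ} {i j : ι}
    (h : SignCross (p₀ i) (p₀ (next i)) (p₀ j) (p₀ (next j))) :
    ∀ᶠ p in 𝓝 p₀, SignCross (p i) (p (next i)) (p j) (p (next j)) := by
  refine IsOpen.mem_nhds (s := {p : ι → ℂ | SignCross (p i) (p (next i)) (p j) (p (next j))}) ?_ h
  have h1 : Continuous fun p : ι → ℂ => planeDet (p (next i) - p i) (p j - p i) *
      planeDet (p (next i) - p i) (p (next j) - p i) := by fun_prop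
  have h2 : Continuous fun p : ι → ℂ => planeDet (p (next j) - p j) (p i - p j) *
      planeDet (p (next j) - p j) (p (next i) - p j) := by fun_prop
  exact (isOpen_lt h1 continuous_const).inter (isOpen_lt h2 continuous_const)

theorem polyCrosses.symm {next : Equiv.Perm ι} {p : ι → ℂ} {i j : ι} (h : polyCrosses next p i j) :
    polyCrosses next p j i :=
  ⟨h.1.symm, h.2.2.1, h.2.1, by rw [inter_comm]; exact h.2.2.2⟩

/-- Genericity keeps the end points of each edge off the other edge, so `signCross_of_meet` applies.
This turns the closed condition of meeting into an open one. -/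
theorem Gen.signCross {next : Equiv.Perm ι} {p : ι → ℂ} (hp : Gen next p) {i j : ι}
    (h : polyCrosses next p i j) : SignCross (p i) (p (next i)) (p j) (p (next j)) := by
  obtain ⟨h1, h2, h3, h4⟩ := h
  refine signCross_of_meet ?_ ?_ ?_ ?_ h4
  · intro h; rcases hp.1 j i h with h | h
    · exact h1 h
    · exact h3 h.symm
  · intro h; rcases hp.1 j (next i) h with h | h
    · exact h2 h
    · exact h1 (next.injective h)
  · intro h; rcases hp.1 i j h with h | h
    · exact h1 h.symm
    · exact h2 h.symm
  · intro h; rcases hp.1 i (next j) h with h | h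
    · exact h3 h
    · exact h1 (next.injective h).symm

theorem Gen.eventually_polyCrosses {next : Equiv.Perm ι} {p₀ : ι → ℂ} (hp : Gen next p₀) {i j : ι}
    (h : polyCrosses next p₀ i j) : ∀ᶠ p in 𝓝 p₀, polyCrosses next p i j := by
  filter_upwards [eventually_signCross (hp.signCross h)] with p hp
  exact ⟨h.1, h.2.1, h.2.2.1, hp.nonempty⟩

/-- Each of the finitely many forbidden incidences is a closed condition, so its absence persists
nearby. -/
theorem Gen.eventually [Finite ι] {next : Equiv.Perm ι} {p₀ : ι → ℂ} (h : Gen next p₀) :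
    ∀ᶠ p in 𝓝 p₀, Gen next p := by
  have h1 : ∀ᶠ p in 𝓝 p₀, ∀ i k, p k ∈ polyEdge next p i → k = i ∨ k = next i := by
    refine eventually_all.2 fun i => eventually_all.2 fun k => ?_
    by_cases hk : p₀ k ∈ polyEdge next p₀ i
    · exact Eventually.of_forall fun p _ => h.1 i k hk
    · filter_upwards [eventually_vertex_notMem hk] with p hp h
      exact absurd h hp
  have h2 : ∀ᶠ p in 𝓝 p₀, ∀ i j k, i ≠ j → j ≠ k → i ≠ k →
      ¬ ∃ z, z ∈ polyEdge next p i ∧ z ∈ polyEdge next p j ∧ z ∈ polyEdge next p k := by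
    refine eventually_all.2 fun i => eventually_all.2 fun j => eventually_all.2 fun k => ?_
    by_cases hne : i ≠ j ∧ j ≠ k ∧ i ≠ k
    · filter_upwards [eventually_not_triple (next := next) (p₀ := p₀) (i := i) (j := j) (k := k)
        (by rintro ⟨z, hi, hj, hk⟩; exact h.2 i j k hne.1 hne.2.1 hne.2.2 z hi hj hk)]
        with p hp _ _ _
      exact hp
    · exact Eventually.of_forall fun p a b c => absurd ⟨a, b, c⟩ hne
  filter_upwards [h1, h2] with p hp hp'
  exact ⟨hp, fun i j k a b c z hi hj hk => hp' i j k a b c ⟨z, hi, hj, hk⟩⟩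

/-- Crossings neither appear nor disappear along a path of generic positions. -/
theorem polyCrosses_of_path {next : Equiv.Perm ι} {p q : ι → ℂ} (γ : Path p q)
    (hγ : ∀ t, Gen next (γ t)) {i j : ι} (h : polyCrosses next p i j) (t : unitInterval) :
    polyCrosses next (γ t) i j := by
  -- The set of times is closed because meeting is, and open because crossings of generic positions
  -- are transversal.
  have hcl : IsClopen {t : unitInterval | polyCrosses next (γ t) i j} := by
    constructor
    · have : {t : unitInterval | polyCrosses next (γ t) i j} =
          γ ⁻¹' {p | (polyEdge next p i ∩ polyEdge next p j).Nonempty} := by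
        ext t
        exact ⟨fun h => h.2.2.2, fun h' => ⟨h.1, h.2.1, h.2.2.1, h'⟩⟩
      rw [this]
      exact (isClosed_meet next i j).preimage γ.continuous
    · rw [isOpen_iff_mem_nhds]
      intro t ht
      exact γ.continuous.continuousAt.eventually ((hγ t).eventually_polyCrosses ht)
  have := hcl.eq_univ ⟨0, by rw [Set.mem_ofPred_eq, γ.source]; exact h⟩
  exact this.ge (mem_univ t)

/-- The classical crossings of `D` survive along the path, so the same relation `isOver` is
admissible at all times and the path is an isotopy move. -/
theorem VDiagram.exists_of_path (D : VDiagram ι) {q : ι → ℂ} (γ : Path D.pos q)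
    (hγ : ∀ t, Gen D.next (γ t)) :
    ∃ D' : VDiagram ι, D'.next = D.next ∧ D'.isOver = D.isOver ∧ D'.pos = q ∧
      D'.link = D.link := by
  let F : unitInterval → VDiagram ι := fun t => D.withPos (γ t) (hγ t)
    fun i j h => polyCrosses_of_path γ hγ (D.over_crosses i j h) t
  have hm : VDiagram.Move (F 0) (F 1) :=
    VDiagram.Move.isotopy F γ.continuous (fun _ => rfl) (fun _ _ _ => Iff.rfl)
  have h0 : F 0 = D := VDiagram.eq_of_data rfl γ.source rfl
  refine ⟨F 1, rfl, rfl, γ.target, ?_⟩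
  rw [← hm.link_eq, h0]

theorem VDiagram.link_eq_of_joinedIn {D D' : VDiagram ι} (hn : D'.next = D.next)
    (ho : D'.isOver = D.isOver) (h : JoinedIn {p | Gen D.next p} D.pos D'.pos) :
    D'.link = D.link := by
  obtain ⟨γ, hγ⟩ := h
  obtain ⟨E, h1, h2, h3, h4⟩ := D.exists_of_path γ hγ
  rw [← h4]
  congr 1
  exact VDiagram.eq_of_data (hn.trans h1.symm) h3.symm (ho.trans h2.symm)

/-- All diagrams with positions near `p₀` and the given combinatorial data represent one link. -/
def Nice (next : Equiv.Perm ι) (ov : ι → ι → Prop) (p₀ : ι → ℂ) : Prop :=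
  ∃ L : VirtualLink, ∀ᶠ p in 𝓝 p₀, ∀ D : VDiagram ι, D.next = next → D.isOver = ov →
    D.pos = p → D.link = L

theorem joinedIn_of_segment_subset {E : Type*} [NormedAddCommGroup E] [NormedSpace ℝ E]
    {s : Set E} {x y : E} (h : segment ℝ x y ⊆ s) : JoinedIn s x y :=
  ((convex_segment x y).isPathConnected ⟨x, left_mem_segment ℝ x y⟩).joinedIn x
    (left_mem_segment ℝ x y) y (right_mem_segment ℝ x y) |>.mono h

/-- Small perturbations of a diagram represent the same link. -/
theorem VDiagram.eventually_perturb (D : VDiagram ι) :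
    ∀ᶠ p in 𝓝 D.pos, ∃ D' : VDiagram ι, D'.next = D.next ∧ D'.isOver = D.isOver ∧ D'.pos = p ∧
      D'.link = D.link := by
  have := D.finite
  have := Fintype.ofFinite ι
  obtain ⟨r, hr, hball⟩ := Metric.eventually_nhds_iff_ball.1 D.gen.eventually
  refine Metric.eventually_nhds_iff_ball.2 ⟨r, hr, fun p hp => ?_⟩
  obtain ⟨γ, hγ⟩ := joinedIn_of_segment_subset (s := {p | Gen D.next p}) (x := D.pos) (y := p)
    (fun q hq => hball q ((convex_ball D.pos r).segment_subset (Metric.mem_ball_self hr) hp hq))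
  exact D.exists_of_path γ hγ

theorem VDiagram.nice (D : VDiagram ι) : Nice D.next D.isOver D.pos := by
  refine ⟨D.link, ?_⟩
  filter_upwards [D.eventually_perturb] with p hp E h1 h2 h3
  obtain ⟨D', h1', h2', h3', h4'⟩ := hp
  rw [← h4']
  congr 1
  exact VDiagram.eq_of_data (h1.trans h1'.symm) (h3.trans h3'.symm) (h2.trans h2'.symm)

/-- On each side of a wall `f = 0`, nearby points are joined near the wall. -/
theorem eventually_joinedIn_wall {E : Type*} [NormedAddCommGroup E] [NormedSpace ℝ E]
    {p₀ w : E} {f c : E → ℝ} (hf : Continuous f) (hc : Continuous c)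
    (hfw : ∀ p (s : ℝ), f (p + s • w) = f p + s * c p) (h0 : f p₀ = 0) (hpos : 0 < c p₀)
    {U : Set E} (hU : U ∈ 𝓝 p₀) :
    ∃ V ∈ 𝓝 p₀, ∀ p ∈ V, ∀ q ∈ V, 0 < f p → 0 < f q → JoinedIn (U ∩ {x | 0 < f x}) p q := by
  obtain ⟨R, hR, hball⟩ := Metric.mem_nhds_iff.1 hU
  obtain ⟨h, hh, hw⟩ : ∃ h : ℝ, 0 < h ∧ h * ‖w‖ < R / 2 := by
    refine ⟨R / 2 / (‖w‖ + 1), by positivity, ?_⟩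
    rw [div_mul_eq_mul_div, div_lt_iff₀ (by positivity)]
    nlinarith [norm_nonneg w]
  have hfh : 0 < f (p₀ + h • w) := by rw [hfw, h0]; positivity
  have hop : IsOpen {x | 0 < f x} := isOpen_lt continuous_const hf
  obtain ⟨r, hr, hball'⟩ := Metric.isOpen_iff.1 hop _ hfh
  refine ⟨Metric.ball p₀ (min r (R / 2)) ∩ {p | 0 < c p},
    inter_mem (Metric.ball_mem_nhds _ (by positivity))
      ((isOpen_lt continuous_const hc).mem_nhds hpos), ?_⟩
  have hnorm : ∀ s : ℝ, 0 ≤ s → s ≤ h → ‖s • w‖ < R / 2 := by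
    intro s h0 h1
    rw [norm_smul, Real.norm_of_nonneg h0]
    exact lt_of_le_of_lt (mul_le_mul_of_nonneg_right h1 (norm_nonneg _)) hw
  have hin : ∀ p ∈ Metric.ball p₀ (R / 2), ∀ s : ℝ, 0 ≤ s → s ≤ h → p + s • w ∈ U := by
    intro p hp s h0 h1
    apply hball
    rw [Metric.mem_ball, dist_eq_norm] at hp ⊢
    calc ‖p + s • w - p₀‖ = ‖(p - p₀) + s • w‖ := by congr 1; abel
      _ ≤ ‖p - p₀‖ + ‖s • w‖ := norm_add_le _ _
      _ < R := by linarith [hnorm s h0 h1]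
  -- The joining path climbs from `p` by `h • w`, which only increases `f` because the slope `c p`
  -- is positive. It then runs inside the translated ball, where `f > 0`, and descends to `q`.
  have hup : ∀ p ∈ Metric.ball p₀ (min r (R / 2)) ∩ {p | 0 < c p}, 0 < f p →
      JoinedIn (U ∩ {x | 0 < f x}) p (p + h • w) := by
    rintro p ⟨hp, hcp⟩ hfp
    apply joinedIn_of_segment_subset
    rw [segment_eq_image']
    rintro _ ⟨t, ⟨ht0, ht1⟩, rfl⟩
    have e : p + t • (p + h • w - p) = p + (t * h) • w := by rw [add_sub_cancel_left, smul_smul]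
    have e1 : t * h ≤ h := by nlinarith
    simp only [e]
    refine ⟨hin p (Metric.ball_subset_ball (min_le_right _ _) hp) _ (by positivity) e1, ?_⟩
    rw [Set.mem_ofPred_eq] at hcp ⊢
    rw [hfw]; positivity
  have htop : ∀ p ∈ Metric.ball p₀ (min r (R / 2)), ∀ q ∈ Metric.ball p₀ (min r (R / 2)),
      JoinedIn (U ∩ {x | 0 < f x}) (p + h • w) (q + h • w) := by
    intro p hp q hq
    apply joinedIn_of_segment_subset
    intro x hx
    have hx' : x - h • w ∈ Metric.ball p₀ (min r (R / 2)) := by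
      apply (convex_ball p₀ (min r (R / 2))).segment_subset hp hq
      obtain ⟨a, b, ha, hb, hab, rfl⟩ := hx
      refine ⟨a, b, ha, hb, hab, ?_⟩
      have : h • w = a • h • w + b • h • w := by rw [← add_smul, hab, one_smul]
      simp only [smul_add]
      nth_rw 3 [this]; abel
    have hxe : x = (x - h • w) + h • w := by abel
    refine ⟨?_, ?_⟩
    · rw [hxe]
      exact hin _ (Metric.ball_subset_ball (min_le_right _ _) hx') h hh.le le_rfl
    · apply hball'
      have := Metric.ball_subset_ball (min_le_left _ _) hx'
      rw [Metric.mem_ball, dist_eq_norm] at this ⊢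
      convert this using 2
      abel
  intro p hp q hq hfp hfq
  exact ((hup p hp hfp).trans (htop p hp.1 q hq.1)).trans (hup q hq hfq).symm

/-- A configuration on a wall `f = 0` is nice, if nearby configurations off the wall are generic,
and if there are diagrams of one link on both sides of the wall, arbitrarily near to it. -/
theorem nice_of_wall [Finite ι] {next : Equiv.Perm ι} {ov : ι → ι → Prop} {p₀ w : ι → ℂ}
    {f c : (ι → ℂ) → ℝ} (hf : Continuous f) (hc : Continuous c)
    (hfw : ∀ p (s : ℝ), f (p + s • w) = f p + s * c p) (h0 : f p₀ = 0) (hpos : 0 < c p₀)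
    (hgen : ∀ᶠ p in 𝓝 p₀, f p ≠ 0 → Gen next p)
    (hwall : ∀ᶠ p in 𝓝 p₀, f p = 0 → ¬ Gen next p)
    (hpair : ∀ V ∈ 𝓝 p₀, ∃ D E : VDiagram ι, D.next = next ∧ D.isOver = ov ∧ D.pos ∈ V ∧
      0 < f D.pos ∧ E.next = next ∧ E.isOver = ov ∧ E.pos ∈ V ∧ f E.pos < 0 ∧
      D.link = E.link) :
    Nice next ov p₀ := by
  have := Fintype.ofFinite ι
  obtain ⟨V, hV, hjoin⟩ := eventually_joinedIn_wall hf hc hfw h0 hpos hgen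
  -- The lower side is the upper side for `-f` and the direction `-w`, with the same slope `c`.
  obtain ⟨V', hV', hjoin'⟩ := eventually_joinedIn_wall (w := -w) (c := c) (f := fun p => - f p)
    hf.neg hc (fun p s => by
      rw [show p + s • -w = p + (-s) • w by simp, hfw]; ring) (by simp [h0]) hpos hgen
  obtain ⟨D, E, hDn, hDo, hDV, hDf, hEn, hEo, hEV, hEf, hlink⟩ := hpair (V ∩ V') (inter_mem hV hV')
  refine ⟨D.link, ?_⟩
  filter_upwards [hV, hV', hwall] with p hp hp' hpw A hAn hAo hAp
  rcases lt_trichotomy (f p) 0 with h | h | h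
  · rw [hlink]
    apply VDiagram.link_eq_of_joinedIn (hAn.trans hEn.symm) (hAo.trans hEo.symm)
    rw [hAp]
    refine (hjoin' _ hEV.2 _ hp' (by linarith) (by linarith)).mono ?_
    rintro x ⟨hx, hx'⟩
    rw [Set.mem_ofPred_eq] at hx' ⊢
    rw [hEn]
    exact hx (by linarith)
  · exfalso
    apply hpw h
    rw [← hAn, ← hAp]
    exact A.gen
  · apply VDiagram.link_eq_of_joinedIn (hAn.trans hDn.symm) (hAo.trans hDo.symm)
    rw [hAp]
    refine (hjoin _ hDV.1 _ hp (by linarith) (by linarith)).mono ?_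
    rintro x ⟨hx, hx'⟩
    rw [Set.mem_ofPred_eq] at hx' ⊢
    rw [hDn]
    exact hx hx'.ne'

/-- A path all of whose points are nice, and generic at a dense set of times, joins diagrams of the
same link. -/
theorem link_eq_of_nice_path {next : Equiv.Perm ι} {ov : ι → ι → Prop} {γ : ℝ → ι → ℂ}
    (hγ : Continuous γ) (hnice : ∀ t ∈ Icc (0 : ℝ) 1, Nice next ov (γ t))
    (hdense : ∀ t ∈ Icc (0 : ℝ) 1, ∃ᶠ s in 𝓝[Icc 0 1] t,
      ∃ D : VDiagram ι, D.next = next ∧ D.isOver = ov ∧ D.pos = γ s)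
    {D E : VDiagram ι} (hDn : D.next = next) (hDo : D.isOver = ov) (hDp : D.pos = γ 0)
    (hEn : E.next = next) (hEo : E.isOver = ov) (hEp : E.pos = γ 1) : D.link = E.link := by
  have : Nonempty VirtualLink := ⟨D.link⟩
  choose! L hL using hnice
  have key : ∀ t ∈ Icc (0 : ℝ) 1, ∀ᶠ s in 𝓝[Icc 0 1] t, L s = L t := by
    intro t ht
    have h1 : ∀ᶠ s in 𝓝 t, ∀ D : VDiagram ι, D.next = next → D.isOver = ov →
      D.pos = γ s → D.link = L t := hγ.continuousAt.eventually (hL t ht)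
    have h2 := h1.eventually_nhds.filter_mono (nhdsWithin_le_nhds (s := Icc (0:ℝ) 1))
    filter_upwards [h2, self_mem_nhdsWithin] with s hs hsI
    have h3 : ∀ᶠ r in 𝓝 s, ∀ D : VDiagram ι, D.next = next → D.isOver = ov →
      D.pos = γ r → D.link = L s := hγ.continuousAt.eventually (hL s hsI)
    -- A generic time `r` near `s` lies in the neighbourhoods belonging to `s` and to `t`. Its
    -- diagram represents both `L s` and `L t`.
    obtain ⟨r, ⟨D, hn, ho, hp⟩, hr, hr'⟩ := ((hdense s hsI).and_eventually
      ((hs.and h3).filter_mono nhdsWithin_le_nhds)).exists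
    rw [← hr D hn ho hp, ← hr' D hn ho hp]
  have hconst : L 0 = L 1 := by
    have hpre : IsPreconnected (Icc (0 : ℝ) 1) := isPreconnected_Icc
    -- With the discrete topology, locally constant means continuous, and connectedness of the
    -- interval applies.
    let _ : TopologicalSpace VirtualLink := ⊥
    have : DiscreteTopology VirtualLink := ⟨rfl⟩
    have hcont : ContinuousOn L (Icc 0 1) := fun t ht =>
      ContinuousWithinAt.congr_of_eventuallyEq (continuousWithinAt_const (b := L t)) (key t ht) rfl
    exact hpre.constant hcont ⟨le_rfl, zero_le_one⟩ ⟨zero_le_one, le_rfl⟩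
  rw [(hL 0 ⟨le_rfl, zero_le_one⟩).self_of_nhds D hDn hDo hDp, hconst,
    (hL 1 ⟨zero_le_one, le_rfl⟩).self_of_nhds E hEn hEo hEp]

end Generic

/-! ## Insertion of vertices -/

section Insertion

variable {ι κ : Type}

open Classical in
/-- The successor permutation after insertion of the new vertex `none` on the edge `a`. -/
noncomputable def insNext (next : Equiv.Perm ι) (a : ι) : Equiv.Perm (Option ι) :=
  -- The extension of `next` fixes `none` and sends `some a` to `some (next a)`. Exchanging these
  -- two values puts `none` between `a` and its successor.
  (Equiv.optionCongr next).trans (Equiv.swap none (some (next a)))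

/-- The positions after insertion of a new vertex at `P`. -/
def insPos (p : ι → ℂ) (P : ℂ) : Option ι → ℂ := fun o => o.elim P p

@[simp] theorem insPos_none (p : ι → ℂ) (P : ℂ) : insPos p P none = P := rfl
@[simp] theorem insPos_some (p : ι → ℂ) (P : ℂ) (x : ι) : insPos p P (some x) = p x := rfl

@[simp] theorem insNext_some_self (next : Equiv.Perm ι) (a : ι) :
    insNext next a (some a) = none := by
  simp [insNext]

@[simp] theorem insNext_none (next : Equiv.Perm ι) (a : ι) :
    insNext next a none = some (next a) := by
  simp [insNext]

theorem insNext_some_of_ne (next : Equiv.Perm ι) {a x : ι} (h : x ≠ a) :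
    insNext next a (some x) = some (next x) := by
  classical
  simp only [insNext, Equiv.trans_apply, Equiv.optionCongr_apply, Option.map_some]
  exact Equiv.swap_apply_of_ne_of_ne (by simp) (by simpa using h)

theorem continuous_insPos {X : Type*} [TopologicalSpace X] {f : X → ι → ℂ} {g : X → ℂ}
    (hf : Continuous f) (hg : Continuous g) : Continuous fun x => insPos (f x) (g x) := by
  refine continuous_pi fun o => ?_
  cases o with
  | none => exact hg
  | some x => exact (continuous_apply x).comp hf

theorem polyEdge_ins_self (next : Equiv.Perm ι) (p : ι → ℂ) (a : ι) (P : ℂ) :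
    polyEdge (insNext next a) (insPos p P) (some a) = segment ℝ (p a) P := by
  simp [polyEdge]

theorem polyEdge_ins_none (next : Equiv.Perm ι) (p : ι → ℂ) (a : ι) (P : ℂ) :
    polyEdge (insNext next a) (insPos p P) none = segment ℝ P (p (next a)) := by
  simp [polyEdge]

theorem polyEdge_ins_of_ne (next : Equiv.Perm ι) (p : ι → ℂ) {a x : ι} (P : ℂ) (h : x ≠ a) :
    polyEdge (insNext next a) (insPos p P) (some x) = polyEdge next p x := by
  simp [polyEdge, insNext_some_of_ne next h]

/-- Two coinciding vertices lie on each other's outgoing edges. If they are different, each is the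
successor of the other, which would be a component with two vertices. -/
theorem Gen.injective {next : Equiv.Perm ι} {p : ι → ℂ} (hnn : ∀ i, next (next i) ≠ i)
    (hp : ∀ i k, p k ∈ polyEdge next p i → k = i ∨ k = next i) : Function.Injective p := by
  intro k l h
  have h1 := hp l k (by rw [h]; exact left_mem_segment _ _ _)
  have h2 := hp k l (by rw [← h]; exact left_mem_segment _ _ _)
  rcases h1 with h1 | h1
  · exact h1
  rcases h2 with h2 | h2
  · exact h2.symm
  · exact absurd (by rw [← h2]; exact h1.symm) (hnn k)

/-- A criterion for the insertion of a vertex at `P` to be generic. -/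
theorem Gen.ins {next : Equiv.Perm ι} {p : ι → ℂ} (hg : Gen next p) (hn : ∀ i, next i ≠ i)
    {a : ι} {P : ℂ} (h1 : ∀ x, x ≠ a → P ∉ polyEdge next p x)
    (h2 : ∀ k, k ≠ a → p k ∉ segment ℝ (p a) P)
    (h3 : ∀ k, k ≠ next a → p k ∉ segment ℝ P (p (next a)))
    (h4 : ∀ x y, x ≠ a → y ≠ a → x ≠ y → ∀ z, z ∈ polyEdge next p x → z ∈ polyEdge next p y →
      z ∉ segment ℝ (p a) P ∧ z ∉ segment ℝ P (p (next a))) :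
    Gen (insNext next a) (insPos p P) := by
  -- A second common point would make the two new edges overlap, which would place an old end of `a`
  -- on the wrong half.
  have hP : ∀ z, z ∈ segment ℝ (p a) P → z ∈ segment ℝ P (p (next a)) → z = P := by
    intro z hz hz'
    by_contra hne
    rcases overlap_of_shared_endpoint hz hz' hne with h | h
    · exact h3 a (hn a).symm h
    · exact h2 (next a) (hn a) h
  constructor
  · intro i k hk
    rcases i with _ | i
    · rw [polyEdge_ins_none] at hk
      rcases k with _ | k
      · exact Or.inl rfl
      · right
        rw [insNext_none]
        by_contra hne
        exact h3 k (fun h => hne (by rw [h])) hk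
    · by_cases hi : i = a
      · subst hi
        rw [polyEdge_ins_self] at hk
        rcases k with _ | k
        · right; simp
        · left
          by_contra hne
          exact h2 k (fun h => hne (by rw [h])) hk
      · rw [polyEdge_ins_of_ne next p P hi] at hk
        rw [insNext_some_of_ne next hi]
        rcases k with _ | k
        · exact absurd hk (h1 i hi)
        · rcases hg.1 i k hk with h | h <;> simp [h]
  · -- the triple condition, sorted by the number of new edges
    have key : ∀ x y, x ≠ a → y ≠ a → x ≠ y → ∀ z, z ∈ polyEdge next p x →
        z ∈ polyEdge next p y → ∀ o : Option ι, o ≠ some x → o ≠ some y →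
        z ∉ polyEdge (insNext next a) (insPos p P) o := by
      intro x y hx hy hxy z hzx hzy o hox hoy hz
      rcases o with _ | o
      · rw [polyEdge_ins_none] at hz
        exact (h4 x y hx hy hxy z hzx hzy).2 hz
      · by_cases ho : o = a
        · subst ho
          rw [polyEdge_ins_self] at hz
          exact (h4 x y hx hy hxy z hzx hzy).1 hz
        · rw [polyEdge_ins_of_ne next p P ho] at hz
          exact hg.2 x y o hxy (fun h => hoy (by rw [h])) (fun h => hox (by rw [h])) z hzx hzy hz
    have key' : ∀ z, z ∈ segment ℝ (p a) P → z ∈ segment ℝ P (p (next a)) → ∀ x, x ≠ a →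
        z ∉ polyEdge next p x := by
      intro z hz hz' x hx
      rw [hP z hz hz']
      exact h1 x hx
    have cases : ∀ o : Option ι, o = none ∨ o = some a ∨ ∃ x, x ≠ a ∧ o = some x := by
      intro o
      rcases o with _ | o
      · exact Or.inl rfl
      · by_cases h : o = a
        · exact Or.inr (Or.inl (by rw [h]))
        · exact Or.inr (Or.inr ⟨o, h, rfl⟩)
    intro i j k hij hjk hik z hi hj hk
    rcases cases i with rfl | rfl | ⟨x, hx, rfl⟩ <;>
    rcases cases j with rfl | rfl | ⟨y, hy, rfl⟩ <;>
    rcases cases k with rfl | rfl | ⟨w, hw, rfl⟩ <;>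
    first
    | exact absurd rfl hij
    | exact absurd rfl hjk
    | exact absurd rfl hik
    | skip
    · rw [polyEdge_ins_none] at hi; rw [polyEdge_ins_self] at hj
      rw [polyEdge_ins_of_ne next p P hw] at hk
      exact key' z hj hi w hw hk
    · rw [polyEdge_ins_none] at hi; rw [polyEdge_ins_self] at hk
      rw [polyEdge_ins_of_ne next p P hy] at hj
      exact key' z hk hi y hy hj
    · rw [polyEdge_ins_of_ne next p P hy] at hj
      rw [polyEdge_ins_of_ne next p P hw] at hk
      exact key y w hy hw (by simpa using hjk) z hj hk _ hij hik hi
    · rw [polyEdge_ins_none] at hj; rw [polyEdge_ins_self] at hi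
      rw [polyEdge_ins_of_ne next p P hw] at hk
      exact key' z hi hj w hw hk
    · rw [polyEdge_ins_none] at hk; rw [polyEdge_ins_self] at hi
      rw [polyEdge_ins_of_ne next p P hy] at hj
      exact key' z hi hk y hy hj
    · rw [polyEdge_ins_of_ne next p P hy] at hj
      rw [polyEdge_ins_of_ne next p P hw] at hk
      exact key y w hy hw (by simpa using hjk) z hj hk _ hij hik hi
    · rw [polyEdge_ins_none] at hj; rw [polyEdge_ins_self] at hk
      rw [polyEdge_ins_of_ne next p P hx] at hi
      exact key' z hk hj x hx hi
    · rw [polyEdge_ins_of_ne next p P hx] at hi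
      rw [polyEdge_ins_of_ne next p P hw] at hk
      exact key x w hx hw (by simpa using hik) z hi hk _ hij.symm hjk hj
    · rw [polyEdge_ins_none] at hk; rw [polyEdge_ins_self] at hj
      rw [polyEdge_ins_of_ne next p P hx] at hi
      exact key' z hj hk x hx hi
    · rw [polyEdge_ins_of_ne next p P hx] at hi
      rw [polyEdge_ins_of_ne next p P hw] at hk
      exact key x w hx hw (by simpa using hik) z hi hk _ hij.symm hjk hj
    · rw [polyEdge_ins_of_ne next p P hx] at hi
      rw [polyEdge_ins_of_ne next p P hy] at hj
      exact key x y hx hy (by simpa using hij) z hi hj _ hik.symm hjk.symm hk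
    · rw [polyEdge_ins_of_ne next p P hx] at hi
      rw [polyEdge_ins_of_ne next p P hy] at hj
      exact key x y hx hy (by simpa using hij) z hi hj _ hik.symm hjk.symm hk
    · rw [polyEdge_ins_of_ne next p P hx] at hi
      rw [polyEdge_ins_of_ne next p P hy] at hj
      exact key x y hx hy (by simpa using hij) z hi hj _ hik.symm hjk.symm hk

theorem insNext_ne {next : Equiv.Perm ι} (hn : ∀ i, next i ≠ i) (a : ι) (o : Option ι) :
    insNext next a o ≠ o := by
  rcases o with _ | x
  · simp
  · by_cases hx : x = a
    · simp [hx]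
    · simpa [insNext_some_of_ne next hx] using hn x

theorem insNext_insNext_ne {next : Equiv.Perm ι} (hn : ∀ i, next i ≠ i)
    (hnn : ∀ i, next (next i) ≠ i) (a : ι) (o : Option ι) :
    insNext next a (insNext next a o) ≠ o := by
  rcases o with _ | x
  · rw [insNext_none, insNext_some_of_ne next (hn a)]; simp
  · by_cases hx : x = a
    · subst hx; simpa using hn x
    · rw [insNext_some_of_ne next hx]
      by_cases hx' : next x = a
      · simp [hx']
      · rw [insNext_some_of_ne next hx']; simpa using hnn x

/-- The diagram obtained from `D` by insertion of a new vertex at `P` on the edge `a`, with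
crossing types inherited from `D`. -/
noncomputable def VDiagram.ins (D : VDiagram ι) (a : ι) (P : ℂ)
    (h : Gen (insNext D.next a) (insPos D.pos P)) : VDiagram (Option ι) where
  finite := by have := D.finite; infer_instance
  next := insNext D.next a
  pos := insPos D.pos P
  isOver x y := D.isOver (x.getD a) (y.getD a) ∧ polyCrosses (insNext D.next a) (insPos D.pos P) x y
  next_ne := insNext_ne D.next_ne a
  next_next_ne := insNext_insNext_ne D.next_ne D.next_next_ne a
  vertex_generic := h.1
  no_triple := h.2
  over_crosses := fun _ _ h => h.2
  over_asymm := fun _ _ h h' => D.over_asymm _ _ h.1 h'.1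

theorem VDiagram.ins_next (D : VDiagram ι) (a : ι) (P : ℂ) (h) :
    (D.ins a P h).next = insNext D.next a := rfl

theorem VDiagram.ins_pos (D : VDiagram ι) (a : ι) (P : ℂ) (h) :
    (D.ins a P h).pos = insPos D.pos P := rfl

theorem polyCrosses_ins_iff {next : Equiv.Perm ι} {p : ι → ℂ} {a x y : ι} {P : ℂ} (hx : x ≠ a)
    (hy : y ≠ a) : polyCrosses (insNext next a) (insPos p P) (some x) (some y) ↔
      polyCrosses next p x y := by
  simp only [polyCrosses, polyEdge_ins_of_ne next p P hx, polyEdge_ins_of_ne next p P hy,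
    insNext_some_of_ne next hx, insNext_some_of_ne next hy, ne_eq, Option.some.injEq]

theorem VDiagram.isInsertion_ins (D : VDiagram ι) (a : ι) (P : ℂ) (h) :
    D.IsInsertion (D.ins a P h) a where
  next_start := insNext_some_self _ _
  next_new := insNext_none _ _
  next_old := fun _ hx => insNext_some_of_ne _ hx
  pos_old := fun _ => rfl
  over_old := fun x y hx hy => by
    change (D.isOver x y ∧ polyCrosses _ _ _ _) ↔ _
    rw [polyCrosses_ins_iff hx hy]
    exact ⟨fun h => h.1, fun h => ⟨h, D.over_crosses _ _ h⟩⟩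

theorem VDiagram.inheritsCrossings_ins (D : VDiagram ι) (a : ι) (P : ℂ) (h) :
    D.InheritsCrossings (D.ins a P h) a := fun _ _ => and_comm

/-- The position of the new vertex when the edge `a` is subdivided in the ratio `s`. -/
def edgePoint (next : Equiv.Perm ι) (a : ι) (s : ℝ) (p : ι → ℂ) : ℂ :=
  p a + s * (p (next a) - p a)

theorem segment_subset_union_of_mem {A B z : ℂ} (hz : z ∈ openSegment ℝ A B) :
    segment ℝ A B ⊆ segment ℝ A z ∪ segment ℝ z B := by
  obtain ⟨s, h0, h1, rfl⟩ := mem_openSegment_iff_real.1 hz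
  intro w hw
  obtain ⟨t, ht0, ht1, rfl⟩ := mem_segment_iff_real.1 hw
  rcases le_total t s with h | h
  · left
    refine mem_segment_iff_real.2 ⟨t / s, by positivity, by rw [div_le_one h0]; exact h, ?_⟩
    have hs' : (s : ℂ) ≠ 0 := by exact_mod_cast h0.ne'
    push_cast; field_simp; ring
  · right
    refine mem_segment_iff_real.2 ⟨(t - s) / (1 - s),
      div_nonneg (by linarith) (by linarith), by rw [div_le_one (by linarith)]; linarith, ?_⟩
    have hs' : ((1 : ℂ) - s) ≠ 0 := by
      have : (1 - s : ℝ) ≠ 0 := by linarith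
      exact_mod_cast this
    push_cast; field_simp; ring

theorem mem_segment_of_both_sides {A B z u v : ℂ} (hz : z ∈ openSegment ℝ A B)
    (hu : u ∈ segment ℝ A z) (hv : v ∈ segment ℝ z B) : z ∈ segment ℝ u v := by
  obtain ⟨s, h0, h1, hs⟩ := mem_openSegment_iff_real.1 hz
  obtain ⟨t, ht0, ht1, ht⟩ := mem_segment_iff_real.1 hu
  obtain ⟨r, hr0, hr1, hr⟩ := mem_segment_iff_real.1 hv
  have hu' : u = A + ((s * t : ℝ) : ℂ) * (B - A) := by rw [ht, hs]; push_cast; ring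
  have hv' : v = A + ((s + r * (1 - s) : ℝ) : ℂ) * (B - A) := by rw [hr, hs]; push_cast; ring
  by_cases hd : s + r * (1 - s) - s * t = 0
  · have hst : s * t = s := by nlinarith [mul_nonneg hr0 (sub_nonneg.2 h1.le), mul_nonneg h0.le (sub_nonneg.2 ht1)]
    have : z = u := by rw [hs, hu', hst]
    rw [this]; exact left_mem_segment _ _ _
  · have hpos : 0 < s + r * (1 - s) - s * t := by
      refine lt_of_le_of_ne ?_ (Ne.symm hd)
      nlinarith [mul_nonneg hr0 (sub_nonneg.2 h1.le), mul_nonneg h0.le (sub_nonneg.2 ht1)]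
    refine mem_segment_iff_real.2 ⟨(s - s * t) / (s + r * (1 - s) - s * t), ?_, ?_, ?_⟩
    · exact div_nonneg (by nlinarith) hpos.le
    · rw [div_le_one hpos]; nlinarith
    · rw [hu', hv', hs]
      have : ((s : ℂ) + r * (1 - s) - s * t) ≠ 0 := by exact_mod_cast hd
      push_cast; field_simp; ring

/-- Both halves are contained in the old edge, so new incidences could only involve the point `z`,
which lies on no other edge. -/
theorem Gen.subdivide {next : Equiv.Perm ι} {p : ι → ℂ} (hg : Gen next p) (hn : ∀ i, next i ≠ i)
    {a : ι} {z : ℂ} (hz : z ∈ openSegment ℝ (p a) (p (next a)))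
    (h1 : ∀ x, x ≠ a → z ∉ polyEdge next p x) :
    Gen (insNext next a) (insPos p z) := by
  have hz' := openSegment_subset_segment _ _ _ hz
  have hs1 : segment ℝ (p a) z ⊆ polyEdge next p a :=
    (convex_segment _ _).segment_subset (left_mem_segment _ _ _) hz'
  have hs2 : segment ℝ z (p (next a)) ⊆ polyEdge next p a :=
    (convex_segment _ _).segment_subset hz' (right_mem_segment _ _ _)
  have hzB : z ≠ p (next a) := fun h => h1 (next a) (hn a) (by rw [h]; exact left_mem_segment _ _ _)
  have hzA : z ≠ p a := by
    intro h
    have := h1 (next.symm a) (fun h => hn a ((Equiv.symm_apply_eq next).1 h).symm)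
    apply this
    rw [h, polyEdge, Equiv.apply_symm_apply]
    exact right_mem_segment _ _ _
  refine hg.ins hn h1 ?_ ?_ ?_
  · intro k hk h
    rcases hg.1 a k (hs1 h) with h' | h'
    · exact hk h'
    · subst h'
      apply hzB
      have := mem_segment_of_both_sides hz h (right_mem_segment ℝ z (p (next a)))
      rwa [segment_same, mem_singleton_iff] at this
  · intro k hk h
    rcases hg.1 a k (hs2 h) with h' | h'
    · subst h'
      apply hzA
      have := mem_segment_of_both_sides hz (left_mem_segment ℝ (p k) z) h
      rwa [segment_same, mem_singleton_iff] at this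
    · exact hk h'
  · intro x y hx hy hxy w hwx hwy
    exact ⟨fun h => hg.2 x y a hxy hy hx w hwx hwy (hs1 h),
      fun h => hg.2 x y a hxy hy hx w hwx hwy (hs2 h)⟩

theorem VDiagram.link_ins_of_mem (D : VDiagram ι) {a : ι} {z : ℂ}
    (hz : z ∈ openSegment ℝ (D.pos a) (D.pos (D.next a))) (h) : (D.ins a z h).link = D.link :=
  (VDiagram.Move.subdivide D (D.ins a z h) a (D.isInsertion_ins a z h) hz
    (D.inheritsCrossings_ins a z h)).link_eq.symm

theorem edgePoint_mem {next : Equiv.Perm ι} {a : ι} {s : ℝ} (h0 : 0 < s) (h1 : s < 1)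
    (p : ι → ℂ) : edgePoint next a s p ∈ openSegment ℝ (p a) (p (next a)) :=
  mem_openSegment_iff_real.2 ⟨s, h0, h1, rfl⟩

/-- The crossing types after subdivision of the edge `a` at `z`. -/
def subOver (next : Equiv.Perm ι) (ov : ι → ι → Prop) (p : ι → ℂ) (a : ι) (z : ℂ) :
    Option ι → Option ι → Prop :=
  fun x y => ov (x.getD a) (y.getD a) ∧ polyCrosses (insNext next a) (insPos p z) x y

theorem meet_of_subdivide {next : Equiv.Perm ι} {p : ι → ℂ} {a Y : ι} {z : ℂ}
    (hz : z ∈ openSegment ℝ (p a) (p (next a))) (hY : Y ≠ a)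
    (h : (polyEdge next p a ∩ polyEdge next p Y).Nonempty) :
    (polyEdge (insNext next a) (insPos p z) (some a) ∩
      polyEdge (insNext next a) (insPos p z) (some Y)).Nonempty ∨
    (polyEdge (insNext next a) (insPos p z) none ∩
      polyEdge (insNext next a) (insPos p z) (some Y)).Nonempty := by
  rw [polyEdge_ins_self, polyEdge_ins_none, polyEdge_ins_of_ne _ _ _ hY]
  obtain ⟨w, hw, hw'⟩ := h
  rcases segment_subset_union_of_mem hz hw with h | h
  · exact Or.inl ⟨w, h, hw'⟩
  · exact Or.inr ⟨w, h, hw'⟩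

/-- By convexity, the part of `Y` between points on the two halves would pass through the dividing
point. Hence exactly one half inherits a crossing. -/
theorem not_both_of_subdivide {next : Equiv.Perm ι} {p : ι → ℂ} {a Y : ι} {z : ℂ}
    (hz : z ∈ openSegment ℝ (p a) (p (next a))) (hY : Y ≠ a) (hzY : z ∉ polyEdge next p Y)
    (h1 : (polyEdge (insNext next a) (insPos p z) (some a) ∩
      polyEdge (insNext next a) (insPos p z) (some Y)).Nonempty)
    (h2 : (polyEdge (insNext next a) (insPos p z) none ∩
      polyEdge (insNext next a) (insPos p z) (some Y)).Nonempty) : False := by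
  rw [polyEdge_ins_self, polyEdge_ins_of_ne _ _ _ hY] at h1
  rw [polyEdge_ins_none, polyEdge_ins_of_ne _ _ _ hY] at h2
  obtain ⟨u, hu, hu'⟩ := h1
  obtain ⟨v, hv, hv'⟩ := h2
  exact hzY ((convex_segment _ _).segment_subset hu' hv' (mem_segment_of_both_sides hz hu hv))

/-- Niceness may be checked after subdivision of an edge. -/
theorem Nice.of_subdivide [Finite ι] {next : Equiv.Perm ι} {ov : ι → ι → Prop} {p₀ : ι → ℂ} {a : ι}
    {s : ℝ} (h0 : 0 < s) (h1 : s < 1)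
    (hz : ∀ x, x ≠ a → edgePoint next a s p₀ ∉ polyEdge next p₀ x)
    (h : Nice (insNext next a) (subOver next ov p₀ a (edgePoint next a s p₀))
      (insPos p₀ (edgePoint next a s p₀))) : Nice next ov p₀ := by
  obtain ⟨L, hL⟩ := h
  refine ⟨L, ?_⟩
  have hcont : Continuous fun p => insPos p (edgePoint next a s p) :=
    continuous_insPos continuous_id (by unfold edgePoint; fun_prop)
  have e1 := hcont.continuousAt.eventually hL
  have e2 : ∀ᶠ p in 𝓝 p₀, ∀ x, x ≠ a → edgePoint next a s p ∉ polyEdge next p x := by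
    refine eventually_all.2 fun x => ?_
    by_cases hx : x = a
    · exact Eventually.of_forall fun p h => absurd hx h
    · have := eventually_vertex_notMem (next := insNext next a)
        (p₀ := insPos p₀ (edgePoint next a s p₀)) (i := some x) (k := none)
        (by rw [polyEdge_ins_of_ne _ _ _ hx]; exact hz x hx)
      filter_upwards [hcont.continuousAt.eventually this] with p hp _
      rwa [polyEdge_ins_of_ne _ _ _ hx] at hp
  -- Edges which do not meet at `p₀` do not meet nearby, since meeting is closed.
  have e3 : ∀ᶠ p in 𝓝 p₀, ∀ x y : Option ι,
      (polyEdge (insNext next a) (insPos p (edgePoint next a s p)) x ∩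
        polyEdge (insNext next a) (insPos p (edgePoint next a s p)) y).Nonempty →
      (polyEdge (insNext next a) (insPos p₀ (edgePoint next a s p₀)) x ∩
        polyEdge (insNext next a) (insPos p₀ (edgePoint next a s p₀)) y).Nonempty := by
    refine eventually_all.2 fun x => eventually_all.2 fun y => ?_
    by_cases hm : (polyEdge (insNext next a) (insPos p₀ (edgePoint next a s p₀)) x ∩
        polyEdge (insNext next a) (insPos p₀ (edgePoint next a s p₀)) y).Nonempty
    · exact Eventually.of_forall fun _ _ => hm
    · filter_upwards [hcont.continuousAt.eventually (eventually_not_meet hm)] with p hp h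
      exact absurd h hp
  filter_upwards [e1, e2, e3] with p he1 he2 he3 D hDn hDo hDp
  subst hDn hDo hDp
  have hzm := edgePoint_mem (next := D.next) (a := a) h0 h1 D.pos
  have hzm0 := edgePoint_mem (next := D.next) (a := a) h0 h1 p₀
  have hg := D.gen.subdivide D.next_ne hzm he2
  rw [← D.link_ins_of_mem hzm hg]
  refine he1 _ rfl ?_ rfl
  funext x y
  refine propext (and_congr_right fun hov => ?_)
  have hD := D.over_crosses _ _ hov
  constructor
  · intro hc
    exact ⟨hc.1, hc.2.1, hc.2.2.1, he3 _ _ hc.2.2.2⟩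
  · intro hc
    refine ⟨hc.1, hc.2.1, hc.2.2.1, ?_⟩
    -- In the nearby diagram some half of `a` meets `Y`. By `e3` that half also meets `Y` at `p₀`,
    -- where only one half does, so it is the same half `o` in both.
    have half : ∀ Y, Y ≠ a → (polyEdge D.next D.pos a ∩ polyEdge D.next D.pos Y).Nonempty →
        ∀ o : Option ι, o = none ∨ o = some a →
        (polyEdge (insNext D.next a) (insPos p₀ (edgePoint D.next a s p₀)) o ∩
          polyEdge (insNext D.next a) (insPos p₀ (edgePoint D.next a s p₀)) (some Y)).Nonempty →
        (polyEdge (insNext D.next a) (insPos D.pos (edgePoint D.next a s D.pos)) o ∩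
          polyEdge (insNext D.next a) (insPos D.pos (edgePoint D.next a s D.pos))
            (some Y)).Nonempty := by
      intro Y hY hm o ho hmo
      rcases ho with rfl | rfl
      · rcases meet_of_subdivide hzm hY hm with h | h
        · exact (not_both_of_subdivide hzm0 hY (hz Y hY) (he3 _ _ h) hmo).elim
        · exact h
      · rcases meet_of_subdivide hzm hY hm with h | h
        · exact h
        · exact (not_both_of_subdivide hzm0 hY (hz Y hY) hmo (he3 _ _ h)).elim
    have tri : ∀ o : Option ι, o.getD a = a → o = none ∨ o = some a := by
      rintro (_ | o) ho
      · exact Or.inl rfl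
      · exact Or.inr (by simpa using ho)
    have tri' : ∀ o : Option ι, o.getD a ≠ a → o = some (o.getD a) := by
      rintro (_ | o) ho
      · exact absurd rfl ho
      · rfl
    by_cases hx : x.getD a = a
    · have hy : y.getD a ≠ a := fun h => hD.1 (hx.trans h.symm)
      have hc4 := hc.2.2.2
      have hD4 := hD.2.2.2
      rw [tri' y hy] at hc4 ⊢
      rw [hx] at hD4
      exact half _ hy hD4 x (tri x hx) hc4
    · by_cases hy : y.getD a = a
      · have hc4 := hc.2.2.2
        have hD4 := hD.2.2.2
        rw [tri' x hx, inter_comm] at hc4 ⊢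
        rw [hy, inter_comm] at hD4
        exact half _ hx hD4 y (tri y hy) hc4
      · rw [tri' x hx, tri' y hy, polyEdge_ins_of_ne _ _ _ hx, polyEdge_ins_of_ne _ _ _ hy]
        exact hD.2.2.2

end Insertion

/-! ## Relabelling, and insertion of a vertex in a convex region met by one further edge -/

section Local

variable {ι κ : Type}

theorem polyEdge_comp {next : Equiv.Perm κ} {next' : Equiv.Perm ι} {e : ι ≃ κ}
    (hn : ∀ i, next (e i) = e (next' i)) (p : κ → ℂ) (i : ι) :
    polyEdge next' (p ∘ e) i = polyEdge next p (e i) := by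
  simp [polyEdge, hn]

theorem polyCrosses_comp {next : Equiv.Perm κ} {next' : Equiv.Perm ι} {e : ι ≃ κ}
    (hn : ∀ i, next (e i) = e (next' i)) (p : κ → ℂ) (i j : ι) :
    polyCrosses next' (p ∘ e) i j ↔ polyCrosses next p (e i) (e j) := by
  simp [polyCrosses, polyEdge_comp hn, hn]

theorem Gen.comp {next : Equiv.Perm κ} {next' : Equiv.Perm ι} {e : ι ≃ κ}
    (hn : ∀ i, next (e i) = e (next' i)) {p : κ → ℂ} (h : Gen next p) : Gen next' (p ∘ e) := by
  constructor
  · intro i k hk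
    rw [polyEdge_comp hn] at hk
    rcases h.1 _ _ hk with h | h
    · exact Or.inl (e.injective h)
    · exact Or.inr (e.injective (h.trans (hn i)))
  · intro i j k hij hjk hik z
    rw [polyEdge_comp hn, polyEdge_comp hn, polyEdge_comp hn]
    exact h.2 _ _ _ (e.injective.ne hij) (e.injective.ne hjk) (e.injective.ne hik) z

/-- The diagram `D` with vertices renamed. -/
def VDiagram.comap (D : VDiagram κ) (e : ι ≃ κ) (next' : Equiv.Perm ι)
    (hn : ∀ i, D.next (e i) = e (next' i)) : VDiagram ι where
  finite := by have := D.finite; exact Finite.of_equiv κ e.symm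
  next := next'
  pos := D.pos ∘ e
  isOver i j := D.isOver (e i) (e j)
  next_ne i h := D.next_ne (e i) (by rw [hn, h])
  next_next_ne i h := D.next_next_ne (e i) (by rw [hn, hn, h])
  vertex_generic := (D.gen.comp hn).1
  no_triple := (D.gen.comp hn).2
  over_crosses i j h := (polyCrosses_comp hn _ _ _).2 (D.over_crosses _ _ h)
  over_asymm i j h := D.over_asymm _ _ h

theorem VDiagram.link_comap (D : VDiagram κ) (e : ι ≃ κ) (next' : Equiv.Perm ι)
    (hn : ∀ i, D.next (e i) = e (next' i)) : (D.comap e next' hn).link = D.link :=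
  (VDiagram.Move.relabel (D.comap e next' hn) D e hn (fun _ => rfl) (fun _ _ => Iff.rfl)).link_eq

theorem Nice.of_comp {next : Equiv.Perm κ} {next' : Equiv.Perm ι} {e : ι ≃ κ}
    (hn : ∀ i, next (e i) = e (next' i)) {ov : κ → κ → Prop} {p₀ : κ → ℂ}
    (h : Nice next' (fun i j => ov (e i) (e j)) (p₀ ∘ e)) : Nice next ov p₀ := by
  obtain ⟨L, hL⟩ := h
  refine ⟨L, ?_⟩
  have hc : Continuous fun p : κ → ℂ => p ∘ e := by fun_prop
  filter_upwards [hc.continuousAt.eventually hL] with p hp D hDn hDo hDp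
  subst hDn hDo hDp
  rw [← D.link_comap e next' hn]
  exact hp _ rfl rfl rfl

/-- In a convex region met by no edges but `a`, `j` and edges adjacent to `a`, insertion of a vertex
off the edge `j` is generic. -/
theorem Gen.ins_of_convex {next : Equiv.Perm ι} {p : ι → ℂ} (hg : Gen next p)
    (hn : ∀ i, next i ≠ i) (hnn : ∀ i, next (next i) ≠ i) {a j : ι} {S : Set ℂ} {P : ℂ}
    (hS : Convex ℝ S) (hA : p a ∈ S) (hB : p (next a) ∈ S)
    (hx : ∀ x, x ≠ a → x ≠ j → ∀ z ∈ polyEdge next p x, z ∈ S → z = p a ∨ z = p (next a))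
    (hj : p j ∉ S ∨ j = next a) (hP : P ∈ S)
    (hPj : P ∉ polyEdge next p j) (hnd : planeDet (p (next a) - p a) (P - p a) ≠ 0) :
    Gen (insNext next a) (insPos p P) := by
  have hinj := Gen.injective hnn hg.1
  have hs1 : segment ℝ (p a) P ⊆ S := hS.segment_subset hA hP
  have hs2 : segment ℝ P (p (next a)) ⊆ S := hS.segment_subset hP hB
  have hk : ∀ k, p k ∈ S → k = a ∨ k = next a := by
    intro k hk
    by_cases hka : k = a
    · exact Or.inl hka
    by_cases hkj : k = j
    · subst hkj
      rcases hj with h | h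
      · exact absurd hk h
      · exact Or.inr h
    · rcases hx k hka hkj (p k) (left_mem_segment _ _ _) hk with h | h
      · exact Or.inl (hinj h)
      · exact Or.inr (hinj h)
  have hBA : p (next a) ∉ segment ℝ (p a) P := by
    intro h
    have := planeDet_eq_zero_of_mem_segment h
    rw [planeDet_swap] at this
    exact hnd (by linarith)
  have hAB : p a ∉ segment ℝ P (p (next a)) := by
    intro h
    rw [segment_symm] at h
    have := planeDet_eq_zero_of_mem_segment h
    apply hnd
    have e : planeDet (p (next a) - p a) (P - p a) =
      planeDet (P - p (next a)) (p a - p (next a)) := by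
      simp only [planeDet, Complex.sub_re, Complex.sub_im]; ring
    rw [e, this]
  refine hg.ins hn ?_ ?_ ?_ ?_
  · intro x hxa h
    by_cases hxj : x = j
    · subst hxj; exact hPj h
    · rcases hx x hxa hxj P h hP with h | h
      · apply hnd; rw [h]; simp [planeDet_zero_right]
      · apply hnd; rw [h]; exact planeDet_self _
  · intro k hka h
    rcases hk k (hs1 h) with h' | h'
    · exact hka h'
    · subst h'; exact hBA h
  · intro k hka h
    rcases hk k (hs2 h) with h' | h'
    · subst h'; exact hAB h
    · exact hka h'
  · intro x y hxa hya hxy z hzx hzy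
    -- Of two different edges through `z`, one is not `j`, so inside `S` it can only pass through an
    -- end of `a`. But only one edge besides `a` passes through that vertex.
    have key : z ∉ S := by
      intro hz
      have haux : ∀ x y, x ≠ a → y ≠ a → x ≠ y → x ≠ j → z ∈ polyEdge next p x →
          z ∈ polyEdge next p y → False := by
        intro x y hxa hya hxy hxj hzx hzy
        rcases hx x hxa hxj z hzx hz with rfl | rfl
        · rcases hg.1 x a hzx with h | h
          · exact hxa h.symm
          rcases hg.1 y a hzy with h' | h'
          · exact hya h'.symm
          exact hxy (next.injective (h.symm.trans h'))
        · rcases hg.1 x _ hzx with h | h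
          · rcases hg.1 y _ hzy with h' | h'
            · exact hxy (h.symm.trans h')
            · exact hya (next.injective h').symm
          · exact hxa (next.injective h).symm
      by_cases hxj : x = j
      · exact haux y x hya hxa hxy.symm (fun h => hxy (hxj.trans h.symm)) hzy hzx
      · exact haux x y hxa hya hxy hxj hzx hzy
    exact ⟨fun h => key (hs1 h), fun h => key (hs2 h)⟩

theorem insPos_segment {p : ι → ℂ} {M P : ℂ} {q : Option ι → ℂ}
    (h : q ∈ segment ℝ (insPos p M) (insPos p P)) :
    ∃ t : ℝ, 0 ≤ t ∧ t ≤ 1 ∧ q = insPos p (M + t * (P - M)) := by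
  rw [segment_eq_image'] at h
  obtain ⟨t, ⟨h0, h1⟩, rfl⟩ := h
  refine ⟨t, h0, h1, ?_⟩
  funext o
  cases o <;> simp

/-- If the new vertex can be moved from the edge `a` to `P` without meeting the edge `j`, then its
insertion does not change the link. -/
theorem VDiagram.link_ins_of_avoid (D : VDiagram ι) {a j : ι} {S : Set ℂ} {P M : ℂ}
    (hS : Convex ℝ S) (hA : D.pos a ∈ S) (hB : D.pos (D.next a) ∈ S)
    (hx : ∀ x, x ≠ a → x ≠ j → ∀ z ∈ polyEdge D.next D.pos x, z ∈ S →
      z = D.pos a ∨ z = D.pos (D.next a))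
    (hj : D.pos j ∉ S ∨ j = D.next a) (hP : P ∈ S)
    (hnd : planeDet (D.pos (D.next a) - D.pos a) (P - D.pos a) ≠ 0)
    (hM : M ∈ openSegment ℝ (D.pos a) (D.pos (D.next a)))
    (hMP : ∀ z ∈ segment ℝ M P, z ∉ polyEdge D.next D.pos j)
    (hg : Gen (insNext D.next a) (insPos D.pos P)) : (D.ins a P hg).link = D.link := by
  have := D.finite
  have := Fintype.ofFinite ι
  have hMS : M ∈ S := hS.segment_subset hA hB (openSegment_subset_segment _ _ _ hM)
  have hAB : D.pos a ≠ D.pos (D.next a) := by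
    intro h; apply hnd; rw [← h]; simp [planeDet_zero_left]
  have hMA : M ≠ D.pos a := by
    intro h
    rw [h, left_mem_openSegment_iff] at hM
    exact hAB hM
  have hMB : M ≠ D.pos (D.next a) := by
    intro h
    rw [h, right_mem_openSegment_iff] at hM
    exact hAB hM
  have hg0 : Gen (insNext D.next a) (insPos D.pos M) := by
    refine D.gen.subdivide D.next_ne hM fun x hxa h => ?_
    by_cases hxj : x = j
    · subst hxj; exact hMP M (left_mem_segment _ _ _) h
    · rcases hx x hxa hxj M h hMS with h | h
      · exact hMA h
      · exact hMB h
  have hall : segment ℝ (insPos D.pos M) (insPos D.pos P) ⊆ {q | Gen (insNext D.next a) q} := by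
    intro q hq
    obtain ⟨t, h0, h1, rfl⟩ := insPos_segment hq
    rcases eq_or_lt_of_le h0 with h | h
    · rw [← h]; simpa using hg0
    · have hmem : M + t * (P - M) ∈ segment ℝ M P := mem_segment_iff_real.2 ⟨t, h0, h1, rfl⟩
      refine D.gen.ins_of_convex D.next_ne D.next_next_ne hS hA hB hx hj
        (hS.segment_subset hMS hP hmem) (hMP _ hmem) ?_
      -- As `M` lies on the edge `a`, the offset of the moving vertex from that line is `t` times
      -- the offset of `P`. It is therefore nonzero for `t > 0`.
      have h0 := planeDet_eq_zero_of_mem_segment (openSegment_subset_segment _ _ _ hM)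
      have e : M + t * (P - M) - D.pos a = (M - D.pos a) + t * ((P - D.pos a) - (M - D.pos a)) := by
        ring
      rw [e, planeDet_add_right, planeDet_mul_right,
        planeDet_sub_right _ (P - D.pos a) (M - D.pos a), h0]
      simpa using ⟨h.ne', hnd⟩
  obtain ⟨γ, hγ⟩ := joinedIn_of_segment_subset hall
  rw [← D.link_ins_of_mem hM hg0]
  refine VDiagram.link_eq_of_joinedIn (D := D.ins a M hg0) (D' := D.ins a P hg) rfl ?_ ⟨γ, hγ⟩
  funext x y
  refine propext (and_congr_right fun _ => ⟨fun h => ?_, fun h => ?_⟩)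
  · simpa using polyCrosses_of_path γ.symm (fun t => hγ _) h 1
  · simpa using polyCrosses_of_path γ hγ h 1

theorem eventually_segment_avoids {C : Set ℂ} (hC : IsClosed C) {A P : ℂ}
    (h : ∀ z ∈ segment ℝ A P, z ∉ C) : ∀ᶠ M in 𝓝 A, ∀ z ∈ segment ℝ M P, z ∉ C := by
  have hcl : IsClosed {M : ℂ | ∃ s : unitInterval, M + ((s : ℝ) : ℂ) * (P - M) ∈ C} :=
    isClosed_exists_compact (P := fun y : unitInterval × ℂ =>
      y.2 + ((y.1 : ℝ) : ℂ) * (P - y.2) ∈ C) (hC.preimage (by fun_prop))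
  have hA : A ∉ {M : ℂ | ∃ s : unitInterval, M + ((s : ℝ) : ℂ) * (P - M) ∈ C} := by
    rintro ⟨s, hs⟩
    exact h _ (mem_segment_iff_real.2 ⟨s, s.2.1, s.2.2, rfl⟩) hs
  filter_upwards [hcl.isOpen_compl.mem_nhds hA] with M hM z hz hzC
  obtain ⟨s, h0, h1, rfl⟩ := mem_segment_iff_real.1 hz
  exact hM ⟨⟨s, h0, h1⟩, hzC⟩

theorem exists_openSegment_near {A B : ℂ} {p : ℂ → Prop} (h : ∀ᶠ M in 𝓝 A, p M) :
    ∃ M ∈ openSegment ℝ A B, p M := by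
  have hc : Continuous fun ε : ℝ => A + ε * (B - A) := by fun_prop
  have h1 : ∀ᶠ ε : ℝ in 𝓝[>] 0, p (A + ε * (B - A)) := by
    have : Tendsto (fun ε : ℝ => A + ε * (B - A)) (𝓝 0) (𝓝 A) := by
      simpa using hc.tendsto 0
    exact (this.eventually h).filter_mono nhdsWithin_le_nhds
  have h2 : ∀ᶠ ε : ℝ in 𝓝[>] 0, ε < 1 :=
    (eventually_lt_nhds one_pos).filter_mono nhdsWithin_le_nhds
  obtain ⟨ε, ⟨he, he1⟩, he0⟩ := ((h1.and h2).and self_mem_nhdsWithin).exists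
  exact ⟨_, mem_openSegment_iff_real.2 ⟨ε, he0, he1, rfl⟩, he⟩

theorem isClosed_polyEdge (next : Equiv.Perm ι) (p : ι → ℂ) (i : ι) :
    IsClosed (polyEdge next p i) := by
  rw [polyEdge, segment_eq_image']
  exact (isCompact_Icc.image (by fun_prop)).isClosed

theorem VDiagram.sweptTriangle_ins_subset (D : VDiagram ι) {a : ι} {P : ℂ} (h) {S : Set ℂ}
    (hS : Convex ℝ S) (hA : D.pos a ∈ S) (hB : D.pos (D.next a) ∈ S) (hP : P ∈ S) :
    D.sweptTriangle (D.ins a P h) a ⊆ S := by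
  refine convexHull_min ?_ hS
  rintro z (rfl | rfl | rfl)
  exacts [hA, hP, hB]

/-- In a convex region met by no edges but `a`, `j` and edges adjacent to `a`, insertion of a vertex
on the edge `a`, which has no classical crossings, does not change the link. -/
theorem VDiagram.link_ins_of_convex (D : VDiagram ι) {a j : ι} {S : Set ℂ} {P : ℂ}
    (hS : Convex ℝ S) (hA : D.pos a ∈ S) (hB : D.pos (D.next a) ∈ S)
    (hx : ∀ x, x ≠ a → x ≠ j → ∀ z ∈ polyEdge D.next D.pos x, z ∈ S →
      z = D.pos a ∨ z = D.pos (D.next a))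
    (hj : D.pos j ∉ S ∨ j = D.next a) (hja : j ≠ a) (hP : P ∈ S)
    (hnd : planeDet (D.pos (D.next a) - D.pos a) (P - D.pos a) ≠ 0)
    (hv : ∀ y, ¬ D.isOver a y ∧ ¬ D.isOver y a)
    (hg : Gen (insNext D.next a) (insPos D.pos P)) : (D.ins a P hg).link = D.link := by
  -- If one of the new edges misses `j`, the vertex can be pushed to `P` by an isotopy, from a point
  -- of `a` near the corresponding end. Otherwise both new edges meet `j`, and a single R1/V1 or
  -- R2/V2 move is needed.
  by_cases h1 : ∀ z ∈ segment ℝ (D.pos a) P, z ∉ polyEdge D.next D.pos j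
  · obtain ⟨M, hM, hMP⟩ := exists_openSegment_near (B := D.pos (D.next a))
      (eventually_segment_avoids (isClosed_polyEdge _ _ _) h1)
    exact D.link_ins_of_avoid hS hA hB hx hj hP hnd hM hMP hg
  by_cases h2 : ∀ z ∈ segment ℝ (D.pos (D.next a)) P, z ∉ polyEdge D.next D.pos j
  · obtain ⟨M, hM, hMP⟩ := exists_openSegment_near (B := D.pos a)
      (eventually_segment_avoids (isClosed_polyEdge _ _ _) h2)
    rw [openSegment_symm] at hM
    exact D.link_ins_of_avoid hS hA hB hx hj hP hnd hM hMP hg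
  push Not at h1 h2
  obtain ⟨z, hz, hzj⟩ := h1
  obtain ⟨w, hw, hwj⟩ := h2
  rw [segment_symm] at hw
  have hm1 : (polyEdge (insNext D.next a) (insPos D.pos P) (some j) ∩
      polyEdge (insNext D.next a) (insPos D.pos P) (some a)).Nonempty := by
    rw [polyEdge_ins_self, polyEdge_ins_of_ne _ _ _ hja]
    exact ⟨z, hzj, hz⟩
  have hm2 : (polyEdge (insNext D.next a) (insPos D.pos P) (some j) ∩
      polyEdge (insNext D.next a) (insPos D.pos P) none).Nonempty := by
    rw [polyEdge_ins_none, polyEdge_ins_of_ne _ _ _ hja]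
    exact ⟨w, hwj, hw⟩
  have hrest : ∀ x, x ≠ a → x ≠ j → D.AvoidsTriangle (D.ins a P hg) a x := by
    rintro x hxa hxj u ⟨hu, hu'⟩
    exact hx x hxa hxj u hu (D.sweptTriangle_ins_subset hg hS hA hB hP hu')
  have hnja := insNext_some_of_ne D.next hja
  have hc2 : D.next a ≠ j → (D.ins a P hg).Crosses (some j) none := by
    intro h
    refine ⟨by simp, ?_, ?_, hm2⟩
    · rw [D.ins_next, hnja]; simp
    · rw [D.ins_next, insNext_none]; simpa using h
  have hc1 : D.next j ≠ a → (D.ins a P hg).Crosses (some j) (some a) := by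
    intro h
    refine ⟨by simpa using hja, ?_, ?_, hm1⟩
    · rw [D.ins_next, hnja]; simpa using h
    · rw [D.ins_next, insNext_some_self]; simp
  -- If `j` is adjacent to `a`, one of the two meetings is the common vertex, and the other one is
  -- the crossing of a curl. If not, there are two crossings, both virtual since `a` has no
  -- classical ones; the over and under conditions of the bigon are then equivalences of false
  -- statements.
  by_cases hf1 : D.next j = a
  · have hf2 : D.next a ≠ j := fun h => D.next_next_ne j (by rw [hf1, h])
    exact (VDiagram.Move.curl D _ a j (D.isInsertion_ins a P hg) (Or.inl hf1) (Or.inl (hc2 hf2))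
      hrest).link_eq.symm
  · by_cases hf2 : D.next a = j
    · exact (VDiagram.Move.curl D _ a j (D.isInsertion_ins a P hg) (Or.inr hf2) (Or.inr (hc1 hf1))
        hrest).link_eq.symm
    · refine (VDiagram.Move.bigon D _ a j (D.isInsertion_ins a P hg) (hc1 hf1) (hc2 hf2) ?_ ?_
        hrest).link_eq.symm
      · exact iff_of_false (fun h => (hv j).2 h.1) (fun h => (hv j).2 h.1)
      · exact iff_of_false (fun h => (hv j).1 h.1) (fun h => (hv j).1 h.1)

end Local

/-! ## A vertex passing through an edge -/

section VertexWall

variable {ι κ : Type}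

/-- The positions `p` are generic, except that the vertex `k` lies on the edge `j`. -/
structure VertexWall (next : Equiv.Perm ι) (p : ι → ℂ) (j k : ι) : Prop where
  mem : p k ∈ polyEdge next p j
  ne : k ≠ j
  ne_next : k ≠ next j
  vertex : ∀ i l, p l ∈ polyEdge next p i → l = i ∨ l = next i ∨ (i = j ∧ l = k)
  triple : ∀ x y z, x ≠ y → y ≠ z → x ≠ z → ∀ w, w ∈ polyEdge next p x → w ∈ polyEdge next p y →
    w ∈ polyEdge next p z → w = p k

/-- The function vanishing on the wall where the vertex `k` lies on the edge `j`. -/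
def vertexWallFun (next : Equiv.Perm ι) (j k : ι) (p : ι → ℂ) : ℝ :=
  planeDet (p (next j) - p j) (p k - p j)

theorem VertexWall.edge_of_mem {next : Equiv.Perm ι} {p : ι → ℂ} {j k : ι}
    (h : VertexWall next p j k) {x : ι} (hx : p k ∈ polyEdge next p x) :
    x = next.symm k ∨ x = k ∨ x = j := by
  rcases h.vertex x k hx with h | h | h
  · exact Or.inr (Or.inl h.symm)
  · exact Or.inl ((Equiv.eq_symm_apply next).2 h.symm)
  · exact Or.inr (Or.inr h.1)

/-- A second common point would make consecutive edges overlap and put a vertex on an edge that it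
does not bound. -/
theorem inter_eq_vertex {next : Equiv.Perm ι} {p : ι → ℂ} (hn : ∀ i, next i ≠ i)
    (hnn : ∀ i, next (next i) ≠ i)
    (hp : ∀ i k, p k ∈ polyEdge next p i → k = i ∨ k = next i) {i : ι} {w : ℂ}
    (h1 : w ∈ polyEdge next p i) (h2 : w ∈ polyEdge next p (next i)) : w = p (next i) := by
  by_contra hne
  rcases overlap_of_shared_endpoint h1 h2 hne with h | h
  · rcases hp _ _ h with h | h
    · exact hn i h.symm
    · exact hnn i h.symm
  · rcases hp _ _ h with h | h
    · exact hnn i h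
    · exact hn (next i) h

/-- A nearby triple point belongs to edges with a triple point at `p₀`. So these are the two edges
at `k` and the edge `j`. The first two still meet only in `k`, so `k` would lie on `j` and the wall
function would vanish. -/
theorem VertexWall.eventually_gen [Finite ι] {next : Equiv.Perm ι} {p₀ : ι → ℂ} {j k : ι}
    (hn : ∀ i, next i ≠ i) (hnn : ∀ i, next (next i) ≠ i) (h : VertexWall next p₀ j k) :
    ∀ᶠ p in 𝓝 p₀, vertexWallFun next j k p ≠ 0 → Gen next p := by
  have h1 : ∀ᶠ p in 𝓝 p₀, ∀ i l, p l ∈ polyEdge next p i →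
      l = i ∨ l = next i ∨ (i = j ∧ l = k) := by
    refine eventually_all.2 fun i => eventually_all.2 fun l => ?_
    by_cases hl : p₀ l ∈ polyEdge next p₀ i
    · exact Eventually.of_forall fun p _ => h.vertex i l hl
    · filter_upwards [eventually_vertex_notMem hl] with p hp h
      exact absurd h hp
  have h2 : ∀ᶠ p in 𝓝 p₀, ∀ x y z, x ≠ y → y ≠ z → x ≠ z →
      (∃ w, w ∈ polyEdge next p x ∧ w ∈ polyEdge next p y ∧ w ∈ polyEdge next p z) →
      (∃ w, w ∈ polyEdge next p₀ x ∧ w ∈ polyEdge next p₀ y ∧ w ∈ polyEdge next p₀ z) := by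
    refine eventually_all.2 fun x => eventually_all.2 fun y => eventually_all.2 fun z => ?_
    by_cases hw : ∃ w, w ∈ polyEdge next p₀ x ∧ w ∈ polyEdge next p₀ y ∧ w ∈ polyEdge next p₀ z
    · exact Eventually.of_forall fun _ _ _ _ _ => hw
    · filter_upwards [eventually_not_triple hw] with p hp _ _ _ h
      exact absurd h hp
  filter_upwards [h1, h2] with p hp1 hp2 hf
  have hkj : p k ∉ polyEdge next p j := fun hm => hf (planeDet_eq_zero_of_mem_segment hm)
  have hv : ∀ i l, p l ∈ polyEdge next p i → l = i ∨ l = next i := by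
    intro i l hl
    rcases hp1 i l hl with h | h | ⟨rfl, rfl⟩
    · exact Or.inl h
    · exact Or.inr h
    · exact absurd hl hkj
  refine ⟨hv, fun x y z hxy hyz hxz w hwx hwy hwz => ?_⟩
  obtain ⟨w₀, hx, hy, hz⟩ := hp2 x y z hxy hyz hxz ⟨w, hwx, hwy, hwz⟩
  have hw := h.triple x y z hxy hyz hxz w₀ hx hy hz
  rw [hw] at hx hy hz
  have key : w ∈ polyEdge next p (next.symm k) → w ∈ polyEdge next p k →
      w ∈ polyEdge next p j → False := by
    intro ha hb hc
    have := inter_eq_vertex hn hnn hv ha (by rwa [Equiv.apply_symm_apply])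
    rw [Equiv.apply_symm_apply] at this
    exact hkj (this ▸ hc)
  rcases h.edge_of_mem hx with rfl | rfl | rfl <;>
  rcases h.edge_of_mem hy with rfl | rfl | rfl <;>
  first
  | exact hxy rfl
  | (rcases h.edge_of_mem hz with rfl | rfl | rfl <;>
      first
      | exact hyz rfl
      | exact hxz rfl
      | exact key (by assumption) (by assumption) (by assumption))

theorem VertexWall.pos_ne {next : Equiv.Perm ι} {p : ι → ℂ} {j k : ι}
    (hnn : ∀ i, next (next i) ≠ i) (h : VertexWall next p j k) :
    p k ≠ p j ∧ p k ≠ p (next j) := by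
  constructor
  · intro he
    have h1 := h.vertex k j (by rw [← he]; exact left_mem_segment _ _ _)
    have h2 := h.vertex (next.symm k) j (by
      rw [← he, polyEdge, Equiv.apply_symm_apply]; exact right_mem_segment _ _ _)
    rw [Equiv.apply_symm_apply] at h2
    rcases h2 with h2 | h2 | h2
    · rcases h1 with h1 | h1 | h1
      · exact h.ne h1.symm
      · apply hnn k
        rw [← h1, h2, Equiv.apply_symm_apply]
      · exact h.ne h1.1
    · exact h.ne h2.symm
    · exact h.ne h2.2.symm
  · intro he
    rcases h.vertex k (next j) (by rw [← he]; exact left_mem_segment _ _ _) with h1 | h1 | h1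
    · exact h.ne_next h1.symm
    · exact h.ne (next.injective h1).symm
    · exact h.ne h1.1

theorem VertexWall.edge_ne {next : Equiv.Perm ι} {p : ι → ℂ} {j k : ι}
    (hnn : ∀ i, next (next i) ≠ i) (h : VertexWall next p j k) : p (next j) - p j ≠ 0 := by
  intro h0
  have hm := h.mem
  rw [polyEdge, sub_eq_zero.1 h0, segment_same, mem_singleton_iff] at hm
  exact (h.pos_ne hnn).1 (hm)

/-- At `p₀` the vertex projects strictly between the ends of `j`, an open condition. Nearby,
vanishing of the determinant therefore puts the vertex on the edge and not merely on its line. -/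
theorem VertexWall.eventually_not_gen {next : Equiv.Perm ι} {p₀ : ι → ℂ} {j k : ι}
    (hnn : ∀ i, next (next i) ≠ i) (h : VertexWall next p₀ j k) :
    ∀ᶠ p in 𝓝 p₀, vertexWallFun next j k p = 0 → ¬ Gen next p := by
  have hd := h.edge_ne hnn
  obtain ⟨hk1, hk2⟩ := h.pos_ne hnn
  obtain ⟨s, hs0, hs1, hs⟩ := mem_segment_iff_real.1 h.mem
  have hs0' : 0 < s := lt_of_le_of_ne hs0 fun h => hk1 (by rw [hs, ← h]; simp)
  have hs1' : s < 1 := lt_of_le_of_ne hs1 fun h => hk2 (by rw [hs, h]; simp)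
  have hn := planeDet_I_mul_pos hd
  rw [planeDet_I_mul] at hn
  have c1 : Continuous fun p : ι → ℂ => (p (next j) - p j).re * (p k - p j).re +
    (p (next j) - p j).im * (p k - p j).im := by fun_prop
  have c2 : Continuous fun p : ι → ℂ => (p j - p (next j)).re * (p k - p (next j)).re +
    (p j - p (next j)).im * (p k - p (next j)).im := by fun_prop
  have c3 : Continuous fun p : ι → ℂ => p (next j) - p j := by fun_prop
  have e1 : 0 < (p₀ (next j) - p₀ j).re * (p₀ k - p₀ j).re +
    (p₀ (next j) - p₀ j).im * (p₀ k - p₀ j).im := by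
    have : p₀ k - p₀ j = s * (p₀ (next j) - p₀ j) := by rw [hs]; ring
    rw [this]
    simp only [Complex.mul_re, Complex.mul_im, Complex.ofReal_re, Complex.ofReal_im]
    nlinarith
  have e2 : 0 < (p₀ j - p₀ (next j)).re * (p₀ k - p₀ (next j)).re +
    (p₀ j - p₀ (next j)).im * (p₀ k - p₀ (next j)).im := by
    have : p₀ k - p₀ (next j) = ((s - 1 : ℝ) : ℂ) * (p₀ (next j) - p₀ j) := by
      rw [hs]; push_cast; ring
    rw [this]
    simp only [Complex.mul_re, Complex.mul_im, Complex.ofReal_re, Complex.ofReal_im,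
      Complex.sub_re, Complex.sub_im] at hn ⊢
    nlinarith
  filter_upwards [(isOpen_lt continuous_const c1).mem_nhds e1,
    (isOpen_lt continuous_const c2).mem_nhds e2,
    (isOpen_ne_fun c3 continuous_const).mem_nhds hd] with p h1 h2 h3 hf hg
  have hm : p k ∈ polyEdge next p j := mem_segment_of_collinear hf (le_of_lt h1) (le_of_lt h2) h3
  rcases hg.1 j k hm with h' | h'
  · exact h.ne h'
  · exact h.ne_next h'

/-- Niceness of a wall configuration, reduced to the existence of one diagram on each side. -/
theorem VertexWall.nice_of_pair [Finite ι] {next : Equiv.Perm ι} {ov : ι → ι → Prop} {p₀ : ι → ℂ}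
    {j k : ι} (hn : ∀ i, next i ≠ i) (hnn : ∀ i, next (next i) ≠ i) (h : VertexWall next p₀ j k)
    (hpair : ∀ V ∈ 𝓝 p₀, ∃ D E : VDiagram ι, D.next = next ∧ D.isOver = ov ∧ D.pos ∈ V ∧
      0 < vertexWallFun next j k D.pos ∧ E.next = next ∧ E.isOver = ov ∧ E.pos ∈ V ∧
      vertexWallFun next j k E.pos < 0 ∧ D.link = E.link) : Nice next ov p₀ := by
  classical
  -- The wall is crossed by moving `k` alone along the normal of `j` at `p₀`; the wall function is
  -- affine in this displacement.
  refine nice_of_wall (f := vertexWallFun next j k)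
    (c := fun p => planeDet (p (next j) - p j) (Complex.I * (p₀ (next j) - p₀ j)))
    (w := Pi.single k (Complex.I * (p₀ (next j) - p₀ j))) ?_ (by fun_prop) ?_
    (planeDet_eq_zero_of_mem_segment h.mem) (planeDet_I_mul_pos (h.edge_ne hnn))
    (h.eventually_gen hn hnn) (h.eventually_not_gen hnn) hpair
  · unfold vertexWallFun; fun_prop
  · intro p s
    simp only [vertexWallFun, Pi.add_apply, Pi.smul_apply, Pi.single_eq_same,
      Pi.single_eq_of_ne h.ne.symm, Pi.single_eq_of_ne h.ne_next.symm, smul_zero, add_zero,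
      Complex.real_smul]
    rw [show p k + s * (Complex.I * (p₀ (next j) - p₀ j)) - p j =
      (p k - p j) + s * (Complex.I * (p₀ (next j) - p₀ j)) by ring, planeDet_add_right,
      planeDet_mul_right]

/-- A wall configuration is nice if a convex neighbourhood of the vertex `none` on the wall, which
contains the two adjacent vertices, is met by no edges but those at these vertices and the edge
`j`. -/
theorem VertexWall.nice_of_local_none [Finite κ] {m : Equiv.Perm κ} {p : κ → ℂ} {k₀ : ℂ} {a j : κ}
    {ov : Option κ → Option κ → Prop} (hn : ∀ i, m i ≠ i) (hnn : ∀ i, m (m i) ≠ i)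
    (hn' : ∀ i, insNext m a i ≠ i) (hnn' : ∀ i, insNext m a (insNext m a i) ≠ i)
    (h : VertexWall (insNext m a) (insPos p k₀) (some j) none)
    (hasymm : ∀ x y, ov x y → ¬ ov y x)
    (hovc : ∀ x y, ov x y → polyCrosses (insNext m a) (insPos p k₀) x y)
    (hov : ∀ x, ¬ ov x none ∧ ¬ ov none x ∧ ¬ ov x (some a) ∧ ¬ ov (some a) x)
    {S : Set ℂ} (hS : Convex ℝ S) (hSk : S ∈ 𝓝 k₀) (hA : p a ∈ S) (hB : p (m a) ∈ S)
    (hx : ∀ x, x ≠ a → x ≠ j → ∀ z ∈ polyEdge m p x, z ∈ S → z = p a ∨ z = p (m a))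
    (hj : p j ∉ S ∨ j = m a) :
    Nice (insNext m a) ov (insPos p k₀) := by
  have hja : j ≠ a := by
    rintro rfl
    exact h.ne_next (insNext_some_self m j).symm
  have hsAB : segment ℝ (p a) (p (m a)) ⊆ S := hS.segment_subset hA hB
  have hvA : ∀ l, p l = p a → l = a := by
    intro l hl
    rcases h.vertex (some a) (some l) (by
      rw [polyEdge_ins_self, insPos_some, hl]; exact left_mem_segment _ _ _) with h | h | h
    · simpa using h
    · simp at h
    · simp at h
  have hvB : ∀ l, p l = p (m a) → l = m a := by
    intro l hl
    rcases h.vertex none (some l) (by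
      rw [polyEdge_ins_none, insPos_some, hl]; exact right_mem_segment _ _ _) with h | h | h
    · simp at h
    · simpa using h
    · simp at h
  have hvx : ∀ x l, x ≠ a → p l ∈ polyEdge m p x → l = x ∨ l = m x := by
    intro x l hxa hl
    rcases h.vertex (some x) (some l) (by rwa [polyEdge_ins_of_ne _ _ _ hxa]) with h | h | h
    · left; simpa using h
    · right; simpa [insNext_some_of_ne m hxa] using h
    · simp at h
  -- With the vertex `none` deleted, the edge `a` joins its neighbours directly. It stays in the
  -- convex set `S`, so it creates no new incidences.
  have hg : Gen m p := by
    constructor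
    · intro i l hl
      by_cases hia : i = a
      · subst hia
        have hlS := hsAB hl
        by_cases hli : l = i
        · exact Or.inl hli
        by_cases hlj : l = j
        · subst hlj
          rcases hj with h | h
          · exact absurd hlS h
          · exact Or.inr h
        · rcases hx l hli hlj _ (left_mem_segment _ _ _) hlS with h | h
          · exact Or.inl (hvA l h)
          · exact Or.inr (hvB l h)
      · exact hvx i l hia hl
    · have haux : ∀ x y w, x ≠ a → y ≠ a → x ≠ y → x ≠ j → w ∈ polyEdge m p x →
          w ∈ polyEdge m p y → w ∉ polyEdge m p a := by
        intro x y w hxa hya hxy hxj hwx hwy hwa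
        rcases hx x hxa hxj w hwx (hsAB hwa) with rfl | rfl
        · rcases hvx x a hxa hwx with h | h
          · exact hxa h.symm
          rcases hvx y a hya hwy with h' | h'
          · exact hya h'.symm
          exact hxy (m.injective (h.symm.trans h'))
        · rcases hvx x _ hxa hwx with h | h
          · rcases hvx y _ hya hwy with h' | h'
            · exact hxy (h.symm.trans h')
            · exact hya (m.injective h').symm
          · exact hxa (m.injective h).symm
      have haux' : ∀ x y w, x ≠ a → y ≠ a → x ≠ y → w ∈ polyEdge m p x →
          w ∈ polyEdge m p y → w ∉ polyEdge m p a := by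
        intro x y w hxa hya hxy hwx hwy
        by_cases hxj : x = j
        · exact haux y x w hya hxa hxy.symm (fun h => hxy (hxj.trans h.symm)) hwy hwx
        · exact haux x y w hxa hya hxy hxj hwx hwy
      intro x y z hxy hyz hxz w hwx hwy hwz
      by_cases hxa : x = a
      · subst hxa; exact haux' y z w hxy.symm hxz.symm hyz hwy hwz hwx
      by_cases hya : y = a
      · subst hya; exact haux' x z w hxa hyz.symm hxz hwx hwz hwy
      by_cases hza : z = a
      · subst hza; exact haux' x y w hxa hya hxy hwx hwy hwz
      rw [← polyEdge_ins_of_ne m p k₀ hxa] at hwx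
      rw [← polyEdge_ins_of_ne m p k₀ hya] at hwy
      rw [← polyEdge_ins_of_ne m p k₀ hza] at hwz
      have hw := h.triple (some x) (some y) (some z) (by simpa) (by simpa) (by simpa) w hwx hwy hwz
      rw [hw] at hwx hwy
      have hxj : x = j := by
        rcases h.vertex _ _ hwx with h | h | h
        · simp at h
        · simp [insNext_some_of_ne m hxa] at h
        · simpa using h.1
      have hyj : y = j := by
        rcases h.vertex _ _ hwy with h | h | h
        · simp at h
        · simp [insNext_some_of_ne m hya] at h
        · simpa using h.1
      exact hxy (hxj.trans hyj.symm)
  -- Both sides of the wall will be insertions into this one diagram, so they represent its link.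
  let D : VDiagram κ :=
    { finite := inferInstance
      next := m
      pos := p
      isOver := fun x y => ov (some x) (some y)
      next_ne := hn
      next_next_ne := hnn
      vertex_generic := hg.1
      no_triple := hg.2
      over_crosses := fun x y hxy => by
        have hxa : x ≠ a := by rintro rfl; exact (hov _).2.2.2 hxy
        have hya : y ≠ a := by rintro rfl; exact (hov _).2.2.1 hxy
        exact (polyCrosses_ins_iff hxa hya).1 (hovc _ _ hxy)
      over_asymm := fun x y => hasymm _ _ }
  have hBA : p (m a) - p a ≠ 0 := by
    intro h0
    exact hn a (hvA _ (sub_eq_zero.1 h0))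
  have hd := h.edge_ne hnn'
  simp only [insNext_some_of_ne m hja, insPos_some] at hd
  have hk₀ : planeDet (p (m j) - p j) (k₀ - p j) = 0 := by
    have := planeDet_eq_zero_of_mem_segment h.mem
    simpa [insNext_some_of_ne m hja] using this
  refine h.nice_of_pair hn' hnn' fun V hV => ?_
  -- a diagram on either side
  have hside : ∀ σ : ℝ, σ ≠ 0 → ∃ E : VDiagram (Option κ), E.next = insNext m a ∧ E.isOver = ov ∧
      E.pos ∈ V ∧ 0 < σ * vertexWallFun (insNext m a) (some j) none E.pos ∧ E.link = D.link := by
    intro σ hσ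
    have hcont : Continuous fun P : ℂ => insPos p P := continuous_insPos continuous_const continuous_id
    have hU : IsOpen (interior S ∩ (fun P : ℂ => insPos p P) ⁻¹' interior V ∩
        {P | 0 < σ * planeDet (p (m j) - p j) (P - p j)}) :=
      (isOpen_interior.inter (isOpen_interior.preimage hcont)).inter
        (isOpen_lt continuous_const (by fun_prop))
    have hUne : (interior S ∩ (fun P : ℂ => insPos p P) ⁻¹' interior V ∩
        {P | 0 < σ * planeDet (p (m j) - p j) (P - p j)}).Nonempty := by
      have hopen : IsOpen (interior S ∩ (fun P : ℂ => insPos p P) ⁻¹' interior V) :=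
        isOpen_interior.inter (isOpen_interior.preimage hcont)
      have hmem : k₀ ∈ interior S ∩ (fun P : ℂ => insPos p P) ⁻¹' interior V :=
        ⟨mem_interior_iff_mem_nhds.2 hSk, mem_interior_iff_mem_nhds.2 hV⟩
      have hc : Continuous fun ε : ℝ => k₀ + ε * (σ * (Complex.I * (p (m j) - p j))) := by fun_prop
      have hev : ∀ᶠ ε : ℝ in 𝓝[>] 0, k₀ + ε * (σ * (Complex.I * (p (m j) - p j))) ∈
          interior S ∩ (fun P : ℂ => insPos p P) ⁻¹' interior V :=
        (hc.continuousAt.eventually_mem (by simpa using hopen.mem_nhds hmem)).filter_mono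
          nhdsWithin_le_nhds
      obtain ⟨ε, hε, hpos⟩ := (hev.and self_mem_nhdsWithin).exists
      refine ⟨_, hε, ?_⟩
      rw [Set.mem_ofPred_eq, show k₀ + ε * (σ * (Complex.I * (p (m j) - p j))) - p j =
        (k₀ - p j) + ε * (σ * (Complex.I * (p (m j) - p j))) by ring, planeDet_add_right, hk₀,
        planeDet_mul_right, planeDet_mul_right]
      have := planeDet_I_mul_pos hd
      have h2 : 0 < σ ^ 2 := by positivity
      calc (0:ℝ) < σ ^ 2 * (ε * planeDet (p (m j) - p j) (Complex.I * (p (m j) - p j))) := by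
            positivity
        _ = _ := by ring
    -- The one line to be avoided carries the edge `a`, so that the swept triangle is nondegenerate.
    obtain ⟨P, ⟨⟨hPS, hPV⟩, hPf⟩, hPl⟩ := exists_mem_open_off_lines (T := (univ : Set Unit))
      finite_univ (fun _ => p a) (fun _ => p (m a) - p a) (fun _ _ => hBA) hU hUne
    have hPl := hPl () (mem_univ _)
    rw [Set.mem_ofPred_eq] at hPf
    have hPS' := interior_subset hPS
    have hPj : P ∉ polyEdge m p j := by
      intro hP
      rw [planeDet_eq_zero_of_mem_segment hP, mul_zero] at hPf
      exact lt_irrefl _ hPf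
    have hgen : Gen (insNext D.next a) (insPos D.pos P) :=
      hg.ins_of_convex hn hnn hS hA hB hx hj hPS' hPj hPl
    refine ⟨D.ins a P hgen, rfl, ?_, interior_subset hPV, ?_, ?_⟩
    · funext x y
      refine propext ⟨fun hxy => ?_, fun hxy => ?_⟩
      · obtain ⟨h1, -⟩ := hxy
        rcases x with _ | x
        · exact absurd h1 (hov _).2.2.2
        rcases y with _ | y
        · exact absurd h1 (hov _).2.2.1
        exact h1
      · rcases x with _ | x
        · exact absurd hxy (hov _).2.1
        rcases y with _ | y
        · exact absurd hxy (hov _).1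
        have hxa : x ≠ a := by rintro rfl; exact (hov _).2.2.2 hxy
        have hya : y ≠ a := by rintro rfl; exact (hov _).2.2.1 hxy
        exact ⟨hxy, (polyCrosses_ins_iff hxa hya).2
          ((polyCrosses_ins_iff hxa hya).1 (hovc _ _ hxy))⟩
    · rw [D.ins_pos]
      simpa [vertexWallFun, insNext_some_of_ne m hja] using hPf
    · exact D.link_ins_of_convex hS hA hB hx hj hja hPS' hPl
        (fun y => ⟨(hov _).2.2.2, (hov _).2.2.1⟩) hgen
  obtain ⟨E, hE1, hE2, hE3, hE4, hE5⟩ := hside 1 one_ne_zero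
  obtain ⟨F, hF1, hF2, hF3, hF4, hF5⟩ := hside (-1) (by norm_num)
  exact ⟨E, F, hE1, hE2, hE3, by linarith, hF1, hF2, hF3, by linarith, hE5.trans hF5.symm⟩

end VertexWall

/-! ## Localization at a vertex on a wall -/

section VertexWallLocal

variable {ι κ : Type}

/-- A vertex wall configuration, together with crossing types `ov` that are virtual near the vertex
`k`, and a radius `r` such that the disc of radius `r` around the vertex `k` meets no edges but the
edge `j`, the edges at `k`, and the next ones. -/
structure LocalWall (next : Equiv.Perm ι) (ov : ι → ι → Prop) (p : ι → ℂ) (j k : ι) (r : ℝ) : Prop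
    extends VertexWall next p j k where
  next_ne : ∀ i, next i ≠ i
  next_next_ne : ∀ i, next (next i) ≠ i
  asymm : ∀ x y, ov x y → ¬ ov y x
  crosses : ∀ x y, ov x y → polyCrosses next p x y
  virt : ¬ ov j k ∧ ¬ ov k j ∧ ¬ ov j (next.symm k) ∧ ¬ ov (next.symm k) j
  clear : ∀ x, x ≠ next.symm k → x ≠ k → x ≠ j → ∀ z ∈ polyEdge next p x, dist z (p k) ≤ r →
    z = p (next.symm k) ∨ z = p (next k)
  pos : 0 < r

/-- `Equiv.removeNone` short-circuits the cycle at `none`, and insertion undoes this. Thus any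
vertex, once named `none`, can be treated as an inserted one. -/
theorem insNext_removeNone {N : Equiv.Perm (Option κ)} {a : κ} (ha : N (some a) = none) :
    insNext (Equiv.removeNone N) a = N := by
  ext1 o
  rcases o with _ | x
  · rw [insNext_none, Equiv.removeNone_none N ha]
  · by_cases hx : x = a
    · subst hx; rw [insNext_some_self, ha]
    · rw [insNext_some_of_ne _ hx]
      apply Equiv.removeNone_some
      rw [← Option.ne_none_iff_exists']
      intro h
      exact hx (by simpa using N.injective (h.trans ha.symm))

variable {next : Equiv.Perm ι} {ov : ι → ι → Prop} {p : ι → ℂ} {j k : ι} {r : ℝ}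

namespace LocalWall

theorem symm_ne (h : LocalWall next ov p j k r) : next.symm k ≠ k := fun he =>
  h.next_ne k ((Equiv.symm_apply_eq next).1 he).symm

theorem symm_ne_next (h : LocalWall next ov p j k r) : next.symm k ≠ next k := fun he =>
  h.next_next_ne k ((Equiv.symm_apply_eq next).1 he).symm

theorem ne_symm (h : LocalWall next ov p j k r) : j ≠ next.symm k := fun he =>
  h.ne_next (by rw [he, Equiv.apply_symm_apply])

theorem edge_symm (_ : LocalWall next ov p j k r) :
    polyEdge next p (next.symm k) = segment ℝ (p (next.symm k)) (p k) := by
  rw [polyEdge, Equiv.apply_symm_apply]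

theorem inj (h : LocalWall next ov p j k r) {v : ι} (hv : p v = p k) : v = k := by
  rcases h.vertex k v (by rw [hv]; exact left_mem_segment _ _ _) with h1 | h1 | h1
  · exact h1
  · rcases h.vertex (next.symm k) v (by
      rw [h.edge_symm, hv]; exact right_mem_segment _ _ _) with h2 | h2 | h2
    · exact absurd (h2.symm.trans h1) h.symm_ne_next
    · rwa [Equiv.apply_symm_apply] at h2
    · exact h2.2
  · exact h1.2

/-- No classical crossings involve the two edges at the vertex `k`. -/
theorem no_over (h : LocalWall next ov p j k r) (h1 : dist (p (next.symm k)) (p k) ≤ r)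
    (h2 : dist (p (next k)) (p k) ≤ r) (x : ι) :
    ¬ ov x k ∧ ¬ ov k x ∧ ¬ ov x (next.symm k) ∧ ¬ ov (next.symm k) x := by
  have hsub1 : polyEdge next p (next.symm k) ⊆ Metric.closedBall (p k) r := by
    rw [h.edge_symm]
    exact (convex_closedBall _ _).segment_subset h1 (by simpa using h.pos.le)
  have hsub2 : polyEdge next p k ⊆ Metric.closedBall (p k) r :=
    (convex_closedBall _ _).segment_subset (by simpa using h.pos.le) h2
  have key1 : polyCrosses next p x k → x = j := by
    rintro ⟨c1, c2, c3, w, hwx, hwk⟩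
    by_contra hxj
    have hxs : x ≠ next.symm k := fun he => c2 (by rw [he, Equiv.apply_symm_apply])
    rcases h.clear x hxs c1 hxj w hwx (hsub2 hwk) with rfl | rfl
    · rcases h.vertex _ _ hwk with e | e | e
      · exact h.symm_ne e
      · exact h.symm_ne_next e
      · exact h.symm_ne e.2
    · rcases h.vertex _ _ hwx with e | e | e
      · exact c3 e
      · exact c1 (next.injective e).symm
      · exact hxj e.1
  have key2 : polyCrosses next p x (next.symm k) → x = j := by
    rintro ⟨c1, c2, c3, w, hwx, hwk⟩
    by_contra hxj
    rw [Equiv.apply_symm_apply] at c3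
    rcases h.clear x c1 c3.symm hxj w hwx (hsub1 hwk) with rfl | rfl
    · rcases h.vertex _ _ hwx with e | e | e
      · exact c1 e.symm
      · exact c2 e.symm
      · exact hxj e.1
    · rcases h.vertex _ _ hwk with e | e | e
      · exact h.symm_ne_next e.symm
      · rw [Equiv.apply_symm_apply] at e; exact h.next_ne k e
      · exact h.next_ne k e.2
  obtain ⟨v1, v2, v3, v4⟩ := h.virt
  refine ⟨fun ho => ?_, fun ho => ?_, fun ho => ?_, fun ho => ?_⟩
  · rw [key1 (h.crosses _ _ ho)] at ho; exact v1 ho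
  · rw [key1 (h.crosses _ _ ho).symm] at ho; exact v2 ho
  · rw [key2 (h.crosses _ _ ho)] at ho; exact v3 ho
  · rw [key2 (h.crosses _ _ ho).symm] at ho; exact v4 ho

/-- A local wall whose two adjacent vertices lie in the disc is nice. -/
theorem nice_of_near [Finite ι] (h : LocalWall next ov p j k r)
    (h1 : dist (p (next.symm k)) (p k) ≤ r) (h2 : dist (p (next k)) (p k) ≤ r)
    (hj : r < dist (p j) (p k) ∨ j = next k) (h3 : next (next (next k)) ≠ k) :
    Nice next ov p := by
  classical
  -- The vertex `k` is renamed `none`, so that it can be deleted and inserted again.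
  let e : Option {x // x ≠ k} ≃ ι := Equiv.optionSubtypeNe k
  have he0 : e none = k := Equiv.optionSubtypeNe_none k
  have he1 : ∀ x : {x // x ≠ k}, e (some x) = x := fun x => Equiv.optionSubtypeNe_some k x
  have hes : ∀ x (hx : x ≠ k), e.symm x = some ⟨x, hx⟩ := fun x hx => by
    rw [Equiv.symm_apply_eq, he1]
  have hes0 : e.symm k = none := by rw [Equiv.symm_apply_eq, he0]
  let N : Equiv.Perm (Option {x // x ≠ k}) := (e.trans next).trans e.symm
  have hN : ∀ o, N o = e.symm (next (e o)) := fun _ => rfl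
  let a : {x // x ≠ k} := ⟨next.symm k, h.symm_ne⟩
  have hNa : N (some a) = none := by
    rw [hN, he1, Equiv.apply_symm_apply, hes0]
  set m := Equiv.removeNone N with hm
  have hins : insNext m a = N := insNext_removeNone hNa
  have hm1 : ∀ x : {x // x ≠ k}, x ≠ a → (m x : ι) = next x := by
    intro x hx
    have : some (m x) = N (some x) := by rw [← hins, insNext_some_of_ne m hx]
    rw [hN, he1] at this
    have := congrArg e this
    rwa [he1, Equiv.apply_symm_apply] at this
  have hm2 : (m a : ι) = next k := by
    have : some (m a) = N none := by rw [← hins, insNext_none]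
    rw [hN, he0] at this
    have := congrArg e this
    rwa [he1, Equiv.apply_symm_apply] at this
  have hxa : ∀ x : {x // x ≠ k}, x ≠ a → (x : ι) ≠ next.symm k := fun x hx hc => hx (Subtype.ext hc)
  have hnext : ∀ i, next (e i) = e (N i) := fun i => by rw [hN, Equiv.apply_symm_apply]
  have hpe : p ∘ e = insPos (fun x : {x // x ≠ k} => p x) (p k) := by
    funext o
    rcases o with _ | x
    · simp [he0]
    · simp [he1]
  have hedge : ∀ x : {x // x ≠ k}, x ≠ a →
      polyEdge m (fun x : {x // x ≠ k} => p x) x = polyEdge next p x := by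
    intro x hx
    simp only [polyEdge, hm1 x hx]
  have hjk : j ≠ k := h.ne.symm
  have hNe : ∀ i, N i ≠ i := fun i hi => h.next_ne (e i) (by rw [hnext, hi])
  have hNNe : ∀ i, N (N i) ≠ i := fun i hi => h.next_next_ne (e i) (by rw [hnext, hnext, hi])
  refine Nice.of_comp hnext ?_
  rw [hpe, ← hins]
  have hno := h.no_over h1 h2
  have hpoly := fun i j => polyCrosses_comp (next' := N) hnext p i j
  rw [hpe] at hpoly
  have hmem : ∀ o, polyEdge N (insPos (fun x : {x // x ≠ k} => p x) (p k)) o =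
      polyEdge next p (e o) := fun o => by rw [← hpe]; exact polyEdge_comp hnext p o
  have hpo : ∀ o, insPos (fun x : {x // x ≠ k} => p x) (p k) o = p (e o) := fun o => by
    rw [← hpe]; rfl
  refine VertexWall.nice_of_local_none (j := ⟨j, hjk⟩) (S := Metric.closedBall (p k) r)
    ?_ ?_ (by rw [hins]; exact hNe) (by rw [hins]; exact hNNe) ?_ ?_ ?_ ?_ (convex_closedBall _ _)
    (Metric.closedBall_mem_nhds _ h.pos) h1 (by rw [hm2]; exact h2) ?_ ?_
  · intro x hx
    by_cases hxa' : x = a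
    · rw [hxa'] at hx
      have := congrArg Subtype.val hx
      rw [hm2] at this
      exact h.symm_ne_next this.symm
    · have := congrArg Subtype.val hx
      rw [hm1 x hxa'] at this
      exact h.next_ne _ this
  · intro x hx
    -- Here `h3` is needed: a component with exactly three vertices would keep only two after the
    -- deletion.
    have hx' := congrArg Subtype.val hx
    by_cases hxa' : x = a
    · rw [hxa'] at hx'
      have hma : m a ≠ a := by
        intro hc
        have := congrArg Subtype.val hc
        rw [hm2] at this
        exact h.symm_ne_next this.symm
      rw [hm1 _ hma, hm2] at hx'
      exact h3 (by rw [hx']; exact Equiv.apply_symm_apply _ _)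
    · by_cases hmx : m x = a
      · rw [hmx, hm2] at hx'
        have := hm1 x hxa'
        rw [hmx, ← hx'] at this
        apply h3
        rw [← this]
        exact Equiv.apply_symm_apply _ _
      · rw [hm1 _ hmx, hm1 _ hxa'] at hx'
        exact h.next_next_ne _ hx'
  · rw [hins]
    refine ⟨?_, by simp, ?_, ?_, ?_⟩
    · rw [hmem, hpo, he0, he1]; exact h.mem
    · rw [hN, he1]
      intro hc
      have := congrArg e hc
      rw [he0, Equiv.apply_symm_apply] at this
      exact h.ne_next this
    · intro i l hl
      rw [hmem, hpo] at hl
      rcases h.vertex _ _ hl with c | c | ⟨c, c'⟩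
      · exact Or.inl (e.injective c)
      · right; left; rw [hN]; rw [Equiv.eq_symm_apply]; exact c
      · right; right
        refine ⟨e.injective ?_, e.injective ?_⟩
        · rw [c, he1]
        · rw [c', he0]
    · intro x y z hxy hyz hxz w
      rw [hmem, hmem, hmem, hpo, he0]
      exact h.triple _ _ _ (e.injective.ne hxy) (e.injective.ne hyz) (e.injective.ne hxz) w
  · intro x y; exact h.asymm _ _
  · rw [hins]
    intro x y hxy
    rw [hpoly]
    exact h.crosses _ _ hxy
  · intro x
    have := hno (e x)
    rw [he0, he1]
    exact this
  · intro x hx hxj z hz hzS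
    rw [hedge x hx] at hz
    have := h.clear x (hxa x hx) x.2 (fun hc => hxj (Subtype.ext hc)) z hz hzS
    rw [hm2]
    exact this
  · rcases hj with hj | hj
    · left
      rw [Metric.mem_closedBall, not_le]; exact hj
    · right
      apply Subtype.ext
      rw [hm2]; exact hj

end LocalWall

/-- The default value in `o.getD a` makes the new edge `none` a part of `a`, so `o.getD a` is the
old edge from which `o` comes. -/
theorem polyEdge_sub_subset {a : ι} {z : ℂ} (hz : z ∈ segment ℝ (p a) (p (next a)))
    (o : Option ι) :
    polyEdge (insNext next a) (insPos p z) o ⊆ polyEdge next p (o.getD a) := by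
  rcases o with _ | x
  · rw [polyEdge_ins_none]
    exact (convex_segment _ _).segment_subset hz (right_mem_segment _ _ _)
  · by_cases hx : x = a
    · subst hx
      rw [polyEdge_ins_self]
      exact (convex_segment _ _).segment_subset (left_mem_segment _ _ _) hz
    · rw [polyEdge_ins_of_ne _ _ _ hx]; rfl

theorem eq_of_mem_both_halves {A B z w : ℂ} (hz : z ∈ openSegment ℝ A B) (h1 : w ∈ segment ℝ A z)
    (h2 : w ∈ segment ℝ z B) : w = z := by
  have := mem_segment_of_both_sides hz h1 h2
  rw [segment_same, mem_singleton_iff] at this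
  exact this.symm

/-- Three distinct edges after a subdivision that have a common point come from three distinct
edges. -/
theorem getD_distinct_of_common {a : ι} {z : ℂ} (hz : z ∈ openSegment ℝ (p a) (p (next a)))
    (hza : ∀ x, x ≠ a → z ∉ polyEdge next p x) {x y u : Option ι} (hxy : x ≠ y) (hyu : y ≠ u)
    (hxu : x ≠ u) {w : ℂ} (hx : w ∈ polyEdge (insNext next a) (insPos p z) x)
    (hy : w ∈ polyEdge (insNext next a) (insPos p z) y)
    (hu : w ∈ polyEdge (insNext next a) (insPos p z) u) : x.getD a ≠ y.getD a := by
  intro he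
  have hcase : ∀ x y : Option ι, x ≠ y → x.getD a = y.getD a →
      (x = none ∧ y = some a) ∨ (x = some a ∧ y = none) := by
    rintro (_ | x) (_ | y) hxy he
    · exact absurd rfl hxy
    · left; simp at he; simp [he]
    · right; simp at he; simp [he]
    · simp at he; exact absurd (by rw [he]) hxy
  have hu' : u.getD a ≠ a := by
    intro hc
    rcases hcase x y hxy he with ⟨rfl, rfl⟩ | ⟨rfl, rfl⟩
    · rcases u with _ | u
      · exact hxu rfl
      · simp at hc; exact hyu (by rw [hc])
    · rcases u with _ | u
      · exact hyu rfl
      · simp at hc; exact hxu (by rw [hc])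
  have hw : w = z := by
    rcases hcase x y hxy he with ⟨rfl, rfl⟩ | ⟨rfl, rfl⟩
    · rw [polyEdge_ins_none] at hx; rw [polyEdge_ins_self] at hy
      exact eq_of_mem_both_halves hz hy hx
    · rw [polyEdge_ins_none] at hy; rw [polyEdge_ins_self] at hx
      exact eq_of_mem_both_halves hz hx hy
  rw [hw] at hu
  exact hza _ hu' (polyEdge_sub_subset (openSegment_subset_segment _ _ _ hz) u hu)

/-- This transfers wall conditions through a subdivision: nontrivial incidences come from old ones,
as `z` lies on no other edge. The quantifiers over `i'` and `l'` extend over the last alternative as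
well, where they are idle. -/
theorem subdivide_vertex {a : ι} {z : ℂ} (hn : ∀ i, next i ≠ i)
    (hz : z ∈ openSegment ℝ (p a) (p (next a)))
    (hza : ∀ x, x ≠ a → z ∉ polyEdge next p x) {i l : Option ι}
    (h : insPos p z l ∈ polyEdge (insNext next a) (insPos p z) i) :
    l = i ∨ l = insNext next a i ∨ ∃ i' l', i = some i' ∧ l = some l' ∧ i' ≠ a ∧
      p l' ∈ polyEdge next p i' ∨ ∃ l', l = some l' ∧ l' ≠ a ∧ l' ≠ next a ∧
        p l' ∈ polyEdge next p a := by
  have hzB : z ≠ p (next a) := fun h => hza (next a) (hn a) (by rw [h]; exact left_mem_segment _ _ _)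
  have hzA : z ≠ p a := by
    intro h
    apply hza (next.symm a) (fun h => hn a ((Equiv.symm_apply_eq next).1 h).symm)
    rw [h, polyEdge, Equiv.apply_symm_apply]
    exact right_mem_segment _ _ _
  have hz' := openSegment_subset_segment _ _ _ hz
  rcases i with _ | i
  · rcases l with _ | l
    · exact Or.inl rfl
    · have hm := polyEdge_sub_subset hz' none h
      rw [polyEdge_ins_none] at h
      by_cases hla : l = a
      · subst hla
        exact absurd (eq_of_mem_both_halves hz (left_mem_segment _ _ _) h).symm hzA
      by_cases hlb : l = next a
      · right; left; simp [hlb]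
      · right; right; refine ⟨a, l, Or.inr ⟨l, rfl, hla, hlb, hm⟩⟩
  · by_cases hia : i = a
    · subst hia
      rcases l with _ | l
      · right; left; simp
      · have hm := polyEdge_sub_subset hz' (some i) h
        rw [polyEdge_ins_self] at h
        by_cases hlb : l = next i
        · subst hlb
          exact absurd (eq_of_mem_both_halves hz h (right_mem_segment _ _ _)).symm hzB
        by_cases hla : l = i
        · left; rw [hla]
        · right; right; refine ⟨i, l, Or.inr ⟨l, rfl, hla, hlb, hm⟩⟩
    · rw [polyEdge_ins_of_ne _ _ _ hia] at h
      rcases l with _ | l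
      · exact absurd h (hza i hia)
      · right; right; exact ⟨i, l, Or.inl ⟨rfl, rfl, hia, h⟩⟩

theorem VertexWall.subdivide (h : VertexWall next p j k) (hn : ∀ i, next i ≠ i) {a : ι} {z : ℂ}
    (haj : a ≠ j) (hz : z ∈ openSegment ℝ (p a) (p (next a)))
    (hza : ∀ x, x ≠ a → z ∉ polyEdge next p x) :
    VertexWall (insNext next a) (insPos p z) (some j) (some k) where
  mem := by rw [polyEdge_ins_of_ne _ _ _ haj.symm]; exact h.mem
  ne := by simpa using h.ne
  ne_next := by rw [insNext_some_of_ne _ haj.symm]; simpa using h.ne_next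
  vertex i l hl := by
    rcases subdivide_vertex hn hz hza hl with c | c | ⟨i', l', ⟨rfl, rfl, hi, c⟩ | ⟨l', rfl, h1, h2, c⟩⟩
    · exact Or.inl c
    · exact Or.inr (Or.inl c)
    · rcases h.vertex _ _ c with c | c | ⟨rfl, rfl⟩
      · left; rw [c]
      · right; left; rw [insNext_some_of_ne _ hi, c]
      · right; right; exact ⟨rfl, rfl⟩
    · rcases h.vertex _ _ c with c | c | ⟨c, -⟩
      · exact absurd c h1
      · exact absurd c h2
      · exact absurd c haj
  triple x y u hxy hyu hxu w hx hy hu := by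
    have hz' := openSegment_subset_segment _ _ _ hz
    exact h.triple _ _ _ (getD_distinct_of_common hz hza hxy hyu hxu hx hy hu)
      (getD_distinct_of_common hz hza hyu hxu.symm hxy.symm hy hu hx)
      (getD_distinct_of_common hz hza hxu hyu.symm hxy hx hu hy) w
      (polyEdge_sub_subset hz' x hx) (polyEdge_sub_subset hz' y hy) (polyEdge_sub_subset hz' u hu)

theorem subOver_asymm (hasymm : ∀ x y, ov x y → ¬ ov y x) {a : ι} {z : ℂ} (x y : Option ι)
    (h : subOver next ov p a z x y) : ¬ subOver next ov p a z y x :=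
  fun h' => hasymm _ _ h.1 h'.1

/-- The point at distance `r` from `c` on the segment `c q`. -/
theorem exists_at_dist {c q : ℂ} {r : ℝ} (hr : 0 < r) (h : r < dist q c) :
    ∃ s : ℝ, 0 < s ∧ s < 1 ∧ dist (c + s * (q - c)) c = r ∧
      ∀ w ∈ segment ℝ (c + s * (q - c)) q, dist w c ≤ r → w = c + s * (q - c) := by
  have hd : 0 < dist q c := hr.trans h
  refine ⟨r / dist q c, div_pos hr hd, (div_lt_one hd).2 h, ?_, ?_⟩
  · rw [dist_eq_norm, add_sub_cancel_left, norm_mul, ← dist_eq_norm]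
    rw [Complex.norm_real, Real.norm_of_nonneg (by positivity)]
    field_simp
  · intro w hw hwr
    obtain ⟨t, ht0, ht1, rfl⟩ := mem_segment_iff_real.1 hw
    set s := r / dist q c with hs
    have hs1 : s < 1 := (div_lt_one hd).2 h
    have hs0 : 0 < s := div_pos hr hd
    have e : c + s * (q - c) + t * (q - (c + s * (q - c))) - c =
      ((s + t * (1 - s) : ℝ) : ℂ) * (q - c) := by push_cast; ring
    rw [dist_eq_norm, e, norm_mul, ← dist_eq_norm, Complex.norm_real,
      Real.norm_of_nonneg (by nlinarith)] at hwr
    have hle : s + t * (1 - s) ≤ s := by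
      rw [hs, le_div_iff₀ hd]
      exact hwr
    have ht : t = 0 := by nlinarith
    rw [ht]; simp

namespace LocalWall

/-- Subdivision of the edge that starts at `k`. -/
theorem exists_next (h : LocalWall next ov p j k r) (hr : r < dist (p (next k)) (p k))
    (hf : next k ≠ j) : ∃ s : ℝ, 0 < s ∧ s < 1 ∧
      (∀ x, x ≠ k → edgePoint next k s p ∉ polyEdge next p x) ∧
      LocalWall (insNext next k) (subOver next ov p k (edgePoint next k s p))
        (insPos p (edgePoint next k s p)) (some j) (some k) r ∧
      dist (edgePoint next k s p) (p k) = r := by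
  obtain ⟨s, hs0, hs1, hd, hw⟩ := exists_at_dist h.pos hr
  have hz := edgePoint_mem (next := next) (a := k) hs0 hs1 p
  change dist (edgePoint next k s p) (p k) = r at hd
  change ∀ w ∈ segment ℝ (edgePoint next k s p) (p (next k)), dist w (p k) ≤ r →
    w = edgePoint next k s p at hw
  set z := edgePoint next k s p with hzdef
  have hz' : z ∈ polyEdge next p k := openSegment_subset_segment _ _ _ hz
  have hzk : z ≠ p k := fun he => by
    rw [he, dist_self] at hd; exact h.pos.ne hd
  -- The point `z` is in the disc, so only the edge before `k` and the edge `j` need an argument.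
  -- Either one already contains the vertex `k`, so a second common point would cause an overlap and
  -- a forbidden incidence; `hf` excludes the permitted one.
  have hza : ∀ x, x ≠ k → z ∉ polyEdge next p x := by
    intro x hxk hx
    by_cases hxs : x = next.symm k
    · rw [hxs, h.edge_symm] at hx
      rcases overlap_of_shared_endpoint hx hz' hzk with c | c
      · rcases h.vertex k _ c with c | c | c
        · exact h.symm_ne c
        · exact h.symm_ne_next c
        · exact h.symm_ne c.2
      · rcases h.vertex (next.symm k) _ (by rw [h.edge_symm]; exact c) with c | c | c
        · exact h.symm_ne_next c.symm
        · rw [Equiv.apply_symm_apply] at c; exact h.next_ne k c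
        · exact h.next_ne k c.2
    by_cases hxj : x = j
    · rw [hxj] at hx
      rcases overlap_of_start_mem h.mem hz' hx hzk with c | c | c
      · rcases h.vertex j _ c with c | c | c
        · exact hf c
        · exact h.ne (next.injective c)
        · exact h.next_ne k c.2
      · rcases h.vertex k _ c with c | c | c
        · exact h.ne c.symm
        · exact hf c.symm
        · exact h.ne c.1
      · rcases h.vertex k _ c with c | c | c
        · exact h.ne_next c.symm
        · exact h.ne (next.injective c).symm
        · exact h.ne c.1
    rcases h.clear x hxs hxk hxj z hx hd.le with c | c
    · rcases h.vertex k (next.symm k) (by rw [← c]; exact hz') with c | c | c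
      · exact h.symm_ne c
      · exact h.symm_ne_next c
      · exact h.symm_ne c.2
    · rw [c] at hd; exact hr.ne' hd
  have hsymm : (insNext next k).symm (some k) = some (next.symm k) := by
    rw [Equiv.symm_apply_eq, insNext_some_of_ne _ h.symm_ne, Equiv.apply_symm_apply]
  refine ⟨s, hs0, hs1, hza, ⟨h.toVertexWall.subdivide h.next_ne h.ne hz hza,
    insNext_ne h.next_ne k, insNext_insNext_ne h.next_ne h.next_next_ne k,
    subOver_asymm h.asymm, fun _ _ c => c.2, ?_, ?_, h.pos⟩, hd⟩
  · rw [hsymm]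
    obtain ⟨v1, v2, v3, v4⟩ := h.virt
    exact ⟨fun c => v1 c.1, fun c => v2 c.1, fun c => v3 c.1, fun c => v4 c.1⟩
  · rw [hsymm]
    intro x hx1 hx2 hx3 w hwx hwr
    rw [insPos_some] at hwr
    rw [insNext_some_self, insPos_none, insPos_some]
    rcases x with _ | x
    · rw [polyEdge_ins_none] at hwx
      exact Or.inr (hw w hwx hwr)
    · have hxk : x ≠ k := fun c => hx2 (by rw [c])
      rw [polyEdge_ins_of_ne _ _ _ hxk] at hwx
      rcases h.clear x (fun c => hx1 (by rw [c])) hxk (fun c => hx3 (by rw [c])) w hwx hwr with c | c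
      · exact Or.inl c
      · rw [c] at hwr; exact absurd hwr (not_le.2 hr)

/-- Subdivision of the edge that ends at `k`. -/
theorem exists_prev (h : LocalWall next ov p j k r) (hr : r < dist (p (next.symm k)) (p k))
    (hf : next j ≠ next.symm k) : ∃ s : ℝ, 0 < s ∧ s < 1 ∧
      (∀ x, x ≠ next.symm k → edgePoint next (next.symm k) s p ∉ polyEdge next p x) ∧
      LocalWall (insNext next (next.symm k))
        (subOver next ov p (next.symm k) (edgePoint next (next.symm k) s p))
        (insPos p (edgePoint next (next.symm k) s p)) (some j) (some k) r ∧
      dist (edgePoint next (next.symm k) s p) (p k) = r := by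
  obtain ⟨s, hs0, hs1, hd, hw⟩ := exists_at_dist h.pos hr
  -- This edge runs towards `k`, so the parameter `s` counted from `k` becomes `1 - s`.
  have hpt : edgePoint next (next.symm k) (1 - s) p = p k + s * (p (next.symm k) - p k) := by
    rw [edgePoint, Equiv.apply_symm_apply]; push_cast; ring
  have hz := edgePoint_mem (next := next) (a := next.symm k) (s := 1 - s) (by linarith)
    (by linarith) p
  rw [← hpt] at hd hw
  set z := edgePoint next (next.symm k) (1 - s) p with hzdef
  have hz' : z ∈ polyEdge next p (next.symm k) := openSegment_subset_segment _ _ _ hz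
  have hz'' : z ∈ segment ℝ (p k) (p (next.symm k)) := by
    rw [segment_symm, ← h.edge_symm]; exact hz'
  have hzk : z ≠ p k := fun he => by
    rw [he, dist_self] at hd; exact h.pos.ne hd
  have hks : k ≠ next.symm k := h.symm_ne.symm
  have hza : ∀ x, x ≠ next.symm k → z ∉ polyEdge next p x := by
    intro x hxs hx
    by_cases hxk : x = k
    · rw [hxk] at hx
      rw [h.edge_symm] at hz'
      rcases overlap_of_shared_endpoint hz' hx hzk with c | c
      · rcases h.vertex k _ c with c | c | c
        · exact h.symm_ne c
        · exact h.symm_ne_next c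
        · exact h.symm_ne c.2
      · rcases h.vertex (next.symm k) _ (by rw [h.edge_symm]; exact c) with c | c | c
        · exact h.symm_ne_next c.symm
        · rw [Equiv.apply_symm_apply] at c; exact h.next_ne k c
        · exact h.next_ne k c.2
    by_cases hxj : x = j
    · rw [hxj] at hx
      rcases overlap_of_start_mem h.mem hz'' hx hzk with c | c | c
      · rcases h.vertex j _ c with c | c | c
        · exact h.ne_symm c.symm
        · exact hf c.symm
        · exact h.symm_ne c.2
      · rw [segment_symm, ← h.edge_symm] at c
        rcases h.vertex _ _ c with c | c | c
        · exact h.ne_symm c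
        · rw [Equiv.apply_symm_apply] at c; exact h.ne c.symm
        · exact h.ne_symm c.1.symm
      · rw [segment_symm, ← h.edge_symm] at c
        rcases h.vertex _ _ c with c | c | c
        · exact hf c
        · rw [Equiv.apply_symm_apply] at c; exact h.ne_next c.symm
        · exact h.ne_next c.2.symm
    rcases h.clear x hxs hxk hxj z hx hd.le with c | c
    · rw [c] at hd; exact hr.ne' hd
    · rcases h.vertex (next.symm k) (next k) (by rw [← c]; exact hz') with c | c | c
      · exact h.symm_ne_next c.symm
      · rw [Equiv.apply_symm_apply] at c; exact h.next_ne k c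
      · exact h.next_ne k c.2
  have hsymm : (insNext next (next.symm k)).symm (some k) = none := by
    rw [Equiv.symm_apply_eq, insNext_none, Equiv.apply_symm_apply]
  refine ⟨1 - s, by linarith, by linarith, hza,
    ⟨h.toVertexWall.subdivide h.next_ne h.ne_symm.symm hz hza,
    insNext_ne h.next_ne _, insNext_insNext_ne h.next_ne h.next_next_ne _,
    subOver_asymm h.asymm, fun _ _ c => c.2, ?_, ?_, h.pos⟩, hd⟩
  · rw [hsymm]
    obtain ⟨v1, v2, v3, v4⟩ := h.virt
    exact ⟨fun c => v1 c.1, fun c => v2 c.1, fun c => v3 c.1, fun c => v4 c.1⟩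
  · rw [hsymm]
    intro x hx1 hx2 hx3 w hwx hwr
    rw [insPos_some] at hwr
    rw [insNext_some_of_ne _ hks, insPos_none, insPos_some]
    rcases x with _ | x
    · exact absurd rfl hx1
    · by_cases hxs : x = next.symm k
      · rw [hxs, polyEdge_ins_self, segment_symm] at hwx
        exact Or.inl (hw w hwx hwr)
      rw [polyEdge_ins_of_ne _ _ _ hxs] at hwx
      rcases h.clear x hxs (fun c => hx2 (by rw [c])) (fun c => hx3 (by rw [c])) w hwx hwr with c | c
      · rw [c] at hwr; exact absurd hwr (not_le.2 hr)
      · exact Or.inr c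

/-- A wall where the edge `j` is not adjacent to `k` on the side of the next vertex. -/
theorem nice_of_next_far [Finite ι] (h : LocalWall next ov p j k r)
    (h1 : dist (p (next.symm k)) (p k) ≤ r) (h2 : r < dist (p (next k)) (p k))
    (hj : r < dist (p j) (p k)) (hf : next k ≠ j) : Nice next ov p := by
  obtain ⟨s, hs0, hs1, hza, hL, hd⟩ := h.exists_next h2 hf
  have hsymm : (insNext next k).symm (some k) = some (next.symm k) := by
    rw [Equiv.symm_apply_eq, insNext_some_of_ne _ h.symm_ne, Equiv.apply_symm_apply]
  refine Nice.of_subdivide hs0 hs1 hza (hL.nice_of_near ?_ ?_ (Or.inl hj) ?_)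
  · rw [hsymm]; exact h1
  · rw [insNext_some_self]; exact hd.le
  · rw [insNext_some_self, insNext_none, insNext_some_of_ne _ (h.next_ne k)]
    simpa using h.next_next_ne k

/-- A wall where the next edge folds back over the edge at `k`. -/
theorem nice_of_prev_far [Finite ι] (h : LocalWall next ov p j k r)
    (h1 : r < dist (p (next.symm k)) (p k)) (h2 : dist (p (next k)) (p k) ≤ r)
    (hj : r < dist (p j) (p k) ∨ j = next k) (hf : next j ≠ next.symm k) : Nice next ov p := by
  obtain ⟨s, hs0, hs1, hza, hL, hd⟩ := h.exists_prev h1 hf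
  have hsymm : (insNext next (next.symm k)).symm (some k) = none := by
    rw [Equiv.symm_apply_eq, insNext_none, Equiv.apply_symm_apply]
  have hks : k ≠ next.symm k := h.symm_ne.symm
  refine Nice.of_subdivide hs0 hs1 hza (hL.nice_of_near ?_ ?_ ?_ ?_)
  · rw [hsymm]; exact hd.le
  · rw [insNext_some_of_ne _ hks]; exact h2
  · rw [insNext_some_of_ne _ hks]; simpa using hj
  · rw [insNext_some_of_ne _ hks, insNext_some_of_ne _ h.symm_ne_next.symm]
    by_cases hc : next (next k) = next.symm k
    · rw [hc, insNext_some_self]; simp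
    · rw [insNext_some_of_ne _ hc]
      intro he
      simp only [Option.some.injEq] at he
      exact hc ((Equiv.eq_symm_apply next).2 he)

/-- A wall where the edge `j` is not adjacent to the edges at `k`. -/
theorem nice_of_far [Finite ι] (h : LocalWall next ov p j k r)
    (h1 : r < dist (p (next.symm k)) (p k)) (h2 : r < dist (p (next k)) (p k))
    (hj : r < dist (p j) (p k)) (hf : next j ≠ next.symm k) (hf' : next k ≠ j) :
    Nice next ov p := by
  obtain ⟨s, hs0, hs1, hza, hL, hd⟩ := h.exists_prev h1 hf
  have hsymm : (insNext next (next.symm k)).symm (some k) = none := by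
    rw [Equiv.symm_apply_eq, insNext_none, Equiv.apply_symm_apply]
  have hks : k ≠ next.symm k := h.symm_ne.symm
  refine Nice.of_subdivide hs0 hs1 hza (hL.nice_of_next_far ?_ ?_ hj ?_)
  · rw [hsymm]; exact hd.le
  · rw [insNext_some_of_ne _ hks]; exact h2
  · rw [insNext_some_of_ne _ hks]; simpa using hf'

end LocalWall

/-- A wall configuration where the edge `j` is not adjacent to the edges at the vertex `k` is
nice. -/
theorem VertexWall.nice [Finite ι] (h : VertexWall next p j k) (hn : ∀ i, next i ≠ i)
    (hnn : ∀ i, next (next i) ≠ i) (hasymm : ∀ x y, ov x y → ¬ ov y x)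
    (hc : ∀ x y, ov x y → polyCrosses next p x y)
    (hv : ¬ ov j k ∧ ¬ ov k j ∧ ¬ ov j (next.symm k) ∧ ¬ ov (next.symm k) j)
    (hf : next j ≠ next.symm k) (hf' : next k ≠ j) : Nice next ov p := by
  have hinj : ∀ v, v ≠ k → p v ≠ p k := by
    intro v hvk he
    have hsk : next.symm k ≠ k := fun he => hn k ((Equiv.symm_apply_eq next).1 he).symm
    rcases h.vertex k v (by rw [he]; exact left_mem_segment _ _ _) with h1 | h1 | h1
    · exact hvk h1
    · rcases h.vertex (next.symm k) v (by
        rw [polyEdge, Equiv.apply_symm_apply, he]; exact right_mem_segment _ _ _) with h2 | h2 | h2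
      · exact hnn k ((Equiv.symm_apply_eq next).1 (h2.symm.trans h1)).symm
      · rw [Equiv.apply_symm_apply] at h2; exact hvk h2
      · exact hvk h2.2
    · exact hvk h1.2
  -- A small enough disc around `k` misses all edges not through `k` and all other vertices, so both
  -- edges at `k` leave it and are to be subdivided.
  have hev : ∀ᶠ r : ℝ in 𝓝[>] 0, (∀ x, x ≠ next.symm k → x ≠ k → x ≠ j →
      ∀ z ∈ polyEdge next p x, r < dist z (p k)) ∧ ∀ v, v ≠ k → r < dist (p v) (p k) := by
    refine Filter.Eventually.and (eventually_all.2 fun x => ?_) (eventually_all.2 fun v => ?_)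
    · by_cases hx : p k ∈ polyEdge next p x
      · refine Eventually.of_forall fun r h1 h2 h3 => ?_
        rcases h.edge_of_mem hx with c | c | c
        exacts [absurd c h1, absurd c h2, absurd c h3]
      · have hpos : 0 < Metric.infDist (p k) (polyEdge next p x) :=
          ((isClosed_polyEdge next p x).notMem_iff_infDist_pos ⟨_, left_mem_segment _ _ _⟩).1 hx
        filter_upwards [(eventually_lt_nhds hpos).filter_mono nhdsWithin_le_nhds]
          with r hr _ _ _ z hz
        rw [dist_comm]
        exact hr.trans_le (Metric.infDist_le_dist_of_mem hz)
    · by_cases hvk : v = k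
      · exact Eventually.of_forall fun r h => absurd hvk h
      · filter_upwards [(eventually_lt_nhds (dist_pos.2 (hinj v hvk))).filter_mono
          nhdsWithin_le_nhds] with r hr _
        exact hr
  obtain ⟨r, ⟨h1, h2⟩, hr⟩ := (hev.and self_mem_nhdsWithin).exists
  have hL : LocalWall next ov p j k r := ⟨h, hn, hnn, hasymm, hc, hv,
    fun x a b c z hz hzr => absurd hzr (not_le.2 (h1 x a b c z hz)), hr⟩
  exact hL.nice_of_far (h2 _ hL.symm_ne) (h2 _ (hn k)) (h2 _ h.ne.symm) hf hf'

end VertexWallLocal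

/-! ## An edge passing through a crossing -/

section TripleWall

variable {ι κ : Type}

/-- The positions `p` are generic, except that the edges `e`, `f`, `g` have a common point. -/
structure TripleWall (next : Equiv.Perm ι) (p : ι → ℂ) (e f g : ι) (X : ℂ) : Prop where
  ef : polyCrosses next p e f
  eg : polyCrosses next p e g
  fg : polyCrosses next p f g
  mem_e : X ∈ polyEdge next p e
  mem_f : X ∈ polyEdge next p f
  mem_g : X ∈ polyEdge next p g
  vertex : ∀ i l, p l ∈ polyEdge next p i → l = i ∨ l = next i
  triple : ∀ x y z, x ≠ y → y ≠ z → x ≠ z → ∀ w, w ∈ polyEdge next p x → w ∈ polyEdge next p y →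
    w ∈ polyEdge next p z → x = e ∨ x = f ∨ x = g

/-- A function vanishing on the wall where the edges `e`, `f`, `g` have a common point. -/
def tripleWallFun (next : Equiv.Perm ι) (e f g : ι) (p : ι → ℂ) : ℝ :=
  planeDet (p (next e) - p e) (p (next f) - p f) * planeDet (p (next g) - p g) (p e - p g) +
    planeDet (p f - p e) (p (next f) - p f) * planeDet (p (next g) - p g) (p (next e) - p e)

/-- By Cramer's rule the parameter of `X` on `e` is a quotient of determinants. `tripleWallFun` is
the signed offset of `X` from the line of `g` with this denominator cleared, hence a polynomial
defined for all positions. -/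
theorem tripleWallFun_eq {next : Equiv.Perm ι} {e f g : ι} {p : ι → ℂ} {X : ℂ}
    (he : X ∈ polyEdge next p e) (hf : X ∈ polyEdge next p f) :
    tripleWallFun next e f g p = planeDet (p (next e) - p e) (p (next f) - p f) *
      planeDet (p (next g) - p g) (X - p g) := by
  obtain ⟨s, -, -, hs⟩ := mem_segment_iff_real.1 he
  obtain ⟨t, -, -, ht⟩ := mem_segment_iff_real.1 hf
  have h1 : p f - p e = s * (p (next e) - p e) - t * (p (next f) - p f) := by
    linear_combination ht.symm.trans hs
  have h2 : X - p g = (p e - p g) + s * (p (next e) - p e) := by rw [hs]; ring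
  rw [tripleWallFun, h1, h2, planeDet_sub_left ((s : ℂ) * (p (next e) - p e)), planeDet_mul_left,
    planeDet_mul_left, planeDet_self, planeDet_add_right (p (next g) - p g) (p e - p g),
    planeDet_mul_right]
  ring

theorem eq_of_lines {a b c d z w : ℂ} (h : planeDet (b - a) (d - c) ≠ 0)
    (hz1 : planeDet (b - a) (z - a) = 0) (hz2 : planeDet (d - c) (z - c) = 0)
    (hw1 : planeDet (b - a) (w - a) = 0) (hw2 : planeDet (d - c) (w - c) = 0) : z = w := by
  have hba : b - a ≠ 0 := by
    intro h0; rw [h0, planeDet_zero_left] at h; exact h rfl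
  have h1 : planeDet (b - a) (z - w) = 0 := by
    rw [show z - w = (z - a) - (w - a) by ring, planeDet_sub_right, hz1, hw1, sub_zero]
  have h2 : planeDet (d - c) (z - w) = 0 := by
    rw [show z - w = (z - c) - (w - c) by ring, planeDet_sub_right, hz2, hw2, sub_zero]
  obtain ⟨t, ht⟩ := exists_real_mul_of_planeDet_eq_zero hba h1
  rw [ht, planeDet_mul_right, planeDet_swap] at h2
  have : t = 0 := by
    rcases mul_eq_zero.1 h2 with h | h
    · exact h
    · exact absurd (by linarith) ‹planeDet (b - a) (d - c) ≠ 0›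
  rw [this] at ht
  simpa [sub_eq_zero] using ht

theorem eq_of_mem_segments {a b c d z w : ℂ} (h : planeDet (b - a) (d - c) ≠ 0)
    (hz1 : z ∈ segment ℝ a b) (hz2 : z ∈ segment ℝ c d) (hw1 : w ∈ segment ℝ a b)
    (hw2 : w ∈ segment ℝ c d) : z = w :=
  eq_of_lines h (planeDet_eq_zero_of_mem_segment hz1) (planeDet_eq_zero_of_mem_segment hz2)
    (planeDet_eq_zero_of_mem_segment hw1) (planeDet_eq_zero_of_mem_segment hw2)

theorem signCross_of_vertex {next : Equiv.Perm ι} {p : ι → ℂ}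
    (hp : ∀ i l, p l ∈ polyEdge next p i → l = i ∨ l = next i) {i j : ι}
    (h : polyCrosses next p i j) : SignCross (p i) (p (next i)) (p j) (p (next j)) := by
  obtain ⟨h1, h2, h3, h4⟩ := h
  refine signCross_of_meet ?_ ?_ ?_ ?_ h4
  · intro h; rcases hp j i h with h | h
    · exact h1 h
    · exact h3 h.symm
  · intro h; rcases hp j (next i) h with h | h
    · exact h2 h
    · exact h1 (next.injective h)
  · intro h; rcases hp i j h with h | h
    · exact h1 h.symm
    · exact h2 h.symm
  · intro h; rcases hp i (next j) h with h | h
    · exact h3 h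
    · exact h1 (next.injective h).symm

theorem SignCross.det_ne {a b c d : ℂ} (h : SignCross a b c d) : planeDet (b - a) (d - c) ≠ 0 := by
  intro h0
  have e1 : planeDet (b - a) (d - a) = planeDet (b - a) (c - a) := by
    have : d - a = (c - a) + (d - c) := by ring
    rw [this, planeDet_add_right, h0, add_zero]
  have := h.1
  rw [e1] at this
  nlinarith [mul_self_nonneg (planeDet (b - a) (c - a))]

variable {next : Equiv.Perm ι} {ov : ι → ι → Prop} {p p₀ : ι → ℂ} {e f g : ι} {X : ℂ}

namespace TripleWall

theorem det_ef (h : TripleWall next p e f g X) :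
    planeDet (p (next e) - p e) (p (next f) - p f) ≠ 0 := (signCross_of_vertex h.vertex h.ef).det_ne

theorem det_eg (h : TripleWall next p e f g X) :
    planeDet (p (next e) - p e) (p (next g) - p g) ≠ 0 := (signCross_of_vertex h.vertex h.eg).det_ne

theorem det_fg (h : TripleWall next p e f g X) :
    planeDet (p (next f) - p f) (p (next g) - p g) ≠ 0 := (signCross_of_vertex h.vertex h.fg).det_ne

theorem fun_eq_zero (h : TripleWall next p e f g X) : tripleWallFun next e f g p = 0 := by
  rw [tripleWallFun_eq h.mem_e h.mem_f, planeDet_eq_zero_of_mem_segment h.mem_g, mul_zero]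

/-- Triple points nearby can only involve edges that have one at `p₀`, hence `e`, `f` and `g`; a
common point of these makes the wall function vanish. -/
theorem eventually_gen [Finite ι] (h : TripleWall next p₀ e f g X) :
    ∀ᶠ p in 𝓝 p₀, tripleWallFun next e f g p ≠ 0 → Gen next p := by
  have h1 : ∀ᶠ p in 𝓝 p₀, ∀ i l, p l ∈ polyEdge next p i → l = i ∨ l = next i := by
    refine eventually_all.2 fun i => eventually_all.2 fun l => ?_
    by_cases hl : p₀ l ∈ polyEdge next p₀ i
    · exact Eventually.of_forall fun p _ => h.vertex i l hl
    · filter_upwards [eventually_vertex_notMem hl] with p hp h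
      exact absurd h hp
  have h2 : ∀ᶠ p in 𝓝 p₀, ∀ x y z, x ≠ y → y ≠ z → x ≠ z →
      (∃ w, w ∈ polyEdge next p x ∧ w ∈ polyEdge next p y ∧ w ∈ polyEdge next p z) →
      (∃ w, w ∈ polyEdge next p₀ x ∧ w ∈ polyEdge next p₀ y ∧ w ∈ polyEdge next p₀ z) := by
    refine eventually_all.2 fun x => eventually_all.2 fun y => eventually_all.2 fun z => ?_
    by_cases hw : ∃ w, w ∈ polyEdge next p₀ x ∧ w ∈ polyEdge next p₀ y ∧ w ∈ polyEdge next p₀ z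
    · exact Eventually.of_forall fun _ _ _ _ _ => hw
    · filter_upwards [eventually_not_triple hw] with p hp _ _ _ h
      exact absurd h hp
  filter_upwards [h1, h2] with p hp1 hp2 hf
  refine ⟨hp1, fun x y z hxy hyz hxz w hwx hwy hwz => ?_⟩
  obtain ⟨w₀, hx, hy, hz⟩ := hp2 x y z hxy hyz hxz ⟨w, hwx, hwy, hwz⟩
  have key : w ∈ polyEdge next p e → w ∈ polyEdge next p f → w ∈ polyEdge next p g → False := by
    intro ha hb hc
    apply hf
    rw [tripleWallFun_eq ha hb, planeDet_eq_zero_of_mem_segment hc, mul_zero]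
  rcases h.triple x y z hxy hyz hxz w₀ hx hy hz with rfl | rfl | rfl <;>
  rcases h.triple y z x hyz hxz.symm hxy.symm w₀ hy hz hx with rfl | rfl | rfl <;>
  first
  | exact hxy rfl
  | (rcases h.triple z _ _ hxz.symm hxy hyz.symm w₀ hz hx hy with rfl | rfl | rfl <;>
      first
      | exact hyz rfl
      | exact hxz rfl
      | exact key (by assumption) (by assumption) (by assumption))

/-- The crossings of `e` with `f` and with `g` persist. On the wall the first lies on the line of
`g`, hence it equals the second, and this is a triple point. -/
theorem eventually_not_gen (h : TripleWall next p₀ e f g X) :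
    ∀ᶠ p in 𝓝 p₀, tripleWallFun next e f g p = 0 → ¬ Gen next p := by
  filter_upwards [eventually_signCross (signCross_of_vertex h.vertex h.ef),
    eventually_signCross (signCross_of_vertex h.vertex h.eg)] with p h1 h2 hf hg
  obtain ⟨w, hw1, hw2⟩ := h1.nonempty
  obtain ⟨w', hw1', hw2'⟩ := h2.nonempty
  rw [tripleWallFun_eq hw1 hw2] at hf
  have hwg := (mul_eq_zero.1 hf).resolve_left h1.det_ne
  have : w = w' := eq_of_lines h2.det_ne (planeDet_eq_zero_of_mem_segment hw1) hwg
    (planeDet_eq_zero_of_mem_segment hw1') (planeDet_eq_zero_of_mem_segment hw2')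
  exact hg.2 e f g h.ef.1 h.fg.1 h.eg.1 w hw1 hw2 (this ▸ hw2')

theorem nice_of_pair [Finite ι] (h : TripleWall next p₀ e f g X)
    (hpair : ∀ V ∈ 𝓝 p₀, ∃ D E : VDiagram ι, D.next = next ∧ D.isOver = ov ∧ D.pos ∈ V ∧
      0 < tripleWallFun next e f g D.pos ∧ E.next = next ∧ E.isOver = ov ∧ E.pos ∈ V ∧
      tripleWallFun next e f g E.pos < 0 ∧ D.link = E.link) : Nice next ov p₀ := by
  classical
  set σ := planeDet (p₀ (next e) - p₀ e) (p₀ (next f) - p₀ f) with hσ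
  -- The wall is crossed by translating the edge `g` along its normal. The factor `-σ` makes the
  -- slope of the wall function at `p₀` a positive multiple of `σ ^ 2`.
  set n : ℂ := ((-σ : ℝ) : ℂ) * (Complex.I * (p₀ (next g) - p₀ g)) with hn
  have hdg : p₀ (next g) - p₀ g ≠ 0 := by
    intro h0
    have := h.det_eg
    rw [h0, planeDet_zero_right] at this
    exact this rfl
  have e1 : e ≠ g := h.eg.1
  have e2 : e ≠ next g := h.eg.2.2.1.symm
  have e3 : next e ≠ g := h.eg.2.1
  have e4 : next e ≠ next g := fun c => h.eg.1 (next.injective c)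
  have f1 : f ≠ g := h.fg.1
  have f2 : f ≠ next g := h.fg.2.2.1.symm
  have f3 : next f ≠ g := h.fg.2.1
  have f4 : next f ≠ next g := fun c => h.fg.1 (next.injective c)
  have g1 : next g ≠ g := by
    intro c; apply hdg; rw [c, sub_self]
  have hσ0 : σ ≠ 0 := h.det_ef
  refine nice_of_wall (f := tripleWallFun next e f g)
    (c := fun p => - (planeDet (p (next e) - p e) (p (next f) - p f) *
      planeDet (p (next g) - p g) n))
    (w := Pi.single g n + Pi.single (next g) n) ?_ (by fun_prop) ?_ h.fun_eq_zero ?_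
    h.eventually_gen h.eventually_not_gen hpair
  · unfold tripleWallFun; fun_prop
  · intro p s
    simp only [tripleWallFun, Pi.add_apply, Pi.smul_apply, Pi.single_eq_same,
      Pi.single_eq_of_ne e1, Pi.single_eq_of_ne e2, Pi.single_eq_of_ne e3, Pi.single_eq_of_ne e4,
      Pi.single_eq_of_ne f1, Pi.single_eq_of_ne f2, Pi.single_eq_of_ne f3, Pi.single_eq_of_ne f4,
      Pi.single_eq_of_ne g1, Pi.single_eq_of_ne g1.symm, smul_zero, add_zero, zero_add,
      Complex.real_smul]
    rw [show p (next g) + s * n - (p g + s * n) = p (next g) - p g by ring,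
      show p e - (p g + s * n) = (p e - p g) - s * n by ring, planeDet_sub_right _ _ (s * n),
      planeDet_mul_right]
    ring
  · simp only [hn, planeDet_mul_right]
    have := planeDet_I_mul_pos hdg
    have h2 : 0 < σ ^ 2 := by positivity
    calc (0 : ℝ) < σ ^ 2 * planeDet (p₀ (next g) - p₀ g) (Complex.I * (p₀ (next g) - p₀ g)) := by
          positivity
      _ = _ := by rw [hσ]; ring

/-- Subdivision of the edge `g` does not affect the wall. -/
theorem subdivide (h : TripleWall next p e f g X) (hn : ∀ i, next i ≠ i) {z : ℂ} {g' : Option ι}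
    (hg' : g' = none ∨ g' = some g) (hz : z ∈ openSegment ℝ (p g) (p (next g)))
    (hza : ∀ x, x ≠ g → z ∉ polyEdge next p x)
    (hX : X ∈ polyEdge (insNext next g) (insPos p z) g') :
    TripleWall (insNext next g) (insPos p z) (some e) (some f) g' X := by
  have e1 : e ≠ g := h.eg.1
  have f1 : f ≠ g := h.fg.1
  have hz' := openSegment_subset_segment _ _ _ hz
  have hcr : ∀ x, polyCrosses next p x g → X ∈ polyEdge next p x →
      polyCrosses (insNext next g) (insPos p z) (some x) g' := by
    rintro x ⟨c1, c2, c3, -⟩ hXx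
    refine ⟨?_, ?_, ?_, X, by rwa [polyEdge_ins_of_ne _ _ _ c1], hX⟩
    · rcases hg' with rfl | rfl <;> simp [c1]
    · rw [insNext_some_of_ne _ c1]
      rcases hg' with rfl | rfl <;> simp [c2]
    · rcases hg' with rfl | rfl <;> simp [c3]
  refine ⟨(polyCrosses_ins_iff e1 f1).2 h.ef, hcr e h.eg h.mem_e, hcr f h.fg h.mem_f,
    by rw [polyEdge_ins_of_ne _ _ _ e1]; exact h.mem_e,
    by rw [polyEdge_ins_of_ne _ _ _ f1]; exact h.mem_f, hX, ?_, ?_⟩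
  · intro i l hl
    rcases subdivide_vertex hn hz hza hl with c | c | ⟨i', l', ⟨rfl, rfl, hi, c⟩ | ⟨l', rfl, h1, h2, c⟩⟩
    · exact Or.inl c
    · exact Or.inr c
    · rcases h.vertex _ _ c with c | c
      · left; rw [c]
      · right; rw [insNext_some_of_ne _ hi, c]
    · rcases h.vertex _ _ c with c | c
      · exact absurd c h1
      · exact absurd c h2
  · intro x y u hxy hyu hxu w hx hy hu
    have d1 := getD_distinct_of_common hz hza hxy hyu hxu hx hy hu
    have d2 := getD_distinct_of_common hz hza hyu hxu.symm hxy.symm hy hu hx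
    have d3 := getD_distinct_of_common hz hza hxu hyu.symm hxy hx hu hy
    have mx := polyEdge_sub_subset hz' x hx
    have my := polyEdge_sub_subset hz' y hy
    have mu := polyEdge_sub_subset hz' u hu
    have tx := h.triple _ _ _ d1 d2 d3 w mx my mu
    have ty := h.triple _ _ _ d2 d3.symm d1.symm w my mu mx
    have tu := h.triple _ _ _ d3.symm d1 d2.symm w mu mx my
    by_cases hxg : x.getD g = g
    · have hw : w = X := by
        have hef : (w ∈ polyEdge next p e ∧ w ∈ polyEdge next p f) := by
          rw [hxg] at d1 d3
          rcases ty with c | c | c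
          · rcases tu with c' | c' | c'
            · exact absurd (c.trans c'.symm) d2
            · rw [c] at my; rw [c'] at mu; exact ⟨my, mu⟩
            · exact absurd c'.symm d3
          · rcases tu with c' | c' | c'
            · rw [c] at my; rw [c'] at mu; exact ⟨mu, my⟩
            · exact absurd (c.trans c'.symm) d2
            · exact absurd c'.symm d3
          · exact absurd c.symm d1
        exact eq_of_mem_segments h.det_ef hef.1 hef.2 h.mem_e h.mem_f
      right; right
      by_contra hne
      -- If `x` were the other half of `g`, then `X` would be on both halves and so be the dividing
      -- point, which lies on no edge but `g`.
      have hXz : X = z := by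
        rw [hw] at hx
        have hcase : ∀ o : Option ι, o.getD g = g → o = none ∨ o = some g := by
          rintro (_ | o) ho
          · exact Or.inl rfl
          · exact Or.inr (by simpa using ho)
        rcases hcase x hxg with rfl | rfl <;> rcases hg' with rfl | rfl
        · exact absurd rfl hne
        · rw [polyEdge_ins_none] at hx; rw [polyEdge_ins_self] at hX
          exact eq_of_mem_both_halves hz hX hx
        · rw [polyEdge_ins_none] at hX; rw [polyEdge_ins_self] at hx
          exact eq_of_mem_both_halves hz hx hX
        · exact absurd rfl hne
      exact hza e e1 (hXz ▸ h.mem_e)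
    · rcases x with _ | x
      · exact absurd rfl hxg
      · rcases tx with c | c | c
        · left; simpa using c
        · right; left; simpa using c
        · exact absurd c hxg

end TripleWall

theorem convex_strip (X u : ℂ) (c : ℝ) :
    Convex ℝ {z : ℂ | -c ≤ planeDet (z - X) u ∧ planeDet (z - X) u ≤ c} := by
  intro x hx y hy a b ha hb hab
  rw [Set.mem_ofPred_eq] at hx hy ⊢
  have e : a • x + b • y - X = a * (x - X) + b * (y - X) := by
    have : (a : ℂ) + b = 1 := by exact_mod_cast hab
    simp only [Complex.real_smul]
    linear_combination X * this
  rw [e, planeDet_add_left, planeDet_mul_left, planeDet_mul_left]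
  constructor <;> nlinarith

/-- A configuration with a triple point `X` on a short edge `a`, which has `X` as its midpoint, is
nice. -/
theorem TripleWall.nice_of_local [Finite κ] {m : Equiv.Perm κ} {ov : κ → κ → Prop} {p : κ → ℂ}
    {e f a : κ} {X v : ℂ} (h : TripleWall m p e f a X) (hn : ∀ i, m i ≠ i)
    (hnn : ∀ i, m (m i) ≠ i) (hasymm : ∀ x y, ov x y → ¬ ov y x)
    (hovc : ∀ x y, ov x y → polyCrosses m p x y) (hv : ∀ y, ¬ ov a y ∧ ¬ ov y a) (hv0 : v ≠ 0)
    (hpa : p a = X - v) (hpma : p (m a) = X + v) {c c' : ℝ} (hc : 1 < c) (hc' : 1 < c')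
    (hprev : p (m.symm a) = X - c * v) (hnext : p (m (m a)) = X + c' * v)
    (hclear : ∀ x, x ≠ e → x ≠ f → x ≠ a → x ≠ m.symm a → x ≠ m a →
      ∀ z ∈ polyEdge m p x, 2 * ‖v‖ < dist z X) : Nice m ov p := by
  classical
  have hvn : 0 < ‖v‖ := norm_pos_iff.2 hv0
  have hdet : 0 < planeDet v (Complex.I * v) := planeDet_I_mul_pos hv0
  have hea : e ≠ a := h.eg.1
  have hmea : m e ≠ a := h.eg.2.1
  have hfa : f ≠ a := h.fg.1
  have hmfa : m f ≠ a := h.fg.2.1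
  have hmaa : m a ≠ a := hn a
  have hsa : m.symm a ≠ a := fun c => hn a ((Equiv.symm_apply_eq m).1 c).symm
  have hedge_prev : polyEdge m p (m.symm a) = segment ℝ (p (m.symm a)) (p a) := by
    rw [polyEdge, Equiv.apply_symm_apply]
  -- the new vertex
  have hZ : edgePoint m a (3 / 4) p = X + v / 2 := by
    rw [edgePoint, hpa, hpma]; push_cast; ring
  have hZmem := edgePoint_mem (next := m) (a := a) (s := 3 / 4) (by norm_num) (by norm_num) p
  have hZseg : edgePoint m a (3 / 4) p ∈ polyEdge m p a := openSegment_subset_segment _ _ _ hZmem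
  have hZX : X ≠ edgePoint m a (3 / 4) p := by
    rw [hZ]; intro h0
    apply hv0
    linear_combination -2 * h0
  have hza : ∀ x, x ≠ a → edgePoint m a (3 / 4) p ∉ polyEdge m p x := by
    intro x hxa hx
    by_cases hxe : x = e
    · rw [hxe] at hx
      exact hZX (eq_of_mem_segments h.det_eg h.mem_e h.mem_g hx hZseg)
    by_cases hxf : x = f
    · rw [hxf] at hx
      exact hZX (eq_of_mem_segments h.det_fg h.mem_f h.mem_g hx hZseg)
    by_cases hxs : x = m.symm a
    · rw [hxs, hedge_prev, hprev, hpa, hZ] at hx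
      obtain ⟨t, ht0, ht1, ht⟩ := mem_segment_iff_real.1 hx
      have : ((3 / 2 + (c - 1) * (1 - t) : ℝ) : ℂ) * v = 0 := by
        push_cast; linear_combination ht
      rcases mul_eq_zero.1 this with h0 | h0
      · have h0 : 3 / 2 + (c - 1) * (1 - t) = 0 := by exact_mod_cast h0
        nlinarith
      · exact hv0 h0
    by_cases hxm : x = m a
    · rw [hxm, polyEdge, hpma, hnext, hZ] at hx
      obtain ⟨t, ht0, ht1, ht⟩ := mem_segment_iff_real.1 hx
      have : ((1 / 2 + (c' - 1) * t : ℝ) : ℂ) * v = 0 := by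
        push_cast; linear_combination -ht
      rcases mul_eq_zero.1 this with h0 | h0
      · have h0 : 1 / 2 + (c' - 1) * t = 0 := by exact_mod_cast h0
        nlinarith
      · exact hv0 h0
    · have := hclear x hxe hxf hxa hxs hxm _ hx
      rw [hZ, dist_eq_norm, add_sub_cancel_left, norm_div] at this
      have h2 : ‖(2 : ℂ)‖ = 2 := by simp
      rw [h2] at this
      linarith
  have hXhalf : X ∈ polyEdge (insNext m a) (insPos p (edgePoint m a (3 / 4) p)) (some a) := by
    rw [polyEdge_ins_self, hZ, hpa]
    refine mem_segment_iff_real.2 ⟨2 / 3, by norm_num, by norm_num, ?_⟩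
    push_cast; ring
  have hq := h.subdivide hn (g' := some a) (Or.inr rfl) hZmem hza hXhalf
  refine Nice.of_subdivide (by norm_num) (by norm_num) hza (hq.nice_of_pair fun V hV => ?_)
  -- the perturbed configurations
  set n : ℂ := Complex.I * v with hndef
  let q : ℝ → κ → ℂ := fun ε => Function.update p a (X - v - ε * n)
  have hqc : Continuous q := by
    apply continuous_const.update a; fun_prop
  have hq0 : q 0 = p := by
    simp only [q]; rw [Function.update_eq_iff]; simp [hpa]
  have hqa : ∀ ε, q ε a = X - v - ε * n := fun ε => Function.update_self _ _ _
  have hqne : ∀ ε x, x ≠ a → q ε x = p x := fun ε x hx => Function.update_of_ne hx _ _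
  -- In `q ε` the edge `a` passes `X` on one side, since its start has moved by `-ε * n`.
  -- Subdividing it gives `rm ε`, while `rp ε` has the new vertex displaced by `ε * n`, so that the
  -- first half passes `X` on the other side.
  let rp : ℝ → Option κ → ℂ := fun ε => insPos (q ε) (X + v / 2 + ε * n)
  let rm : ℝ → Option κ → ℂ := fun ε => insPos (q ε) (edgePoint m a (3 / 4) (q ε))
  have hrpc : Continuous rp := continuous_insPos hqc (by fun_prop)
  have hrmc : Continuous rm := continuous_insPos hqc (by unfold edgePoint; fun_prop)
  have hrp0 : rp 0 = insPos p (edgePoint m a (3 / 4) p) := by simp [rp, hq0, hZ]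
  have hrm0 : rm 0 = insPos p (edgePoint m a (3 / 4) p) := by simp [rm, hq0]
  have tq : Tendsto q (𝓝[>] 0) (𝓝 p) := by
    have := hqc.tendsto 0; rw [hq0] at this; exact this.mono_left nhdsWithin_le_nhds
  have trp : Tendsto rp (𝓝[>] 0) (𝓝 (insPos p (edgePoint m a (3 / 4) p))) := by
    have := hrpc.tendsto 0; rw [hrp0] at this; exact this.mono_left nhdsWithin_le_nhds
  have trm : Tendsto rm (𝓝[>] 0) (𝓝 (insPos p (edgePoint m a (3 / 4) p))) := by
    have := hrmc.tendsto 0; rw [hrm0] at this; exact this.mono_left nhdsWithin_le_nhds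
  have hcrall : ∀ᶠ q in 𝓝 p, ∀ x y, polyCrosses m p x y → polyCrosses m q x y := by
    refine eventually_all.2 fun x => eventually_all.2 fun y => ?_
    by_cases hxy : polyCrosses m p x y
    · filter_upwards [eventually_signCross (signCross_of_vertex h.vertex hxy)] with q hq _
      exact ⟨hxy.1, hxy.2.1, hxy.2.2.1, hq.nonempty⟩
    · exact Eventually.of_forall fun _ c => absurd c hxy
  have hlt1 : ∀ᶠ ε : ℝ in 𝓝[>] 0, ε < 1 :=
    (eventually_lt_nhds one_pos).filter_mono nhdsWithin_le_nhds
  obtain ⟨ε, ⟨⟨⟨⟨⟨⟨⟨E1, E2⟩, E3⟩, E4⟩, E5⟩, E6⟩, E7⟩, hε⟩⟩ := (((((((tq.eventually h.eventually_gen).and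
    (trp.eventually hq.eventually_gen)).and (trm.eventually hq.eventually_gen)).and
    (tq.eventually hcrall)).and (trp.eventually hV)).and (trm.eventually hV)).and hlt1 |>.and
    self_mem_nhdsWithin).exists
  have hε : 0 < ε := hε
  have hXe : X ∈ polyEdge m (q ε) e := by
    simpa only [polyEdge, hqne ε e hea, hqne ε (m e) hmea] using h.mem_e
  have hXf : X ∈ polyEdge m (q ε) f := by
    simpa only [polyEdge, hqne ε f hfa, hqne ε (m f) hmfa] using h.mem_f
  set σ := planeDet (p (m e) - p e) (p (m f) - p f) with hσ
  have hσ0 : σ ≠ 0 := h.det_ef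
  have hfq : tripleWallFun m e f a (q ε) = σ * (ε * planeDet v n) := by
    rw [tripleWallFun_eq hXe hXf, hqne ε e hea, hqne ε (m e) hmea, hqne ε f hfa, hqne ε (m f) hmfa,
      hqa, hqne ε _ hmaa, hpma, ← hσ]
    congr 1
    rw [show X + v - (X - v - ε * n) = ((2 : ℝ) : ℂ) * v + ε * n by push_cast; ring,
      show X - (X - v - ε * n) = v + ε * n by ring]
    simp only [planeDet_add_left, planeDet_add_right, planeDet_mul_left, planeDet_mul_right,
      planeDet_self, planeDet_swap n v]
    ring
  have hins : ∀ P : ℂ, tripleWallFun (insNext m a) (some e) (some f) (some a) (insPos (q ε) P) =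
      σ * planeDet (P - q ε a) (X - q ε a) := by
    intro P
    have h1 : X ∈ polyEdge (insNext m a) (insPos (q ε) P) (some e) := by
      rwa [polyEdge_ins_of_ne _ _ _ hea]
    have h2 : X ∈ polyEdge (insNext m a) (insPos (q ε) P) (some f) := by
      rwa [polyEdge_ins_of_ne _ _ _ hfa]
    rw [tripleWallFun_eq h1 h2, insNext_some_of_ne _ hea, insNext_some_of_ne _ hfa,
      insNext_some_self]
    simp only [insPos_some, insPos_none]
    rw [hqne ε e hea, hqne ε (m e) hmea, hqne ε f hfa, hqne ε (m f) hmfa]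
  have hfrp : tripleWallFun (insNext m a) (some e) (some f) (some a) (rp ε) =
      σ * (-(1 / 2) * (ε * planeDet v n)) := by
    rw [hins, hqa]
    congr 1
    rw [show X + v / 2 + ε * n - (X - v - ε * n) = ((3 / 2 : ℝ) : ℂ) * v + ((2 * ε : ℝ) : ℂ) * n by
        push_cast; ring,
      show X - (X - v - ε * n) = v + ε * n by ring]
    simp only [planeDet_add_left, planeDet_add_right, planeDet_mul_left, planeDet_mul_right,
      planeDet_self, planeDet_swap n v]
    ring
  have hfrm : tripleWallFun (insNext m a) (some e) (some f) (some a) (rm ε) =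
      σ * ((3 / 4) * (ε * planeDet v n)) := by
    rw [hins, hqa, edgePoint, hqa, hqne ε _ hmaa, hpma]
    congr 1
    rw [show X - v - ε * n + ((3 / 4 : ℝ) : ℂ) * (X + v - (X - v - ε * n)) - (X - v - ε * n) =
        ((3 / 2 : ℝ) : ℂ) * v + ((3 / 4 * ε : ℝ) : ℂ) * n by push_cast; ring,
      show X - (X - v - ε * n) = v + ε * n by ring]
    simp only [planeDet_add_left, planeDet_add_right, planeDet_mul_left, planeDet_mul_right,
      planeDet_self, planeDet_swap n v]
    ring
  have hpos : 0 < ε * planeDet v n := mul_pos hε hdet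
  have hgq : Gen m (q ε) := E1 (by rw [hfq]; exact mul_ne_zero hσ0 hpos.ne')
  have hgp : Gen (insNext m a) (rp ε) := E2 (by
    rw [hfrp]; exact mul_ne_zero hσ0 (mul_ne_zero (by norm_num) hpos.ne'))
  have hgm : Gen (insNext m a) (rm ε) := E3 (by
    rw [hfrm]; exact mul_ne_zero hσ0 (mul_ne_zero (by norm_num) hpos.ne'))
  let D : VDiagram κ :=
    { finite := inferInstance
      next := m
      pos := q ε
      isOver := ov
      next_ne := hn
      next_next_ne := hnn
      vertex_generic := hgq.1
      no_triple := hgq.2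
      over_crosses := fun x y hxy => E4 x y (hovc x y hxy)
      over_asymm := hasymm }
  have hover : ∀ (P : ℂ) (hg : Gen (insNext D.next a) (insPos D.pos P)),
      (D.ins a P hg).isOver = subOver m ov p a (edgePoint m a (3 / 4) p) := by
    intro P hg
    funext x y
    refine propext (and_congr_right fun ho => ?_)
    have hxa : x.getD a ≠ a := fun c => (hv _).1 (c ▸ ho)
    have hya : y.getD a ≠ a := fun c => (hv _).2 (c ▸ ho)
    rcases x with _ | x
    · exact absurd rfl hxa
    rcases y with _ | y
    · exact absurd rfl hya
    have hxa : x ≠ a := hxa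
    have hya : y ≠ a := hya
    exact iff_of_true ((polyCrosses_ins_iff hxa hya).2 (D.over_crosses _ _ ho))
      ((polyCrosses_ins_iff hxa hya).2 (hovc _ _ ho))
  have hlm : (D.ins a (edgePoint m a (3 / 4) (q ε)) hgm).link = D.link :=
    D.link_ins_of_mem (edgePoint_mem (by norm_num) (by norm_num) _) hgm
  have hlp : (D.ins a (X + v / 2 + ε * n) hgp).link = D.link := by
    have cr : ∀ x, polyCrosses m p x a → D.Crosses a x := fun x hx => (E4 _ _ hx).symm
    have hae := cr e h.eg
    have haf := cr f h.fg
    have hef : D.Crosses e f := E4 _ _ h.ef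
    refine (VDiagram.Move.triangle D _ a e f (D.isInsertion_ins _ _ hgp) hae haf hef
      ⟨X, ⟨hXe, hXf⟩, ?_⟩ ⟨a, e, f, rfl, ?_⟩ (D.inheritsCrossings_ins _ _ hgp) ?_).link_eq.symm
    · have hG1 : D.pos a ∈ D.sweptTriangle (D.ins a (X + v / 2 + ε * n) hgp) a :=
        subset_convexHull ℝ _ (by simp)
      have hZp : X + v / 2 + ε * n ∈ D.sweptTriangle (D.ins a (X + v / 2 + ε * n) hgp) a :=
        subset_convexHull ℝ _ (by simp [VDiagram.ins_pos])
      have hG2 : D.pos (D.next a) ∈ D.sweptTriangle (D.ins a (X + v / 2 + ε * n) hgp) a :=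
        subset_convexHull ℝ _ (by simp)
      have hcv : Convex ℝ (D.sweptTriangle (D.ins a (X + v / 2 + ε * n) hgp) a) :=
        convex_convexHull ℝ _
      -- This is the midpoint of the start and the new vertex. The point `X` lies one fifth of the
      -- way from it to the end `X + v`, hence in the swept triangle.
      have hmid : (X - v / 4 : ℂ) ∈ D.sweptTriangle (D.ins a (X + v / 2 + ε * n) hgp) a := by
        refine hcv.segment_subset hG1 hZp (mem_segment_iff_real.2 ⟨1 / 2, by norm_num, by norm_num, ?_⟩)
        change _ = q ε a + _ * (_ - q ε a)
        rw [hqa]; push_cast; ring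
      refine hcv.segment_subset hmid hG2 (mem_segment_iff_real.2 ⟨1 / 5, by norm_num, by norm_num, ?_⟩)
      change _ = _ + _ * (q ε (m a) - _)
      rw [hqne ε _ hmaa, hpma]; push_cast; ring
    · have v1 : D.Virtual a e := ⟨hae, (hv e).1, (hv e).2⟩
      have v2 : D.Virtual a f := ⟨haf, (hv f).1, (hv f).2⟩
      by_cases hcl : D.Classical e f
      · exact Or.inr (Or.inr ⟨v1, v2, hcl⟩)
      · refine Or.inr (Or.inl ⟨v1, v2, hef, ?_, ?_⟩)
        · exact fun c => hcl (Or.inl c)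
        · exact fun c => hcl (Or.inr c)
    · rintro x hxa hxe hxf w ⟨hw, hwT⟩
      have hw : w ∈ polyEdge m (q ε) x := hw
      have hball : w ∈ Metric.closedBall X (2 * ‖v‖) := by
        refine D.sweptTriangle_ins_subset hgp (convex_closedBall X (2 * ‖v‖)) ?_ ?_ ?_ hwT
        · change q ε a ∈ _
          rw [hqa, Metric.mem_closedBall, dist_eq_norm,
            show X - v - ε * n - X = -(v + ε * n) by ring, norm_neg]
          calc ‖v + ε * n‖ ≤ ‖v‖ + ‖(ε : ℂ) * n‖ := norm_add_le _ _
            _ ≤ 2 * ‖v‖ := by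
              rw [norm_mul, hndef, norm_mul, Complex.norm_I, one_mul, Complex.norm_real,
                Real.norm_of_nonneg hε.le]
              nlinarith
        · change q ε (m a) ∈ _
          rw [hqne ε _ hmaa, hpma, Metric.mem_closedBall, dist_eq_norm, add_sub_cancel_left]
          linarith
        · rw [Metric.mem_closedBall, dist_eq_norm,
            show X + v / 2 + ε * n - X = v / 2 + ε * n by ring]
          calc ‖v / 2 + ε * n‖ ≤ ‖v / 2‖ + ‖(ε : ℂ) * n‖ := norm_add_le _ _
            _ ≤ 2 * ‖v‖ := by
              rw [norm_mul, hndef, norm_mul, Complex.norm_I, one_mul, Complex.norm_real,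
                Real.norm_of_nonneg hε.le, norm_div, show ‖(2 : ℂ)‖ = 2 by simp]
              nlinarith
      have hvv : planeDet n n = 0 := planeDet_self n
      -- Relative to `X`, the triangle has components along `v` between `-1` and `1`. The adjacent
      -- edges leave this strip at once, since their far ends have components `-c` and `c'`.
      have hstrip : -planeDet v n ≤ planeDet (w - X) n ∧ planeDet (w - X) n ≤ planeDet v n := by
        refine D.sweptTriangle_ins_subset hgp (convex_strip X n (planeDet v n)) ?_ ?_ ?_ hwT
        · change -planeDet v n ≤ planeDet (q ε a - X) n ∧ planeDet (q ε a - X) n ≤ planeDet v n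
          rw [hqa, show X - v - ε * n - X = -v - ε * n by ring, planeDet_sub_left, planeDet_neg_left,
            planeDet_mul_left, hvv]
          constructor <;> nlinarith
        · change -planeDet v n ≤ planeDet (q ε (m a) - X) n ∧
            planeDet (q ε (m a) - X) n ≤ planeDet v n
          rw [hqne ε _ hmaa, hpma, add_sub_cancel_left]
          constructor <;> linarith
        · rw [Set.mem_ofPred_eq, show X + v / 2 + ε * n - X = ((1 / 2 : ℝ) : ℂ) * v + ε * n by
            push_cast; ring, planeDet_add_left, planeDet_mul_left, planeDet_mul_left, hvv]
          constructor <;> nlinarith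
      have hdp : (0 : ℝ) < planeDet v n := hdet
      by_cases hxs : x = m.symm a
      · left
        rw [hxs, polyEdge, Equiv.apply_symm_apply, hqne ε _ hsa, hqa, hprev, segment_symm] at hw
        obtain ⟨t, ht0, ht1, ht⟩ := mem_segment_iff_real.1 hw
        have hwX : w - X = ((-1 - t * (c - 1) : ℝ) : ℂ) * v + ((-ε * (1 - t) : ℝ) : ℂ) * n := by
          rw [ht]; push_cast; ring
        rw [hwX, planeDet_add_left, planeDet_mul_left, planeDet_mul_left, hvv] at hstrip
        have h1 := hstrip.1
        have ht' : t = 0 := by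
          have h2 : t * (c - 1) * planeDet v n ≤ 0 := by linarith
          have h3 : 0 ≤ t * (c - 1) * planeDet v n :=
            mul_nonneg (mul_nonneg ht0 (by linarith)) hdp.le
          have h4 : t * (c - 1) * planeDet v n = 0 := le_antisymm h2 h3
          rcases mul_eq_zero.1 h4 with h5 | h5
          · rcases mul_eq_zero.1 h5 with h6 | h6
            · exact h6
            · linarith
          · linarith
        change w = q ε a
        rw [hqa, ht, ht']; simp
      by_cases hxm : x = m a
      · right
        have hmma : m (m a) ≠ a := hnn a
        rw [hxm, polyEdge, hqne ε _ hmaa, hqne ε _ hmma, hpma, hnext] at hw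
        obtain ⟨t, ht0, ht1, ht⟩ := mem_segment_iff_real.1 hw
        have hwX : w - X = ((1 + t * (c' - 1) : ℝ) : ℂ) * v := by
          rw [ht]; push_cast; ring
        rw [hwX, planeDet_mul_left] at hstrip
        have h1 := hstrip.2
        have ht' : t = 0 := by
          have h2 : t * (c' - 1) * planeDet v n ≤ 0 := by linarith
          have h3 : 0 ≤ t * (c' - 1) * planeDet v n :=
            mul_nonneg (mul_nonneg ht0 (by linarith)) hdp.le
          have h4 : t * (c' - 1) * planeDet v n = 0 := le_antisymm h2 h3
          rcases mul_eq_zero.1 h4 with h5 | h5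
          · rcases mul_eq_zero.1 h5 with h6 | h6
            · exact h6
            · linarith
          · linarith
        change w = q ε (m a)
        rw [hqne ε _ hmaa, hpma, ht, ht']; simp
      · exfalso
        have hmx : m x ≠ a := fun c => hxs ((Equiv.eq_symm_apply m).2 c)
        rw [polyEdge, hqne ε x hxa, hqne ε _ hmx] at hw
        exact absurd (hclear x hxe hxf hxa hxs hxm w hw) (not_lt.2 hball)
  -- The sign of `σ` decides which of the two diagrams is on the positive side of the wall.
  rcases lt_or_gt_of_ne hσ0 with hs | hs
  · refine ⟨D.ins a _ hgp, D.ins a _ hgm, rfl, hover _ _, E5, ?_, rfl, hover _ _, E6, ?_,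
      hlp.trans hlm.symm⟩
    · change 0 < tripleWallFun _ _ _ _ (rp ε)
      rw [hfrp]; nlinarith
    · change tripleWallFun _ _ _ _ (rm ε) < 0
      rw [hfrm]; nlinarith
  · refine ⟨D.ins a _ hgm, D.ins a _ hgp, rfl, hover _ _, E6, ?_, rfl, hover _ _, E5, ?_,
      hlm.trans hlp.symm⟩
    · change 0 < tripleWallFun _ _ _ _ (rm ε)
      rw [hfrm]; nlinarith
    · change tripleWallFun _ _ _ _ (rp ε) < 0
      rw [hfrp]; nlinarith

end TripleWall

/-- A configuration with a triple point on an edge `g` without classical crossings is nice. -/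
theorem TripleWall.nice [Finite κ] {m : Equiv.Perm κ} {ov : κ → κ → Prop} {p : κ → ℂ}
    {e f g : κ} {X : ℂ} (h : TripleWall m p e f g X) (hn : ∀ i, m i ≠ i)
    (hnn : ∀ i, m (m i) ≠ i) (hasymm : ∀ x y, ov x y → ¬ ov y x)
    (hv : ∀ y, ¬ ov g y ∧ ¬ ov y g) : Nice m ov p := by
  classical
  have heg : e ≠ g := h.eg.1
  have hfg : f ≠ g := h.fg.1
  obtain ⟨t, ht0, ht1, hX⟩ := mem_segment_iff_real.1 h.mem_g
  set d := p (m g) - p g with hd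
  have ht0 : 0 < t := ht0.lt_of_ne fun h0 => by
    rw [← h0] at hX
    have := h.vertex e g (by simpa [hX] using h.mem_e)
    rcases this with c | c
    exacts [heg c.symm, h.eg.2.1 c.symm]
  have ht1 : t < 1 := ht1.lt_of_ne fun h0 => by
    rw [h0] at hX
    have := h.vertex e (m g) (by simpa [hX, hd] using h.mem_e)
    rcases this with c | c
    exacts [h.eg.2.2.1 c, heg (m.injective c).symm]
  have hd0 : d ≠ 0 := by
    intro h0
    apply h.det_eg
    rw [← hd, h0, planeDet_zero_right]
  have hdn : 0 < ‖d‖ := norm_pos_iff.2 hd0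
  -- The edge `g` will be divided at the parameters `t + δ` and `t - δ`. The middle piece is centred
  -- at `X` and has half length `δ * ‖d‖`.
  have hev : ∀ᶠ δ : ℝ in 𝓝[>] 0, (∀ x, x ≠ e → x ≠ f → x ≠ g → ∀ z ∈ polyEdge m p x,
      2 * (δ * ‖d‖) < dist z X) ∧ δ < t ∧ δ < 1 - t := by
    refine Filter.Eventually.and (eventually_all.2 fun x => ?_) (Filter.Eventually.and
      ((eventually_lt_nhds ht0).filter_mono nhdsWithin_le_nhds)
      ((eventually_lt_nhds (by linarith)).filter_mono nhdsWithin_le_nhds))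
    by_cases hx : x ≠ e ∧ x ≠ f ∧ x ≠ g
    · have hXx : X ∉ polyEdge m p x := fun hc => by
        rcases h.triple x e f hx.1 h.ef.1 hx.2.1 X hc h.mem_e h.mem_f with c | c | c
        exacts [hx.1 c, hx.2.1 c, hx.2.2 c]
      have hpos : 0 < Metric.infDist X (polyEdge m p x) :=
        ((isClosed_polyEdge m p x).notMem_iff_infDist_pos ⟨_, left_mem_segment _ _ _⟩).1 hXx
      have hc : Tendsto (fun δ : ℝ => 2 * (δ * ‖d‖)) (𝓝 0) (𝓝 0) := by
        have : Continuous (fun δ : ℝ => 2 * (δ * ‖d‖)) := by fun_prop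
        simpa using this.tendsto 0
      filter_upwards [(hc.eventually (eventually_lt_nhds hpos)).filter_mono nhdsWithin_le_nhds]
        with δ hδ _ _ _ z hz
      rw [dist_comm]
      exact hδ.trans_le (Metric.infDist_le_dist_of_mem hz)
    · exact Eventually.of_forall fun δ h1 h2 h3 => absurd ⟨h1, h2, h3⟩ hx
  obtain ⟨δ, ⟨hclear, hδt, hδt'⟩, hδ⟩ := (hev.and self_mem_nhdsWithin).exists
  have hδ : 0 < δ := hδ
  have hδC : (δ : ℂ) ≠ 0 := by exact_mod_cast hδ.ne'
  set v : ℂ := δ * d with hvdef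
  have hv0 : v ≠ 0 := mul_ne_zero hδC hd0
  have hvn : ‖v‖ = δ * ‖d‖ := by
    rw [hvdef, norm_mul, Complex.norm_real, Real.norm_of_nonneg hδ.le]
  have hpg : p (m g) = p g + d := by rw [hd]; ring
  have havoid : ∀ z ∈ polyEdge m p g, z ≠ X → dist z X ≤ ‖v‖ → ∀ x, x ≠ g → z ∉ polyEdge m p x := by
    intro z hz hzX hdist x hxg hx
    by_cases hxe : x = e
    · rw [hxe] at hx
      exact hzX (eq_of_mem_segments h.det_eg hx hz h.mem_e h.mem_g)
    by_cases hxf : x = f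
    · rw [hxf] at hx
      exact hzX (eq_of_mem_segments h.det_fg hx hz h.mem_f h.mem_g)
    have := hclear x hxe hxf hxg z hx
    rw [hvn] at hdist
    have : 0 < δ * ‖d‖ := mul_pos hδ hdn
    linarith
  -- the outer subdivision point
  have hs0 : 0 < t + δ := by linarith
  have hs1 : t + δ < 1 := by linarith
  have hE1 : edgePoint m g (t + δ) p = X + v := by
    rw [edgePoint, ← hd, hX, hvdef]; push_cast; ring
  have hZ1 := edgePoint_mem (next := m) (a := g) hs0 hs1 p
  have hza1 := havoid _ (openSegment_subset_segment _ _ _ hZ1)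
    (by rw [hE1]; simpa using hv0) (by rw [hE1]; simp [dist_eq_norm])
  have hX1 : X ∈ polyEdge (insNext m g) (insPos p (edgePoint m g (t + δ) p)) (some g) := by
    rw [polyEdge_ins_self, hE1]
    refine mem_segment_iff_real.2 ⟨t / (t + δ), by positivity, (div_le_one hs0).2 (by linarith), ?_⟩
    rw [hvdef, hX]
    have : (t : ℂ) + δ ≠ 0 := by exact_mod_cast hs0.ne'
    push_cast; field_simp; ring
  have h1 := h.subdivide hn (g' := some g) (Or.inr rfl) hZ1 hza1 hX1
  refine Nice.of_subdivide hs0 hs1 hza1 ?_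
  have hn1 := insNext_ne hn g
  have hnn1 := insNext_insNext_ne hn hnn g
  set z₁ := edgePoint m g (t + δ) p with hz₁
  -- The second division takes place on the first piece, from `p g` to `X + v`, where the point `X -
  -- v` has this parameter.
  have hr0 : 0 < (t - δ) / (t + δ) := div_pos (by linarith) hs0
  have hr1 : (t - δ) / (t + δ) < 1 := (div_lt_one hs0).2 (by linarith)
  have hE2 : edgePoint (insNext m g) (some g) ((t - δ) / (t + δ)) (insPos p z₁) = X - v := by
    rw [edgePoint, insNext_some_self, insPos_some, insPos_none, hE1, hX, hvdef]
    have : (t : ℂ) + δ ≠ 0 := by exact_mod_cast hs0.ne'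
    push_cast; field_simp; ring
  have hZ2 := edgePoint_mem (next := insNext m g) (a := some g) hr0 hr1 (insPos p z₁)
  have hmemg : X - v ∈ polyEdge m p g := by
    refine mem_segment_iff_real.2 ⟨t - δ, by linarith, by linarith, ?_⟩
    rw [hX, hvdef]; push_cast; ring
  have hza2 : ∀ x, x ≠ some g → edgePoint (insNext m g) (some g) ((t - δ) / (t + δ)) (insPos p z₁) ∉
      polyEdge (insNext m g) (insPos p z₁) x := by
    rw [hE2]
    rintro (_ | x) hx hc
    · rw [polyEdge_ins_none, hE1, hpg] at hc
      obtain ⟨u, hu0, hu1, hu⟩ := mem_segment_iff_real.1 hc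
      have : ((2 * δ + u * (1 - t - δ) : ℝ) : ℂ) * d = 0 := by
        rw [hX, hvdef] at hu; push_cast; linear_combination -hu
      rcases mul_eq_zero.1 this with h0 | h0
      · have h0 : 2 * δ + u * (1 - t - δ) = 0 := by exact_mod_cast h0
        nlinarith
      · exact hd0 h0
    · have hx : x ≠ g := fun c => hx (by rw [c])
      rw [polyEdge_ins_of_ne _ _ _ hx] at hc
      exact havoid _ hmemg (by simpa using hv0) (by simp) x hx hc
  have hX2 : X ∈ polyEdge (insNext (insNext m g) (some g)) (insPos (insPos p z₁)
      (edgePoint (insNext m g) (some g) ((t - δ) / (t + δ)) (insPos p z₁))) none := by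
    rw [polyEdge_ins_none, insNext_some_self, insPos_none, hE2, hE1]
    refine mem_segment_iff_real.2 ⟨1 / 2, by norm_num, by norm_num, ?_⟩
    push_cast; ring
  have h2 := h1.subdivide hn1 (g' := none) (Or.inl rfl) hZ2 hza2 hX2
  refine Nice.of_subdivide hr0 hr1 hza2 ?_
  have hsymm : (insNext (insNext m g) (some g)).symm none = some (some g) := by
    rw [Equiv.symm_apply_eq, insNext_some_self]
  -- The neighbours of the middle piece are the ends of `g`, at `X - (t / δ) * v` and `X + ((1 - t)
  -- / δ) * v`.
  refine h2.nice_of_local (v := v) (c := t / δ) (c' := (1 - t) / δ) (insNext_ne hn1 _)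
    (insNext_insNext_ne hn1 hnn1 _) (subOver_asymm (subOver_asymm hasymm)) (fun x y hxy => hxy.2)
    (fun y => ⟨fun hc => (hv _).1 hc.1.1, fun hc => (hv _).2 hc.1.1⟩) hv0 ?_ ?_ ?_ ?_ ?_ ?_ ?_
  · rw [insPos_none, hE2]
  · rw [insNext_none, insNext_some_self, insPos_some, insPos_none, hE1]
  · rw [one_lt_div hδ]; exact hδt
  · rw [one_lt_div hδ]; exact hδt'
  · rw [hsymm, insPos_some, insPos_some, hX, hvdef]
    push_cast; field_simp; ring
  · rw [insNext_none, insNext_some_self, insNext_some_of_ne _ (by simp), insNext_none, insPos_some,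
      insPos_some, hpg, hX, hvdef]
    push_cast; field_simp; ring
  · rintro (_ | _ | x) ha hb hc hd' he z hz
    · exact absurd rfl hc
    · exact absurd (by rw [insNext_none, insNext_some_self]) he
    · have hxg : x ≠ g := fun c => hd' (by rw [hsymm, c])
      rw [polyEdge_ins_of_ne _ _ _ (by simpa using hxg), polyEdge_ins_of_ne _ _ _ hxg] at hz
      rw [hvn]
      exact hclear x (by simpa using ha) (by simpa using hb) hxg z hz

/-! ## Moving a vertex between two edges without classical crossings -/

section Sweep

variable {κ : Type}

/-- The points which lie on two edges different from `A` and `F`. -/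
def staticMeets (m : Equiv.Perm κ) (q : κ → ℂ) (A F : κ) : Set ℂ :=
  {w | ∃ x y, x ≠ A ∧ x ≠ F ∧ y ≠ A ∧ y ≠ F ∧ x ≠ y ∧ w ∈ polyEdge m q x ∧ w ∈ polyEdge m q y}

/-- The part of the data of a polygonal curve that remains unchanged when the vertex `F` moves, the
neighbouring vertices being `Z`, `A` before `F` and `B`, `m B` after `F`. The edges `Z`
and `B` are so short that they lie in discs which meet few other edges. -/
structure StaticPart (m : Equiv.Perm κ) (ov : κ → κ → Prop) (q : κ → ℂ) (Z A F B : κ) (r r' : ℝ) :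
    Prop where
  next_ne : ∀ i, m i ≠ i
  next_next_ne : ∀ i, m (m i) ≠ i
  asymm : ∀ x y, ov x y → ¬ ov y x
  crosses : ∀ x y, ov x y → polyCrosses m q x y
  virt_A : ∀ y, ¬ ov A y ∧ ¬ ov y A
  virt_F : ∀ y, ¬ ov F y ∧ ¬ ov y F
  next_Z : m Z = A
  next_A : m A = F
  next_F : m F = B
  Z_ne_B : Z ≠ B
  vertex : ∀ x v, x ≠ A → x ≠ F → v ≠ F → q v ∈ polyEdge m q x → v = x ∨ v = m x
  triple : ∀ x y z, x ≠ A → x ≠ F → y ≠ A → y ≠ F → z ≠ A → z ≠ F → x ≠ y → y ≠ z → x ≠ z →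
    ∀ w, w ∈ polyEdge m q x → w ∈ polyEdge m q y → w ∉ polyEdge m q z
  pos_r : 0 < r
  pos_r' : 0 < r'
  le_r : dist (q A) (q Z) ≤ r
  lt_r : r < dist (q (m.symm Z)) (q Z)
  le_r' : dist (q B) (q (m B)) ≤ r'
  lt_r' : r' < dist (q (m (m B))) (q (m B))
  clear : ∀ x, x ≠ A → x ≠ F → x ≠ Z → x ≠ m.symm Z → ∀ z ∈ polyEdge m q x, r < dist z (q Z)
  clear' : ∀ x, x ≠ A → x ≠ F → x ≠ B → x ≠ m B → ∀ z ∈ polyEdge m q x, r' < dist z (q (m B))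

namespace StaticPart

variable {m : Equiv.Perm κ} {ov : κ → κ → Prop} {q : κ → ℂ} {Z A F B : κ} {r r' : ℝ}

theorem A_ne_F (h : StaticPart m ov q Z A F B r r') : A ≠ F :=
  fun c => h.next_ne A (h.next_A.trans c.symm)

theorem B_ne_F (h : StaticPart m ov q Z A F B r r') : B ≠ F :=
  fun c => h.next_ne F (h.next_F.trans c)

theorem B_ne_A (h : StaticPart m ov q Z A F B r r') : B ≠ A :=
  fun c => h.next_next_ne A (by rw [h.next_A, h.next_F, c])

theorem Z_ne_A (h : StaticPart m ov q Z A F B r r') : Z ≠ A :=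
  fun c => h.next_ne Z (h.next_Z.trans c.symm)

theorem Z_ne_F (h : StaticPart m ov q Z A F B r r') : Z ≠ F :=
  fun c => h.next_next_ne Z (by rw [h.next_Z, h.next_A, c])

theorem eq_Z (h : StaticPart m ov q Z A F B r r') {x : κ} (hx : m x = A) : x = Z :=
  m.injective (hx.trans h.next_Z.symm)

theorem eq_A (h : StaticPart m ov q Z A F B r r') {x : κ} (hx : m x = F) : x = A :=
  m.injective (hx.trans h.next_A.symm)

theorem eq_F (h : StaticPart m ov q Z A F B r r') {x : κ} (hx : m x = B) : x = F :=
  m.injective (hx.trans h.next_F.symm)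

theorem edge_Z (h : StaticPart m ov q Z A F B r r') {z : ℂ} (hz : z ∈ polyEdge m q Z) :
    dist z (q Z) ≤ r := by
  have : z ∈ Metric.closedBall (q Z) r := by
    refine (convex_closedBall (q Z) r).segment_subset (Metric.mem_closedBall_self h.pos_r.le) ?_ hz
    rw [h.next_Z]; exact h.le_r
  exact this

theorem edge_B (h : StaticPart m ov q Z A F B r r') {z : ℂ} (hz : z ∈ polyEdge m q B) :
    dist z (q (m B)) ≤ r' := by
  have : z ∈ Metric.closedBall (q (m B)) r' :=
    (convex_closedBall (q (m B)) r').segment_subset h.le_r'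
      (Metric.mem_closedBall_self h.pos_r'.le) hz
  exact this

theorem inter_eq (h : StaticPart m ov q Z A F B r r') {x : κ} (h1 : x ≠ A) (h2 : x ≠ F)
    (h3 : m x ≠ A) {w : ℂ} (hx : w ∈ polyEdge m q x) (hy : w ∈ polyEdge m q (m x)) :
    w = q (m x) := by
  have h4 : m x ≠ F := fun c => h1 (h.eq_A c)
  by_contra hne
  rcases overlap_of_shared_endpoint hx hy hne with c | c
  · rcases h.vertex _ _ h3 h4 h2 c with c | c
    · exact h.next_ne x c.symm
    · exact h.next_next_ne x c.symm
  · rcases h.vertex _ _ h1 h2 (fun c => h3 (h.eq_A c)) c with c | c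
    · exact h.next_next_ne x c
    · exact h.next_ne (m x) c

/-- Consecutive edges meet only in their common vertex. The short edges `Z` and `B` lie in discs
cleared of the edges not adjacent to them, so they have no crossings with static edges. -/
theorem staticMeets_cases (h : StaticPart m ov q Z A F B r r') {w : ℂ}
    (hw : w ∈ staticMeets m q A F) :
    (∃ v, v ≠ A ∧ v ≠ F ∧ v ≠ B ∧ w = q v) ∨
    ∃ x y, x ≠ A ∧ x ≠ F ∧ x ≠ Z ∧ x ≠ B ∧ y ≠ A ∧ y ≠ F ∧ y ≠ Z ∧ y ≠ B ∧
      polyCrosses m q x y ∧ w ∈ polyEdge m q x ∧ w ∈ polyEdge m q y := by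
  obtain ⟨x, y, xA, xF, yA, yF, hxy, hx, hy⟩ := hw
  by_cases h1 : m x = y
  · subst h1
    exact Or.inl ⟨m x, yA, yF, fun c => xF (h.eq_F c), h.inter_eq xA xF yA hx hy⟩
  by_cases h2 : m y = x
  · subst h2
    exact Or.inl ⟨m y, xA, xF, fun c => yF (h.eq_F c), h.inter_eq yA yF xA hy hx⟩
  have key : ∀ x y, x ≠ A → x ≠ F → y ≠ A → y ≠ F → x ≠ y → m x ≠ y → m y ≠ x →
      w ∈ polyEdge m q x → w ∈ polyEdge m q y → x ≠ Z ∧ x ≠ B := by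
    intro x y xA xF yA yF hxy h1 h2 hx hy
    constructor
    · rintro rfl
      have := h.clear y yA yF hxy.symm (fun c => h2 (by rw [c, Equiv.apply_symm_apply])) w hy
      exact absurd (h.edge_Z hx) (not_le.2 this)
    · rintro rfl
      have := h.clear' y yA yF hxy.symm (Ne.symm h1) w hy
      exact absurd (h.edge_B hx) (not_le.2 this)
  obtain ⟨k1, k2⟩ := key x y xA xF yA yF hxy h1 h2 hx hy
  obtain ⟨k3, k4⟩ := key y x yA yF xA xF hxy.symm h2 h1 hy hx
  exact Or.inr ⟨x, y, xA, xF, k1, k2, yA, yF, k3, k4, ⟨hxy, h1, h2, w, hx, hy⟩, hx, hy⟩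

/-- A vertex lies on its incoming and its outgoing edge. Both are static unless the vertex is an end
of a moving edge, and these ends are `A`, `F` and `B`. -/
theorem vertex_mem_staticMeets (h : StaticPart m ov q Z A F B r r') {v : κ} (hA : v ≠ A)
    (hF : v ≠ F) (hB : v ≠ B) : q v ∈ staticMeets m q A F := by
  refine ⟨v, m.symm v, hA, hF, ?_, ?_, ?_, left_mem_segment _ _ _, ?_⟩
  · intro c; rw [Equiv.symm_apply_eq, h.next_A] at c; exact hF c
  · intro c; rw [Equiv.symm_apply_eq, h.next_F] at c; exact hB c
  · intro c; exact h.next_ne v ((Equiv.symm_apply_eq m).1 c.symm).symm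
  · rw [polyEdge, Equiv.apply_symm_apply]; exact right_mem_segment _ _ _

end StaticPart

/-- A position of the moving vertex `F` at which at most one event happens. -/
structure SweepStep (m : Equiv.Perm κ) (ov : κ → κ → Prop) (q : κ → ℂ) (Z A F B : κ) (r r' : ℝ) :
    Prop extends StaticPart m ov q Z A F B r r' where
  off : planeDet (q B - q A) (q F - q A) ≠ 0
  clear_F : ∀ z ∈ polyEdge m q F, r < dist z (q Z)
  clear_A : ∀ z ∈ polyEdge m q A, r' < dist z (q (m B))
  uniq_A : ∀ S ∈ staticMeets m q A F, ∀ S' ∈ staticMeets m q A F, S ∈ polyEdge m q A →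
    S' ∈ polyEdge m q A → S = S'
  uniq_F : ∀ S ∈ staticMeets m q A F, ∀ S' ∈ staticMeets m q A F, S ∈ polyEdge m q F →
    S' ∈ polyEdge m q F → S = S'
  uniq_AF : ∀ S ∈ staticMeets m q A F, ∀ S' ∈ staticMeets m q A F, S ∈ polyEdge m q A →
    S' ∉ polyEdge m q F
  uniq_A_edge : ∀ S ∈ staticMeets m q A F, S ∈ polyEdge m q A →
    ∀ x, x ≠ A → x ≠ F → q F ∉ polyEdge m q x
  uniq_F_edge : ∀ S ∈ staticMeets m q A F, S ∈ polyEdge m q F →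
    ∀ x, x ≠ A → x ≠ F → q F ∉ polyEdge m q x

namespace SweepStep

variable {m : Equiv.Perm κ} {ov : κ → κ → Prop} {q : κ → ℂ} {Z A F B : κ} {r r' : ℝ}

theorem F_mem_A (h : SweepStep m ov q Z A F B r r') : q F ∈ polyEdge m q A := by
  rw [polyEdge, h.next_A]; exact right_mem_segment _ _ _

theorem F_mem_F (_h : SweepStep m ov q Z A F B r r') : q F ∈ polyEdge m q F :=
  left_mem_segment _ _ _

/-- The vertex `F` is off the line `A B`, so the moving edges are two sides of a nondegenerate
triangle. -/
theorem inter_moving (h : SweepStep m ov q Z A F B r r') {w : ℂ} (h1 : w ∈ polyEdge m q A)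
    (h2 : w ∈ polyEdge m q F) : w = q F := by
  rw [polyEdge, h.next_A] at h1
  rw [polyEdge, h.next_F] at h2
  by_contra hne
  apply h.off
  rcases overlap_of_shared_endpoint h1 h2 hne with c | c
  · obtain ⟨s, -, -, hs⟩ := mem_segment_iff_real.1 c
    rw [show q B - q A = ((1 - s : ℝ) : ℂ) * (q B - q F) by
      push_cast; linear_combination -hs, show q F - q A = ((-s : ℝ) : ℂ) * (q B - q F) by
      push_cast; linear_combination -hs, planeDet_mul_left, planeDet_mul_right, planeDet_self]
    ring
  · rw [planeDet_swap, planeDet_eq_zero_of_mem_segment c, neg_zero]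

theorem vertex_cases (h : SweepStep m ov q Z A F B r r') {i l : κ} (hl : q l ∈ polyEdge m q i) :
    l = i ∨ l = m i ∨ (i ≠ A ∧ i ≠ F ∧ l = F) ∨
      ((i = A ∨ i = F) ∧ l ≠ A ∧ l ≠ F ∧ l ≠ B ∧ q l ∈ staticMeets m q A F) := by
  by_cases hiA : i = A
  · subst hiA
    by_cases l1 : l = i
    · exact Or.inl l1
    by_cases l2 : l = F
    · exact Or.inr (Or.inl (l2.trans h.next_A.symm))
    by_cases l3 : l = B
    · refine absurd ?_ h.off
      rw [l3, polyEdge, h.next_A] at hl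
      rw [planeDet_swap, planeDet_eq_zero_of_mem_segment hl, neg_zero]
    · exact Or.inr (Or.inr (Or.inr ⟨Or.inl rfl, l1, l2, l3, h.vertex_mem_staticMeets l1 l2 l3⟩))
  by_cases hiF : i = F
  · subst hiF
    by_cases l1 : l = i
    · exact Or.inl l1
    by_cases l2 : l = B
    · exact Or.inr (Or.inl (l2.trans h.next_F.symm))
    by_cases l3 : l = A
    · have : q A ∈ polyEdge m q A := left_mem_segment _ _ _
      have e := h.inter_moving this (l3 ▸ hl)
      exact absurd (by rw [e, sub_self, planeDet_zero_right]) h.off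
    · exact Or.inr (Or.inr (Or.inr ⟨Or.inr rfl, l3, l1, l2, h.vertex_mem_staticMeets l3 l1 l2⟩))
  by_cases hlF : l = F
  · exact Or.inr (Or.inr (Or.inl ⟨hiA, hiF, hlF⟩))
  · rcases h.vertex i l hiA hiF hlF hl with c | c
    · exact Or.inl c
    · exact Or.inr (Or.inl c)

/-- If both moving edges pass through `w`, then `w` is the vertex `F`, and one of the three edges is
static. If only one does, two of the three are static and meet in `w`. Three static edges have no
common point. -/
theorem triple_cases (h : SweepStep m ov q Z A F B r r') {x y z : κ} (hxy : x ≠ y) (hyz : y ≠ z)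
    (hxz : x ≠ z) {w : ℂ} (hx : w ∈ polyEdge m q x) (hy : w ∈ polyEdge m q y)
    (hz : w ∈ polyEdge m q z) :
    (w = q F ∧ ∃ s, s ≠ A ∧ s ≠ F ∧ q F ∈ polyEdge m q s) ∨
      (w ∈ staticMeets m q A F ∧ (w ∈ polyEdge m q A ∨ w ∈ polyEdge m q F)) := by
  have hAF := h.A_ne_F
  by_cases hA : w ∈ polyEdge m q A
  · by_cases hF : w ∈ polyEdge m q F
    · have e := h.inter_moving hA hF
      left
      refine ⟨e, ?_⟩
      rw [← e]
      by_cases c1 : x ≠ A ∧ x ≠ F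
      · exact ⟨x, c1.1, c1.2, hx⟩
      by_cases c2 : y ≠ A ∧ y ≠ F
      · exact ⟨y, c2.1, c2.2, hy⟩
      by_cases c3 : z ≠ A ∧ z ≠ F
      · exact ⟨z, c3.1, c3.2, hz⟩
      exfalso; grind
    · right
      refine ⟨?_, Or.inl hA⟩
      have k : ∀ s, w ∈ polyEdge m q s → s ≠ F := fun s hs c => hF (c ▸ hs)
      have := k x hx; have := k y hy; have := k z hz
      by_cases c1 : x = A
      · exact ⟨y, z, by grind, k y hy, by grind, k z hz, hyz, hy, hz⟩
      by_cases c2 : y = A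
      · exact ⟨x, z, by grind, k x hx, by grind, k z hz, hxz, hx, hz⟩
      · exact ⟨x, y, by grind, k x hx, by grind, k y hy, hxy, hx, hy⟩
  · have k : ∀ s, w ∈ polyEdge m q s → s ≠ A := fun s hs c => hA (c ▸ hs)
    by_cases hF : w ∈ polyEdge m q F
    · right
      refine ⟨?_, Or.inr hF⟩
      have := k x hx; have := k y hy; have := k z hz
      by_cases c1 : x = F
      · exact ⟨y, z, k y hy, by grind, k z hz, by grind, hyz, hy, hz⟩
      by_cases c2 : y = F
      · exact ⟨x, z, k x hx, by grind, k z hz, by grind, hxz, hx, hz⟩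
      · exact ⟨x, y, k x hx, by grind, k y hy, by grind, hxy, hx, hy⟩
    · have k' : ∀ s, w ∈ polyEdge m q s → s ≠ F := fun s hs c => hF (c ▸ hs)
      exact absurd hz (h.triple x y z (k x hx) (k' x hx) (k y hy) (k' y hy) (k z hz) (k' z hz)
        hxy hyz hxz w hx hy)

/-- Without events the configuration is generic. -/
theorem gen (h : SweepStep m ov q Z A F B r r')
    (h1 : ∀ x, x ≠ A → x ≠ F → q F ∉ polyEdge m q x)
    (h2 : ∀ S ∈ staticMeets m q A F, S ∉ polyEdge m q A ∧ S ∉ polyEdge m q F) : Gen m q := by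
  refine ⟨fun i l hl => ?_, fun x y z hxy hyz hxz w hx hy hz => ?_⟩
  · rcases h.vertex_cases hl with c | c | ⟨c1, c2, c3⟩ | ⟨c | c, -, -, -, c'⟩
    · exact Or.inl c
    · exact Or.inr c
    · exact absurd (c3 ▸ hl) (h1 i c1 c2)
    · exact absurd (c ▸ hl) (h2 _ c').1
    · exact absurd (c ▸ hl) (h2 _ c').2
  · rcases h.triple_cases hxy hyz hxz hx hy hz with ⟨-, s, c1, c2, c3⟩ | ⟨c, c' | c'⟩
    · exact h1 s c1 c2 c3
    · exact (h2 _ c).1 c'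
    · exact (h2 _ c).2 c'

/-- The diagram of a generic configuration. -/
theorem exists_diagram [Finite κ] (h : SweepStep m ov q Z A F B r r') (hg : Gen m q) :
    ∃ D : VDiagram κ, D.next = m ∧ D.isOver = ov ∧ D.pos = q :=
  ⟨{ finite := inferInstance
     next := m
     pos := q
     isOver := ov
     next_ne := h.next_ne
     next_next_ne := h.next_next_ne
     vertex_generic := hg.1
     no_triple := hg.2
     over_crosses := h.crosses
     over_asymm := h.asymm }, rfl, rfl, rfl⟩

/-- The moving vertex on a static edge is a vertex wall, and the uniqueness conditions exclude any
further degeneracy. Since `F` stays outside both discs, `x` is neither `Z` nor `B`, as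
`VertexWall.nice` requires. -/
theorem nice_of_edge [Finite κ] (h : SweepStep m ov q Z A F B r r') {x : κ} (xA : x ≠ A)
    (xF : x ≠ F) (hx : q F ∈ polyEdge m q x) : Nice m ov q := by
  have hS : ∀ S ∈ staticMeets m q A F, S ∉ polyEdge m q A ∧ S ∉ polyEdge m q F := fun S hS =>
    ⟨fun c => h.uniq_A_edge S hS c x xA xF hx, fun c => h.uniq_F_edge S hS c x xA xF hx⟩
  have hxZ : x ≠ Z := fun c => absurd (h.edge_Z (c ▸ hx)) (not_le.2 (h.clear_F _ h.F_mem_F))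
  have hxB : x ≠ B := fun c => absurd (h.edge_B (c ▸ hx)) (not_le.2 (h.clear_A _ h.F_mem_A))
  have hsymm : m.symm F = A := by rw [Equiv.symm_apply_eq, h.next_A]
  have hW : VertexWall m q x F := by
    refine ⟨hx, xF.symm, fun c => xA (h.eq_A c.symm), fun i l hl => ?_,
      fun a b c hab hbc hac w ha hb hc => ?_⟩
    · rcases h.vertex_cases hl with c | c | ⟨c1, c2, c3⟩ | ⟨c | c, -, -, -, c'⟩
      · exact Or.inl c
      · exact Or.inr (Or.inl c)
      · refine Or.inr (Or.inr ⟨?_, c3⟩)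
        by_contra hix
        rw [c3] at hl
        exact (hS (q F) ⟨i, x, c1, c2, xA, xF, hix, hl, hx⟩).1 h.F_mem_A
      · exact absurd (c ▸ hl) (hS _ c').1
      · exact absurd (c ▸ hl) (hS _ c').2
    · rcases h.triple_cases hab hbc hac ha hb hc with ⟨c, -⟩ | ⟨c, c' | c'⟩
      · exact c
      · exact absurd c' (hS _ c).1
      · exact absurd c' (hS _ c).2
  refine hW.nice h.next_ne h.next_next_ne h.asymm h.crosses ?_ ?_ ?_
  · rw [hsymm]
    exact ⟨(h.virt_F x).2, (h.virt_F x).1, (h.virt_A x).2, (h.virt_A x).1⟩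
  · rw [hsymm]; exact fun c => hxZ (h.eq_Z c)
  · rw [h.next_F]; exact hxB.symm

theorem uniq (h : SweepStep m ov q Z A F B r r') {S S' : ℂ} {g g' : κ}
    (hS : S ∈ staticMeets m q A F) (hS' : S' ∈ staticMeets m q A F) (hg : g = A ∨ g = F)
    (hg' : g' = A ∨ g' = F) (hm : S ∈ polyEdge m q g) (hm' : S' ∈ polyEdge m q g') :
    S' = S ∧ g' = g := by
  rcases hg with rfl | rfl <;> rcases hg' with rfl | rfl
  · exact ⟨h.uniq_A _ hS' _ hS hm' hm, rfl⟩
  · exact absurd hm' (h.uniq_AF _ hS _ hS' hm)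
  · exact absurd hm (h.uniq_AF _ hS' _ hS hm')
  · exact ⟨h.uniq_F _ hS' _ hS hm' hm, rfl⟩

/-- By `staticMeets_cases` the point on the moving edge is a vertex or a proper crossing of static
edges, so this is a vertex wall or a triple wall without any other degeneracy. -/
theorem nice_of_meet [Finite κ] (h : SweepStep m ov q Z A F B r r') {S : ℂ} {g : κ}
    (hS : S ∈ staticMeets m q A F) (hg : g = A ∨ g = F) (hm : S ∈ polyEdge m q g) :
    Nice m ov q := by
  have hAF := h.A_ne_F
  have hBA := h.B_ne_A
  have hBF := h.B_ne_F
  have hZA := h.Z_ne_A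
  have hZF := h.Z_ne_F
  have hE : ∀ x, x ≠ A → x ≠ F → q F ∉ polyEdge m q x := by
    rcases hg with rfl | rfl
    · exact h.uniq_A_edge S hS hm
    · exact h.uniq_F_edge S hS hm
  have hvirt : ∀ y, ¬ ov g y ∧ ¬ ov y g := by
    rcases hg with rfl | rfl
    · exact h.virt_A
    · exact h.virt_F
  have hnotg : ∀ x, x ≠ A → x ≠ F → x ≠ g := by
    rcases hg with rfl | rfl
    · exact fun x h1 _ => h1
    · exact fun x _ h2 => h2
  have hu : ∀ S' ∈ staticMeets m q A F, ∀ g', g' = A ∨ g' = F → S' ∈ polyEdge m q g' →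
      S' = S ∧ g' = g := fun S' hS' g' hg' hm' => h.uniq hS hS' hg hg' hm hm'
  have htrip : ∀ a b c, a ≠ b → b ≠ c → a ≠ c → ∀ w, w ∈ polyEdge m q a → w ∈ polyEdge m q b →
      w ∈ polyEdge m q c → w = S := by
    intro a b c hab hbc hac w ha hb hc
    rcases h.triple_cases hab hbc hac ha hb hc with ⟨-, s, c1, c2, c3⟩ | ⟨c1, c2 | c2⟩
    · exact absurd c3 (hE s c1 c2)
    · exact (hu w c1 A (Or.inl rfl) c2).1
    · exact (hu w c1 F (Or.inr rfl) c2).1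
  rcases h.staticMeets_cases hS with ⟨v, vA, vF, vB, hv⟩ |
      ⟨x, y, xA, xF, xZ, xB, yA, yF, yZ, yB, hcr, hx, hy⟩
  · have hW : VertexWall m q g v := by
      refine ⟨hv ▸ hm, hnotg v vA vF, ?_, fun i l hl => ?_, fun a b c hab hbc hac w ha hb hc => ?_⟩
      · rcases hg with rfl | rfl
        · rw [h.next_A]; exact vF
        · rw [h.next_F]; exact vB
      · rcases h.vertex_cases hl with c | c | ⟨c1, c2, c3⟩ | ⟨c, lA, lF, lB, c'⟩
        · exact Or.inl c
        · exact Or.inr (Or.inl c)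
        · exact absurd (c3 ▸ hl) (hE i c1 c2)
        · obtain ⟨e1, e2⟩ := hu _ c' i c hl
          refine Or.inr (Or.inr ⟨e2, ?_⟩)
          rw [hv] at e1
          have k1 := h.vertex v l vA vF lF (by rw [e1]; exact left_mem_segment _ _ _)
          have k2 := h.vertex l v lA lF vF (by rw [← e1]; exact left_mem_segment _ _ _)
          rcases k1 with k1 | k1
          · exact k1
          rcases k2 with k2 | k2
          · exact k2.symm
          · exact absurd (by rw [← k2, ← k1]) (h.next_next_ne l)
      · rw [htrip a b c hab hbc hac w ha hb hc, hv]
    have hvv : ¬ ov g v ∧ ¬ ov v g ∧ ¬ ov g (m.symm v) ∧ ¬ ov (m.symm v) g :=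
      ⟨(hvirt _).1, (hvirt _).2, (hvirt _).1, (hvirt _).2⟩
    -- Here the edge `A` passes through the vertex just before its own start, and the sides may
    -- differ by a curl. The short edge `Z` lies in the disc of radius `r`, so only the edge before
    -- `Z` is subdivided.
    by_cases hvZ : v = Z ∧ g = A
    · obtain ⟨rfl, rfl⟩ := hvZ
      have hL : LocalWall m ov q g v r :=
        ⟨hW, h.next_ne, h.next_next_ne, h.asymm, h.crosses, hvv, fun x h1 h2 h3 z hz hzr => by
          by_cases hxF : x = F
          · exact absurd hzr (not_le.2 (h.clear_F z (hxF ▸ hz)))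
          · exact absurd hzr (not_le.2 (h.clear x h3 hxF h2 h1 z hz)), h.pos_r⟩
      refine hL.nice_of_prev_far h.lt_r (by rw [h.next_Z]; exact h.le_r)
        (Or.inr h.next_Z.symm) ?_
      rw [h.next_A]
      intro c
      rw [Equiv.eq_symm_apply, h.next_F] at c
      exact h.Z_ne_B c.symm
    -- This is the mirror image of the previous case, at the end of the edge `F`.
    by_cases hvB : v = m B ∧ g = F
    · obtain ⟨rfl, rfl⟩ := hvB
      have hL : LocalWall m ov q g (m B) r' :=
        ⟨hW, h.next_ne, h.next_next_ne, h.asymm, h.crosses, hvv, fun x h1 h2 h3 z hz hzr => by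
          rw [Equiv.symm_apply_apply] at h1
          by_cases hxA : x = A
          · exact absurd hzr (not_le.2 (h.clear_A z (hxA ▸ hz)))
          · exact absurd hzr (not_le.2 (h.clear' x hxA h3 h1 h2 z hz)), h.pos_r'⟩
      refine hL.nice_of_next_far (by rw [Equiv.symm_apply_apply]; exact h.le_r') h.lt_r'
        (h.clear_A _ h.F_mem_A) ?_
      intro c
      exact vA (h.eq_A c)
    refine hW.nice h.next_ne h.next_next_ne h.asymm h.crosses hvv ?_ ?_
    · intro c
      rw [Equiv.eq_symm_apply] at c
      rcases hg with rfl | rfl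
      · rw [h.next_A, h.next_F] at c; exact vB c.symm
      · rw [h.next_F] at c; exact hvB ⟨c.symm, rfl⟩
    · intro c
      rcases hg with rfl | rfl
      · exact hvZ ⟨h.eq_Z c, rfl⟩
      · exact vA (h.eq_A c)
  · have hcg : ∀ s, s ≠ A → s ≠ F → s ≠ Z → s ≠ B → S ∈ polyEdge m q s → polyCrosses m q s g := by
      intro s sA sF sZ sB hs
      refine ⟨hnotg s sA sF, ?_, ?_, S, hs, hm⟩
      · rcases hg with rfl | rfl
        · exact fun c => sZ (h.eq_Z c)
        · exact fun c => sA (h.eq_A c)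
      · rcases hg with rfl | rfl
        · rw [h.next_A]; exact sF.symm
        · rw [h.next_F]; exact sB.symm
    -- The crossing edges are not `Z` or `B`, so they are not adjacent to `g` and cross it properly.
    have hW : TripleWall m q x y g S := by
      refine ⟨hcr, hcg x xA xF xZ xB hx, hcg y yA yF yZ yB hy, hx, hy, hm, fun i l hl => ?_,
        fun a b c hab hbc hac w ha hb hc => ?_⟩
      · rcases h.vertex_cases hl with c | c | ⟨c1, c2, c3⟩ | ⟨c, lA, lF, lB, c'⟩
        · exact Or.inl c
        · exact Or.inr c
        · exact absurd (c3 ▸ hl) (hE i c1 c2)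
        · exfalso
          obtain ⟨e1, -⟩ := hu _ c' i c hl
          have k1 := h.vertex x l xA xF lF (by rw [e1]; exact hx)
          have k2 := h.vertex y l yA yF lF (by rw [e1]; exact hy)
          obtain ⟨n1, n2, n3, -⟩ := hcr
          rcases k1 with k1 | k1 <;> rcases k2 with k2 | k2
          · exact n1 (k1.symm.trans k2)
          · exact n3 (k2.symm.trans k1)
          · exact n2 (k1.symm.trans k2)
          · exact n1 (m.injective (k1.symm.trans k2))
      · have e := htrip a b c hab hbc hac w ha hb hc
        rw [e] at ha
        by_cases haA : a = A ∨ a = F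
        · exact Or.inr (Or.inr (hu S hS a haA ha).2)
        · push Not at haA
          by_contra hne
          push Not at hne
          exact h.triple a x y haA.1 haA.2 xA xF yA yF hne.1 hcr.1 hne.2.1 S ha hx hy
    exact hW.nice h.next_ne h.next_next_ne h.asymm hvirt

/-- A configuration with at most one event is nice. -/
theorem nice [Finite κ] (h : SweepStep m ov q Z A F B r r') : Nice m ov q := by
  by_cases h1 : ∃ x, x ≠ A ∧ x ≠ F ∧ q F ∈ polyEdge m q x
  · obtain ⟨x, xA, xF, hx⟩ := h1
    exact h.nice_of_edge xA xF hx
  by_cases h2 : ∃ S ∈ staticMeets m q A F, S ∈ polyEdge m q A ∨ S ∈ polyEdge m q F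
  · obtain ⟨S, hS, c | c⟩ := h2
    · exact h.nice_of_meet hS (Or.inl rfl) c
    · exact h.nice_of_meet hS (Or.inr rfl) c
  push Not at h1 h2
  obtain ⟨D, rfl, rfl, rfl⟩ := h.exists_diagram (h.gen h1 h2)
  exact D.nice

end SweepStep

end Sweep

/-! ### Moving a vertex along a segment in general position. -/

section SweepPath

variable {κ : Type}

theorem planeDet_eq_zero_of_mem_three {a b x y z : ℂ} (hx : x ∈ segment ℝ a b)
    (hy : y ∈ segment ℝ a b) (hz : z ∈ segment ℝ a b) : planeDet (y - x) (z - x) = 0 := by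
  obtain ⟨s, -, -, hs⟩ := mem_segment_iff_real.1 hx
  obtain ⟨t, -, -, ht⟩ := mem_segment_iff_real.1 hy
  obtain ⟨u, -, -, hu⟩ := mem_segment_iff_real.1 hz
  rw [show y - x = ((t - s : ℝ) : ℂ) * (b - a) by rw [hs, ht]; push_cast; ring,
    show z - x = ((u - s : ℝ) : ℂ) * (b - a) by rw [hs, hu]; push_cast; ring,
    planeDet_mul_left, planeDet_mul_right, planeDet_self]
  ring

/-- The determinant is affine in `t` and nonzero at `t = 1`. -/
theorem finite_setOf_planeDet_eq_zero {u b P C : ℂ} (h : planeDet u (C - b) ≠ 0) :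
    {t : ℝ | planeDet u (P + t * (C - P) - b) = 0}.Finite := by
  have e : ∀ t : ℝ, planeDet u (P + t * (C - P) - b) =
      planeDet u (P - b) + t * planeDet u (C - P) := by
    intro t
    rw [show P + t * (C - P) - b = (P - b) + t * (C - P) by ring, planeDet_add_right,
      planeDet_mul_right]
  have e1 : planeDet u (C - b) = planeDet u (P - b) + planeDet u (C - P) := by
    rw [show C - b = (P - b) + (C - P) by ring, planeDet_add_right]
  apply Set.Subsingleton.finite
  intro t ht s hs
  rw [Set.mem_ofPred_eq, e] at ht hs
  by_contra hne
  have hβ : planeDet u (C - P) = 0 := by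
    have : (t - s) * planeDet u (C - P) = 0 := by linear_combination ht - hs
    exact (mul_eq_zero.1 this).resolve_left (sub_ne_zero.2 hne)
  apply h
  rw [e1]
  rw [hβ] at ht ⊢
  linarith

/-- Adjacent edges share only a vertex, and others cross transversally. Hence there are finitely
many meeting points to avoid. -/
theorem Gen.subsingleton_inter {m : Equiv.Perm κ} {p : κ → ℂ} (hg : Gen m p) (hn : ∀ i, m i ≠ i)
    (hnn : ∀ i, m (m i) ≠ i) {x y : κ} (hxy : x ≠ y) :
    (polyEdge m p x ∩ polyEdge m p y).Subsingleton := by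
  rintro w ⟨hwx, hwy⟩ w' ⟨hwx', hwy'⟩
  by_cases h1 : m x = y
  · subst h1
    rw [inter_eq_vertex hn hnn hg.1 hwx hwy, inter_eq_vertex hn hnn hg.1 hwx' hwy']
  by_cases h2 : m y = x
  · subst h2
    rw [inter_eq_vertex hn hnn hg.1 hwy hwx, inter_eq_vertex hn hnn hg.1 hwy' hwx']
  · exact eq_of_mem_segments (hg.signCross ⟨hxy, h1, h2, w, hwx, hwy⟩).det_ne hwx hwy hwx' hwy'

theorem Gen.finite_staticMeets [Finite κ] {m : Equiv.Perm κ} {p : κ → ℂ} (hg : Gen m p)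
    (hn : ∀ i, m i ≠ i) (hnn : ∀ i, m (m i) ≠ i) (A F : κ) : (staticMeets m p A F).Finite := by
  have : (⋃ z : {z : κ × κ // z.1 ≠ z.2}, polyEdge m p z.1.1 ∩ polyEdge m p z.1.2).Finite :=
    Set.finite_iUnion fun z => (hg.subsingleton_inter hn hnn z.2).finite
  refine this.subset ?_
  rintro w ⟨x, y, -, -, -, -, hxy, hx, hy⟩
  exact mem_iUnion.2 ⟨⟨(x, y), hxy⟩, hx, hy⟩

/-! ### Data unaffected by the motion of one vertex. -/

section Update

variable {m : Equiv.Perm κ} {ov : κ → κ → Prop} {q q' : κ → ℂ} {Z A F B : κ} {r r' : ℝ}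

theorem polyEdge_eq_of_static (hA : m A = F) (hq : ∀ v, v ≠ F → q' v = q v) {x : κ} (xA : x ≠ A)
    (xF : x ≠ F) : polyEdge m q' x = polyEdge m q x := by
  rw [polyEdge, polyEdge, hq x xF, hq (m x) fun c => xA (m.injective (c.trans hA.symm))]

theorem staticMeets_eq (hA : m A = F) (hq : ∀ v, v ≠ F → q' v = q v) :
    staticMeets m q' A F = staticMeets m q A F := by
  ext w
  constructor
  · rintro ⟨x, y, xA, xF, yA, yF, hxy, hx, hy⟩
    rw [polyEdge_eq_of_static hA hq xA xF] at hx
    rw [polyEdge_eq_of_static hA hq yA yF] at hy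
    exact ⟨x, y, xA, xF, yA, yF, hxy, hx, hy⟩
  · rintro ⟨x, y, xA, xF, yA, yF, hxy, hx, hy⟩
    rw [← polyEdge_eq_of_static hA hq xA xF] at hx
    rw [← polyEdge_eq_of_static hA hq yA yF] at hy
    exact ⟨x, y, xA, xF, yA, yF, hxy, hx, hy⟩

theorem StaticPart.of_eq (h : StaticPart m ov q Z A F B r r') (hq : ∀ v, v ≠ F → q' v = q v) :
    StaticPart m ov q' Z A F B r r' := by
  have hE : ∀ x, x ≠ A → x ≠ F → polyEdge m q' x = polyEdge m q x := fun x xA xF =>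
    polyEdge_eq_of_static h.next_A hq xA xF
  have n1 : m B ≠ F := fun c => h.B_ne_A (h.eq_A c)
  have n2 : m (m B) ≠ F := fun c => h.Z_ne_B (h.eq_Z (h.eq_A c)).symm
  have n3 : m.symm Z ≠ F := by
    intro c; rw [Equiv.symm_apply_eq, h.next_F] at c; exact h.Z_ne_B c
  refine ⟨h.next_ne, h.next_next_ne, h.asymm, fun x y hxy => ?_, h.virt_A, h.virt_F, h.next_Z,
    h.next_A, h.next_F, h.Z_ne_B, fun x v xA xF vF hv => ?_,
    fun x y z xA xF yA yF zA zF hxy hyz hxz w hx hy hz => ?_, h.pos_r, h.pos_r', ?_, ?_, ?_, ?_,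
    fun x xA xF xZ xZ' z hz => ?_, fun x xA xF xB xB' z hz => ?_⟩
  · obtain ⟨h1, h2, h3, h4⟩ := h.crosses x y hxy
    have xA : x ≠ A := fun c => (h.virt_A y).1 (c ▸ hxy)
    have xF : x ≠ F := fun c => (h.virt_F y).1 (c ▸ hxy)
    have yA : y ≠ A := fun c => (h.virt_A x).2 (c ▸ hxy)
    have yF : y ≠ F := fun c => (h.virt_F x).2 (c ▸ hxy)
    exact ⟨h1, h2, h3, by rw [hE x xA xF, hE y yA yF]; exact h4⟩
  · rw [hE x xA xF, hq v vF] at hv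
    exact h.vertex x v xA xF vF hv
  · rw [hE x xA xF] at hx
    rw [hE y yA yF] at hy
    rw [hE z zA zF] at hz
    exact h.triple x y z xA xF yA yF zA zF hxy hyz hxz w hx hy hz
  · rw [hq _ h.A_ne_F, hq _ h.Z_ne_F]; exact h.le_r
  · rw [hq _ n3, hq _ h.Z_ne_F]; exact h.lt_r
  · rw [hq _ h.B_ne_F, hq _ n1]; exact h.le_r'
  · rw [hq _ n2, hq _ n1]; exact h.lt_r'
  · rw [hE x xA xF] at hz; rw [hq _ h.Z_ne_F]; exact h.clear x xA xF xZ xZ' z hz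
  · rw [hE x xA xF] at hz; rw [hq _ n1]; exact h.clear' x xA xF xB xB' z hz

end Update

/-- A vertex between edges without classical crossings may be moved along a generic segment,
starting on the segment between the neighbouring vertices. -/
theorem VDiagram.link_eq_of_sweep {D E : VDiagram κ} {Z A F B : κ} {r r' : ℝ} {m : Equiv.Perm κ}
    {ov : κ → κ → Prop} {p : κ → ℂ} {C : ℂ} (hDn : D.next = m) (hDo : D.isOver = ov)
    (hDp : D.pos = p) (hn : E.next = m) (ho : E.isOver = ov) (hp : ∀ v, v ≠ F → E.pos v = p v)
    (hC : E.pos F = C) (hs : StaticPart m ov p Z A F B r r')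
    (hF : p F ∈ openSegment ℝ (p A) (p B)) {HA HF : Set ℂ} (cA : Convex ℝ HA)
    (cF : Convex ℝ HF) (hAA : p A ∈ HA) (hAD : p F ∈ HA) (hAE : C ∈ HA)
    (hFB : p B ∈ HF) (hFD : p F ∈ HF) (hFE : C ∈ HF)
    (dA : ∀ z ∈ HA, r' < dist z (p (m B))) (dF : ∀ z ∈ HF, r < dist z (p Z))
    (gA : ∀ S ∈ staticMeets m p A F, ∀ S' ∈ staticMeets m p A F, S ≠ S' →
      planeDet (S' - S) (p A - S) ≠ 0)
    (gB : ∀ S ∈ staticMeets m p A F, ∀ S' ∈ staticMeets m p A F, S ≠ S' →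
      planeDet (S' - S) (p B - S) ≠ 0)
    (hoff : planeDet (p B - p A) (C - p A) ≠ 0)
    (eA : ∀ S ∈ staticMeets m p A F, planeDet (S - p A) (C - p A) ≠ 0)
    (eB : ∀ S ∈ staticMeets m p A F, planeDet (S - p B) (C - p B) ≠ 0)
    (ex : ∀ x, x ≠ A → x ≠ F → planeDet (p (m x) - p x) (C - p x) ≠ 0)
    (uAB : ∀ t : ℝ, 0 < t → ∀ S ∈ staticMeets m p A F, ∀ S' ∈ staticMeets m p A F,
      planeDet (S - p A) (p F + t * (C - p F) - p A) = 0 →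
      planeDet (S' - p B) (p F + t * (C - p F) - p B) ≠ 0)
    (uA : ∀ t : ℝ, 0 < t → ∀ S ∈ staticMeets m p A F, ∀ x, x ≠ A → x ≠ F → x ≠ Z → x ≠ B →
      planeDet (S - p A) (p F + t * (C - p F) - p A) = 0 →
      planeDet (p (m x) - p x) (p F + t * (C - p F) - p x) ≠ 0)
    (uB : ∀ t : ℝ, 0 < t → ∀ S ∈ staticMeets m p A F, ∀ x, x ≠ A → x ≠ F → x ≠ Z → x ≠ B →
      planeDet (S - p B) (p F + t * (C - p F) - p B) = 0 →
      planeDet (p (m x) - p x) (p F + t * (C - p F) - p x) ≠ 0) :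
    D.link = E.link := by
  classical
  have := D.finite
  let P : ℝ → ℂ := fun t => p F + t * (C - p F)
  let γ : ℝ → κ → ℂ := fun t => Function.update p F (P t)
  have hγF : ∀ t, γ t F = P t := fun t => Function.update_self _ _ _
  have hγ : ∀ t v, v ≠ F → γ t v = p v := fun t v hv => Function.update_of_ne hv _ _
  have hγc : Continuous γ := by
    apply continuous_const.update F; fun_prop
  have hγ0 : p = γ 0 := by
    symm; simp only [γ]; rw [Function.update_eq_iff]; simp [P]
  have hγ1 : E.pos = γ 1 := by
    funext v
    by_cases hv : v = F
    · subst hv; rw [hγF]; simp only [P, hC]; push_cast; ring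
    · rw [hγ 1 v hv, hp v hv]
  have hmA := hs.next_A
  have hmF := hs.next_F
  have hAF := hs.A_ne_F
  have hBF := hs.B_ne_F
  have hSM : ∀ t, staticMeets m (γ t) A F = staticMeets m p A F := fun t =>
    staticMeets_eq hmA (hγ t)
  have hst : ∀ t, StaticPart m ov (γ t) Z A F B r r' := fun t => hs.of_eq (hγ t)
  have hEA : ∀ t, polyEdge m (γ t) A = segment ℝ (p A) (P t) := fun t => by
    rw [polyEdge, hmA, hγF, hγ t A hAF]
  have hEF : ∀ t, polyEdge m (γ t) F = segment ℝ (P t) (p B) := fun t => by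
    rw [polyEdge, hmF, hγF, hγ t B hBF]
  have hEx : ∀ t x, x ≠ A → x ≠ F → polyEdge m (γ t) x = polyEdge m p x := fun t x xA xF =>
    polyEdge_eq_of_static hmA (hγ t) xA xF
  have hPmem : ∀ {H : Set ℂ}, Convex ℝ H → p F ∈ H → C ∈ H → ∀ t, 0 < t → t ≤ 1 → P t ∈ H :=
    fun hc h1 h2 t ht ht1 =>
      hc.segment_subset h1 h2 (mem_segment_iff_real.2 ⟨t, ht.le, ht1, rfl⟩)
  have cA0 : ∀ t S, S ∈ segment ℝ (p A) (P t) → planeDet (S - p A) (P t - p A) = 0 := fun t S hS =>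
    planeDet_eq_zero_of_mem_three (left_mem_segment _ _ _) hS (right_mem_segment _ _ _)
  have cB0 : ∀ t S, S ∈ segment ℝ (P t) (p B) → planeDet (S - p B) (P t - p B) = 0 := fun t S hS =>
    planeDet_eq_zero_of_mem_three (right_mem_segment _ _ _) hS (left_mem_segment _ _ _)
  have hstep : ∀ t, 0 < t → t ≤ 1 → SweepStep m ov (γ t) Z A F B r r' := by
    intro t ht ht1
    have hPA := hPmem cA hAD hAE t ht ht1
    have hPF := hPmem cF hFD hFE t ht ht1
    have n1 : m B ≠ F := fun c => hs.B_ne_A (hs.eq_A c)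
    have hAsub : ∀ z ∈ polyEdge m (γ t) A, z ∈ HA := fun z hz => by
      rw [hEA] at hz; exact cA.segment_subset hAA hPA hz
    have hFsub : ∀ z ∈ polyEdge m (γ t) F, z ∈ HF := fun z hz => by
      rw [hEF] at hz; exact cF.segment_subset hPF hFB hz
    have hxZB : ∀ x, P t ∈ polyEdge m p x → x ≠ Z ∧ x ≠ B := fun x hx =>
      ⟨fun c => absurd (hs.edge_Z (c ▸ hx)) (not_le.2 (dF _ hPF)),
        fun c => absurd (hs.edge_B (c ▸ hx)) (not_le.2 (dA _ hPA))⟩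
    refine ⟨hst t, ?_, ?_, ?_, ?_, ?_, ?_, ?_, ?_⟩
    · rw [hγF, hγ t A hAF, hγ t B hBF]
      obtain ⟨s, -, -, hsF⟩ := mem_openSegment_iff_real.1 hF
      -- The motion starts on the segment `A B` and ends off its line, so the offset from the line
      -- grows linearly.
      have : planeDet (p B - p A) (P t - p A) = t * planeDet (p B - p A) (C - p A) := by
        rw [show P t - p A = (((1 - t) * s : ℝ) : ℂ) * (p B - p A) + t * (C - p A) by
          simp only [P]; rw [hsF]; push_cast; ring, planeDet_add_right, planeDet_mul_right,
          planeDet_mul_right, planeDet_self]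
        ring
      rw [this]
      exact mul_ne_zero ht.ne' hoff
    · intro z hz
      rw [hγ t Z hs.Z_ne_F]
      exact dF z (hFsub z hz)
    · intro z hz
      rw [hγ t _ n1]
      exact dA z (hAsub z hz)
    · intro S hS S' hS' h1 h2
      rw [hSM] at hS hS'
      rw [hEA] at h1 h2
      by_contra hne
      exact gA S hS S' hS' hne (planeDet_eq_zero_of_mem_three h1 h2 (left_mem_segment _ _ _))
    · intro S hS S' hS' h1 h2
      rw [hSM] at hS hS'
      rw [hEF] at h1 h2
      by_contra hne
      exact gB S hS S' hS' hne (planeDet_eq_zero_of_mem_three h1 h2 (right_mem_segment _ _ _))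
    · intro S hS S' hS' h1 h2
      rw [hSM] at hS hS'
      rw [hEA] at h1
      rw [hEF] at h2
      exact uAB t ht S hS S' hS' (cA0 t S h1) (cB0 t S' h2)
    · intro S hS h1 x xA xF hx
      rw [hSM] at hS
      rw [hEA] at h1
      rw [hEx t x xA xF, hγF] at hx
      obtain ⟨xZ, xB⟩ := hxZB x hx
      exact uA t ht S hS x xA xF xZ xB (cA0 t S h1) (planeDet_eq_zero_of_mem_segment hx)
    · intro S hS h1 x xA xF hx
      rw [hSM] at hS
      rw [hEF] at h1
      rw [hEx t x xA xF, hγF] at hx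
      obtain ⟨xZ, xB⟩ := hxZB x hx
      exact uB t ht S hS x xA xF xZ xB (cB0 t S h1) (planeDet_eq_zero_of_mem_segment hx)
  have hfin : (staticMeets m p A F).Finite := by
    rw [← hDn, ← hDp]; exact D.gen.finite_staticMeets D.next_ne D.next_next_ne A F
  -- These finitely many times include all events with `t > 0`. At the other times strictly between
  -- `0` and `1` the position is generic, which gives density.
  let Bad : Set ℝ := (⋃ S ∈ staticMeets m p A F, {t : ℝ | planeDet (S - p A) (P t - p A) = 0}) ∪
    (⋃ S ∈ staticMeets m p A F, {t : ℝ | planeDet (S - p B) (P t - p B) = 0}) ∪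
    ⋃ x ∈ {x | x ≠ A ∧ x ≠ F}, {t : ℝ | planeDet (p (m x) - p x) (P t - p x) = 0}
  have hBad : Bad.Finite := by
    refine Set.Finite.union (Set.Finite.union ?_ ?_) ?_
    · exact hfin.biUnion fun S hS => finite_setOf_planeDet_eq_zero (eA S hS)
    · exact hfin.biUnion fun S hS => finite_setOf_planeDet_eq_zero (eB S hS)
    · exact (Set.toFinite _).biUnion fun x hx => finite_setOf_planeDet_eq_zero (ex x hx.1 hx.2)
  refine link_eq_of_nice_path hγc ?_ ?_ hDn hDo (hDp.trans hγ0) hn ho hγ1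
  · intro t ht
    rcases ht.1.eq_or_lt with h0 | h0
    · rw [← h0, ← hγ0, ← hDn, ← hDo, ← hDp]; exact D.nice
    · exact (hstep t h0 ht.2).nice
  · intro t ht
    have hdense : Dense (Badᶜ) := hBad.countable.dense_compl ℝ
    have hmem : t ∈ closure (Ioo (0 : ℝ) 1 ∩ Badᶜ) := by
      have := hdense.open_subset_closure_inter (isOpen_Ioo (a := (0 : ℝ)) (b := 1))
      have h2 := closure_mono this
      rw [closure_Ioo (by norm_num), closure_closure] at h2
      exact h2 ht
    rw [frequently_nhdsWithin_iff]
    refine (mem_closure_iff_frequently.1 hmem).mono ?_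
    rintro s ⟨hs01, hsB⟩
    refine ⟨(hstep s hs01.1 hs01.2.le).exists_diagram ((hstep s hs01.1 hs01.2.le).gen ?_ ?_),
      Ioo_subset_Icc_self hs01⟩
    · intro x xA xF hx
      rw [hEx s x xA xF, hγF] at hx
      exact hsB (Or.inr (mem_biUnion (show x ∈ {x | x ≠ A ∧ x ≠ F} from ⟨xA, xF⟩)
        (planeDet_eq_zero_of_mem_segment hx)))
    · intro S hS
      rw [hSM] at hS
      rw [hEA, hEF]
      exact ⟨fun c => hsB (Or.inl (Or.inl (mem_biUnion hS (cA0 s S c)))),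
        fun c => hsB (Or.inl (Or.inr (mem_biUnion hS (cB0 s S c))))⟩

end SweepPath

/-- A line is recorded as a base point and a direction. Ignoring zero directions allows families of
lines to be listed without checking nondegeneracy. -/
theorem exists_mem_open_off {T : Set (ℂ × ℂ)} (hT : T.Finite) {U : Set ℂ} (hU : IsOpen U)
    (hne : U.Nonempty) : ∃ z ∈ U, ∀ l ∈ T, l.2 ≠ 0 → planeDet l.2 (z - l.1) ≠ 0 := by
  obtain ⟨z, hz, h⟩ := exists_mem_open_off_lines (T := T ∩ {l | l.2 ≠ 0}) (hT.inter_of_left _)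
    Prod.fst Prod.snd (fun i hi => hi.2) hU hne
  exact ⟨z, hz, fun l hl h0 => h l ⟨hl, h0⟩⟩

/-- Two different lines have at most one common point. -/
theorem exists_unique_inter {a u b v : ℂ} (hu : u ≠ 0) (hne : planeDet v (a - b) ≠ 0) :
    ∃ q, ∀ z, planeDet u (z - a) = 0 → planeDet v (z - b) = 0 → z = q := by
  by_cases hex : ∃ q, planeDet u (q - a) = 0 ∧ planeDet v (q - b) = 0
  · obtain ⟨q, hq1, hq2⟩ := hex
    refine ⟨q, fun z hz1 hz2 => ?_⟩
    by_contra hzq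
    have h1 : planeDet u (z - q) = 0 := by
      rw [show z - q = (z - a) - (q - a) by ring, planeDet_sub_right, hz1, hq1, sub_zero]
    have h2 : planeDet v (z - q) = 0 := by
      rw [show z - q = (z - b) - (q - b) by ring, planeDet_sub_right, hz2, hq2, sub_zero]
    obtain ⟨k, hk⟩ := exists_real_mul_of_planeDet_eq_zero hu h1
    obtain ⟨l, hl⟩ := exists_real_mul_of_planeDet_eq_zero hu hq1
    have hk0 : k ≠ 0 := by
      rintro rfl
      exact hzq (by simpa [sub_eq_zero] using hk)
    have h3 : planeDet v u = 0 := by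
      rw [hk, planeDet_mul_right] at h2
      exact (mul_eq_zero.1 h2).resolve_left hk0
    apply hne
    rw [show a - b = (q - b) - (q - a) by ring, planeDet_sub_right, hq2, hl, planeDet_mul_right, h3]
    ring
  · exact ⟨0, fun z h1 h2 => absurd ⟨z, h1, h2⟩ hex⟩

/-! ### Achieving general position by perturbation. -/

section GeneralMove

variable {κ : Type}

/-- Two diagrams which differ in the position of the vertex `F` between edges without classical
crossings represent the same link, if the edges before and after are short. -/
theorem VDiagram.link_eq_of_local_move {D E : VDiagram κ} {Z A F B : κ} {r r' : ℝ}
    (hn : E.next = D.next) (ho : E.isOver = D.isOver) (hp : ∀ v, v ≠ F → E.pos v = D.pos v)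
    (vA : ∀ y, ¬ D.isOver A y ∧ ¬ D.isOver y A) (vF : ∀ y, ¬ D.isOver F y ∧ ¬ D.isOver y F)
    (hZ : D.next Z = A) (hA : D.next A = F) (hF : D.next F = B) (hZB : Z ≠ B)
    (hmem : D.pos F ∈ openSegment ℝ (D.pos A) (D.pos B))
    (hr : 0 < r) (hr' : 0 < r') (le_r : dist (D.pos A) (D.pos Z) < r)
    (lt_r : r < dist (D.pos (D.next.symm Z)) (D.pos Z))
    (le_r' : dist (D.pos B) (D.pos (D.next B)) < r')
    (lt_r' : r' < dist (D.pos (D.next (D.next B))) (D.pos (D.next B)))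
    (hrr : r + r' < dist (D.pos Z) (D.pos (D.next B)))
    (clear : ∀ x, x ≠ A → x ≠ F → x ≠ Z → x ≠ D.next.symm Z → x ≠ B →
      ∀ z ∈ polyEdge D.next D.pos x, r < dist z (D.pos Z))
    (clear' : ∀ x, x ≠ A → x ≠ F → x ≠ B → x ≠ D.next B → x ≠ Z →
      ∀ z ∈ polyEdge D.next D.pos x, r' < dist z (D.pos (D.next B)))
    {HA HF : Set ℂ} (cA : Convex ℝ HA) (oA : IsOpen HA) (cF : Convex ℝ HF) (oF : IsOpen HF)
    (hAA : D.pos A ∈ HA) (hAD : D.pos F ∈ HA) (hAE : E.pos F ∈ HA)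
    (hFB : D.pos B ∈ HF) (hFD : D.pos F ∈ HF) (hFE : E.pos F ∈ HF)
    (dA : ∀ z ∈ HA, r' < dist z (D.pos (D.next B))) (dF : ∀ z ∈ HF, r < dist z (D.pos Z)) :
    D.link = E.link := by
  classical
  have := D.finite
  set m := D.next with hm
  set p := D.pos with hpdef
  set C₀ := E.pos F with hC₀
  have hn1 : ∀ i, m i ≠ i := D.next_ne
  have hn2 : ∀ i, m (m i) ≠ i := D.next_next_ne
  -- distinctness
  have nAF : A ≠ F := fun c => hn1 A (hA.trans c.symm)
  have nBF : B ≠ F := fun c => hn1 F (hF.trans c)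
  have nBA : B ≠ A := fun c => hn2 A (by rw [hA, hF, c])
  have nZA : Z ≠ A := fun c => hn1 Z (hZ.trans c.symm)
  have nZF : Z ≠ F := fun c => hn2 Z (by rw [hZ, hA, c])
  have nMF : m B ≠ F := fun c => nBA (m.injective (c.trans hA.symm))
  have nMA : m B ≠ A := fun c => hZB (m.injective (c.trans hZ.symm)).symm
  have nMB : m B ≠ B := hn1 B
  have nMMF : m (m B) ≠ F := fun c => nMA (m.injective (c.trans hA.symm))
  have nMMB : m (m B) ≠ B := hn2 B
  have nSF : m.symm Z ≠ F := fun c => hZB (((Equiv.symm_apply_eq m).1 c).trans hF)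
  have nSA : m.symm Z ≠ A := fun c => nZF (((Equiv.symm_apply_eq m).1 c).trans hA)
  have nMZ : m B ≠ Z := by
    intro c
    rw [c, dist_self] at hrr
    linarith
  have nMMA : m (m B) ≠ A := fun c => nMZ (m.injective (c.trans hZ.symm))
  have nSB : m.symm Z ≠ B := fun c => nMZ ((Equiv.symm_apply_eq m).1 c).symm
  obtain ⟨s, hs0, hs1, hsF⟩ := mem_openSegment_iff_real.1 hmem
  -- the static part of nearby configurations
  have hstat : ∀ p' : κ → ℂ, Gen m p' → (∀ x y, D.isOver x y → polyCrosses m p' x y) →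
      (∀ v, v ≠ A → v ≠ F → v ≠ B → p' v = p v) → dist (p' A) (p Z) < r →
      dist (p' B) (p (m B)) < r' → StaticPart m D.isOver p' Z A F B r r' := by
    intro p' hg hcr hv h1 h2
    have eZ : p' Z = p Z := hv Z nZA nZF hZB
    have eM : p' (m B) = p (m B) := hv _ nMA nMF nMB
    have eS : p' (m.symm Z) = p (m.symm Z) := hv _ nSA nSF nSB
    have eMM : p' (m (m B)) = p (m (m B)) := hv _ nMMA nMMF nMMB
    have hE : ∀ x, x ≠ A → x ≠ F → x ≠ Z → x ≠ B → polyEdge m p' x = polyEdge m p x := by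
      intro x xA xF xZ xB
      rw [polyEdge, polyEdge, hv x xA xF xB, hv (m x) (fun c => xZ (m.injective (c.trans hZ.symm)))
        (fun c => xA (m.injective (c.trans hA.symm))) (fun c => xF (m.injective (c.trans hF.symm)))]
    have hZball : ∀ z ∈ polyEdge m p' Z, dist z (p Z) < r := by
      intro z hz
      refine (convex_ball (p Z) r).segment_subset ?_ ?_ hz
      · rw [eZ]; exact Metric.mem_ball_self hr
      · rw [hZ]; exact h1
    have hBball : ∀ z ∈ polyEdge m p' B, dist z (p (m B)) < r' := by
      intro z hz
      refine (convex_ball (p (m B)) r').segment_subset h2 ?_ hz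
      rw [eM]; exact Metric.mem_ball_self hr'
    refine ⟨hn1, hn2, D.over_asymm, hcr, vA, vF, hZ, hA, hF, hZB, fun x v _ _ _ => hg.1 x v,
      fun x y z _ _ _ _ _ _ => hg.2 x y z, hr, hr', ?_, ?_, ?_, ?_, ?_, ?_⟩
    · rw [eZ]; exact h1.le
    · rw [eZ, eS]; exact lt_r
    · rw [eM]; exact h2.le
    · rw [eM, eMM]; exact lt_r'
    · intro x xA xF xZ xS z hz
      rw [eZ]
      -- By `hrr` the two discs are disjoint, so the short edge `B`, inside its own disc, stays away
      -- from `Z`.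
      by_cases xB : x = B
      · have h3 := hBball z (xB ▸ hz)
        have h4 := dist_triangle (p Z) z (p (m B))
        rw [dist_comm (p Z) z] at h4
        linarith
      · rw [hE x xA xF xZ xB] at hz
        exact clear x xA xF xZ xS xB z hz
    · intro x xA xF xB xM z hz
      rw [eM]
      by_cases xZ : x = Z
      · have h3 := hZball z (xZ ▸ hz)
        have h4 := dist_triangle (p Z) z (p (m B))
        rw [dist_comm (p Z) z] at h4
        linarith
      · rw [hE x xA xF xZ xB] at hz
        exact clear' x xA xF xB xM xZ z hz
  have hst0 : StaticPart m D.isOver p Z A F B r r' :=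
    hstat p D.gen D.over_crosses (fun _ _ _ _ => rfl) le_r le_r'
  set M₀ := staticMeets m p A F with hM
  have hMfin : M₀.Finite := D.gen.finite_staticMeets D.next_ne D.next_next_ne A F
  have hAM : p A ∉ M₀ := by
    rintro ⟨x, y, xA, xF, yA, yF, hxy, hx, hy⟩
    have k : ∀ x, x ≠ A → p A ∈ polyEdge m p x → x = Z := fun x xA hx => by
      rcases D.gen.1 x A hx with c | c
      · exact absurd c.symm xA
      · exact hst0.eq_Z c.symm
    exact hxy ((k x xA hx).trans (k y yA hy).symm)
  have hBM : p B ∉ M₀ := by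
    rintro ⟨x, y, xA, xF, yA, yF, hxy, hx, hy⟩
    have k : ∀ x, x ≠ F → p B ∈ polyEdge m p x → x = B := fun x xF hx => by
      rcases D.gen.1 x B hx with c | c
      · exact c.symm
      · exact absurd (hst0.eq_F c.symm) xF
    exact hxy ((k x xF hx).trans (k y yF hy).symm)
  -- the perturbed configurations
  let Φ : ℂ × ℂ → κ → ℂ := fun w => Function.update (Function.update (Function.update p A w.1) B w.2)
    F (w.1 + s * (w.2 - w.1))
  -- `Φ` keeps `F` on the segment between its neighbours at the fixed ratio `s`, as the sweep
  -- requires at its start. `Ψ` puts `F` at the perturbed target.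
  let Ψ : (ℂ × ℂ) × ℂ → κ → ℂ := fun w => Function.update (Φ w.1) F w.2
  have hΦc : Continuous Φ :=
    ((continuous_const.update A (by fun_prop)).update B (by fun_prop)).update F (by fun_prop)
  have hΨc : Continuous Ψ := (hΦc.comp continuous_fst).update F continuous_snd
  have hΦF : ∀ w, Φ w F = w.1 + s * (w.2 - w.1) := fun w => Function.update_self _ _ _
  have hΦB : ∀ w, Φ w B = w.2 := fun w => by simp [Φ, Function.update_of_ne nBF]
  have hΦA : ∀ w, Φ w A = w.1 := fun w => by
    simp [Φ, Function.update_of_ne nAF, Function.update_of_ne nBA.symm]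
  have hΦv : ∀ w v, v ≠ A → v ≠ F → v ≠ B → Φ w v = p v := fun w v h1 h2 h3 => by
    simp [Φ, Function.update_of_ne h1, Function.update_of_ne h2, Function.update_of_ne h3]
  have hΨF : ∀ w, Ψ w F = w.2 := fun w => Function.update_self _ _ _
  have hΨv : ∀ w v, v ≠ F → Ψ w v = Φ w.1 v := fun w v h => Function.update_of_ne h _ _
  have hΦ0 : Φ (p A, p B) = p := by
    funext v
    by_cases h1 : v = F
    · rw [h1, hΦF, hsF]
    by_cases h2 : v = A
    · rw [h2, hΦA]
    by_cases h3 : v = B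
    · rw [h3, hΦB]
    exact hΦv _ v h2 h1 h3
  have hΨ0 : Ψ ((p A, p B), C₀) = E.pos := by
    funext v
    by_cases h1 : v = F
    · rw [h1, hΨF]
    · rw [hΨv _ _ h1, hΦ0, hp v h1]
  have hfst : Tendsto (fun w : (ℂ × ℂ) × ℂ => w.1) (𝓝 ((p A, p B), C₀)) (𝓝 (p A, p B)) :=
    continuous_fst.tendsto _
  have e1 : ∀ᶠ w in 𝓝 ((p A, p B), C₀), ∃ D' : VDiagram κ, D'.next = m ∧ D'.isOver = D.isOver ∧
      D'.pos = Φ w.1 ∧ D'.link = D.link := by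
    have h := D.eventually_perturb
    rw [← hpdef, ← hΦ0] at h
    exact ((hΦc.tendsto (p A, p B)).comp hfst).eventually h
  have e2 : ∀ᶠ w in 𝓝 ((p A, p B), C₀), ∃ D' : VDiagram κ, D'.next = m ∧ D'.isOver = D.isOver ∧
      D'.pos = Ψ w ∧ D'.link = E.link := by
    have h := E.eventually_perturb
    rw [hn, ho, ← hΨ0] at h
    exact (hΨc.tendsto ((p A, p B), C₀)).eventually h
  have cw1 : Continuous fun w : (ℂ × ℂ) × ℂ => w.1.1 := by fun_prop
  have cw2 : Continuous fun w : (ℂ × ℂ) × ℂ => w.1.2 := by fun_prop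
  have cw3 : Continuous fun w : (ℂ × ℂ) × ℂ => w.2 := by fun_prop
  have cwF : Continuous fun w : (ℂ × ℂ) × ℂ => w.1.1 + s * (w.1.2 - w.1.1) := by fun_prop
  have e3 : ∀ᶠ w in 𝓝 ((p A, p B), C₀), w.1.1 ∈ HA ∩ Metric.ball (p Z) r ∩ M₀ᶜ :=
    cw1.tendsto _ (((oA.inter Metric.isOpen_ball).inter hMfin.isClosed.isOpen_compl).mem_nhds
      ⟨⟨hAA, le_r⟩, hAM⟩)
  have e4 : ∀ᶠ w in 𝓝 ((p A, p B), C₀), w.1.2 ∈ HF ∩ Metric.ball (p (m B)) r' ∩ M₀ᶜ :=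
    cw2.tendsto _ (((oF.inter Metric.isOpen_ball).inter hMfin.isClosed.isOpen_compl).mem_nhds
      ⟨⟨hFB, le_r'⟩, hBM⟩)
  have e5 : ∀ᶠ w in 𝓝 ((p A, p B), C₀), w.2 ∈ HA ∩ HF :=
    cw3.tendsto _ ((oA.inter oF).mem_nhds ⟨hAE, hFE⟩)
  have e6 : ∀ᶠ w in 𝓝 ((p A, p B), C₀), (w.1.1 + (s : ℂ) * (w.1.2 - w.1.1) : ℂ) ∈ HA ∩ HF := by
    refine cwF.tendsto ((p A, p B), C₀) ((oA.inter oF).mem_nhds ?_)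
    change p A + (s : ℂ) * (p B - p A) ∈ HA ∩ HF
    rw [← hsF]; exact ⟨hAD, hFD⟩
  obtain ⟨UAB, UC, oUAB, hUAB, oUC, hUC, hU⟩ :=
    mem_nhds_prod_iff'.1 ((((((e1.and e2).and e3).and e4).and e5).and e6))
  obtain ⟨UA, UB, oUA, hUA, oUB, hUB, hU'⟩ := mem_nhds_prod_iff'.1 (oUAB.mem_nhds hUAB)
  -- the choice of the neighbours and of the end point
  let T0 : Set (ℂ × ℂ) := (fun z : ℂ × ℂ => (z.1, z.2 - z.1)) '' (M₀ ×ˢ M₀)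
  have hT0 : T0.Finite := (hMfin.prod hMfin).image _
  -- First `b` is chosen off the lines through two points of `M₀`, then `a` off these and off the
  -- lines from `b` to points of `M₀`. Thus a line through `a` and `S` differs from one through `b`
  -- and `S'`.
  obtain ⟨b, hb, hbT⟩ := exists_mem_open_off hT0 oUB ⟨_, hUB⟩
  obtain ⟨a, ha, haT⟩ := exists_mem_open_off (hT0.union (hMfin.image fun S => (b, S - b))) oUA
    ⟨_, hUA⟩
  have hab : (a, b) ∈ UAB := hU' ⟨ha, hb⟩
  obtain ⟨⟨⟨⟨⟨-, -⟩, ⟨⟨ha1, ha2⟩, ha3⟩⟩, ⟨⟨hb1, hb2⟩, hb3⟩⟩, -⟩, hf1, hf2⟩ := hU (mk_mem_prod hab hUC)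
  set f : ℂ := a + s * (b - a) with hf
  have hf1 : f ∈ HA := hf1
  have hf2 : f ∈ HF := hf2
  set p' := Φ (a, b) with hp'
  have gB : ∀ S ∈ M₀, ∀ S' ∈ M₀, S ≠ S' → planeDet (S' - S) (b - S) ≠ 0 := fun S hS S' hS' hne =>
    hbT (S, S' - S) ⟨(S, S'), ⟨hS, hS'⟩, rfl⟩ (sub_ne_zero.2 hne.symm)
  have gA : ∀ S ∈ M₀, ∀ S' ∈ M₀, S ≠ S' → planeDet (S' - S) (a - S) ≠ 0 := fun S hS S' hS' hne =>
    haT (S, S' - S) (Or.inl ⟨(S, S'), ⟨hS, hS'⟩, rfl⟩) (sub_ne_zero.2 hne.symm)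
  have neA : ∀ S ∈ M₀, S - a ≠ 0 := fun S hS h0 => ha3 (by rwa [← sub_eq_zero.1 h0])
  have neB : ∀ S ∈ M₀, S - b ≠ 0 := fun S hS h0 => hb3 (by rwa [← sub_eq_zero.1 h0])
  have gAB : ∀ S ∈ M₀, planeDet (S - b) (a - b) ≠ 0 := fun S hS =>
    haT (b, S - b) (Or.inr ⟨S, hS, rfl⟩) (neB S hS)
  have qAB : ∀ z : ℂ × ℂ, z.1 ∈ M₀ → z.2 ∈ M₀ → ∃ q, ∀ w, planeDet (z.1 - a) (w - a) = 0 →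
      planeDet (z.2 - b) (w - b) = 0 → w = q := fun z h1 h2 =>
    exists_unique_inter (neA _ h1) (gAB _ h2)
  have pinj : ∀ x, p x ≠ p (m x) := fun x c => hn1 x (Gen.injective hn2 D.gen.1 c).symm
  have hxM : ∀ x, x ≠ A → x ≠ F → x ≠ Z → x ≠ B → p x ∈ M₀ ∧ p (m x) ∈ M₀ := fun x xA xF xZ xB =>
    ⟨hst0.vertex_mem_staticMeets xA xF xB, hst0.vertex_mem_staticMeets
      (fun c => xZ (hst0.eq_Z c)) (fun c => xA (hst0.eq_A c)) (fun c => xF (hst0.eq_F c))⟩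
  have qA : ∀ z : ℂ × κ, z.1 ∈ M₀ → z.2 ≠ A → z.2 ≠ F → z.2 ≠ Z → z.2 ≠ B → ∃ q, ∀ w,
      planeDet (z.1 - a) (w - a) = 0 → planeDet (p (m z.2) - p z.2) (w - p z.2) = 0 → w = q := by
    intro z h1 xA xF xZ xB
    obtain ⟨k1, k2⟩ := hxM _ xA xF xZ xB
    exact exists_unique_inter (neA _ h1) (gA _ k1 _ k2 (pinj _))
  have qB : ∀ z : ℂ × κ, z.1 ∈ M₀ → z.2 ≠ A → z.2 ≠ F → z.2 ≠ Z → z.2 ≠ B → ∃ q, ∀ w,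
      planeDet (z.1 - b) (w - b) = 0 → planeDet (p (m z.2) - p z.2) (w - p z.2) = 0 → w = q := by
    intro z h1 xA xF xZ xB
    obtain ⟨k1, k2⟩ := hxM _ xA xF xZ xB
    exact exists_unique_inter (neB _ h1) (gB _ k1 _ k2 (pinj _))
  -- These name the points at which two events could coincide: the intersections of a line from `a`
  -- or `b` to a point of `M₀` with another such line or with a static edge. Their number is finite,
  -- so the path from `f` to `c` can avoid them.
  choose! fAB hfAB using qAB
  choose! fA hfA using qA
  choose! fB hfB using qB
  let T : Set (ℂ × ℂ) := ((fun S => (a, S - a)) '' M₀ ∪ (fun S => (b, S - b)) '' M₀) ∪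
    (range (fun x => (p' x, p' (m x) - p' x)) ∪ {(a, b - a)}) ∪
    ((fun z => (f, fAB z - f)) '' (M₀ ×ˢ M₀) ∪ ((fun z => (f, fA z - f)) '' (M₀ ×ˢ univ) ∪
      (fun z => (f, fB z - f)) '' (M₀ ×ˢ univ)))
  have hT : T.Finite :=
    (((hMfin.image _).union (hMfin.image _)).union ((finite_range _).union (finite_singleton _))).union
      (((hMfin.prod hMfin).image _).union (((hMfin.prod finite_univ).image _).union
        ((hMfin.prod finite_univ).image _)))
  obtain ⟨c, hc, hcT⟩ := exists_mem_open_off hT oUC ⟨_, hUC⟩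
  obtain ⟨⟨⟨⟨⟨⟨Dt, d1, d2, d3, d4⟩, ⟨Et, t1, t2, t3, t4⟩⟩, -⟩, -⟩, ⟨hc1, hc2⟩⟩, -⟩ :=
    hU (mk_mem_prod hab hc)
  have d3 : Dt.pos = p' := d3
  have hDg : Gen m p' := by rw [← d1, ← d3]; exact Dt.gen
  have hst' : StaticPart m D.isOver p' Z A F B r r' := by
    refine hstat p' hDg ?_ (hΦv _) ?_ ?_
    · rw [← d1, ← d2, ← d3]; exact Dt.over_crosses
    · rw [hp', hΦA]; exact ha2
    · rw [hp', hΦB]; exact hb2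
  have hE' : ∀ x, x ≠ A → x ≠ F → x ≠ Z → x ≠ B → p' x = p x ∧ p' (m x) = p (m x) := by
    intro x xA xF xZ xB
    exact ⟨hΦv _ x xA xF xB, hΦv _ (m x) (fun c => xZ (hst0.eq_Z c)) (fun c => xA (hst0.eq_A c))
      (fun c => xF (hst0.eq_F c))⟩
  have hM' : ∀ S ∈ staticMeets m p' A F, S ∈ M₀ := by
    intro S hS
    rcases hst'.staticMeets_cases hS with ⟨v, vA, vF, vB, hv⟩ |
      ⟨x, y, xA, xF, xZ, xB, yA, yF, yZ, yB, hcr, hx, hy⟩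
    · rw [hv, hp', hΦv _ v vA vF vB]
      exact hst0.vertex_mem_staticMeets vA vF vB
    · obtain ⟨k1, k2⟩ := hE' x xA xF xZ xB
      obtain ⟨k3, k4⟩ := hE' y yA yF yZ yB
      rw [polyEdge, k1, k2] at hx
      rw [polyEdge, k3, k4] at hy
      exact ⟨x, y, xA, xF, yA, yF, hcr.1, hx, hy⟩
  have pA : p' A = a := hΦA _
  have pB : p' B = b := hΦB _
  have pF : p' F = f := hΦF _
  have hba : b - a ≠ 0 := by
    intro h0
    have := Gen.injective hn2 hDg.1 (show p' A = p' B by rw [pA, pB, sub_eq_zero.1 h0])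
    exact nBA this.symm
  have hoff : planeDet (b - a) (c - a) ≠ 0 := hcT (a, b - a) (by simp [T]) hba
  -- If `q ≠ f`, the target `c` is off the line through `f` and `q`, so the ray towards `c` misses
  -- `q`. If `q = f`, the ray has left `f` for `t > 0`, because `c ≠ f` by `hoff`.
  have havoid : ∀ q : ℂ, (q - f ≠ 0 → planeDet (q - f) (c - f) ≠ 0) → ∀ t : ℝ, 0 < t →
      f + t * (c - f) ≠ q := by
    intro q hq t ht he
    have hqf : q - f = t * (c - f) := by rw [← he]; ring
    by_cases h0 : q - f = 0
    · rw [h0] at hqf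
      have htc : (t : ℂ) ≠ 0 := by exact_mod_cast ht.ne'
      have hcf : c - f = 0 := (mul_eq_zero.1 hqf.symm).resolve_left htc
      apply hoff
      rw [show c - a = (s : ℂ) * (b - a) by rw [sub_eq_zero.1 hcf, hf]; ring, planeDet_mul_right,
        planeDet_self, mul_zero]
    · apply hq h0
      rw [hqf, planeDet_mul_left, planeDet_self, mul_zero]
  rw [← d4, ← t4]
  refine VDiagram.link_eq_of_sweep d1 d2 d3 t1 t2 (C := c) (F := F) ?_ ?_ hst' ?_ cA cF ?_ ?_ hc1 ?_
    ?_ hc2 ?_ ?_ ?_ ?_ ?_ ?_ ?_ ?_ ?_ ?_ ?_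
  · intro v hv; rw [t3, hΨv _ _ hv]
  · rw [t3, hΨF]
  · rw [pA, pB, pF]
    exact mem_openSegment_iff_real.2 ⟨s, hs0, hs1, rfl⟩
  · rw [pA]; exact ha1
  · rw [pF]; exact hf1
  · rw [pB]; exact hb1
  · rw [pF]; exact hf2
  · rw [hp', hΦv _ _ nMA nMF nMB]; exact dA
  · rw [hp', hΦv _ _ nZA nZF hZB]; exact dF
  · rw [pA]
    exact fun S hS S' hS' hne => gA S (hM' S hS) S' (hM' S' hS') hne
  · rw [pB]
    exact fun S hS S' hS' hne => gB S (hM' S hS) S' (hM' S' hS') hne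
  · rw [pA, pB]; exact hoff
  · rw [pA]
    exact fun S hS => hcT (a, S - a) (Or.inl (Or.inl (Or.inl ⟨S, hM' S hS, rfl⟩))) (neA S (hM' S hS))
  · rw [pB]
    exact fun S hS => hcT (b, S - b) (Or.inl (Or.inl (Or.inr ⟨S, hM' S hS, rfl⟩))) (neB S (hM' S hS))
  · exact fun x _ _ => hcT (p' x, p' (m x) - p' x) (Or.inl (Or.inr (Or.inl ⟨x, rfl⟩)))
      (sub_ne_zero.2 fun h0 => hn1 x (Gen.injective hn2 hDg.1 h0))
  · rw [pA, pB, pF]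
    intro t ht S hS S' hS' h1 h2
    have hS := hM' S hS
    have hS' := hM' S' hS'
    exact havoid _ (fun h0 => hcT (f, fAB (S, S') - f)
      (Or.inr (Or.inl ⟨(S, S'), ⟨hS, hS'⟩, rfl⟩)) h0) t ht (hfAB (S, S') hS hS' _ h1 h2)
  · rw [pA, pF]
    intro t ht S hS x xA xF xZ xB h1 h2
    have hS := hM' S hS
    rw [(hE' x xA xF xZ xB).1, (hE' x xA xF xZ xB).2] at h2
    exact havoid _ (fun h0 => hcT (f, fA (S, x) - f)
      (Or.inr (Or.inr (Or.inl ⟨(S, x), ⟨hS, mem_univ _⟩, rfl⟩))) h0) t ht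
      (hfA (S, x) hS xA xF xZ xB _ h1 h2)
  · rw [pB, pF]
    intro t ht S hS x xA xF xZ xB h1 h2
    have hS := hM' S hS
    rw [(hE' x xA xF xZ xB).1, (hE' x xA xF xZ xB).2] at h2
    exact havoid _ (fun h0 => hcT (f, fB (S, x) - f)
      (Or.inr (Or.inr (Or.inr ⟨(S, x), ⟨hS, mem_univ _⟩, rfl⟩))) h0) t ht
      (hfB (S, x) hS xA xF xZ xB _ h1 h2)

end GeneralMove

/-- The triangle with vertices `P`, `C`, `B`, where `P` lies between `A` and `B`, keeps a distance
from `A`. -/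
theorem exists_open_convex_away {A B C P : ℂ} (hA : A ∉ segment ℝ C B)
    (hP : P ∈ openSegment ℝ A B) : ∃ H : Set ℂ, IsOpen H ∧ Convex ℝ H ∧ P ∈ H ∧ C ∈ H ∧ B ∈ H ∧
      ∃ d > 0, ∀ z ∈ H, d < dist z A := by
  have hfin : ({P, C, B} : Set ℂ).Finite := by simp
  set K := convexHull ℝ ({P, C, B} : Set ℂ) with hK
  have hAK : A ∉ K := by
    intro hAK
    rw [hK, convexHull_insert (by simp), convexHull_pair, mem_convexJoin] at hAK
    obtain ⟨P', hP', y, hy, hAy⟩ := hAK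
    rw [mem_singleton_iff] at hP'
    subst hP'
    obtain ⟨s, hs0, hs1, hs⟩ := mem_openSegment_iff_real.1 hP
    obtain ⟨l, hl0, hl1, hl⟩ := mem_segment_iff_real.1 hy
    obtain ⟨k, hk0, hk1, hk⟩ := mem_segment_iff_real.1 hAy
    -- Since `P - A` is a positive multiple of `B - A`, a convex combination equal to `A` gives a
    -- nontrivial nonnegative relation between `C - A` and `B - A`. That puts `A` between `C` and
    -- `B`.
    have hrel : ((k * (1 - l) : ℝ) : ℂ) * (C - A) + ((s * (1 - k) + k * l : ℝ) : ℂ) * (B - A) = 0 := by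
      rw [hl, hs] at hk
      push_cast
      linear_combination -hk
    have hκ : 0 ≤ k * (1 - l) := mul_nonneg hk0 (by linarith)
    have hτ : 0 ≤ s * (1 - k) + k * l := by
      have := mul_nonneg hs0.le (sub_nonneg.2 hk1)
      have := mul_nonneg hk0 hl0
      linarith
    have hpos : 0 < k * (1 - l) + (s * (1 - k) + k * l) := by
      have : k * (1 - l) + (s * (1 - k) + k * l) = k + s * (1 - k) := by ring
      rw [this]
      rcases hk0.eq_or_lt with h0 | h0
      · rw [← h0]; linarith
      · have := mul_nonneg hs0.le (sub_nonneg.2 hk1)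
        linarith
    set κ := k * (1 - l)
    set τ := s * (1 - k) + k * l
    apply hA
    refine mem_segment_iff_real.2 ⟨τ / (κ + τ), by positivity, (div_le_one hpos).2 (by linarith), ?_⟩
    have hne : (κ : ℂ) + τ ≠ 0 := by exact_mod_cast hpos.ne'
    push_cast
    field_simp
    linear_combination -hrel
  have hclosed : IsClosed K := (hfin.isCompact_convexHull ℝ).isClosed
  have hsub : ({P, C, B} : Set ℂ) ⊆ K := subset_convexHull ℝ _
  have hd : 0 < Metric.infDist A K :=
    (hclosed.notMem_iff_infDist_pos ⟨P, hsub (by simp)⟩).1 hAK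
  set d := Metric.infDist A K with hddef
  have hsub' : K ⊆ Metric.thickening (d / 2) K := Metric.self_subset_thickening (by linarith) _
  refine ⟨Metric.thickening (d / 2) K, Metric.isOpen_thickening,
    (convex_convexHull ℝ _).thickening _, hsub' (hsub (by simp)), hsub' (hsub (by simp)),
    hsub' (hsub (by simp)), d / 2, by linarith, fun z hz => ?_⟩
  obtain ⟨y, hy, hzy⟩ := Metric.mem_thickening_iff.1 hz
  have h1 : d ≤ dist A y := Metric.infDist_le_dist_of_mem hy
  have h2 := dist_triangle A z y
  rw [dist_comm A z] at h2
  linarith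

/-! ### The detour move without conditions on neighbouring edges. -/

section VertexMove

variable {κ : Type}

/-- The diagrams `D` and `E` differ only in the position of the vertex `F` between edges without
classical crossings. -/
structure VertexMove (D E : VDiagram κ) (A F B : κ) : Prop where
  next_eq : E.next = D.next
  over_eq : E.isOver = D.isOver
  pos_eq : ∀ v, v ≠ F → E.pos v = D.pos v
  virt_A : ∀ y, ¬ D.isOver A y ∧ ¬ D.isOver y A
  virt_F : ∀ y, ¬ D.isOver F y ∧ ¬ D.isOver y F
  next_A : D.next A = F
  next_F : D.next F = B
  mem : D.pos F ∈ openSegment ℝ (D.pos A) (D.pos B)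

namespace VertexMove

variable {D E : VDiagram κ} {A F B : κ}

theorem A_ne_F (h : VertexMove D E A F B) : A ≠ F :=
  fun c => D.next_ne A (h.next_A.trans c.symm)

theorem B_ne_F (h : VertexMove D E A F B) : B ≠ F :=
  fun c => D.next_ne F (h.next_F.trans c)

theorem B_ne_A (h : VertexMove D E A F B) : B ≠ A :=
  fun c => D.next_next_ne A (by rw [h.next_A, h.next_F, c])

theorem not_mem_right (h : VertexMove D E A F B) : D.pos A ∉ segment ℝ (E.pos F) (D.pos B) := by
  intro c
  rw [← h.pos_eq A h.A_ne_F, ← h.pos_eq B h.B_ne_F, ← h.next_F, ← h.next_eq] at c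
  rcases E.vertex_generic F A c with c | c
  · exact h.A_ne_F c
  · rw [h.next_eq, h.next_F] at c; exact h.B_ne_A c.symm

theorem not_mem_left (h : VertexMove D E A F B) : D.pos B ∉ segment ℝ (E.pos F) (D.pos A) := by
  intro c
  rw [segment_symm, ← h.pos_eq A h.A_ne_F, ← h.pos_eq B h.B_ne_F] at c
  have c : E.pos B ∈ polyEdge E.next E.pos A := by
    rw [polyEdge, h.next_eq, h.next_A]; exact c
  rcases E.vertex_generic A B c with c | c
  · exact h.B_ne_A c
  · rw [h.next_eq, h.next_A] at c; exact h.B_ne_F c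

/-- Subdivision of another edge. -/
theorem ins (h : VertexMove D E A F B) {e : κ} (eA : e ≠ A) (eF : e ≠ F) {Y : ℂ}
    (hD : Gen (insNext D.next e) (insPos D.pos Y)) (hE : Gen (insNext E.next e) (insPos E.pos Y)) :
    VertexMove (D.ins e Y hD) (E.ins e Y hE) (some A) (some F) (some B) where
  next_eq := by rw [VDiagram.ins_next, VDiagram.ins_next, h.next_eq]
  over_eq := by
    funext x y
    change (E.isOver _ _ ∧ polyCrosses (insNext E.next e) (insPos E.pos Y) x y) =
      (D.isOver _ _ ∧ polyCrosses (insNext D.next e) (insPos D.pos Y) x y)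
    rw [h.over_eq, h.next_eq]
    refine propext (and_congr_right fun ho => ?_)
    have key : ∀ x : Option κ, x.getD e ≠ A → x.getD e ≠ F →
        polyEdge (insNext D.next e) (insPos E.pos Y) x =
          polyEdge (insNext D.next e) (insPos D.pos Y) x := by
      intro x xA xF
      refine polyEdge_eq_of_static (A := some A) (F := some F) ?_ ?_ ?_ ?_
      · rw [insNext_some_of_ne _ eA.symm, h.next_A]
      · rintro (_ | v) hv
        · rfl
        · exact h.pos_eq v fun c => hv (by rw [c])
      · rintro rfl; exact xA rfl
      · rintro rfl; exact xF rfl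
    have k1 := key x (fun c => (h.virt_A _).1 (c ▸ ho)) (fun c => (h.virt_F _).1 (c ▸ ho))
    have k2 := key y (fun c => (h.virt_A _).2 (c ▸ ho)) (fun c => (h.virt_F _).2 (c ▸ ho))
    simp only [polyCrosses, k1, k2]
  pos_eq := by
    rintro (_ | v) hv
    · rfl
    · exact h.pos_eq v fun c => hv (by rw [c])
  virt_A y := ⟨fun c => (h.virt_A _).1 c.1, fun c => (h.virt_A _).2 c.1⟩
  virt_F y := ⟨fun c => (h.virt_F _).1 c.1, fun c => (h.virt_F _).2 c.1⟩
  next_A := by rw [VDiagram.ins_next, insNext_some_of_ne _ eA.symm, h.next_A]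
  next_F := by rw [VDiagram.ins_next, insNext_some_of_ne _ eF.symm, h.next_F]
  mem := h.mem

end VertexMove

/-- Points of an edge near its start lie on no other edge. -/
theorem VDiagram.eventually_clear_start (D : VDiagram κ) (a : κ) :
    ∀ᶠ z in 𝓝 (D.pos a), z ∈ openSegment ℝ (D.pos a) (D.pos (D.next a)) →
      ∀ x, x ≠ a → z ∉ polyEdge D.next D.pos x := by
  have := D.finite
  have hinj := Gen.injective D.next_next_ne D.vertex_generic
  have h1 : ∀ᶠ z in 𝓝 (D.pos a), ∀ x, D.pos a ∉ polyEdge D.next D.pos x →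
      z ∉ polyEdge D.next D.pos x := by
    refine eventually_all.2 fun x => ?_
    by_cases hx : D.pos a ∈ polyEdge D.next D.pos x
    · exact Eventually.of_forall fun z h => absurd hx h
    · filter_upwards [(isClosed_polyEdge D.next D.pos x).isOpen_compl.mem_nhds hx] with z hz _
      exact hz
  filter_upwards [h1] with z hz hzo x hxa hzx
  by_cases hx : D.pos a ∈ polyEdge D.next D.pos x
  · rcases D.vertex_generic x a hx with c | c
    · exact hxa c.symm
    · subst c
      have := inter_eq_vertex D.next_ne D.next_next_ne D.vertex_generic hzx
        (openSegment_subset_segment _ _ _ hzo)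
      rw [this, left_mem_openSegment_iff] at hzo
      exact D.next_ne _ (hinj hzo).symm
  · exact hz x hx hzx

/-- Points of an edge near its end lie on no other edge. -/
theorem VDiagram.eventually_clear_end (D : VDiagram κ) (a : κ) :
    ∀ᶠ z in 𝓝 (D.pos (D.next a)), z ∈ openSegment ℝ (D.pos a) (D.pos (D.next a)) →
      ∀ x, x ≠ a → z ∉ polyEdge D.next D.pos x := by
  have := D.finite
  have hinj := Gen.injective D.next_next_ne D.vertex_generic
  have h1 : ∀ᶠ z in 𝓝 (D.pos (D.next a)), ∀ x, D.pos (D.next a) ∉ polyEdge D.next D.pos x →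
      z ∉ polyEdge D.next D.pos x := by
    refine eventually_all.2 fun x => ?_
    by_cases hx : D.pos (D.next a) ∈ polyEdge D.next D.pos x
    · exact Eventually.of_forall fun z h => absurd hx h
    · filter_upwards [(isClosed_polyEdge D.next D.pos x).isOpen_compl.mem_nhds hx] with z hz _
      exact hz
  filter_upwards [h1] with z hz hzo x hxa hzx
  by_cases hx : D.pos (D.next a) ∈ polyEdge D.next D.pos x
  · rcases D.vertex_generic x (D.next a) hx with c | c
    · subst c
      have := inter_eq_vertex D.next_ne D.next_next_ne D.vertex_generic
        (openSegment_subset_segment _ _ _ hzo) hzx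
      rw [this, right_mem_openSegment_iff] at hzo
      exact D.next_ne _ (hinj hzo).symm
    · exact hxa (D.next.injective c).symm
  · exact hz x hx hzx

/-- A point on a new edge near a vertex is at a positive distance from a closed set. -/
theorem eventually_ray_avoids {K : Set ℂ} (hK : IsClosed K) {A : ℂ} (hA : A ∉ K) (d : ℝ)
    (u : ℂ) : ∀ᶠ ε : ℝ in 𝓝[>] 0, ∀ z ∈ K, ε * d < dist z (A + ε * u) := by
  have hne : ∃ δ > 0, ∀ z ∈ K, δ ≤ dist z A := by
    obtain ⟨δ, hδ, hb⟩ := Metric.mem_nhds_iff.1 (hK.isOpen_compl.mem_nhds hA)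
    exact ⟨δ, hδ, fun z hz => not_lt.1 fun c => hb (Metric.mem_ball.2 c) hz⟩
  obtain ⟨δ, hδ, hb⟩ := hne
  have hc : Tendsto (fun ε : ℝ => ε * d + |ε| * ‖u‖) (𝓝 0) (𝓝 0) := by
    have : Continuous (fun ε : ℝ => ε * d + |ε| * ‖u‖) := by fun_prop
    simpa using this.tendsto 0
  filter_upwards [(hc.eventually (eventually_lt_nhds hδ)).filter_mono nhdsWithin_le_nhds] with ε hε z hz
  have h1 := hb z hz
  have h2 := dist_triangle z (A + ε * u) A
  have h3 : dist (A + ε * u) A = |ε| * ‖u‖ := by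
    rw [dist_eq_norm, add_sub_cancel_left, norm_mul, Complex.norm_real, Real.norm_eq_abs]
  linarith

namespace VertexMove

variable {D E : VDiagram κ} {A F B : κ}

/-- A vertex move, if the edge after the moving edges is short. -/
theorem link_eq_of_short (h : VertexMove D E A F B) {r' : ℝ} (hr' : 0 < r')
    (le_r' : dist (D.pos B) (D.pos (D.next B)) < r')
    (lt_r' : r' < dist (D.pos (D.next (D.next B))) (D.pos (D.next B)))
    (clear' : ∀ x, x ≠ A → x ≠ F → x ≠ B → x ≠ D.next B →
      ∀ z ∈ polyEdge D.next D.pos x, r' < dist z (D.pos (D.next B)))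
    {HA : Set ℂ} (cA : Convex ℝ HA) (oA : IsOpen HA) (hAA : D.pos A ∈ HA) (hAD : D.pos F ∈ HA)
    (hAE : E.pos F ∈ HA) (dA : ∀ z ∈ HA, r' < dist z (D.pos (D.next B))) : D.link = E.link := by
  have := D.finite
  obtain ⟨w, hw⟩ := D.next.surjective A
  have nAF := h.A_ne_F
  have nBF := h.B_ne_F
  have nBA := h.B_ne_A
  have wA : w ≠ A := fun c => D.next_ne w (hw.trans c.symm)
  have wF : w ≠ F := fun c => D.next_next_ne w (by rw [hw, h.next_A, c])
  have wB : w ≠ B := by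
    rintro rfl
    rw [hw] at dA
    have h1 := dA _ hAA
    rw [dist_self] at h1
    linarith
  obtain ⟨HF, oF, cF, hFD, hFE, hFB, d, hd, hdF⟩ := exists_open_convex_away h.not_mem_right h.mem
  set u := D.pos w - D.pos A with hu
  have hu0 : u ≠ 0 := by
    intro h0
    exact wA (Gen.injective D.next_next_ne D.vertex_generic (sub_eq_zero.1 h0))
  have hun : 0 < ‖u‖ := norm_pos_iff.2 hu0
  have hray : Tendsto (fun ε : ℝ => D.pos A + ε * u) (𝓝[>] 0) (𝓝 (D.pos A)) := by
    have : Continuous fun ε : ℝ => D.pos A + ε * u := by fun_prop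
    have := this.tendsto 0
    simp only [Complex.ofReal_zero, zero_mul, add_zero] at this
    exact this.mono_left nhdsWithin_le_nhds
  -- The disc around `Y` has radius `2 * ε * ‖u‖`. The vertex `w`, at distance `(1 - ε) * ‖u‖`, must
  -- be outside, whereas `A`, at distance `ε * ‖u‖`, is inside.
  have q1 : ∀ᶠ ε : ℝ in 𝓝[>] 0, ε < 1 / 3 :=
    (eventually_lt_nhds (by norm_num)).filter_mono nhdsWithin_le_nhds
  have q2 : ∀ᶠ ε : ℝ in 𝓝[>] 0, ∀ x, x ≠ A → x ≠ w → ∀ z ∈ polyEdge D.next D.pos x,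
      ε * (2 * ‖u‖) < dist z (D.pos A + ε * u) := by
    refine eventually_all.2 fun x => ?_
    by_cases hx : D.pos A ∈ polyEdge D.next D.pos x
    · refine Eventually.of_forall fun ε h1 h2 => ?_
      rcases D.vertex_generic x A hx with c | c
      · exact absurd c.symm h1
      · exact absurd (D.next.injective (c.symm.trans hw.symm)) h2
    · filter_upwards [eventually_ray_avoids (isClosed_polyEdge D.next D.pos x) hx (2 * ‖u‖) u]
        with ε hε _ _
      exact hε
  have q3 : ∀ᶠ ε : ℝ in 𝓝[>] 0, ∀ z ∈ HF, ε * (2 * ‖u‖) < dist z (D.pos A + ε * u) := by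
    have hcl : D.pos A ∉ closure HF := by
      intro hc
      obtain ⟨z, hz, hz'⟩ := Metric.mem_closure_iff.1 hc d hd
      have := hdF z hz
      rw [dist_comm] at this
      linarith
    filter_upwards [eventually_ray_avoids isClosed_closure hcl (2 * ‖u‖) u] with ε hε z hz
    exact hε z (subset_closure hz)
  have q4 : ∀ᶠ ε : ℝ in 𝓝[>] 0, ε * (2 * ‖u‖) + r' < dist (D.pos A + ε * u) (D.pos (D.next B)) := by
    have hc : Continuous fun ε : ℝ =>
        dist (D.pos A + ε * u) (D.pos (D.next B)) - (ε * (2 * ‖u‖) + r') := by fun_prop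
    have h0 : 0 < dist (D.pos A) (D.pos (D.next B)) - r' := sub_pos.2 (dA _ hAA)
    have := hc.tendsto 0
    simp only [Complex.ofReal_zero, zero_mul, add_zero, zero_add] at this
    filter_upwards [(this.eventually (eventually_gt_nhds h0)).filter_mono nhdsWithin_le_nhds]
      with ε hε
    linarith
  have q5 : ∀ᶠ ε : ℝ in 𝓝[>] 0, D.pos A + ε * u ∈ openSegment ℝ (D.pos w) (D.pos (D.next w)) →
      ∀ x, x ≠ w → D.pos A + ε * u ∉ polyEdge D.next D.pos x := by
    have := D.eventually_clear_end w
    rw [hw] at this ⊢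
    exact hray.eventually this
  have q6 : ∀ᶠ ε : ℝ in 𝓝[>] 0, D.pos A + ε * u ∈ openSegment ℝ (D.pos w) (D.pos (D.next w)) →
      ∀ x, x ≠ w → D.pos A + ε * u ∉ polyEdge E.next E.pos x := by
    have := E.eventually_clear_end w
    rw [h.next_eq, hw, h.pos_eq A nAF, h.pos_eq w wF] at this
    rw [h.next_eq, hw]
    exact hray.eventually this
  obtain ⟨ε, ⟨⟨⟨⟨⟨⟨hε1, hε2⟩, hε3⟩, hε4⟩, hε5⟩, hε6⟩, hε⟩⟩ :=
    ((((((q1.and q2).and q3).and q4).and q5).and q6).and self_mem_nhdsWithin).exists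
  have hε : 0 < ε := hε
  set Y := D.pos A + ε * u with hY
  have hYm : Y ∈ openSegment ℝ (D.pos w) (D.pos (D.next w)) := by
    rw [hw]
    refine mem_openSegment_iff_real.2 ⟨1 - ε, by linarith, by linarith, ?_⟩
    rw [hY, hu]; push_cast; ring
  have hYm' : Y ∈ openSegment ℝ (E.pos w) (E.pos (E.next w)) := by
    rw [h.next_eq, h.pos_eq w wF, h.pos_eq (D.next w) (by rw [hw]; exact nAF)]; exact hYm
  have hgD := D.gen.subdivide D.next_ne hYm (hε5 hYm)
  have hgE := E.gen.subdivide E.next_ne hYm' (hε6 hYm)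
  rw [← D.link_ins_of_mem hYm hgD, ← E.link_ins_of_mem hYm' hgE]
  have h2 := h.ins wA wF hgD hgE
  have hsymm : (insNext D.next w).symm none = some w := by
    rw [Equiv.symm_apply_eq, insNext_some_self]
  have hnB : (insNext D.next w) (some B) = some (D.next B) := insNext_some_of_ne _ wB.symm
  have hYA : dist (D.pos A) Y = ε * ‖u‖ := by
    rw [hY, dist_comm, dist_eq_norm, add_sub_cancel_left, norm_mul, Complex.norm_real,
      Real.norm_of_nonneg hε.le]
  have hεu : 0 < ε * ‖u‖ := mul_pos hε hun
  -- The inserted vertex `Y` plays the role of `Z`, which makes the edge before `A` short.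
  refine VDiagram.link_eq_of_local_move (Z := none) (r := ε * (2 * ‖u‖)) (r' := r')
    h2.next_eq h2.over_eq h2.pos_eq h2.virt_A h2.virt_F ?_ h2.next_A h2.next_F (by simp) h2.mem
    (by positivity) hr' ?_ ?_ ?_ ?_ ?_ ?_ ?_ cA oA cF oF hAA hAD hAE hFB hFD hFE ?_ hε3
  · rw [VDiagram.ins_next, insNext_none, hw]
  · change dist (D.pos A) Y < _
    rw [hYA]; linarith
  · rw [VDiagram.ins_next, VDiagram.ins_pos, hsymm, insPos_some, insPos_none]
    rw [show D.pos w = D.pos A + u by rw [hu]; ring, hY, dist_eq_norm,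
      show D.pos A + u - (D.pos A + ε * u) = ((1 - ε : ℝ) : ℂ) * u by push_cast; ring, norm_mul,
      Complex.norm_real, Real.norm_of_nonneg (by linarith)]
    nlinarith
  · rw [VDiagram.ins_next, VDiagram.ins_pos, hnB]; exact le_r'
  · rw [VDiagram.ins_next, VDiagram.ins_pos, hnB, insPos_some]
    by_cases hwB : D.next B = w
    · rw [hwB, insNext_some_self, insPos_none]
      rw [hwB] at hε4
      linarith
    · rw [insNext_some_of_ne _ hwB, insPos_some]; exact lt_r'
  · rw [VDiagram.ins_next, VDiagram.ins_pos, hnB]; exact hε4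
  · intro x xA xF xZ xS xB z hz
    rw [VDiagram.ins_next, hsymm] at xS
    rcases x with _ | x
    · exact absurd rfl xZ
    have xw : x ≠ w := fun c => xS (by rw [c])
    rw [VDiagram.ins_next, VDiagram.ins_pos, polyEdge_ins_of_ne _ _ _ xw] at hz
    exact hε2 x (fun c => xA (by rw [c])) xw z hz
  · intro x xA xF xB xM xZ z hz
    rw [VDiagram.ins_next, hnB] at xM
    rw [VDiagram.ins_next, VDiagram.ins_pos] at hz ⊢
    rw [hnB, insPos_some]
    rcases x with _ | x
    · exact absurd rfl xZ
    refine clear' x (fun c => xA (by rw [c])) (fun c => xF (by rw [c])) (fun c => xB (by rw [c]))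
      (fun c => xM (by rw [c])) z ?_
    by_cases xw : x = w
    · subst xw
      rw [polyEdge_ins_self] at hz
      exact (convex_segment _ _).segment_subset (left_mem_segment _ _ _)
        (openSegment_subset_segment _ _ _ hYm) hz
    · rwa [polyEdge_ins_of_ne _ _ _ xw] at hz
  · rw [VDiagram.ins_next, VDiagram.ins_pos, hnB, insPos_some]; exact dA

/-- A vertex between edges without classical crossings may be moved. -/
theorem link_eq (h : VertexMove D E A F B) : D.link = E.link := by
  have := D.finite
  have nAF := h.A_ne_F
  have nBF := h.B_ne_F
  have nBA := h.B_ne_A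
  have nMF : D.next B ≠ F := fun c => nBA (D.next.injective (c.trans h.next_A.symm))
  obtain ⟨HA, oA, cA, hAD, hAE, hAA, d, hd, hdA⟩ := exists_open_convex_away h.not_mem_left
    (by rw [openSegment_symm]; exact h.mem)
  set u := D.pos (D.next B) - D.pos B with hu
  have hu0 : u ≠ 0 := by
    intro h0
    exact D.next_ne B (Gen.injective D.next_next_ne D.vertex_generic (sub_eq_zero.1 h0))
  have hun : 0 < ‖u‖ := norm_pos_iff.2 hu0
  have hray : Tendsto (fun ε : ℝ => D.pos B + ε * u) (𝓝[>] 0) (𝓝 (D.pos B)) := by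
    have : Continuous fun ε : ℝ => D.pos B + ε * u := by fun_prop
    have := this.tendsto 0
    simp only [Complex.ofReal_zero, zero_mul, add_zero] at this
    exact this.mono_left nhdsWithin_le_nhds
  have q1 : ∀ᶠ ε : ℝ in 𝓝[>] 0, ε < 1 / 3 :=
    (eventually_lt_nhds (by norm_num)).filter_mono nhdsWithin_le_nhds
  have q2 : ∀ᶠ ε : ℝ in 𝓝[>] 0, ∀ x, x ≠ F → x ≠ B → ∀ z ∈ polyEdge D.next D.pos x,
      ε * (2 * ‖u‖) < dist z (D.pos B + ε * u) := by
    refine eventually_all.2 fun x => ?_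
    by_cases hx : D.pos B ∈ polyEdge D.next D.pos x
    · refine Eventually.of_forall fun ε h1 h2 => ?_
      rcases D.vertex_generic x B hx with c | c
      · exact absurd c.symm h2
      · exact absurd (D.next.injective (c.symm.trans h.next_F.symm)) h1
    · filter_upwards [eventually_ray_avoids (isClosed_polyEdge D.next D.pos x) hx (2 * ‖u‖) u]
        with ε hε _ _
      exact hε
  have q3 : ∀ᶠ ε : ℝ in 𝓝[>] 0, ∀ z ∈ HA, ε * (2 * ‖u‖) < dist z (D.pos B + ε * u) := by
    have hcl : D.pos B ∉ closure HA := by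
      intro hc
      obtain ⟨z, hz, hz'⟩ := Metric.mem_closure_iff.1 hc d hd
      have := hdA z hz
      rw [dist_comm] at this
      linarith
    filter_upwards [eventually_ray_avoids isClosed_closure hcl (2 * ‖u‖) u] with ε hε z hz
    exact hε z (subset_closure hz)
  have q5 : ∀ᶠ ε : ℝ in 𝓝[>] 0, D.pos B + ε * u ∈ openSegment ℝ (D.pos B) (D.pos (D.next B)) →
      ∀ x, x ≠ B → D.pos B + ε * u ∉ polyEdge D.next D.pos x :=
    hray.eventually (D.eventually_clear_start B)
  have q6 : ∀ᶠ ε : ℝ in 𝓝[>] 0, D.pos B + ε * u ∈ openSegment ℝ (D.pos B) (D.pos (D.next B)) →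
      ∀ x, x ≠ B → D.pos B + ε * u ∉ polyEdge E.next E.pos x := by
    have := E.eventually_clear_start B
    rw [h.next_eq, h.pos_eq B nBF, h.pos_eq _ nMF] at this
    rw [h.next_eq]
    exact hray.eventually this
  obtain ⟨ε, ⟨⟨⟨⟨⟨hε1, hε2⟩, hε3⟩, hε5⟩, hε6⟩, hε⟩⟩ :=
    (((((q1.and q2).and q3).and q5).and q6).and self_mem_nhdsWithin).exists
  have hε : 0 < ε := hε
  set Y := D.pos B + ε * u with hY
  have hYm : Y ∈ openSegment ℝ (D.pos B) (D.pos (D.next B)) :=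
    mem_openSegment_iff_real.2 ⟨ε, by linarith, by linarith, rfl⟩
  have hYm' : Y ∈ openSegment ℝ (E.pos B) (E.pos (E.next B)) := by
    rw [h.next_eq, h.pos_eq B nBF, h.pos_eq _ nMF]; exact hYm
  have hgD := D.gen.subdivide D.next_ne hYm (hε5 hYm)
  have hgE := E.gen.subdivide E.next_ne hYm' (hε6 hYm)
  rw [← D.link_ins_of_mem hYm hgD, ← E.link_ins_of_mem hYm' hgE]
  have h2 := h.ins nBA nBF hgD hgE
  have hYB : dist (D.pos B) Y = ε * ‖u‖ := by
    rw [hY, dist_comm, dist_eq_norm, add_sub_cancel_left, norm_mul, Complex.norm_real,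
      Real.norm_of_nonneg hε.le]
  have hεu : 0 < ε * ‖u‖ := mul_pos hε hun
  -- Now `Y` is the vertex after `B`, so the edge after the moving ones is short; the edge before
  -- them is treated in `link_eq_of_short`.
  refine h2.link_eq_of_short (r' := ε * (2 * ‖u‖)) (by positivity) ?_ ?_ ?_ cA oA hAA hAD hAE ?_
  · rw [VDiagram.ins_next, VDiagram.ins_pos, insNext_some_self, insPos_some, insPos_none, hYB]
    linarith
  · rw [VDiagram.ins_next, VDiagram.ins_pos, insNext_some_self, insNext_none, insPos_some,
      insPos_none, show D.pos (D.next B) = D.pos B + u by rw [hu]; ring, hY, dist_eq_norm,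
      show D.pos B + u - (D.pos B + ε * u) = ((1 - ε : ℝ) : ℂ) * u by push_cast; ring, norm_mul,
      Complex.norm_real, Real.norm_of_nonneg (by linarith)]
    nlinarith
  · intro x xA xF xB xM z hz
    rw [VDiagram.ins_next, insNext_some_self] at xM
    rw [VDiagram.ins_next, VDiagram.ins_pos] at hz ⊢
    rw [insNext_some_self, insPos_none]
    rcases x with _ | x
    · exact absurd rfl xM
    have xB' : x ≠ B := fun c => xB (by rw [c])
    rw [polyEdge_ins_of_ne _ _ _ xB'] at hz
    exact hε2 x (fun c => xF (by rw [c])) xB' z hz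
  · rw [VDiagram.ins_next, VDiagram.ins_pos, insNext_some_self, insPos_none]; exact hε3

end VertexMove

/-- The detour move: an edge without classical crossings may be replaced by any two edges. -/
theorem VDiagram.link_ins_of_virtual (D : VDiagram κ) {a : κ} {C : ℂ}
    (hv : ∀ y, ¬ D.isOver a y ∧ ¬ D.isOver y a) (h : Gen (insNext D.next a) (insPos D.pos C)) :
    (D.ins a C h).link = D.link := by
  -- Any clear point of `a` would do. The detour is a subdivision at `M` followed by moving the new
  -- vertex from `M` to `C`.
  obtain ⟨M, hM, hMx⟩ := exists_openSegment_near (B := D.pos (D.next a)) (D.eventually_clear_start a)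
  have hg := D.gen.subdivide D.next_ne hM (hMx hM)
  rw [← D.link_ins_of_mem hM hg]
  symm
  refine VertexMove.link_eq (A := some a) (F := none) (B := some (D.next a)) ⟨rfl, ?_, ?_, ?_, ?_,
    insNext_some_self _ _, insNext_none _ _, hM⟩
  · funext x y
    refine propext (and_congr_right fun ho => ?_)
    have key : ∀ x : Option κ, x.getD a ≠ a → ∃ x', x' ≠ a ∧ x = some x' := by
      rintro (_ | x) hx
      · exact absurd rfl hx
      · exact ⟨x, hx, rfl⟩
    obtain ⟨x', hx', rfl⟩ := key x fun c => (hv _).1 (c ▸ ho)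
    obtain ⟨y', hy', rfl⟩ := key y fun c => (hv _).2 (c ▸ ho)
    rw [polyCrosses_ins_iff hx' hy', polyCrosses_ins_iff hx' hy']
  · rintro (_ | v) hv
    · exact absurd rfl hv
    · rfl
  · exact fun y => ⟨fun c => (hv _).1 c.1, fun c => (hv _).2 c.1⟩
  · exact fun y => ⟨fun c => (hv _).1 c.1, fun c => (hv _).2 c.1⟩

end VertexMove

/-! ## Making the strands at classical crossings run counterclockwise -/

section Positive

variable {κ : Type}

/-- The edge `i` runs counterclockwise around the origin iff this number is positive. -/
def VDiagram.turn (D : VDiagram κ) (i : κ) : ℝ := planeDet (D.pos i) (D.pos (D.next i))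

theorem VDiagram.Classical.symm {D : VDiagram κ} {x y : κ} (h : D.Classical x y) :
    D.Classical y x := Or.symm h

theorem VDiagram.Classical.crosses {D : VDiagram κ} {x y : κ} (h : D.Classical x y) :
    polyCrosses D.next D.pos x y :=
  h.elim (D.over_crosses _ _) fun h => (D.over_crosses _ _ h).symm

/-- The ends of classical crossings at which the strand does not run counterclockwise. -/
def VDiagram.badPairs (D : VDiagram κ) : Set (κ × κ) :=
  {x | D.Classical x.1 x.2 ∧ D.turn x.1 < 0}

/-- A small translation of the diagram moves the origin off the finitely many lines that carry
edges. -/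
theorem VDiagram.exists_turn_ne_zero (D : VDiagram κ) :
    ∃ E : VDiagram κ, E.link = D.link ∧ ∀ i, E.turn i ≠ 0 := by
  have := D.finite
  have hc : Continuous fun c : ℂ => fun i => D.pos i - c := by fun_prop
  have h0 : Tendsto (fun c : ℂ => fun i => D.pos i - c) (𝓝 0) (𝓝 D.pos) := by
    simpa using hc.tendsto 0
  obtain ⟨U, hU, oU, h0U⟩ := eventually_nhds_iff.1 (h0.eventually D.eventually_perturb)
  obtain ⟨c, hcU, hcT⟩ := exists_mem_open_off
    (finite_range fun i => (D.pos i, D.pos (D.next i) - D.pos i)) oU ⟨0, h0U⟩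
  obtain ⟨E, h1, -, h3, h4⟩ := hU c hcU
  refine ⟨E, h4, fun i => ?_⟩
  have hne : D.pos (D.next i) - D.pos i ≠ 0 := sub_ne_zero.2 fun h =>
    D.next_ne i (Gen.injective D.next_next_ne D.vertex_generic h)
  have := hcT _ ⟨i, rfl⟩ hne
  rw [VDiagram.turn, h1, h3]
  have e : planeDet (D.pos i - c) (D.pos (D.next i) - c) =
      planeDet (D.pos (D.next i) - D.pos i) (c - D.pos i) := by
    simp only [planeDet, Complex.sub_re, Complex.sub_im]; ring
  change planeDet (D.pos i - c) (D.pos (D.next i) - c) ≠ 0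
  rwa [e]

/-! ### Turning signs and bad crossings under insertion of a vertex. -/

section Ins

variable {D : VDiagram κ} {a : κ} {P : ℂ} {h : Gen (insNext D.next a) (insPos D.pos P)}

theorem VDiagram.turn_ins_self : (D.ins a P h).turn (some a) = planeDet (D.pos a) P := by
  rw [VDiagram.turn, VDiagram.ins_next, VDiagram.ins_pos, insNext_some_self]; rfl

theorem VDiagram.turn_ins_none : (D.ins a P h).turn none = planeDet P (D.pos (D.next a)) := by
  rw [VDiagram.turn, VDiagram.ins_next, VDiagram.ins_pos, insNext_none]; rfl

theorem VDiagram.turn_ins_of_ne {x : κ} (hx : x ≠ a) : (D.ins a P h).turn (some x) = D.turn x := by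
  rw [VDiagram.turn, VDiagram.ins_next, VDiagram.ins_pos, insNext_some_of_ne _ hx]; rfl

theorem VDiagram.Classical.of_ins {x y : Option κ} (hc : (D.ins a P h).Classical x y) :
    D.Classical (x.getD a) (y.getD a) :=
  hc.imp (fun h => h.1) fun h => h.1

/-- Sending the ends of a crossing to their parent edges is injective on classical crossings,
because by `hinj` no edge crosses both halves of `a` classically. This bounds the number of bad
pairs after an insertion. -/
theorem VDiagram.badPairs_ins
    (hsign : ∀ o y, (D.ins a P h).Classical o y → (D.ins a P h).turn o < 0 → D.turn (o.getD a) < 0)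
    (hinj : ∀ y, (D.ins a P h).Classical (some a) y → ¬ (D.ins a P h).Classical none y) :
    MapsTo (fun x : Option κ × Option κ => (x.1.getD a, x.2.getD a)) (D.ins a P h).badPairs
      D.badPairs ∧
    InjOn (fun x : Option κ × Option κ => (x.1.getD a, x.2.getD a)) (D.ins a P h).badPairs := by
  refine ⟨fun x hx => ⟨hx.1.of_ins, hsign _ _ hx.1 hx.2⟩, ?_⟩
  have key : ∀ x x' y y' : Option κ, (D.ins a P h).Classical x y → (D.ins a P h).Classical x' y' →
      x.getD a = x'.getD a → y.getD a = y'.getD a → x = x' := by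
    intro x x' y y' h1 h2 e1 e2
    have n1 := h1.of_ins.crosses.1
    have n2 := h2.of_ins.crosses.1
    have hy : x.getD a = a → y = y' := by
      intro hx
      have hx' : x'.getD a = a := e1.symm.trans hx
      rcases y with _ | y <;> rcases y' with _ | y'
      · rfl
      · exact absurd hx n1
      · exact absurd hx' n2
      · simpa using e2
    rcases x with _ | x <;> rcases x' with _ | x'
    · rfl
    · have : x' = a := by simpa using e1.symm
      subst this
      rw [hy rfl] at h1
      exact absurd h1 (hinj _ h2)
    · have : x = a := by simpa using e1
      subst this
      rw [← hy rfl] at h2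
      exact absurd h2 (hinj _ h1)
    · simpa using e1
  rintro ⟨x, y⟩ hx ⟨x', y'⟩ hx' he
  simp only [Prod.mk.injEq] at he
  exact Prod.ext (key x x' y y' hx.1 hx'.1 he.1 he.2) (key y y' x x' hx.1.symm hx'.1.symm he.2 he.1)

/-- The areas swept from the origin by the two parts are proportional to their lengths, so signs are
inherited. -/
theorem VDiagram.turn_subdivide (hm : P ∈ openSegment ℝ (D.pos a) (D.pos (D.next a)))
    (o : Option κ) : ∃ s : ℝ, 0 < s ∧ (D.ins a P h).turn o = s * D.turn (o.getD a) := by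
  obtain ⟨s, hs0, hs1, hs⟩ := mem_openSegment_iff_real.1 hm
  rcases o with _ | x
  · refine ⟨1 - s, by linarith, ?_⟩
    rw [VDiagram.turn_ins_none, Option.getD_none, VDiagram.turn, hs]
    simp only [planeDet, Complex.add_re, Complex.add_im, Complex.mul_re, Complex.mul_im,
      Complex.sub_re, Complex.sub_im, Complex.ofReal_re, Complex.ofReal_im]
    ring
  · by_cases hx : x = a
    · subst hx
      refine ⟨s, hs0, ?_⟩
      rw [VDiagram.turn_ins_self, Option.getD_some, VDiagram.turn, hs]
      simp only [planeDet, Complex.add_re, Complex.add_im, Complex.mul_re, Complex.mul_im,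
        Complex.sub_re, Complex.sub_im, Complex.ofReal_re, Complex.ofReal_im]
      ring
    · exact ⟨1, one_pos, by rw [VDiagram.turn_ins_of_ne hx, one_mul, Option.getD_some]⟩

theorem VDiagram.turn_ne_zero_subdivide (hm : P ∈ openSegment ℝ (D.pos a) (D.pos (D.next a)))
    (hD : ∀ i, D.turn i ≠ 0) (o : Option κ) : (D.ins a P h).turn o ≠ 0 := by
  obtain ⟨s, hs, e⟩ := VDiagram.turn_subdivide (h := h) hm o
  rw [e]; exact mul_ne_zero hs.ne' (hD _)

theorem VDiagram.ncard_badPairs_subdivide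
    (hm : P ∈ openSegment ℝ (D.pos a) (D.pos (D.next a)))
    (hx : ∀ x, x ≠ a → P ∉ polyEdge D.next D.pos x) :
    (D.ins a P h).badPairs.ncard ≤ D.badPairs.ncard := by
  have := D.finite
  obtain ⟨h1, h2⟩ := VDiagram.badPairs_ins (h := h) (fun o y _ ho => by
    obtain ⟨s, hs, e⟩ := VDiagram.turn_subdivide (h := h) hm o
    rw [e] at ho
    by_contra hc
    exact absurd ho (not_lt.2 (mul_nonneg hs.le (not_lt.1 hc))))
    (fun y c1 c2 => by
      have c3 := c1.of_ins.crosses.1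
      rcases y with _ | y
      · exact c3 rfl
      · have hya : y ≠ a := Ne.symm c3
        exact not_both_of_subdivide hm hya (hx y hya) c1.crosses.2.2.2 c2.crosses.2.2.2)
  exact Set.ncard_le_ncard_of_injOn _ h1 h2 (Set.toFinite _)

end Ins

/-- A short edge with a single, classical crossing is replaced by two edges such that the one with
the crossing runs counterclockwise. -/
theorem VDiagram.exists_fewer_bad_of_short (D : VDiagram κ) (hD : ∀ i, D.turn i ≠ 0) {a j : κ}
    {X d c : ℂ} {η : ℝ} (hη : 0 < η) (hpa : D.pos a = X - η * d)
    (hpa' : D.pos (D.next a) = X + η * d) (hX : X ∈ polyEdge D.next D.pos j)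
    (hcl : D.Classical a j) (hta : D.turn a < 0)
    (hγ : planeDet (D.pos (D.next j) - D.pos j) d ≠ 0)
    (hc : planeDet (D.pos (D.next j) - D.pos j) c = - planeDet (D.pos (D.next j) - D.pos j) d)
    (hdc : planeDet d c ≠ 0) (h1 : 0 < planeDet (X + η * c) (X + η * d))
    (h2 : planeDet (X - η * d) (X + η * c) ≠ 0) {S : Set ℂ} (hS : Convex ℝ S)
    (hA : D.pos a ∈ S) (hB : D.pos (D.next a) ∈ S) (hC : X + η * c ∈ S)
    (hx : ∀ x, x ≠ a → x ≠ j → ∀ z ∈ polyEdge D.next D.pos x, z ∈ S →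
      z = D.pos a ∨ z = D.pos (D.next a)) (hj : D.pos j ∉ S) :
    ∃ (κ' : Type) (E : VDiagram κ'), E.link = D.link ∧ (∀ i, E.turn i ≠ 0) ∧
      E.badPairs.ncard < D.badPairs.ncard := by
  have := D.finite
  set g := D.pos (D.next j) - D.pos j with hg
  set γ := planeDet g d with hγdef
  have hXj : ∀ z ∈ polyEdge D.next D.pos j, planeDet g (z - X) = 0 := by
    intro z hz
    have e1 := planeDet_eq_zero_of_mem_segment hz
    have e2 := planeDet_eq_zero_of_mem_segment hX
    rw [show z - X = (z - D.pos j) - (X - D.pos j) by ring, planeDet_sub_right, e1, e2, sub_zero]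
  -- By `hc` the point `X + η * c` is on the same side of the line of `j` as the start of `a`. So
  -- neither the new first edge (`μ = η`) nor the path of the new vertex (`μ = η / 2`) meets `j`,
  -- and the insertion is an isotopy.
  have havoid : ∀ μ : ℝ, 0 < μ → ∀ z ∈ segment ℝ (X - μ * d) (X + η * c),
      z ∉ polyEdge D.next D.pos j := by
    intro μ hμ z hz hzj
    have := hXj z hzj
    obtain ⟨k, hk0, hk1, hk⟩ := mem_segment_iff_real.1 hz
    rw [show z - X = ((-((1 - k) * μ) : ℝ) : ℂ) * d + ((k * η : ℝ) : ℂ) * c by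
      rw [hk]; push_cast; ring, planeDet_add_right, planeDet_mul_right, planeDet_mul_right, hc] at this
    have h3 : ((1 - k) * μ + k * η) * γ = 0 := by linear_combination -this
    rcases mul_eq_zero.1 h3 with h4 | h4
    · rcases hk0.eq_or_lt with h5 | h5
      · rw [← h5] at h4; linarith
      · have := mul_pos h5 hη
        have := mul_nonneg (sub_nonneg.2 hk1) hμ.le
        linarith
    · exact hγ h4
  have hnd : planeDet (D.pos (D.next a) - D.pos a) (X + η * c - D.pos a) ≠ 0 := by
    rw [hpa, hpa', show X + η * d - (X - η * d) = ((2 * η : ℝ) : ℂ) * d by push_cast; ring,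
      show X + η * c - (X - η * d) = (η : ℂ) * (c + d) by ring, planeDet_mul_left,
      planeDet_mul_right, planeDet_add_right, planeDet_self, add_zero]
    exact mul_ne_zero (by positivity) (mul_ne_zero hη.ne' hdc)
  have hCj : X + η * c ∉ polyEdge D.next D.pos j := havoid 1 one_pos _ (right_mem_segment _ _ _)
  have hgen := D.gen.ins_of_convex D.next_ne D.next_next_ne hS hA hB hx (Or.inl hj) hC hCj hnd
  have hM : X - ((η / 2 : ℝ) : ℂ) * d ∈ openSegment ℝ (D.pos a) (D.pos (D.next a)) := by
    rw [hpa, hpa']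
    refine mem_openSegment_iff_real.2 ⟨1 / 4, by norm_num, by norm_num, ?_⟩
    push_cast; ring
  refine ⟨Option κ, D.ins a (X + η * c) hgen, D.link_ins_of_avoid hS hA hB hx (Or.inl hj) hC hnd hM
    (havoid _ (by positivity)) hgen, ?_, ?_⟩
  · rintro (_ | x)
    · rw [VDiagram.turn_ins_none, hpa']; exact h1.ne'
    · by_cases hxa : x = a
      · rw [hxa, VDiagram.turn_ins_self, hpa]; exact h2
      · rw [VDiagram.turn_ins_of_ne hxa]; exact hD x
  have honly : ∀ y, D.Classical a y → y = j := by
    intro y hy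
    by_contra hyj
    obtain ⟨n1, n2, n3, z, hza, hzy⟩ := hy.crosses
    rcases hx y n1.symm hyj z hzy (hS.segment_subset hA hB hza) with e | e
    · rw [e] at hzy
      rcases D.vertex_generic y a hzy with k | k
      exacts [n1 k, n3 k.symm]
    · rw [e] at hzy
      rcases D.vertex_generic y _ hzy with k | k
      exacts [n2 k, n1 (D.next.injective k)]
  have hja : j ≠ a := Ne.symm hcl.crosses.1
  have hnone : ∀ y, ¬ (D.ins a (X + η * c) hgen).Classical (some a) y := by
    intro y hy
    have e : y.getD a = j := honly _ hy.of_ins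
    rcases y with _ | y
    · exact hja e.symm
    · have e : y = j := e
      subst e
      obtain ⟨-, -, -, z, hz1, hz2⟩ := hy.crosses
      rw [VDiagram.ins_next, VDiagram.ins_pos, polyEdge_ins_self, hpa] at hz1
      rw [VDiagram.ins_next, VDiagram.ins_pos, polyEdge_ins_of_ne _ _ _ hja] at hz2
      exact havoid η hη z hz1 hz2
  have htn : 0 < (D.ins a (X + η * c) hgen).turn none := by
    rw [VDiagram.turn_ins_none, hpa']; exact h1
  obtain ⟨m1, m2⟩ := VDiagram.badPairs_ins (h := hgen) (fun o y hoy ho => by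
    rcases o with _ | x
    · exact absurd htn (not_lt.2 ho.le)
    · by_cases hxa : x = a
      · exact absurd (hxa ▸ hoy) (hnone y)
      · rwa [VDiagram.turn_ins_of_ne hxa] at ho) (fun y hy => absurd hy (hnone y))
  have hmem : (a, j) ∈ D.badPairs := ⟨hcl, hta⟩
  -- The pair `(a, j)` is not hit: the first new edge has no classical crossings, and the second
  -- runs counterclockwise.
  have hle : (D.ins a (X + η * c) hgen).badPairs.ncard ≤ (D.badPairs \ {(a, j)}).ncard := by
    refine Set.ncard_le_ncard_of_injOn _ (fun x hx' => ⟨m1 hx', ?_⟩) m2 (Set.toFinite _)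
    intro he
    have e1 : x.1.getD a = a := congrArg Prod.fst he
    obtain ⟨⟨x, y⟩⟩ := x
    · exact absurd htn (not_lt.2 hx'.2.le)
    · rename_i x
      have : x = a := e1
      subst this
      exact hnone _ hx'.1
  exact hle.trans_lt (Set.ncard_sdiff_singleton_lt_of_mem hmem (Set.toFinite _))

end Positive

/-! ### Rotating a strand at a classical crossing. -/

section Positive

variable {κ : Type}

/-- The piece of `e` from `X - η * d` to `X + η * d` is replaced by a path through `X + η * c` with
`c = d - v`, so that its second edge has direction `v`. The vector `v` is built from `X` and the
direction `g` of `f` so that `planeDet X v = θ ^ 2 > 0`, which makes this edge counterclockwise for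
small `η`, and `planeDet g v = 2 * γ`, which makes this edge, rather than the first, cross `f` in
the same direction as `e`. -/
theorem VDiagram.exists_fewer_bad (D : VDiagram κ) (hD : ∀ i, D.turn i ≠ 0) {e f : κ}
    (hcl : D.Classical e f) (hte : D.turn e < 0) :
    ∃ (κ' : Type) (E : VDiagram κ'), E.link = D.link ∧ (∀ i, E.turn i ≠ 0) ∧
      E.badPairs.ncard < D.badPairs.ncard := by
  have := D.finite
  obtain ⟨nef, nef', nfe', X, hXe, hXf⟩ := hcl.crosses
  set d := D.pos (D.next e) - D.pos e with hd
  set g := D.pos (D.next f) - D.pos f with hg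
  have hde : D.pos (D.next e) = D.pos e + d := by rw [hd]; ring
  have hdet := (D.gen.signCross hcl.crosses).det_ne
  set γ := planeDet g d with hγdef
  have hγ : γ ≠ 0 := by rw [hγdef, planeDet_swap]; exact neg_ne_zero.2 hdet
  obtain ⟨t, ht0, ht1, hX⟩ := mem_segment_iff_real.1 hXe
  rw [← hd] at hX
  have ht0 : 0 < t := ht0.lt_of_ne fun h0 => by
    rw [← h0] at hX
    rcases D.vertex_generic f e (by simpa [hX] using hXf) with c | c
    exacts [nef c, nfe' c.symm]
  have ht1 : t < 1 := ht1.lt_of_ne fun h0 => by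
    rw [h0] at hX
    rcases D.vertex_generic f (D.next e) (by simpa [hX, hd] using hXf) with c | c
    exacts [nef' c, nef (D.next.injective c)]
  have hXd : planeDet X d = D.turn e := by
    rw [VDiagram.turn, hde, hX, planeDet_add_left, planeDet_mul_left, planeDet_self,
      planeDet_add_right, planeDet_self]
    ring
  have hXg : planeDet X g = D.turn f := by
    obtain ⟨s, -, -, hs⟩ := mem_segment_iff_real.1 hXf
    rw [← hg] at hs
    rw [VDiagram.turn, show D.pos (D.next f) = D.pos f + g by rw [hg]; ring, hs, planeDet_add_left,
      planeDet_mul_left, planeDet_self, planeDet_add_right, planeDet_self]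
    ring
  set θ := planeDet X g with hθ
  have hθ0 : θ ≠ 0 := by rw [hXg]; exact hD f
  have hd0 : d ≠ 0 := by
    intro h0; apply hγ; rw [hγdef, h0, planeDet_zero_right]
  -- the direction of the new edge
  set v : ℂ := ((-(2 * γ / θ) : ℝ) : ℂ) * X + (θ : ℂ) * g with hv
  have hgv : planeDet g v = 2 * γ := by
    rw [hv, planeDet_add_right, planeDet_mul_right, planeDet_mul_right, planeDet_self,
      planeDet_swap g X, ← hθ]
    field_simp; ring
  have hXv : 0 < planeDet X v := by
    rw [hv, planeDet_add_right, planeDet_mul_right, planeDet_mul_right, planeDet_self, ← hθ]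
    have : 0 < θ * θ := mul_self_pos.2 hθ0
    linarith
  -- If `v` were parallel to `d`, comparison of `planeDet g` would give `v = 2 * d`. But `planeDet X
  -- d = D.turn e` is negative and `planeDet X v` is positive.
  have hdv : planeDet d v ≠ 0 := by
    intro h0
    obtain ⟨k, hk⟩ := exists_real_mul_of_planeDet_eq_zero hd0 h0
    rw [hk, planeDet_mul_right] at hgv hXv
    have hk2 : k = 2 := by
      have : (k - 2) * γ = 0 := by linear_combination hgv
      rcases mul_eq_zero.1 this with h | h
      · linarith
      · exact absurd h hγ
    rw [hk2, hXd] at hXv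
    linarith
  set c := d - v with hc
  have hgc : planeDet g c = -γ := by rw [hc, planeDet_sub_right, hgv]; ring
  have hdc : planeDet d c ≠ 0 := by
    rw [hc, planeDet_sub_right, planeDet_self, zero_sub]; exact neg_ne_zero.2 hdv
  set K := ‖d‖ + ‖c‖ with hK
  have hKd : ‖d‖ ≤ K := by rw [hK]; linarith [norm_nonneg c]
  have hKc : ‖c‖ ≤ K := by rw [hK]; linarith [norm_nonneg d]
  have q1 : ∀ᶠ η : ℝ in 𝓝[>] 0, η < t :=
    (eventually_lt_nhds ht0).filter_mono nhdsWithin_le_nhds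
  have q2 : ∀ᶠ η : ℝ in 𝓝[>] 0, η < 1 - t :=
    (eventually_lt_nhds (by linarith)).filter_mono nhdsWithin_le_nhds
  have q3 : ∀ᶠ η : ℝ in 𝓝[>] 0, ∀ x, x ≠ e → x ≠ f → ∀ z ∈ polyEdge D.next D.pos x,
      η * K < dist z X := by
    refine eventually_all.2 fun x => ?_
    by_cases hx : x ≠ e ∧ x ≠ f
    · have hXx : X ∉ polyEdge D.next D.pos x :=
        D.no_triple e f x nef (Ne.symm hx.2) (Ne.symm hx.1) X hXe hXf
      filter_upwards [eventually_ray_avoids (isClosed_polyEdge D.next D.pos x) hXx K 0] with η hη _ _ z hz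
      simpa using hη z hz
    · exact Eventually.of_forall fun η h1 h2 => absurd ⟨h1, h2⟩ hx
  have q4 : ∀ᶠ η : ℝ in 𝓝[>] 0, η * K < dist (D.pos f) X := by
    have hne : X ∉ ({D.pos f} : Set ℂ) := by
      intro h0
      rw [mem_singleton_iff] at h0
      rcases D.vertex_generic e f (by rw [← h0]; exact hXe) with k | k
      exacts [nef k.symm, nef' k.symm]
    filter_upwards [eventually_ray_avoids isClosed_singleton hne K 0] with η hη
    simpa using hη _ (mem_singleton _)
  have q5 : ∀ᶠ η : ℝ in 𝓝[>] 0, 0 < planeDet X v + η * planeDet c d := by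
    have hcont : Continuous fun η : ℝ => planeDet X v + η * planeDet c d := by fun_prop
    have := hcont.tendsto 0
    simp only [zero_mul, add_zero] at this
    exact (this.eventually (eventually_gt_nhds hXv)).filter_mono nhdsWithin_le_nhds
  -- Up to the factor `η` this is the turn of the first new edge. It stays clockwise, which is
  -- harmless as that edge has no classical crossings; only nonvanishing matters.
  have q6 : ∀ᶠ η : ℝ in 𝓝[>] 0, 2 * planeDet X d - planeDet X v - η * planeDet d c < 0 := by
    have hcont : Continuous fun η : ℝ => 2 * planeDet X d - planeDet X v - η * planeDet d c := by
      fun_prop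
    have := hcont.tendsto 0
    simp only [zero_mul, sub_zero] at this
    exact (this.eventually (eventually_lt_nhds (by rw [hXd]; linarith))).filter_mono
      nhdsWithin_le_nhds
  obtain ⟨η, ⟨⟨⟨⟨⟨⟨hη1, hη2⟩, hη3⟩, hη4⟩, hη5⟩, hη6⟩, hη⟩⟩ :=
    ((((((q1.and q2).and q3).and q4).and q5).and q6).and self_mem_nhdsWithin).exists
  have hη : 0 < η := hη
  have hηC : (η : ℂ) ≠ 0 := by exact_mod_cast hη.ne'
  have hηd : (η : ℂ) * d ≠ 0 := mul_ne_zero hηC hd0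
  have hline : ∀ l : ℝ, l ≠ 0 → |l| ≤ η → -t ≤ l → l ≤ 1 - t → ∀ x, x ≠ e →
      X + l * d ∉ polyEdge D.next D.pos x := by
    intro l hl hlη hl1 hl2 x hxe hx
    have hmem : X + l * d ∈ polyEdge D.next D.pos e :=
      mem_segment_iff_real.2 ⟨t + l, by linarith, by linarith, by rw [hX, ← hd]; push_cast; ring⟩
    by_cases hxf : x = f
    · rw [hxf] at hx
      have := eq_of_mem_segments hdet hmem hx hXe hXf
      have h0 : (l : ℂ) * d = 0 := by linear_combination this
      rcases mul_eq_zero.1 h0 with h | h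
      · exact hl (by exact_mod_cast h)
      · exact hd0 h
    · have := hη3 x hxe hxf _ hx
      rw [dist_eq_norm, add_sub_cancel_left, norm_mul, Complex.norm_real, Real.norm_eq_abs] at this
      have h1 := mul_le_mul hlη hKd (norm_nonneg _) hη.le
      linarith
  -- subdivide the edge on both sides of the crossing
  have hm1 : X + η * d ∈ openSegment ℝ (D.pos e) (D.pos (D.next e)) :=
    mem_openSegment_iff_real.2 ⟨t + η, by linarith, by linarith, by rw [hX, ← hd]; push_cast; ring⟩
  have hx1 := hline η hη.ne' (by rw [abs_of_pos hη]) (by linarith) hη2.le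
  have hg1 := D.gen.subdivide D.next_ne hm1 hx1
  set D₁ := D.ins e (X + η * d) hg1 with hD₁
  have hn1 : D₁.next = insNext D.next e := rfl
  have hp1 : D₁.pos = insPos D.pos (X + η * d) := rfl
  have hm2 : X - η * d ∈ openSegment ℝ (D₁.pos (some e)) (D₁.pos (D₁.next (some e))) := by
    rw [hn1, hp1, insNext_some_self, insPos_some, insPos_none]
    have hpos : 0 < t + η := by linarith
    refine mem_openSegment_iff_real.2 ⟨(t - η) / (t + η), div_pos (by linarith) hpos,
      (div_lt_one hpos).2 (by linarith), ?_⟩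
    have : (t : ℂ) + η ≠ 0 := by exact_mod_cast hpos.ne'
    rw [hX]; push_cast; field_simp; ring
  have hcol : ∀ {l k : ℝ}, X + (l : ℂ) * d = X + k * d → l = k := by
    intro l k h
    have h0 : ((l - k : ℝ) : ℂ) * d = 0 := by push_cast; linear_combination h
    rcases mul_eq_zero.1 h0 with h | h
    · have : l - k = 0 := by exact_mod_cast h
      linarith
    · exact absurd h hd0
  have hlast : ∀ z ∈ segment ℝ (X + η * d) (D.pos (D.next e)), ∃ l : ℝ, η ≤ l ∧ z = X + l * d := by
    intro z hz
    obtain ⟨k, hk0, hk1, hk⟩ := mem_segment_iff_real.1 hz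
    refine ⟨η + k * (1 - t - η), by nlinarith, ?_⟩
    rw [hk, hde, hX]; push_cast; ring
  have hx2 : ∀ x, x ≠ some e → X - η * d ∉ polyEdge D₁.next D₁.pos x := by
    rw [hn1, hp1]
    rintro (_ | x) hx hz
    · rw [polyEdge_ins_none] at hz
      obtain ⟨l, hl, hl'⟩ := hlast _ hz
      have : -η = l := hcol (by rw [← hl']; push_cast; ring)
      linarith
    · have hxe : x ≠ e := fun k => hx (by rw [k])
      rw [polyEdge_ins_of_ne _ _ _ hxe] at hz
      refine hline (-η) (by linarith) (by rw [abs_neg, abs_of_pos hη]) (by linarith) (by linarith) x hxe ?_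
      push_cast
      rwa [neg_mul, ← sub_eq_add_neg]
  have hg2 := D₁.gen.subdivide D₁.next_ne hm2 hx2
  set D₂ := D₁.ins (some e) (X - η * d) hg2 with hD₂
  have hn2 : D₂.next = insNext (insNext D.next e) (some e) := rfl
  have hp2 : D₂.pos = insPos (insPos D.pos (X + η * d)) (X - η * d) := rfl
  have hE : ∀ y, y ≠ e → polyEdge D₂.next D₂.pos (some (some y)) = polyEdge D.next D.pos y := by
    intro y hy
    rw [hn2, hp2, polyEdge_ins_of_ne _ _ _ (by simpa using hy), polyEdge_ins_of_ne _ _ _ hy]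
  have hpa : D₂.pos none = X - η * d := rfl
  have hna : D₂.next none = some none := by rw [hn2, insNext_none, insNext_some_self]
  have hpa' : D₂.pos (D₂.next none) = X + η * d := by rw [hna]; rfl
  have hfe : f ≠ e := nef.symm
  have hnf : D₂.next (some (some f)) = some (some (D.next f)) := by
    rw [hn2, insNext_some_of_ne _ (by simpa using hfe), insNext_some_of_ne _ hfe]
  have hXa : X ∈ polyEdge D₂.next D₂.pos none := by
    rw [polyEdge, hpa, hpa']
    refine mem_segment_iff_real.2 ⟨1 / 2, by norm_num, by norm_num, ?_⟩
    push_cast; ring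
  have hXf2 : X ∈ polyEdge D₂.next D₂.pos (some (some f)) := by rw [hE f hfe]; exact hXf
  have hcr1 : polyCrosses D₁.next D₁.pos (some e) (some f) := by
    rw [hn1, hp1]
    refine ⟨by simpa using nef, by simp, ?_, X, ?_, ?_⟩
    · rw [insNext_some_of_ne _ hfe]; simpa using nfe'
    · rw [polyEdge_ins_self]
      have hpos : 0 < t + η := by linarith
      refine mem_segment_iff_real.2 ⟨t / (t + η), by positivity, (div_le_one hpos).2 (by linarith), ?_⟩
      have : (t : ℂ) + η ≠ 0 := by exact_mod_cast hpos.ne'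
      rw [hX]; push_cast; field_simp; ring
    · rwa [polyEdge_ins_of_ne _ _ _ hfe]
  have hcr2 : polyCrosses D₂.next D₂.pos none (some (some f)) := by
    refine ⟨by simp, ?_, ?_, X, hXa, hXf2⟩
    · rw [hna]; simp
    · rw [hnf]; simp
  have hcl2 : D₂.Classical none (some (some f)) :=
    hcl.imp (fun h => ⟨⟨h, hcr1⟩, hcr2⟩) fun h => ⟨⟨h, hcr1.symm⟩, hcr2.symm⟩
  have hB1 : D₁.badPairs.ncard ≤ D.badPairs.ncard := VDiagram.ncard_badPairs_subdivide hm1 hx1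
  have hB2 : D₂.badPairs.ncard ≤ D₁.badPairs.ncard := VDiagram.ncard_badPairs_subdivide hm2 hx2
  have hT1 : ∀ i, D₁.turn i ≠ 0 := VDiagram.turn_ne_zero_subdivide hm1 hD
  have hT2 : ∀ i, D₂.turn i ≠ 0 := VDiagram.turn_ne_zero_subdivide hm2 hT1
  have hL : D₂.link = D.link := (D₁.link_ins_of_mem hm2 hg2).trans (D.link_ins_of_mem hm1 hg1)
  set S := convexHull ℝ ({X + η * c, X - η * d, X + η * d} : Set ℂ) with hS
  have hsub : ({X + η * c, X - η * d, X + η * d} : Set ℂ) ⊆ S := subset_convexHull ℝ _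
  have hball : S ⊆ Metric.closedBall X (η * K) := by
    refine convexHull_min ?_ (convex_closedBall _ _)
    have hn : ∀ u : ℂ, ‖u‖ ≤ K → ‖(η : ℂ) * u‖ ≤ η * K := fun u hu => by
      rw [norm_mul, Complex.norm_real, Real.norm_of_nonneg hη.le]
      exact mul_le_mul_of_nonneg_left hu hη.le
    rintro z (rfl | rfl | rfl) <;> rw [Metric.mem_closedBall, dist_eq_norm]
    · rw [add_sub_cancel_left]; exact hn c hKc
    · rw [sub_sub_cancel_left, norm_neg]; exact hn d hKd
    · rw [add_sub_cancel_left]; exact hn d hKd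
  -- The apex of the triangle is off the line of `e`, so the triangle meets this line only in its
  -- base. Hence the outer pieces of `e` touch it only at the ends of the base.
  have hSline : ∀ l : ℝ, X + l * d ∈ S → |l| ≤ η := by
    intro l hl
    rw [hS, convexHull_insert (by simp), convexHull_pair, mem_convexJoin] at hl
    obtain ⟨C', hC', y, hy, hz⟩ := hl
    rw [mem_singleton_iff] at hC'
    subst hC'
    obtain ⟨k, hk0, hk1, hk⟩ := mem_segment_iff_real.1 hz
    obtain ⟨s, hs0, hs1, hs⟩ := mem_segment_iff_real.1 hy
    have e1 : ((l - k * (2 * s - 1) * η : ℝ) : ℂ) * d = (((1 - k) * η : ℝ) : ℂ) * c := by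
      rw [hs] at hk
      push_cast
      linear_combination hk
    have e2 : (1 - k) * η * planeDet d c = 0 := by
      rw [← planeDet_mul_right, ← e1, planeDet_mul_right, planeDet_self, mul_zero]
    have hk : k = 1 := by
      rcases mul_eq_zero.1 e2 with h | h
      · rcases mul_eq_zero.1 h with h | h
        · linarith
        · exact absurd h hη.ne'
      · exact absurd h hdc
    have e3 : l - (2 * s - 1) * η = 0 := by
      rw [hk] at e1
      simp only [sub_self, zero_mul, Complex.ofReal_zero, one_mul] at e1
      rcases mul_eq_zero.1 e1 with h | h
      · exact_mod_cast h
      · exact absurd h hd0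
    rw [abs_le]
    constructor <;> nlinarith
  suffices hkey : ∃ (κ' : Type) (E : VDiagram κ'), E.link = D₂.link ∧ (∀ i, E.turn i ≠ 0) ∧
      E.badPairs.ncard < D₂.badPairs.ncard by
    obtain ⟨κ', E, hE1, hE2, hE3⟩ := hkey
    exact ⟨κ', E, hE1.trans hL, hE2, hE3.trans_le (hB2.trans hB1)⟩
  refine D₂.exists_fewer_bad_of_short hT2 (a := none) (j := some (some f))
    (X := X) (d := d) (c := c) (η := η) (S := S) hη hpa hpa' hXf2 hcl2 ?_ ?_ ?_ hdc ?_ ?_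
    (convex_convexHull ℝ _) (by rw [hpa]; exact hsub (by simp))
    (by rw [hpa']; exact hsub (by simp)) (hsub (by simp)) ?_ ?_
  · rw [VDiagram.turn, hpa, hpa', planeDet_sub_left, planeDet_add_right, planeDet_add_right,
      planeDet_mul_left, planeDet_mul_left, planeDet_mul_right, planeDet_mul_right, planeDet_self,
      planeDet_self, planeDet_swap d X, hXd]
    nlinarith
  · rw [hnf]; exact hγ
  · rw [hnf]; exact hgc
  · have : planeDet (X + η * c) (X + η * d) = η * (planeDet X v + η * planeDet c d) := by
      have e1 : planeDet X v = planeDet X d - planeDet X c := by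
        rw [hc, planeDet_sub_right X d v]; ring
      rw [e1]
      simp only [planeDet_add_left, planeDet_add_right, planeDet_mul_left, planeDet_mul_right,
        planeDet_self, planeDet_swap c X]
      ring
    rw [this]; exact mul_pos hη hη5
  · have : planeDet (X - η * d) (X + η * c) =
        η * (2 * planeDet X d - planeDet X v - η * planeDet d c) := by
      have e1 : planeDet X v = planeDet X d - planeDet X c := by
        rw [hc, planeDet_sub_right X d v]; ring
      rw [e1]
      simp only [planeDet_sub_left, planeDet_add_right, planeDet_mul_left, planeDet_mul_right,
        planeDet_self, planeDet_swap d X]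
      ring
    rw [this]; exact (mul_neg_of_pos_of_neg hη hη6).ne
  · rintro (_ | _ | x) hx1 hx2 z hz hzS
    · exact absurd rfl hx1
    · right
      rw [hn2, hp2, polyEdge_ins_of_ne _ _ _ (by simp), polyEdge_ins_none] at hz
      obtain ⟨l, hl, hl'⟩ := hlast _ hz
      rw [hl'] at hzS ⊢
      have := abs_le.1 (hSline l hzS)
      rw [hpa', le_antisymm this.2 hl]
    · by_cases hxe : x = e
      · left
        rw [hxe, hn2, hp2, polyEdge_ins_self, insPos_some] at hz
        obtain ⟨k, hk0, hk1, hk⟩ := mem_segment_iff_real.1 hz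
        have hz' : z = X + ((-t + k * (t - η) : ℝ) : ℂ) * d := by
          rw [hk, hX]; push_cast; ring
        rw [hz'] at hzS ⊢
        have := abs_le.1 (hSline _ hzS)
        have hle : -t + k * (t - η) ≤ -η := by nlinarith
        rw [hpa, le_antisymm hle this.1]; push_cast; ring
      · have hxf : x ≠ f := fun k => hx2 (by rw [k])
        rw [hE x hxe] at hz
        exact absurd (hball hzS) (not_le.2 (hη3 x hxe hxf z hz))
  · intro h
    exact absurd (hball h) (not_le.2 hη4)

/-- Every link has a diagram in which the strands of classical crossings run counterclockwise. -/
theorem VDiagram.exists_classical_positive (D : VDiagram κ) :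
    ∃ (κ' : Type) (E : VDiagram κ'), E.link = D.link ∧ (∀ i, E.turn i ≠ 0) ∧
      ∀ x y, E.Classical x y → 0 < E.turn x := by
  obtain ⟨D₀, h0, hD₀⟩ := D.exists_turn_ne_zero
  rw [← h0]
  clear h0
  clear D
  induction hN : D₀.badPairs.ncard using Nat.strong_induction_on generalizing κ with
  | _ N ih =>
    by_cases h : ∃ x y, D₀.Classical x y ∧ D₀.turn x < 0
    · obtain ⟨x, y, hxy, hx⟩ := h
      obtain ⟨κ', E, h1, h2, h3⟩ := D₀.exists_fewer_bad hD₀ hxy hx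
      rw [← h1]
      exact ih _ (hN ▸ h3) E h2 rfl
    · push Not at h
      exact ⟨κ, D₀, rfl, hD₀, fun x y hxy => (h x y hxy).lt_of_ne (hD₀ x).symm⟩

end Positive

/-! ## Making all edges run counterclockwise -/

section Counterclockwise

variable {κ : Type}

/-- An edge without classical crossings that does not run counterclockwise is replaced by two edges
running counterclockwise. -/
theorem VDiagram.exists_fewer_negative (D : VDiagram κ) (hD : ∀ i, D.turn i ≠ 0)
    (hcl : ∀ x y, D.Classical x y → 0 < D.turn x) {a : κ} (ha : D.turn a < 0) :
    ∃ E : VDiagram (Option κ), E.link = D.link ∧ (∀ i, E.turn i ≠ 0) ∧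
      (∀ x y, E.Classical x y → 0 < E.turn x) ∧
      {i | E.turn i < 0}.ncard < {i | D.turn i < 0}.ncard := by
  have := D.finite
  have hv : ∀ y, ¬ D.isOver a y ∧ ¬ D.isOver y a := fun y =>
    ⟨fun h => absurd (hcl a y (Or.inl h)) (not_lt.2 ha.le),
      fun h => absurd (hcl a y (Or.inr h)) (not_lt.2 ha.le)⟩
  set A := D.pos a with hA
  set B := D.pos (D.next a) with hB
  have hAB : planeDet A B < 0 := ha
  have hinj := Gen.injective D.next_next_ne D.vertex_generic
  -- From here both new edges run counterclockwise. This is the open cone spanned by `-A` and `-B`,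
  -- so the edge is thrown to the opposite side of the axis.
  let U : Set ℂ := {z | 0 < planeDet A z} ∩ {z | 0 < planeDet z B}
  have oU : IsOpen U := (isOpen_lt continuous_const (by fun_prop)).inter
    (isOpen_lt continuous_const (by fun_prop))
  have neU : U.Nonempty := by
    refine ⟨-(A + B), ?_, ?_⟩
    · change 0 < planeDet A (-(A + B))
      rw [planeDet_neg_right, planeDet_add_right, planeDet_self]; linarith
    · change 0 < planeDet (-(A + B)) B
      rw [planeDet_neg_left, planeDet_add_left, planeDet_self]; linarith
  set M := staticMeets D.next D.pos a a with hM
  have hMfin : M.Finite := D.gen.finite_staticMeets D.next_ne D.next_next_ne a a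
  -- Off these lines, `C` is on no edge, and the new edges contain no vertices but their ends and no
  -- meeting points of other edges.
  let T : Set (ℂ × ℂ) := range (fun x => (D.pos x, D.pos (D.next x) - D.pos x)) ∪
    (range (fun k => (A, D.pos k - A)) ∪ range (fun k => (B, D.pos k - B))) ∪
    ((fun z => (A, z - A)) '' M ∪ (fun z => (B, z - B)) '' M)
  have hT : T.Finite := ((finite_range _).union ((finite_range _).union (finite_range _))).union
    ((hMfin.image _).union (hMfin.image _))
  obtain ⟨C, ⟨hC1, hC2⟩, hCT⟩ := exists_mem_open_off hT oU neU
  have hC1 : 0 < planeDet A C := hC1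
  have hC2 : 0 < planeDet C B := hC2
  have hseg : ∀ {Q z : ℂ}, planeDet (z - Q) (C - Q) ≠ 0 → z ∉ segment ℝ Q C := fun h hz =>
    h (planeDet_eq_zero_of_mem_three (left_mem_segment _ _ _) hz (right_mem_segment _ _ _))
  have hMne : ∀ z ∈ M, z ≠ A ∧ z ≠ B := by
    rintro z ⟨x, y, xa, -, ya, -, hxy, hx, hy⟩
    constructor
    · rintro rfl
      rcases D.vertex_generic x a hx with c | c
      · exact xa c.symm
      rcases D.vertex_generic y a hy with c' | c'
      · exact ya c'.symm
      · exact hxy (D.next.injective (c.symm.trans c'))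
    · rintro rfl
      rcases D.vertex_generic x _ hx with c | c
      · rcases D.vertex_generic y _ hy with c' | c'
        · exact hxy (c.symm.trans c')
        · exact ya (D.next.injective c').symm
      · exact xa (D.next.injective c).symm
  have hg : Gen (insNext D.next a) (insPos D.pos C) := by
    refine D.gen.ins D.next_ne ?_ ?_ ?_ ?_
    · intro x _ hx
      exact hCT _ (Or.inl (Or.inl ⟨x, rfl⟩)) (sub_ne_zero.2 fun h => D.next_ne x (hinj h))
        (planeDet_eq_zero_of_mem_segment hx)
    · intro k hk
      exact hseg (hCT _ (Or.inl (Or.inr (Or.inl ⟨k, rfl⟩))) (sub_ne_zero.2 fun h => hk (hinj h)))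
    · intro k hk
      rw [segment_symm]
      exact hseg (hCT _ (Or.inl (Or.inr (Or.inr ⟨k, rfl⟩))) (sub_ne_zero.2 fun h => hk (hinj h)))
    · intro x y hx hy hxy z hzx hzy
      have hz : z ∈ M := ⟨x, y, hx, hx, hy, hy, hxy, hzx, hzy⟩
      obtain ⟨n1, n2⟩ := hMne z hz
      rw [segment_symm ℝ C]
      exact ⟨hseg (hCT _ (Or.inr (Or.inl ⟨z, hz, rfl⟩)) (sub_ne_zero.2 n1)),
        hseg (hCT _ (Or.inr (Or.inr ⟨z, hz, rfl⟩)) (sub_ne_zero.2 n2))⟩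
  have t1 : (D.ins a C hg).turn (some a) = planeDet A C := VDiagram.turn_ins_self
  have t2 : (D.ins a C hg).turn none = planeDet C B := VDiagram.turn_ins_none
  have t3 : ∀ x, x ≠ a → (D.ins a C hg).turn (some x) = D.turn x := fun x =>
    VDiagram.turn_ins_of_ne
  refine ⟨D.ins a C hg, D.link_ins_of_virtual hv hg, ?_, ?_, ?_⟩
  · rintro (_ | x)
    · rw [t2]; exact hC2.ne'
    · by_cases hx : x = a
      · rw [hx, t1]; exact hC1.ne'
      · rw [t3 x hx]; exact hD x
  · rintro (_ | x) y hxy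
    · rw [t2]; exact hC2
    · by_cases hx : x = a
      · rw [hx, t1]; exact hC1
      · rw [t3 x hx]; exact hcl x _ hxy.of_ins
  · have hle : {i | (D.ins a C hg).turn i < 0}.ncard ≤ ({i | D.turn i < 0} \ {a}).ncard := by
      have hneg : ∀ o, (D.ins a C hg).turn o < 0 → ∃ x, x ≠ a ∧ o = some x ∧ D.turn x < 0 := by
        rintro (_ | x) ho
        · rw [t2] at ho; linarith
        · by_cases hx : x = a
          · rw [hx, t1] at ho; linarith
          · exact ⟨x, hx, rfl, by rwa [t3 x hx] at ho⟩
      refine Set.ncard_le_ncard_of_injOn (fun o => o.getD a) ?_ ?_ (Set.toFinite _)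
      · intro o ho
        obtain ⟨x, hx, rfl, hx'⟩ := hneg o ho
        exact ⟨hx', hx⟩
      · intro o ho o' ho' he
        obtain ⟨x, -, rfl, -⟩ := hneg o ho
        obtain ⟨x', -, rfl, -⟩ := hneg o' ho'
        exact congrArg some he
    exact hle.trans_lt (Set.ncard_sdiff_singleton_lt_of_mem (a := a) ha (Set.toFinite _))

/-- Every link has a diagram all of whose edges run counterclockwise. -/
theorem VDiagram.exists_counterclockwise (D : VDiagram κ) :
    ∃ (κ' : Type) (E : VDiagram κ'), E.link = D.link ∧ ∀ i, 0 < E.turn i := by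
  obtain ⟨κ₀, D₀, h0, hD₀, hcl⟩ := D.exists_classical_positive
  rw [← h0]
  clear h0 D
  induction hN : {i | D₀.turn i < 0}.ncard using Nat.strong_induction_on generalizing κ₀ with
  | _ N ih =>
    by_cases h : ∃ a, D₀.turn a < 0
    · obtain ⟨a, ha⟩ := h
      obtain ⟨E, h1, h2, h3, h4⟩ := D₀.exists_fewer_negative hD₀ hcl ha
      rw [← h1]
      exact ih _ (hN ▸ h4) _ E h2 h3 rfl
    · push Not at h
      exact ⟨κ₀, D₀, rfl, fun i => (h i).lt_of_ne (hD₀ i).symm⟩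

/-- Every link has a diagram all of whose edges run counterclockwise, and whose crossings lie on
different rays from the origin and off the real line. -/
theorem VDiagram.exists_counterclockwise_generic (D : VDiagram κ) :
    ∃ (κ' : Type) (E : VDiagram κ'), E.link = D.link ∧ (∀ i, 0 < E.turn i) ∧
      (∀ a b z, E.Crosses a b → z ∈ E.edge a → z ∈ E.edge b → z.im ≠ 0) ∧
      (∀ a b z a' b' z', E.Crosses a b → z ∈ E.edge a → z ∈ E.edge b → E.Crosses a' b' →
        z' ∈ E.edge a' → z' ∈ E.edge b' → planeDet z z' = 0 → z = z') := by
  obtain ⟨κ', E, h1, h2⟩ := D.exists_counterclockwise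
  have := E.finite
  let M : Set ℂ := ⋃ z : {z : κ' × κ' // z.1 ≠ z.2}, polyEdge E.next E.pos z.1.1 ∩
    polyEdge E.next E.pos z.1.2
  have hM : M.Finite := Set.finite_iUnion fun z =>
    (E.gen.subsingleton_inter E.next_ne E.next_next_ne z.2).finite
  have hc : Continuous fun c : ℂ => fun i => E.pos i - c := by fun_prop
  have h0 : Tendsto (fun c : ℂ => fun i => E.pos i - c) (𝓝 0) (𝓝 E.pos) := by
    simpa using hc.tendsto 0
  have hturn : ∀ᶠ p : κ' → ℂ in 𝓝 E.pos, ∀ i, 0 < planeDet (p i) (p (E.next i)) := by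
    refine eventually_all.2 fun i => ?_
    have hcont : Continuous fun p : κ' → ℂ => planeDet (p i) (p (E.next i)) := by fun_prop
    exact (hcont.tendsto _).eventually (eventually_gt_nhds (h2 i))
  obtain ⟨U, hU, oU, h0U⟩ := eventually_nhds_iff.1 (h0.eventually (E.eventually_perturb.and hturn))
  -- The new origin `c` avoids the horizontal lines through meeting points, which keeps crossings
  -- off the real line, and the lines through two of them, which keeps crossings on different rays.
  obtain ⟨c, hcU, hcT⟩ := exists_mem_open_off (T := (fun z => (z, 1)) '' M ∪
    (fun z : ℂ × ℂ => (z.1, z.2 - z.1)) '' (M ×ˢ M))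
    ((hM.image _).union ((hM.prod hM).image _)) oU ⟨0, h0U⟩
  obtain ⟨⟨E', e1, -, e3, e4⟩, e5⟩ := hU c hcU
  have hmem : ∀ {i z}, z ∈ E'.edge i → z + c ∈ polyEdge E.next E.pos i := by
    intro i z hz
    rw [VDiagram.edge, e1, e3] at hz
    obtain ⟨s, hs0, hs1, hs⟩ := mem_segment_iff_real.1 hz
    exact mem_segment_iff_real.2 ⟨s, hs0, hs1, by rw [hs]; ring⟩
  have hmemM : ∀ {a b z}, E'.Crosses a b → z ∈ E'.edge a → z ∈ E'.edge b → z + c ∈ M :=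
    fun hab hz hz' => mem_iUnion.2 ⟨⟨(_, _), hab.1⟩, hmem hz, hmem hz'⟩
  refine ⟨κ', E', e4.trans h1, fun i => ?_, ?_, ?_⟩
  · rw [VDiagram.turn, e1, e3]; exact e5 i
  · intro a b z hab hz hz' him
    have := hcT (z + c, 1) (Or.inl ⟨_, hmemM hab hz hz', rfl⟩) one_ne_zero
    apply this
    simp [planeDet, him]
  · intro a b z a' b' z' hab hz1 hz2 hab' hz1' hz2' hdet
    by_contra hne
    have := hcT (z + c, (z' + c) - (z + c)) (Or.inr ⟨(z + c, z' + c),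
      ⟨hmemM hab hz1 hz2, hmemM hab' hz1' hz2'⟩, rfl⟩) (by
        rw [add_sub_add_right_eq_sub]; exact sub_ne_zero.2 (Ne.symm hne))
    apply this
    simp only [planeDet, Complex.sub_re, Complex.sub_im, Complex.add_re, Complex.add_im] at hdet ⊢
    linear_combination hdet

end Counterclockwise

/-! ## Counting the strands on a ray -/

section Rays

variable {κ : Type}

/-- The edges which meet the open ray from the origin through `u` in a point other than their end
point, for a diagram all of whose edges run counterclockwise. -/
def VDiagram.rayEdges (D : VDiagram κ) (u : ℂ) : Set κ :=
  {i | 0 ≤ planeDet (D.pos i) u ∧ 0 < planeDet u (D.pos (D.next i))}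

/-- A counterclockwise edge enters the sector between the rays only through `u` and leaves it only
through `v`. Along the closed components, entries and exits balance. -/
theorem VDiagram.ncard_rayEdges_eq (D : VDiagram κ) (hD : ∀ i, 0 < D.turn i) {u v : ℂ}
    (huv : 0 < planeDet u v) : (D.rayEdges u).ncard = (D.rayEdges v).ncard := by
  classical
  have := D.finite
  have := Fintype.ofFinite κ
  have hcard : ∀ s : Set κ, (s.ncard : ℤ) = ∑ i, if i ∈ s then 1 else 0 := by
    intro s
    rw [Set.ncard_eq_toFinset_card', Finset.sum_boole]
    congr 2
    ext i; simp
  -- The indicator of the sector is open at `u` and closed at `v`, to match the half-open convention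
  -- of `rayEdges`. Its sum over all vertices is invariant under `next`.
  let f : κ → ℤ := fun i => if 0 < planeDet u (D.pos i) ∧ planeDet v (D.pos i) ≤ 0 then 1 else 0
  have key : ∀ i, f (D.next i) - f i =
      (if i ∈ D.rayEdges u then 1 else 0) - (if i ∈ D.rayEdges v then 1 else 0) := by
    intro i
    have hpl : 0 < planeDet u (D.pos i) * planeDet v (D.pos (D.next i)) -
        planeDet u (D.pos (D.next i)) * planeDet v (D.pos i) := by
      have := mul_pos huv (hD i)
      rw [VDiagram.turn] at this
      simp only [planeDet] at this ⊢
      linarith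
    simp only [f, VDiagram.rayEdges, Set.mem_ofPred_eq, planeDet_swap (D.pos i)]
    generalize planeDet u (D.pos i) = x at *
    generalize planeDet v (D.pos i) = x' at *
    generalize planeDet u (D.pos (D.next i)) = y at *
    generalize planeDet v (D.pos (D.next i)) = y' at *
    rcases lt_or_ge 0 x with a1 | a1 <;> rcases lt_or_ge 0 x' with a2 | a2 <;>
      rcases lt_or_ge 0 y with a3 | a3 <;> rcases lt_or_ge 0 y' with a4 | a4 <;>
      simp [a1, a2, a3, a4, not_lt.2, not_le.2] <;> nlinarith
  have hsum : ∑ i, (f (D.next i) - f i) = 0 := by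
    rw [Finset.sum_sub_distrib, Equiv.sum_comp D.next f, sub_self]
  have : ((D.rayEdges u).ncard : ℤ) - (D.rayEdges v).ncard = 0 := by
    rw [hcard, hcard, ← Finset.sum_sub_distrib]
    exact (Finset.sum_congr rfl fun i _ => (key i).symm).trans hsum
  omega

theorem VDiagram.mem_rayEdges (D : VDiagram κ) (hD : ∀ i, 0 < D.turn i) {u z : ℂ} {k : ℝ}
    (hk : 0 < k) {i : κ} (hz : z ∈ D.edge i) (hzk : z = k * u) (hne : z ≠ D.pos (D.next i)) :
    i ∈ D.rayEdges u := by
  obtain ⟨s, hs0, hs1, hs⟩ := mem_segment_iff_real.1 hz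
  have hs1 : s < 1 := hs1.lt_of_ne fun h => hne (by rw [hs, h]; push_cast; ring)
  have ht := hD i
  have e1 : k * planeDet (D.pos i) u = s * D.turn i := by
    rw [← planeDet_mul_right, ← hzk, hs, VDiagram.turn, planeDet_add_right, planeDet_self,
      planeDet_mul_right, planeDet_sub_right, planeDet_self]
    ring
  have e2 : k * planeDet u (D.pos (D.next i)) = (1 - s) * D.turn i := by
    rw [← planeDet_mul_left, ← hzk, hs, VDiagram.turn, planeDet_add_left, planeDet_mul_left,
      planeDet_sub_left, planeDet_self]
    ring
  constructor
  · by_contra hc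
    have := mul_neg_of_pos_of_neg hk (not_le.1 hc)
    have := mul_nonneg hs0 ht.le
    linarith
  · by_contra hc
    have := mul_nonpos_of_nonneg_of_nonpos hk.le (not_lt.1 hc)
    have := mul_pos (sub_pos.2 hs1) ht
    linarith

/-- The parameter is determined by `k * planeDet u (D.pos (D.next i) - D.pos i) = D.turn i`, whose
right side is nonzero. -/
theorem VDiagram.ray_unique (D : VDiagram κ) (hD : ∀ i, 0 < D.turn i) {u : ℂ} {k k' : ℝ} {i : κ}
    (hz : (k : ℂ) * u ∈ D.edge i) (hz' : (k' : ℂ) * u ∈ D.edge i) : k = k' := by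
  have key : ∀ k : ℝ, (k : ℂ) * u ∈ D.edge i →
      k * planeDet u (D.pos (D.next i) - D.pos i) = D.turn i := by
    intro k hk
    obtain ⟨s, -, -, hs⟩ := mem_segment_iff_real.1 hk
    rw [← planeDet_mul_left, hs, VDiagram.turn, planeDet_add_left, planeDet_mul_left, planeDet_self,
      planeDet_sub_right, planeDet_self]
    ring
  have h1 := key k hz
  have h2 := key k' hz'
  have h3 := hD i
  have hne : planeDet u (D.pos (D.next i) - D.pos i) ≠ 0 := by
    intro h0; rw [h0] at h1; linarith
  have : (k - k') * planeDet u (D.pos (D.next i) - D.pos i) = 0 := by linarith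
  have := (mul_eq_zero.1 this).resolve_right hne
  linarith

/-- The identity `D.turn i * u = α * D.pos i + β * D.pos (D.next i)`, divided by `α + β`, exhibits a
point of the edge on the ray. -/
theorem VDiagram.exists_mem_ray (D : VDiagram κ) (hD : ∀ i, 0 < D.turn i) {u : ℂ} {i : κ}
    (hi : i ∈ D.rayEdges u) : ∃ k : ℝ, 0 < k ∧ (k : ℂ) * u ∈ D.edge i := by
  obtain ⟨h1, h2⟩ := hi
  have ht := hD i
  set α := planeDet u (D.pos (D.next i)) with hα
  set β := planeDet (D.pos i) u with hβ
  have hpos : 0 < α + β := by linarith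
  refine ⟨D.turn i / (α + β), div_pos ht hpos, ?_⟩
  refine mem_segment_iff_real.2 ⟨β / (α + β), by positivity, (div_le_one hpos).2 (by linarith), ?_⟩
  have hrel : (D.turn i : ℂ) * u = α * D.pos i + β * D.pos (D.next i) := by
    apply Complex.ext <;>
      simp only [hα, hβ, VDiagram.turn, planeDet, Complex.mul_re, Complex.mul_im, Complex.add_re,
        Complex.add_im, Complex.ofReal_re, Complex.ofReal_im] <;> ring
  have hne : (α : ℂ) + β ≠ 0 := by exact_mod_cast hpos.ne'
  push_cast
  field_simp
  linear_combination hrel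

theorem VDiagram.mem_trace {D : VDiagram κ} {z : ℂ} : z ∈ D.trace ↔ ∃ i, z ∈ D.edge i := by
  rw [VDiagram.trace, mem_iUnion]

/-- A vertex is assigned to its outgoing edge, in accordance with the convention of `rayEdges`. -/
theorem VDiagram.exists_edge_start (D : VDiagram κ) {z : ℂ} (hz : z ∈ D.trace) :
    ∃ i, z ∈ D.edge i ∧ z ≠ D.pos (D.next i) := by
  obtain ⟨i, hi⟩ := VDiagram.mem_trace.1 hz
  by_cases h : z = D.pos (D.next i)
  · refine ⟨D.next i, by rw [h]; exact left_mem_segment _ _ _, fun h' => ?_⟩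
    exact D.next_ne _ (Gen.injective D.next_next_ne D.vertex_generic (h'.symm.trans h))
  · exact ⟨i, hi, h⟩

/-- The number of strands between the origin and a crossing. -/
theorem VDiagram.ncard_inner_add_two_le (D : VDiagram κ) (hD : ∀ i, 0 < D.turn i) {e f : κ} {X : ℂ}
    (hef : D.Crosses e f) (he : X ∈ D.edge e) (hf : X ∈ D.edge f) :
    (D.trace ∩ openSegment ℝ 0 X).ncard + 2 ≤ (D.rayEdges X).ncard := by
  have := D.finite
  have hray : ∀ z ∈ openSegment ℝ 0 X, ∃ k : ℝ, 0 < k ∧ k < 1 ∧ z = k * X := by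
    intro z hz
    obtain ⟨k, h0, h1, hk⟩ := mem_openSegment_iff_real.1 hz
    exact ⟨k, h0, h1, by rw [hk]; ring⟩
  have hnot : ∀ i, X ∈ D.edge i → ∀ z ∈ openSegment ℝ 0 X, z ∉ D.edge i := by
    intro i hi z hz hzi
    obtain ⟨k, -, h1, hk⟩ := hray z hz
    rw [hk] at hzi
    have := D.ray_unique hD hzi (k' := 1) (by simpa using hi)
    linarith
  have hend : ∀ a b, D.Crosses a b → X ∈ D.edge a → X ∈ D.edge b → a ∈ D.rayEdges X := by
    intro a b hab ha hb
    refine D.mem_rayEdges hD one_pos ha (by simp) fun h => ?_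
    rcases D.vertex_generic b (D.next a) (by rw [← h]; exact hb) with c | c
    · exact hab.2.1 c
    · exact hab.1 (D.next.injective c)
  have : Nonempty κ := ⟨e⟩
  choose! g hg using fun z (hz : z ∈ D.trace) => D.exists_edge_start hz
  -- An edge meets the ray only once, so inner points inject into the ray edges, and the two edges
  -- that cross at `X` are not used.
  have hle : (D.trace ∩ openSegment ℝ 0 X).ncard ≤ (D.rayEdges X \ {e, f}).ncard := by
    refine Set.ncard_le_ncard_of_injOn g ?_ ?_ (Set.toFinite _)
    · rintro z ⟨hz, hzX⟩
      obtain ⟨k, h0, -, hk⟩ := hray z hzX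
      refine ⟨D.mem_rayEdges hD h0 (hg z hz).1 hk (hg z hz).2, ?_⟩
      rintro (h | h)
      · exact hnot e he z hzX (h ▸ (hg z hz).1)
      · have h : g z = f := h
        exact hnot f hf z hzX (h ▸ (hg z hz).1)
    · rintro z ⟨hz, hzX⟩ z' ⟨hz', hzX'⟩ hgg
      obtain ⟨k, -, -, hk⟩ := hray z hzX
      obtain ⟨k', -, -, hk'⟩ := hray z' hzX'
      have m1 := (hg z hz).1
      have m2 := (hg z' hz').1
      rw [← hgg] at m2
      generalize g z = j at m1 m2
      rw [hk'] at m2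
      rw [hk] at m1
      rw [hk, hk', D.ray_unique hD m1 m2]
  have hsub : ({e, f} : Set κ) ⊆ D.rayEdges X := by
    rintro i (rfl | hi)
    · exact hend _ f hef he hf
    · have hi : i = f := hi
      rw [hi]; exact hend f e (polyCrosses.symm hef) hf he
  have h2 : ({e, f} : Set κ).ncard = 2 := Set.ncard_pair hef.1
  have h3 := Set.ncard_sdiff_add_ncard_of_subset hsub (Set.toFinite _)
  omega

/-- The number of strands on the negative real axis. -/
theorem VDiagram.ncard_rayEdges_le (D : VDiagram κ) (hD : ∀ i, 0 < D.turn i)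
    (him : ∀ a b z, D.Crosses a b → z ∈ D.edge a → z ∈ D.edge b → z.im ≠ 0) :
    (D.rayEdges (-1)).ncard ≤ (D.trace ∩ {z : ℂ | z.re < 0 ∧ z.im = 0}).ncard := by
  have := D.finite
  have hfin : (D.trace ∩ {z : ℂ | z.re < 0 ∧ z.im = 0}).Finite := by
    have hsub : D.trace ∩ {z : ℂ | z.re < 0 ∧ z.im = 0} ⊆
        ⋃ i, D.edge i ∩ {z : ℂ | z.re < 0 ∧ z.im = 0} := by
      rintro z ⟨hz, hz'⟩
      obtain ⟨i, hi⟩ := VDiagram.mem_trace.1 hz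
      exact mem_iUnion.2 ⟨i, hi, hz'⟩
    refine (Set.finite_iUnion fun i => Set.Subsingleton.finite ?_).subset hsub
    rintro z ⟨hz, -, h2⟩ w ⟨hw, -, h4⟩
    have e1 : z = ((-z.re : ℝ) : ℂ) * (-1) := by
      apply Complex.ext <;> simp [h2]
    have e2 : w = ((-w.re : ℝ) : ℂ) * (-1) := by
      apply Complex.ext <;> simp [h4]
    rw [e1] at hz
    rw [e2] at hw
    rw [e1, e2, D.ray_unique hD hz hw]
  choose! g hg using fun i (hi : i ∈ D.rayEdges (-1)) => D.exists_mem_ray hD hi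
  refine Set.ncard_le_ncard_of_injOn (fun i => (g i : ℂ) * (-1)) ?_ ?_ hfin
  · intro i hi
    refine ⟨VDiagram.mem_trace.2 ⟨i, (hg i hi).2⟩, ?_, ?_⟩
    · simpa using (hg i hi).1
    · simp
  · intro i hi j hj hij
    by_contra hne
    have m1 := (hg i hi).2
    have m2 := (hg j hj).2
    have hij : (g i : ℂ) * (-1) = (g j : ℂ) * (-1) := hij
    rw [← hij] at m2
    -- At a common vertex on the ray the first edge would end there, which `rayEdges` excludes.
    -- Non-adjacent edges would have a crossing on the real line.
    have hadj : ∀ i j, i ∈ D.rayEdges (-1) → D.next i = j → (g i : ℂ) * (-1) ∈ D.edge i →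
        (g i : ℂ) * (-1) ∈ D.edge j → False := by
      rintro i _ hi rfl m1 m2
      have := inter_eq_vertex D.next_ne D.next_next_ne D.vertex_generic m1 m2
      have hd := hi.2
      rw [← this, planeDet_mul_right, planeDet_self] at hd
      simp at hd
    by_cases h1 : D.next i = j
    · exact hadj i j hi h1 m1 m2
    by_cases h2 : D.next j = i
    · exact hadj j i hj h2 (hij ▸ m2) (hij ▸ m1)
    · exact him i j _ ⟨hne, h1, h2, _, m1, m2⟩ m1 m2 (by simp)

/-- A crossing has fewer strands below it than there are on the negative real axis. -/
theorem VDiagram.ncard_inner_lt (D : VDiagram κ) (hD : ∀ i, 0 < D.turn i)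
    (him : ∀ a b z, D.Crosses a b → z ∈ D.edge a → z ∈ D.edge b → z.im ≠ 0) {e f : κ} {X : ℂ}
    (hef : D.Crosses e f) (he : X ∈ D.edge e) (hf : X ∈ D.edge f) :
    (D.trace ∩ openSegment ℝ 0 X).ncard <
      (D.trace ∩ {z : ℂ | z.re < 0 ∧ z.im = 0}).ncard - 1 := by
  have h1 := D.ncard_inner_add_two_le hD hef he hf
  have h2 := D.ncard_rayEdges_le hD him
  have h3 : (D.rayEdges X).ncard = (D.rayEdges (-1)).ncard := by
    -- As `X` is not real, it spans with `-1` an angle less than `π`; the sign of its imaginary part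
    -- gives the order.
    rcases lt_or_gt_of_ne (him e f X hef he hf) with h | h
    · exact (D.ncard_rayEdges_eq hD (by simpa [planeDet] using h)).symm
    · exact D.ncard_rayEdges_eq hD (by simpa [planeDet] using h)
  omega

end Rays

/-! ## Reading off the braid word -/

section Reading

variable {κ : Type}

theorem planeDet_eq_zero_of_arg_eq {z w : ℂ} (hz : z ≠ 0) (hw : w ≠ 0) (h : z.arg = w.arg) :
    planeDet z w = 0 := by
  rw [Complex.arg_eq_arg_iff hz hw, ← Complex.ofReal_div] at h
  rw [← h, planeDet, Complex.re_ofReal_mul, Complex.im_ofReal_mul]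
  ring

/-- The crossings of a diagram, each given by its strands `a`, `b` in the order in which `a` goes
from left to right of `b`. -/
abbrev VDiagram.Crossing (D : VDiagram κ) : Type :=
  {c : κ × κ // D.Crosses c.1 c.2 ∧ 0 < planeDet (D.dir c.1) (D.dir c.2)}

/-- Without triple points the two crossings have the same pair of edges, and the sign of the
determinant fixes their order. -/
theorem VDiagram.crossing_eq_of_mem (D : VDiagram κ) {c c' : D.Crossing} {z : ℂ}
    (h1 : z ∈ D.edge c.1.1) (h2 : z ∈ D.edge c.1.2) (h1' : z ∈ D.edge c'.1.1)
    (h2' : z ∈ D.edge c'.1.2) : c = c' := by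
  obtain ⟨⟨a, b⟩, hc, hdet⟩ := c
  obtain ⟨⟨a', b'⟩, hc', hdet'⟩ := c'
  simp only at *
  have on : ∀ x, z ∈ D.edge x → x = a ∨ x = b := by
    intro x hx
    by_contra! hne
    exact D.no_triple a b x hc.1 hne.2.symm hne.1.symm z h1 h2 hx
  apply Subtype.ext
  rcases on a' h1' with rfl | rfl <;> rcases on b' h2' with rfl | rfl
  · exact absurd rfl hc'.1
  · rfl
  · rw [planeDet_swap] at hdet'
    exact absurd hdet (by linarith)
  · exact absurd rfl hc'.1

open Classical in
/-- The elementary braid diagram at position `i` of the type of a given crossing. -/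
noncomputable def VDiagram.letter (D : VDiagram κ) {n : ℕ} (a b : κ) (i : Fin (n - 1)) :
    BraidLetter n :=
  if D.isOver a b then .sigma i else if D.isOver b a then .sigmaInv i else .nu i

theorem VDiagram.index_letter (D : VDiagram κ) {n : ℕ} (a b : κ) (i : Fin (n - 1)) :
    (D.letter a b i).index = i := by
  unfold VDiagram.letter
  split_ifs <;> rfl

theorem VDiagram.hasType_letter (D : VDiagram κ) {n : ℕ} {a b : κ} (h : D.Crosses a b)
    (i : Fin (n - 1)) : D.HasType a b (D.letter a b i) := by
  unfold VDiagram.letter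
  split_ifs with h1 h2
  · exact h1
  · exact h2
  · exact ⟨h, h1, h2⟩

/-- Crossings on different rays have different arguments, so sorting them by argument lists the
letters of the word. The position of a letter is the number of strands below its crossing. -/
theorem VDiagram.exists_isClosedBraid (D : VDiagram κ) (hD : ∀ i, 0 < D.turn i)
    (him : ∀ a b z, D.Crosses a b → z ∈ D.edge a → z ∈ D.edge b → z.im ≠ 0)
    (hray : ∀ a b z a' b' z', D.Crosses a b → z ∈ D.edge a → z ∈ D.edge b → D.Crosses a' b' →
      z' ∈ D.edge a' → z' ∈ D.edge b' → planeDet z z' = 0 → z = z') :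
    ∃ n w, D.IsClosedBraid n w := by
  have := D.finite
  have : Finite D.Crossing := Subtype.finite
  have := Fintype.ofFinite D.Crossing
  choose x hx using fun c : D.Crossing => c.2.1.2.2.2
  have himx : ∀ c, (x c).im ≠ 0 := fun c => him _ _ _ c.2.1 (hx c).1 (hx c).2
  have hne : ∀ c, x c ≠ 0 := fun c h => himx c (by rw [h, Complex.zero_im])
  have hinj : Function.Injective fun c => (x c).arg := by
    intro c c' h
    have h' := hray _ _ _ _ _ _ c.2.1 (hx c).1 (hx c).2 c'.2.1 (hx c').1 (hx c').2
      (planeDet_eq_zero_of_arg_eq (hne c) (hne c') h)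
    exact D.crossing_eq_of_mem (hx c).1 (hx c).2 (h' ▸ (hx c').1) (h' ▸ (hx c').2)
  let _ : LinearOrder D.Crossing := LinearOrder.lift' (fun c => (x c).arg) hinj
  let e : Fin (Fintype.card D.Crossing) ≃o D.Crossing := Fintype.orderIsoFinOfCardEq _ rfl
  have hlt : ∀ {c c' : D.Crossing}, c < c' → (x c).arg < (x c').arg := fun h => h
  -- With this choice of `n`, `ncard_inner_lt` gives exactly the bound needed for indices in `Fin (n
  -- - 1)`.
  let n := (D.trace ∩ {z : ℂ | z.re < 0 ∧ z.im = 0}).ncard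
  let idx : D.Crossing → Fin (n - 1) := fun c =>
    ⟨(D.trace ∩ openSegment ℝ 0 (x c)).ncard, D.ncard_inner_lt hD him c.2.1 (hx c).1 (hx c).2⟩
  let w : List (BraidLetter n) := List.ofFn fun k => D.letter (e k).1.1 (e k).1.2 (idx (e k))
  have hw : w.length = Fintype.card D.Crossing := List.length_ofFn
  have hget : ∀ k : Fin w.length, w.get k = D.letter (e (k.cast hw)).1.1 (e (k.cast hw)).1.2
      (idx (e (k.cast hw))) := fun k => List.get_ofFn _ k
  refine ⟨n, w, hD, rfl, fun k => (e (k.cast hw)).1, fun k => x (e (k.cast hw)),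
    fun k => (e _).2, fun a b hab hdet => ?_, fun k => hx _,
    fun k => Or.inr (himx _), fun k l hkl => hlt (e.strictMono ?_), fun k => ?_, fun k => ?_⟩
  · refine ⟨(e.symm ⟨(a, b), hab, hdet⟩).cast hw.symm, ?_⟩
    exact congrArg Subtype.val (e.apply_symm_apply ⟨(a, b), hab, hdet⟩)
  · exact hkl
  · rw [hget, D.index_letter]
  · rw [hget]
    exact D.hasType_letter (e _).2.1 _

end Reading

theorem theoremL (K : VirtualLink) :
    ∃ (n : ℕ) (β : VirtualBraidGroup n), IsBraidClosure β K := by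
  induction K using Quotient.inductionOn with
  | h X =>
    obtain ⟨κ, E, hlink, hD, him, hray⟩ := X.2.exists_counterclockwise_generic
    obtain ⟨n, w, hw⟩ := E.exists_isClosedBraid hD him hray
    exact ⟨n, _, w, rfl, κ, E, hw, hlink⟩
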